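/- Setting. Let $N\ge 2$, $G=SU(N)$, and let $R$ be any (possibly anomalous) continuous unitary representation of $G$ on $\mathbb C^d$. For $n\ge1$, $a>0$ let $\Lambda=a(\mathbb Z/n\mathbb Z)^4$ be the periodic lattice with link fields $U(x,\mu)\in G$, and let fermion fields satisfy $\psi(x+na\hat\mu)=b_\mu\psi(x)$ with fixed phases $|b_\mu|=1$ (periodic, antiperiodic, …). Let $D=\frac1a\{1-A(A^\dagger A)^{-1/2}\}$, $A=1-aD_{\rm w}$, be the overlap operator in the representation $R$ built from the Wilson operator $D_{\rm w}=\sum_\mu\frac12\{\gamma_\mu(\nabla^*_\mu+\nabla_\mu)-a\nabla_\mu^*\nabla_\mu\}$, and put $\hat\gamma_5=\gamma_5(1-aD)$, $\hat P_\pm=\frac12(1\pm\hat\gamma_5)$, $P_\pm=\frac12(1\pm\gamma_5)$. For a $\mathfrak{su}(N)$-valued field $\eta_\mu(x)$ let $\delta_\eta$ be the variation with $\delta_\eta U(x,\mu)=a\eta_\mu(x)U(x,\mu)$. Norms of matrices are operator norms. Let $\epsilon<1/[6(2+\sqrt2)]$ and let $\delta>0$ satisfy $$\delta\le\sqrt2\sqrt{1-\cos\{\pi/(N-1)\}},\qquad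 4\delta+6\delta^2+4\delta^3+\delta^4\le\epsilon .$$ Let $\mathcal U$ be the set of smooth link fields: $\|1-U(x,\mu)\|<\delta$ and $\|1-R[U(x,\mu)]\|<\delta$ for all $x,\mu$. For $U=V\,{\rm diag}(e^{i\theta_j})V^{-1}$ with $-\pi<\theta_j<\pi$ put $[U]^t=V\,{\rm diag}(e^{it\theta_j})V^{-1}$, and let $U_t(x,\mu)=[U(x,\mu)]^t$, $P_t=\hat P_-|_{U=U_t}$, and $$\mathfrak L_\eta=i\int_0^1dt\,{\rm Tr}\{P_t[\partial_tP_t,\delta_\eta P_t]\}.$$ Then $\mathcal U$ is contained in the vacuum sector (the connected component of $U\equiv1$ in $\{U:\|1-R[U(x,\mu)U(x+a\hat\mu,\nu)U(x+a\hat\nu,\mu)^{-1}U(x,\nu)^{-1}]\|<\epsilon\ \forall x,\mu,\nu\}$). For $U\in\mathcal U$ and $0\le t\le1$ one has $U_t\in\mathcal U$, $U_0=1$, $U_1=U$; moreover $P_t$ is a smooth function of $t$ and $U$, and $\mathfrak L_\eta$ is a smooth function of $U\in\mathcal U$, linear in $\eta$: $\mathfrak L_\eta=a^4\sum_{x,\mu}\eta^a_\mu(x)j^a_\mu(x)$.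 Furthermore: (1) Locality. There are $\theta>0$ and constants $C_k$, $k\geq 0$, independent of $n$, $a$, $b_\mu$, $U$, $x$, $\mu$, such that for every $X\in\mathfrak{su}(N)$ the component of the measure current $j_\mu(x)$ in the direction $X$ is on $\mathcal U$ a sum $\sum_{r\ge0}j_r$ of smooth functions, where $j_r$ depends only on the link variables at sites within lattice distance $r$ of $x$ and its derivatives of order $k$ with respect to the link variables are bounded by $C_k\|X\|a^{-3}e^{-\theta r}$. (2) Local integrability. On $\mathcal U$, for all link-field independent $\eta,\zeta$, $$\delta_\eta\mathfrak L_\zeta-\delta_\zeta\mathfrak L_\eta+a\mathfrak L_{[\eta,\zeta]}=i\,{\rm Tr}\{\hat P_-[\delta_\eta\hat P_-,\delta_\zeta\hat P_-]\}.$$ Moreover $\mathfrak L_\eta|_{U=U_t}=0$ for $a\eta_\mu(x)=\partial_tU_t(x,\mu)U_t(x,\mu)^{-1}$. (3) Existence of the integration measure. With $m=2dn^4$ there are, for $U\in\mathcal U$, orthonormal bases $v_1,\dots,v_m$ of the space $\{\psi:\hat P_-\psi=\psi\}$ that are single-valued $C^\infty$ functions of $U\in\mathcal U$ and whose measure term is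 the given one, $i\sum_j(v_j,\delta_\eta v_j)=\mathfrak L_\eta$. The space $\{\bar\psi:\bar\psi P_+=\bar\psi\}$ has an orthonormal basis of $m$ elements, and for every such ($U$-independent) basis $\bar v_k$ the following holds. With $\psi=\sum_jv_jc_j$, $\bar\psi=\sum_k\bar c_k\bar v_k$, ${\rm D}[\psi]{\rm D}[\bar\psi]=\prod_jdc_j\prod_kd\bar c_k$ and $S_{\rm F}=a^4\sum_x\bar\psi D\psi$, every expectation value $\langle\mathcal O\rangle_{\rm F}=\int{\rm D}[\psi]{\rm D}[\bar\psi]\,\mathcal O\,e^{-S_{\rm F}}$, $\mathcal O$ in the Grassmann algebra of the field components, is a $C^\infty$ function on $\mathcal U$. (4) Effective action. If $U\in\mathcal U$ and $D$ is invertible, then $\langle1\rangle_{\rm F}[U]\ne0$ and $$\delta_\eta\ln\langle1\rangle_{\rm F}[U]={\rm Tr}\{\delta_\eta D\,\hat P_-D^{-1}P_+\}-i\mathfrak L_\eta .$$ If $D$ is invertible at $U_t$ for all $t\in[T_0,T_1]\subseteq[0,1]$, then the integrand below is continuous in $t$ there and $$\langle1\rangle_{\rm F}[U_{T_1}]=\langle1\rangle_{\rm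 F}[U_{T_0}]\,\exp\int_{T_0}^{T_1}dt\,{\rm Tr}\{\partial_tD\,\hat P_-D^{-1}P_+\}\big|_{U=U_t};$$ for $T_0=0$, $T_1=1$ this is $\ln\langle1\rangle_{\rm F}[U]-\ln\langle1\rangle_{\rm F}[1]=\int_0^1dt\,{\rm Tr}\{\partial_tD\,\hat P_-D^{-1}P_+\}|_{U=U_t}$. -/

import Mathlib

open scoped Matrix Kronecker ContDiff Topology Matrix.Norms.L2Operator

noncomputable section

namespace LatticeWeyl

/-! Matrix norms are the operator norm, i.e. the square root of the largest eigenvalue of `Aᴴ A`. -/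

/-! ## Gauge group, Lie algebra and representation -/

/-- The gauge group `SU(N)`. -/
abbrev SU (N : ℕ) : Type := Matrix.specialUnitaryGroup (Fin N) ℂ

/-- A unitary matrix representation of `SU(N)` of dimension `d`. -/
abbrev Rep (N d : ℕ) : Type := SU N →* Matrix.unitaryGroup (Fin d) ℂ

/-- The Lie algebra `su(N)`: anti-Hermitian traceless matrices. -/
def su (N : ℕ) : Submodule ℝ (Matrix (Fin N) (Fin N) ℂ) where
  carrier := {X | Xᴴ = -X ∧ X.trace = 0}
  zero_mem' := by simp
  add_mem' := by
    rintro X Y ⟨h1, h2⟩ ⟨h3, h4⟩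
    exact ⟨by rw [Matrix.conjTranspose_add, h1, h3, neg_add], by
      rw [Matrix.trace_add, h2, h4, add_zero]⟩
  smul_mem' := by
    rintro c X ⟨h1, h2⟩
    refine ⟨?_, by rw [Matrix.trace_smul, h2, smul_zero]⟩
    rw [Matrix.conjTranspose_smul, h1]
    simp

/-- The Lie bracket of `su(N)`. -/
def suBracket {N : ℕ} (X Y : su N) : su N :=
  ⟨X.1 * Y.1 - Y.1 * X.1, by
    obtain ⟨X, h1, h2⟩ := X
    obtain ⟨Y, h3, h4⟩ := Y
    refine ⟨?_, ?_⟩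
    · simp only [Matrix.conjTranspose_sub, Matrix.conjTranspose_mul, h1, h3]
      noncomm_ring
    · simp only [Matrix.trace_sub, Matrix.trace_mul_comm X Y, sub_self]⟩

/-- The exponential of an element of `su(N)` lies in `SU(N)`. -/
theorem exp_mem_specialUnitaryGroup {N : ℕ} (X : su N) :
    NormedSpace.exp X.1 ∈ Matrix.specialUnitaryGroup (Fin N) ℂ := by
  obtain ⟨X, h1, h2⟩ := X
  show NormedSpace.exp X ∈ _
  rw [Matrix.mem_specialUnitaryGroup_iff]
  refine ⟨?_, ?_⟩
  · let _ : NormedAlgebra ℚ (Matrix (Fin N) (Fin N) ℂ) := NormedAlgebra.restrictScalars ℚ ℂ _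
    exact NormedSpace.exp_mem_unitary_of_mem_skewAdjoint (by rw [skewAdjoint.mem_iff]; exact h1)
  · have hH : (Complex.I • X).IsHermitian := by
      rw [Matrix.IsHermitian, Matrix.conjTranspose_smul, h1]; simp
    have hX : X = (hH.eigenvectorUnitary : Matrix (Fin N) (Fin N) ℂ) *
        Matrix.diagonal (fun i => -Complex.I * (hH.eigenvalues i : ℂ)) *
        (hH.eigenvectorUnitary : Matrix (Fin N) (Fin N) ℂ)⁻¹ := by
      have hs := hH.spectral_theorem
      rw [Unitary.conjStarAlgAut_apply] at hs
      have hinv : (hH.eigenvectorUnitary : Matrix (Fin N) (Fin N) ℂ)⁻¹ =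
          star (hH.eigenvectorUnitary : Matrix (Fin N) (Fin N) ℂ) :=
        Matrix.inv_eq_left_inv (Unitary.star_mul_self_of_mem hH.eigenvectorUnitary.2)
      have hd : Matrix.diagonal (fun i => -Complex.I * (hH.eigenvalues i : ℂ)) =
          (-Complex.I) • Matrix.diagonal (RCLike.ofReal ∘ hH.eigenvalues : Fin N → ℂ) := by
        rw [← Matrix.diagonal_smul]; rfl
      rw [hinv, hd, Matrix.mul_smul, Matrix.smul_mul]
      calc X = (-Complex.I) • (Complex.I • X) := by simp [smul_smul]
        _ = _ := congrArg _ hs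
    have hU : IsUnit (hH.eigenvectorUnitary : Matrix (Fin N) (Fin N) ℂ) :=
      (Unitary.toUnits hH.eigenvectorUnitary).isUnit
    have ht := hH.trace_eq_sum_eigenvalues
    rw [Matrix.trace_smul, h2, smul_zero] at ht
    rw [hX, Matrix.exp_conj _ _ hU, Matrix.det_conj hU, Matrix.exp_diagonal, Matrix.det_diagonal]
    have : ∀ i, NormedSpace.exp (fun i => -Complex.I * (hH.eigenvalues i : ℂ)) i =
        Complex.exp (-Complex.I * (hH.eigenvalues i : ℂ)) := by
      intro i
      rw [Pi.coe_exp, Complex.exp_eq_exp_ℂ]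
    simp_rw [this]
    rw [← Complex.exp_sum, ← Finset.mul_sum]
    have h0 : (∑ i, (hH.eigenvalues i : ℂ)) = 0 := ht.symm
    rw [h0]; simp

/-- The exponential map `su(N) → SU(N)`. -/
def expSU {N : ℕ} (X : su N) : SU N := ⟨NormedSpace.exp X.1, exp_mem_specialUnitaryGroup X⟩

/-- The matrix `[U]^t = V diag(e^{itθ₁}, …, e^{itθ_N}) V⁻¹` for a unitary matrix
`U = V diag(e^{iθ₁}, …, e^{iθ_N}) V⁻¹` with all angles taken in `(-π, π]`. -/
def powMatrix {N : ℕ} (t : ℝ) (U : SU N) : Matrix (Fin N) (Fin N) ℂ :=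
  cfc (fun z : ℂ => Complex.exp (Complex.I * t * Complex.arg z)) (U : Matrix (Fin N) (Fin N) ℂ)

open Classical in
/-- `[U]^t` as an element of `SU(N)`; the value `1` is used if the matrix `[U]^t` is not
in `SU(N)`. -/
def powSU {N : ℕ} (t : ℝ) (U : SU N) : SU N :=
  if h : powMatrix t U ∈ Matrix.specialUnitaryGroup (Fin N) ℂ then ⟨powMatrix t U, h⟩ else 1

/-! ## Lattice and link fields -/

/-- Sites of the periodic four-dimensional lattice with `n` sites in each direction; the point
of `a ℤ⁴` is `a` times the integer coordinates. -/
abbrev Site (n : ℕ) : Type := Fin 4 → ZMod n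

/-- The neighbour `x + a μ̂`. -/
def step {n : ℕ} (x : Site n) (μ : Fin 4) : Site n := x + Pi.single μ 1

/-- The distance of two sites on the periodic lattice, in lattice units. -/
def siteDist {n : ℕ} (x y : Site n) : ℕ := ∑ μ, (x μ - y μ).valMinAbs.natAbs

/-- Link fields `U(x, μ)`. -/
abbrev Config (n N : ℕ) : Type := Site n → Fin 4 → SU N

/-- Variation vectors `η_μ(x)` of link fields. -/
abbrev Pert (n N : ℕ) : Type := Site n → Fin 4 → su N

/-- The link field `exp(X_μ(x)) U(x, μ)`. -/
def shift {n N : ℕ} (X : Pert n N) (U : Config n N) : Config n N :=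
  fun x μ => expSU (X x μ) * U x μ

/-- The one-parameter family `U_t(x, μ) = [U(x, μ)]^t`. -/
def powConfig {n N : ℕ} (t : ℝ) (U : Config n N) : Config n N := fun x μ => powSU t (U x μ)

/-- The plaquette variable. -/
def plaquette {n N : ℕ} (U : Config n N) (x : Site n) (μ ν : Fin 4) : SU N :=
  U x μ * U (step x μ) ν * (U (step x ν) μ)⁻¹ * (U x ν)⁻¹

/-- Admissible link fields: `‖1 - R[P_{μν}(x)]‖ < ε` for all plaquettes. -/
def admissible (n : ℕ) {N d : ℕ} (R : Rep N d) (ε : ℝ) : Set (Config n N) :=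
  {U | ∀ x μ ν, ‖1 - (R (plaquette U x μ ν) : Matrix (Fin d) (Fin d) ℂ)‖ < ε}

/-- The vacuum sector: the connected component of `U ≡ 1` in the space of admissible fields. -/
def vacuumSector (n : ℕ) {N d : ℕ} (R : Rep N d) (ε : ℝ) : Set (Config n N) :=
  connectedComponentIn (admissible n R ε) 1

/-- Smooth link fields: `‖1 - U(x, μ)‖ < δ` and `‖1 - R[U(x, μ)]‖ < δ` for all links. -/
def smoothFields (n : ℕ) {N d : ℕ} (R : Rep N d) (δ : ℝ) : Set (Config n N) :=
  {U | ∀ x μ, ‖1 - (U x μ : Matrix (Fin N) (Fin N) ℂ)‖ < δ ∧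
    ‖1 - (R (U x μ) : Matrix (Fin d) (Fin d) ℂ)‖ < δ}

/-! ## Smooth functions of link variables, variations and locality -/

/-- `F` is `C^∞` at every point of the set `S` of link fields, expressed in the exponential
charts `X ↦ exp(X) U` of the manifold of link fields centred at the points `U` of `S`. -/
def SmoothOn {n N : ℕ} [NeZero n] {E : Type*} [NormedAddCommGroup E] [NormedSpace ℝ E]
    (S : Set (Config n N)) (F : Config n N → E) : Prop :=
  ∀ U ∈ S, ContDiffAt ℝ ∞ (fun X : Pert n N => F (shift X U)) 0

/-- The variation `δ_η F`, for `δ_η U(x, μ) = a η_μ(x) U(x, μ)`. -/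
def variation {n N : ℕ} {E : Type*} [NormedAddCommGroup E] [NormedSpace ℝ E]
    (a : ℝ) (η : Pert n N) (F : Config n N → E) (U : Config n N) : E :=
  deriv (fun s : ℝ => F (shift ((s * a) • η) U)) 0

/-- `f` is, on the set `S` of link fields, a local expression of link variables at the site `x`,
with localization constant `θ` and bounds `B`: it is a sum over `r = 0, 1, 2, …` of smooth strictly
local functions of the link variables within distance `r` of `x`, which, together with all their
derivatives with respect to the link variables, decay as `e^{-θ r}`. -/
def IsLocalAt {n N : ℕ} [NeZero n] (S : Set (Config n N)) (x : Site n) (θ : ℝ) (B : ℕ → ℝ)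
    (f : Config n N → ℂ) : Prop :=
  ∃ g : ℕ → Config n N → ℂ,
    (∀ r, SmoothOn S (g r)) ∧
    (∀ r, ∀ U ∈ S, ∀ U' ∈ S, (∀ y ν, siteDist x y ≤ r → U y ν = U' y ν) → g r U = g r U') ∧
    (∀ r k, ∀ U ∈ S,
      ‖iteratedFDeriv ℝ k (fun X : Pert n N => g r (shift X U)) 0‖ ≤ B k * Real.exp (-θ * r)) ∧
    (∀ U ∈ S, HasSum (fun r => g r U) (f U))

/-! ## Dirac operator and chiral projectors -/

/-- The index set of fermion fields: site, spin and colour. -/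
abbrev Idx (n d : ℕ) : Type := Site n × (Fin 4 × Fin d)

/-- Operators on fermion fields, as matrices. -/
abbrev Op (n d : ℕ) : Type := Matrix (Idx n d) (Idx n d) ℂ

/-- Euclidean Dirac matrices in the chiral representation. -/
def gamma : Fin 4 → Matrix (Fin 4) (Fin 4) ℂ :=
  ![!![0, 0, -1, 0; 0, 0, 0, -1; -1, 0, 0, 0; 0, -1, 0, 0],
    !![0, 0, 0, -Complex.I; 0, 0, -Complex.I, 0; 0, Complex.I, 0, 0; Complex.I, 0, 0, 0],
    !![0, 0, 0, -1; 0, 0, 1, 0; 0, 1, 0, 0; -1, 0, 0, 0],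
    !![0, 0, -Complex.I, 0; 0, 0, 0, Complex.I; Complex.I, 0, 0, 0; 0, -Complex.I, 0, 0]]

/-- A spin matrix acting on fermion fields. -/
def spinOp (n d : ℕ) (M : Matrix (Fin 4) (Fin 4) ℂ) : Op n d :=
  (1 : Matrix (Site n) (Site n) ℂ) ⊗ₖ (M ⊗ₖ (1 : Matrix (Fin d) (Fin d) ℂ))

/-- `γ₅ = γ₀ γ₁ γ₂ γ₃`. -/
def gamma5 (n d : ℕ) : Op n d := spinOp n d (gamma 0 * gamma 1 * gamma 2 * gamma 3)

/-- The covariant shift `(T_μ ψ)(x) = R[U(x, μ)] ψ(x + a μ̂)`. The fermion field satisfies the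
boundary condition `ψ(x + L μ̂) = b_μ ψ(x)` (`b_μ = 1` periodic, `b_μ = -1` antiperiodic). -/
def shiftOp {n N d : ℕ} (R : Rep N d) (b : Fin 4 → Circle) (U : Config n N) (μ : Fin 4) :
    Op n d :=
  fun p q => if q.1 = step p.1 μ ∧ p.2.1 = q.2.1 then
    (if p.1 μ + 1 = 0 then (b μ : ℂ) else 1) * (R (U p.1 μ) : Matrix (Fin d) (Fin d) ℂ) p.2.2 q.2.2
    else 0

/-- The forward covariant difference operator. -/
def nablaFwd {n N d : ℕ} (R : Rep N d) (a : ℝ) (b : Fin 4 → Circle) (U : Config n N)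
    (μ : Fin 4) : Op n d :=
  (a : ℂ)⁻¹ • (shiftOp R b U μ - 1)

/-- The backward covariant difference operator
`(∇*_μ ψ)(x) = [ψ(x) - R[U(x - a μ̂, μ)]⁻¹ ψ(x - a μ̂)] / a`. -/
def nablaBwd {n N d : ℕ} (R : Rep N d) (a : ℝ) (b : Fin 4 → Circle) (U : Config n N)
    (μ : Fin 4) : Op n d :=
  (a : ℂ)⁻¹ • (1 - (shiftOp R b U μ)ᴴ)

/-- The Wilson-Dirac operator `∑_μ ½ {γ_μ (∇*_μ + ∇_μ) - a ∇*_μ ∇_μ}`. -/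
def wilsonD {n N d : ℕ} [NeZero n] (R : Rep N d) (a : ℝ) (b : Fin 4 → Circle) (U : Config n N) :
    Op n d :=
  ∑ μ, (1 / 2 : ℂ) • (spinOp n d (gamma μ) * (nablaBwd R a b U μ + nablaFwd R a b U μ)
    - (a : ℂ) • (nablaBwd R a b U μ * nablaFwd R a b U μ))

/-- `A = 1 - a D_w`. -/
def overlapA {n N d : ℕ} [NeZero n] (R : Rep N d) (a : ℝ) (b : Fin 4 → Circle) (U : Config n N) :
    Op n d :=
  1 - (a : ℂ) • wilsonD R a b U

/-- The overlap Dirac operator `D = (1/a) {1 - A (A† A)^{-1/2}}`. -/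
def overlapD {n N d : ℕ} [NeZero n] (R : Rep N d) (a : ℝ) (b : Fin 4 → Circle) (U : Config n N) :
    Op n d :=
  (a : ℂ)⁻¹ • (1 - overlapA R a b U *
    cfc (fun x : ℝ => (Real.sqrt x)⁻¹) ((overlapA R a b U)ᴴ * overlapA R a b U))

/-- `γ̂₅ = γ₅ (1 - a D)`. -/
def hatGamma5 {n N d : ℕ} [NeZero n] (R : Rep N d) (a : ℝ) (b : Fin 4 → Circle)
    (U : Config n N) : Op n d :=
  gamma5 n d * (1 - (a : ℂ) • overlapD R a b U)

/-- `P̂₋ = ½ (1 - γ̂₅)`. -/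
def hatPMinus {n N d : ℕ} [NeZero n] (R : Rep N d) (a : ℝ) (b : Fin 4 → Circle)
    (U : Config n N) : Op n d :=
  (1 / 2 : ℂ) • (1 - hatGamma5 R a b U)

/-- `P₊ = ½ (1 + γ₅)`. -/
def pPlus (n d : ℕ) : Op n d := (1 / 2 : ℂ) • (1 + gamma5 n d)

/-! ## The measure term -/

/-- `P_t[U]`, the projector `P̂₋` at the link field `U_t`. -/
def projT {n N d : ℕ} [NeZero n] (R : Rep N d) (a : ℝ) (b : Fin 4 → Circle) (t : ℝ)
    (U : Config n N) : Op n d :=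
  hatPMinus R a b (powConfig t U)

/-- The measure term `𝔏_η = i ∫₀¹ dt Tr {P_t [∂_t P_t, δ_η P_t]}`. -/
def measureTerm {n N d : ℕ} [NeZero n] (R : Rep N d) (a : ℝ) (b : Fin 4 → Circle) (η : Pert n N)
    (U : Config n N) : ℂ :=
  Complex.I * ∫ t in (0 : ℝ)..1,
    (projT R a b t U * ⁅deriv (fun s => projT R a b s U) t,
      variation a η (projT R a b t) U⁆).trace

/-- The measure current, defined by `𝔏_η = a⁴ ∑_{x, μ} η_μ^a(x) j_μ^a(x)`: this is its component
`j_μ^a(x)` in the direction `X = T^a` of the Lie algebra. -/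
def measureCurrent {n N d : ℕ} [NeZero n] (R : Rep N d) (a : ℝ) (b : Fin 4 → Circle) (x : Site n)
    (μ : Fin 4) (X : su N) (U : Config n N) : ℂ :=
  ((a : ℂ) ^ 4)⁻¹ * measureTerm R a b (Pi.single x (Pi.single μ X)) U

/-! ## Fermion integration measures -/

/-- The inner product `(f, g) = a⁴ ∑ₓ f(x)† g(x)` of fermion fields. -/
def fieldInner {n d : ℕ} [NeZero n] (a : ℝ) (f g : Idx n d → ℂ) : ℂ :=
  (a : ℂ) ^ 4 * ∑ s, star (f s) * g s

/-- `v` is an orthonormal basis of the space of fields `ψ` with `P ψ = ψ`. -/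
structure IsWeylBasis {n d m : ℕ} [NeZero n] (a : ℝ) (P : Op n d) (v : Fin m → Idx n d → ℂ) :
    Prop where
  proj : ∀ j, P *ᵥ v j = v j
  orthonormal : ∀ k j, fieldInner a (v k) (v j) = if k = j then 1 else 0
  complete : ∀ w, P *ᵥ w = w → w ∈ Submodule.span ℂ (Set.range v)

/-- `vb` is an orthonormal basis of the space of row fields `ψ̄` with `ψ̄ P = ψ̄`. -/
structure IsDualWeylBasis {n d m : ℕ} [NeZero n] (a : ℝ) (P : Op n d)
    (vb : Fin m → Idx n d → ℂ) : Prop where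
  proj : ∀ k, vb k ᵥ* P = vb k
  orthonormal : ∀ j k, fieldInner a (star (vb j)) (star (vb k)) = if j = k then 1 else 0
  complete : ∀ w, w ᵥ* P = w → w ∈ Submodule.span ℂ (Set.range vb)

/-- The Grassmann algebra generated by the field components `ψ(s)` and `ψ̄(s)`. -/
abbrev FieldAlg (n d : ℕ) : Type := ExteriorAlgebra ℂ (Idx n d ⊕ Idx n d → ℂ)

/-- The Grassmann algebra generated by the expansion coefficients `c_j` and `c̄_k`. -/
abbrev CoeffAlg (m : ℕ) : Type := ExteriorAlgebra ℂ (Fin m ⊕ Fin m → ℂ)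

/-- The field component `ψ(s)`. -/
def psi {n d : ℕ} (s : Idx n d) : FieldAlg n d :=
  ExteriorAlgebra.ι ℂ (Pi.single (M := fun _ => ℂ) (Sum.inl s) 1)

/-- The field component `ψ̄(s)`. -/
def psiBar {n d : ℕ} (s : Idx n d) : FieldAlg n d :=
  ExteriorAlgebra.ι ℂ (Pi.single (M := fun _ => ℂ) (Sum.inr s) 1)

/-- The fermion action `S_F = a⁴ ∑ₓ ψ̄(x) D ψ(x)`. -/
def fermionAction {n d : ℕ} [NeZero n] (a : ℝ) (D : Op n d) : FieldAlg n d :=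
  ((a : ℂ) ^ 4) • ∑ s, ∑ s', D s s' • (psiBar s * psi s')

/-- `e^{-S_F}`; the exponential series terminates since `S_F` is nilpotent. -/
def boltzmann {n d : ℕ} [NeZero n] (a : ℝ) (D : Op n d) : FieldAlg n d :=
  ∑ k ∈ Finset.range (Fintype.card (Idx n d) + 1),
    ((k.factorial : ℂ)⁻¹) • (-fermionAction a D) ^ k

/-- The expansion of the field variables, `ψ(s) = ∑_j v_j(s) c_j`, `ψ̄(s) = ∑_k c̄_k v̄_k(s)`. -/
def expand {n d m : ℕ} [NeZero n] (v vb : Fin m → Idx n d → ℂ) :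
    FieldAlg n d →ₐ[ℂ] CoeffAlg m :=
  ExteriorAlgebra.map
    { toFun := fun f => Sum.elim (fun j => ∑ s, f (Sum.inl s) * v j s)
        (fun k => ∑ s, f (Sum.inr s) * vb k s)
      map_add' := by
        intro f g
        ext (j | k) <;> simp [add_mul, Finset.sum_add_distrib]
      map_smul' := by
        intro c f
        ext (j | k) <;> simp [Finset.mul_sum, mul_assoc] }

/-- The Grassmann integral `∫ ∏_j dc_j ∏_k dc̄_k`: the coefficient of the monomial
`c_1 ⋯ c_m c̄_1 ⋯ c̄_m` (other ordering conventions change it by a constant sign). -/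
def berezin (m : ℕ) : CoeffAlg m →ₗ[ℂ] ℂ :=
  ExteriorAlgebra.liftAlternating (R := ℂ) (M := Fin m ⊕ Fin m → ℂ) (N := ℂ)
    (Pi.single (m + m)
      ((Pi.basisFun ℂ (Fin m ⊕ Fin m)).det.domDomCongr finSumFinEquiv))

/-- The fermion expectation value `⟨O⟩_F = ∫ D[ψ] D[ψ̄] O e^{-S_F}` for the integration measure
defined by the bases `v` and `vb`. -/
def expectation {n d m : ℕ} [NeZero n] (a : ℝ) (D : Op n d) (v vb : Fin m → Idx n d → ℂ)
    (O : FieldAlg n d) : ℂ :=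
  berezin m (expand v vb (O * boltzmann a D))

end LatticeWeyl

end

/-!
The measure term is constructed from a smooth extension of everything in sight to fields of
matrices, so that all statements become facts about families of projectors on an open subset of a
normed space.

A continuous representation `R` has a linear generator `ρ` on `su(N)`. The bound on `δ` involving
the cosine makes the principal logarithm of a smooth link variable traceless, and the other one
forces `δ ≤ 1/80`; then `R(exp X) = exp ρ(X)` holds with principal logarithms on both sides
(`rho_eq_log`, `exists_smallRep`), so that `U_t = exp (t log U)` lies in the smooth fields and its
represented links are smooth functions of `t` and the link matrices (`blockFn`). The free Wilson
operator satisfies `A† A ≥ 1` (`free_wilson_algebra`). Close to it `1 - A† A / 128` has norm below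
one, uniformly in the lattice (`norm_gapB_le`), and `P̂₋` is given by the binomial series of the
inverse square root (`hasSum_cfc_invSqrt`, `blockP`). This yields a smooth family of projectors
`projFamily`, whose pullback to link fields is `P_t`.

The measure term is `i` times the one-form `connection`, the integral over `t` of the curvature
`Tr {P [∂_t P, δP]}`. The curvature is a closed two-form (`curvature_closed`), and at `t = 0` the
family does not depend on the link field. Hence the exterior derivative of the connection is the
curvature at `t = 1`, which is the integrability condition (`local_integrability`). Along `U_t` the
projectors depend on one parameter only, so that the measure term vanishes
(`measureTerm_powConfig`).

Locality follows by truncating the binomial series. After `K` terms the measure current depends only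
on the links at a distance below `8 K`, and the error decays geometrically. The decay of its
derivatives is measured by the submultiplicative `jetNorm`, with a weight so small that the jet of
`1 - A† A / 128` still has norm below one; since the variation of a single link has a bounded trace
norm, no factor of the volume arises (`exists_truncation_bound`). The local piece `j_r` is the
difference of the currents where only the links at distances up to `r`, respectively below `r`, from
`x` are kept and the others are set to `1`; comparison with the truncated series shows that it is
exponentially small (`exists_isLocalAt_measureCurrent`).

For smooth fields no non-zero vector of the range of the free projector is annihilated by the
projector at `U`, or conversely (`eq_zero_of_blockP`). Polar decomposition then provides a smooth
global frame (`pairK`). The exterior derivative of its connection form is the curvature of the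
projectors, so the form differs from the measure term by the derivative of the phase accumulated
along `t` (`IsFrame.hasFDerivAt_phase`). Removing this phase, spread evenly over the basis vectors,
gives the required bases (`exists_weylIsometry`).

The Grassmann integral is a constant multiple of a top coefficient, computed by linear substitution
(`berezin_map`); the expectation values are polynomials in the entries of the bases and of `D`,
hence smooth (`contDiffAt_expectation`), and `⟨1⟩` is a determinant up to a constant factor
(`expectation_one`). The Ginsparg–Wilson relation gives `P₊ D = D P̂₋` (`pPlus_mul_overlapD`), which
makes the determinant invertible where `D` is and turns its logarithmic derivative into the trace
in the effective action (`hasDerivAt_det_weyl`). Integration along `U_t`, where the measure term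
vanishes, gives the exponential formula (`eq_mul_exp_integral`).
-/

set_option linter.unusedSectionVars false

noncomputable section

namespace LatticeWeyl

open Matrix hiding add_apply neg_apply smul_apply sub_apply zero_apply
open ContinuousLinearMap hiding norm_fst_le norm_snd_le
open Complex hiding exp exp_zero exp_nsmul exp_neg exp_add contDiff_exp Gamma
open Finset hiding exists_between
open NormedSpace (exp)
open intervalIntegral

open scoped Real

local notation "SmoothAt" => ContDiffAt ℝ ∞
local notation "𝐃" => iteratedFDeriv ℝ
local notation "𝐝" => fderiv ℝ
local notation "Mat" k:max => Matrix (Fin k) (Fin k) ℂ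
local notation "𝕀" => Set.Icc (0 : ℝ) 1

/-! ### Truncated jet norms -/

section Jets

variable {E F G H : Type*} [NormedAddCommGroup E] [NormedSpace ℝ E] [NormedAddCommGroup F]
  [NormedSpace ℝ F] [NormedAddCommGroup G] [NormedSpace ℝ G] [NormedAddCommGroup H]
  [NormedSpace ℝ H]

/-- The norm of the Taylor polynomial of order `k` of `f` at `z`, where the term of order `j` has
weight `σ ^ j / j!`. It is submultiplicative, and it tends to `‖f z‖` as `σ → 0`. -/
def jetNorm (k : ℕ) (σ : ℝ) (f : E → F) (z : E) : ℝ :=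
  ∑ j ∈ range (k + 1), σ ^ j / j.factorial * ‖𝐃 j f z‖

lemma iteratedFDeriv_congr_of_eventuallyEq {f g : E → F} {z : E} (h : f =ᶠ[𝓝 z] g) (j : ℕ) :
    𝐃 j f z = 𝐃 j g z := by
  rw [← iteratedFDerivWithin_univ, ← iteratedFDerivWithin_univ]
  exact Filter.EventuallyEq.iteratedFDerivWithin_eq (by rwa [nhdsWithin_univ]) h.eq_of_nhds j

lemma jetNorm_congr {f g : E → F} {z : E} (h : f =ᶠ[𝓝 z] g) (k : ℕ) (σ : ℝ) :
    jetNorm k σ f z = jetNorm k σ g z := by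
  simp only [jetNorm, iteratedFDeriv_congr_of_eventuallyEq h]

lemma jetNorm_nonneg {k : ℕ} {σ : ℝ} (hσ : 0 ≤ σ) {f : E → F} {z : E} : 0 ≤ jetNorm k σ f z :=
  sum_nonneg fun _ _ => by positivity

lemma norm_iteratedFDeriv_le_jetNorm {k j : ℕ} (hj : j ≤ k) {σ : ℝ} (hσ : 0 < σ) (f : E → F)
    (z : E) : ‖𝐃 j f z‖ ≤ j.factorial / σ ^ j * jetNorm k σ f z := by
  have := single_le_sum (f := fun j => σ ^ j / j.factorial * ‖𝐃 j f z‖)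
    (fun j _ => by positivity) (Finset.mem_range.2 (Nat.lt_succ_of_le hj))
  have h2 : (j.factorial : ℝ) / σ ^ j * (σ ^ j / j.factorial * ‖𝐃 j f z‖) = ‖𝐃 j f z‖ := by
    have : (j.factorial : ℝ) ≠ 0 := by positivity
    field_simp
  rw [← h2]
  gcongr
  exact this

lemma jetNorm_mono {k l : ℕ} (hkl : k ≤ l) {σ : ℝ} (hσ : 0 ≤ σ) (f : E → F) (z : E) :
    jetNorm k σ f z ≤ jetNorm l σ f z :=
  sum_le_sum_of_subset_of_nonneg (by gcongr) fun _ _ _ => by positivity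

lemma jetNorm_add_le {k : ℕ} {σ : ℝ} (hσ : 0 ≤ σ) {f g : E → F} {z : E}
    (hf : SmoothAt f z) (hg : SmoothAt g z) :
    jetNorm k σ (fun y => f y + g y) z ≤ jetNorm k σ f z + jetNorm k σ g z := by
  rw [jetNorm, jetNorm, jetNorm, ← sum_add_distrib]
  refine sum_le_sum fun j _ => ?_
  have : 𝐃 j (fun y => f y + g y) z = _ :=
    iteratedFDeriv_add_apply (hf.of_le (mod_cast le_top)) (hg.of_le (mod_cast le_top))
  rw [← mul_add, this]
  gcongr
  exact norm_add_le _ _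

lemma jetNorm_clm_comp_le {k : ℕ} {σ : ℝ} (hσ : 0 ≤ σ) (L : F →L[ℝ] G) {f : E → F} {z : E}
    (hf : SmoothAt f z) :
    jetNorm k σ (fun y => L (f y)) z ≤ ‖L‖ * jetNorm k σ f z := by
  rw [jetNorm, jetNorm, mul_sum]
  refine sum_le_sum fun j _ => ?_
  have : ‖𝐃 j (fun y => L (f y)) z‖ ≤ ‖L‖ * ‖𝐃 j f z‖ :=
    L.norm_iteratedFDeriv_comp_left hf (mod_cast le_top)
  calc _ ≤ σ ^ j / j.factorial * (‖L‖ * ‖𝐃 j f z‖) := by gcongr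
    _ = _ := by ring

lemma jetNorm_neg {k : ℕ} {σ : ℝ} (f : E → F) (z : E) :
    jetNorm k σ (fun y => -f y) z = jetNorm k σ f z := by
  have : (fun y => -f y) = (LinearIsometryEquiv.neg ℝ (E := F)) ∘ f := rfl
  simp only [jetNorm, this, LinearIsometryEquiv.norm_iteratedFDeriv_comp_left]

lemma jetNorm_sub_le {k : ℕ} {σ : ℝ} (hσ : 0 ≤ σ) {f g : E → F} {z : E}
    (hf : SmoothAt f z) (hg : SmoothAt g z) :
    jetNorm k σ (fun y => f y - g y) z ≤ jetNorm k σ f z + jetNorm k σ g z := by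
  have := jetNorm_add_le (k := k) hσ hf hg.neg
  simpa only [← sub_eq_add_neg, Pi.neg_apply, jetNorm_neg] using this

lemma jetNorm_const {k : ℕ} {σ : ℝ} (c : F) (z : E) : jetNorm k σ (fun _ => c) z = ‖c‖ := by
  rw [jetNorm, sum_eq_single 0]
  · simp
  · intro j _ hj
    rw [iteratedFDeriv_const_of_ne hj]
    simp
  · simp

lemma jetNorm_smul_le {𝕜 : Type*} [RCLike 𝕜] [NormedSpace 𝕜 F] {k : ℕ} {σ : ℝ} (hσ : 0 ≤ σ)
    [IsScalarTower ℝ 𝕜 F] (c : 𝕜) {f : E → F} {z : E} (hf : SmoothAt f z) :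
    jetNorm k σ (fun y => c • f y) z ≤ ‖c‖ * jetNorm k σ f z := by
  let L : F →L[ℝ] F := (c • ContinuousLinearMap.id 𝕜 F).restrictScalars ℝ
  refine (jetNorm_clm_comp_le hσ L hf).trans ?_
  have : 0 ≤ jetNorm k σ f z := jetNorm_nonneg hσ
  gcongr
  refine L.opNorm_le_bound (norm_nonneg _) fun x => ?_
  show ‖c • x‖ ≤ _
  rw [norm_smul]

/-- The Leibniz bound for a bilinear map of norm at most one, at a point of smoothness. -/
lemma norm_iteratedFDeriv_bilin_le (B : F →L[ℝ] G →L[ℝ] H) (hB : ‖B‖ ≤ 1) {f : E → F} {g : E → G}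
    {z : E} (hf : SmoothAt f z) (hg : SmoothAt g z) (n : ℕ) :
    ‖𝐃 n (fun y => B (f y) (g y)) z‖ ≤ ∑ i ∈ range (n + 1),
      (n.choose i : ℝ) * ‖𝐃 i f z‖ * ‖𝐃 (n - i) g z‖ := by
  obtain ⟨u, hu, hfu⟩ := (hf.of_le (m := n) (mod_cast le_top)).contDiffOn le_rfl (by simp)
  obtain ⟨v, hv, hgv⟩ := (hg.of_le (m := n) (mod_cast le_top)).contDiffOn le_rfl (by simp)
  obtain ⟨s, hs, hso, hzs⟩ := mem_nhds_iff.1 (Filter.inter_mem hu hv)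
  have := B.norm_iteratedFDerivWithin_le_of_bilinear_of_le_one (n := n) (N := n)
    (hfu.mono (hs.trans Set.inter_subset_left)) (hgv.mono (hs.trans Set.inter_subset_right))
    hso.uniqueDiffOn hzs le_rfl hB
  simpa only [iteratedFDerivWithin_of_isOpen _ hso hzs] using this

lemma jetNorm_bilin_le (B : F →L[ℝ] G →L[ℝ] H) (hB : ‖B‖ ≤ 1) {f : E → F} {g : E → G}
    {z : E} (hf : SmoothAt f z) (hg : SmoothAt g z) {k : ℕ} {σ : ℝ} (hσ : 0 ≤ σ) :
    jetNorm k σ (fun y => B (f y) (g y)) z ≤ jetNorm k σ f z * jetNorm k σ g z := by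
  set a : ℕ → ℝ := fun j => σ ^ j / j.factorial * ‖𝐃 j f z‖ with ha
  set b : ℕ → ℝ := fun j => σ ^ j / j.factorial * ‖𝐃 j g z‖ with hb
  have ha0 : ∀ j, 0 ≤ a j := fun j => by positivity
  have hb0 : ∀ j, 0 ≤ b j := fun j => by positivity
  calc jetNorm k σ (fun y => B (f y) (g y)) z
      ≤ ∑ j ∈ range (k + 1), ∑ i ∈ range (j + 1), a i * b (j - i) := by
        refine sum_le_sum fun j _ => ?_
        calc _ ≤ σ ^ j / j.factorial * ∑ i ∈ range (j + 1),
              (j.choose i : ℝ) * ‖𝐃 i f z‖ * ‖𝐃 (j - i) g z‖ := by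
              gcongr
              exact norm_iteratedFDeriv_bilin_le B hB hf hg j
          _ = _ := by
              rw [mul_sum]
              refine sum_congr rfl fun i hi => ?_
              have hij : i ≤ j := Nat.lt_succ_iff.1 (Finset.mem_range.1 hi)
              have h1 : (j.choose i : ℝ) = j.factorial / (i.factorial * (j - i).factorial) :=
                Nat.cast_choose ℝ hij
              have h2 : σ ^ j = σ ^ i * σ ^ (j - i) := by rw [← pow_add, Nat.add_sub_cancel' hij]
              have h3 : (j.factorial : ℝ) ≠ 0 := by positivity
              have h4 : (i.factorial : ℝ) ≠ 0 := by positivity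
              have h5 : ((j - i).factorial : ℝ) ≠ 0 := by positivity
              simp only [ha, hb]
              rw [h1, h2]
              field_simp
    _ = ∑ p ∈ ((range (k + 1)).sigma fun j => range (j + 1)),
          a p.2 * b (p.1 - p.2) := by rw [sum_sigma]
    _ = ∑ p ∈ ((range (k + 1)).sigma fun j => range (j + 1)).image
          (fun p => (p.2, p.1 - p.2)), a p.1 * b p.2 := by
        rw [sum_image]
        rintro ⟨j, i⟩ h ⟨j', i'⟩ h' heq
        simp only [coe_sigma, Set.mem_sigma_iff, mem_coe, mem_range] at h h'
        simp only [Prod.mk.injEq] at heq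
        obtain ⟨rfl, h2⟩ := heq
        have : j = j' := by omega
        subst this
        rfl
    _ ≤ ∑ p ∈ range (k + 1) ×ˢ range (k + 1), a p.1 * b p.2 := by
        refine sum_le_sum_of_subset_of_nonneg ?_ fun p _ _ => mul_nonneg (ha0 _) (hb0 _)
        intro p hp
        simp only [mem_image, mem_sigma, mem_range, mem_product] at hp ⊢
        obtain ⟨q, hq, rfl⟩ := hp
        constructor <;> simp only <;> omega
    _ = jetNorm k σ f z * jetNorm k σ g z := by rw [sum_product, jetNorm, jetNorm, sum_mul_sum]

lemma jetNorm_mul_le {A : Type*} [NormedRing A] [NormedAlgebra ℝ A] {f g : E → A}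
    {z : E} (hf : SmoothAt f z) (hg : SmoothAt g z) {k : ℕ} {σ : ℝ} (hσ : 0 ≤ σ) :
    jetNorm k σ (fun y => f y * g y) z ≤ jetNorm k σ f z * jetNorm k σ g z :=
  jetNorm_bilin_le (mul ℝ A) (opNorm_mul_le ℝ A) hf hg hσ

lemma jetNorm_pow_le {A : Type*} [NormedRing A] [NormedAlgebra ℝ A] (h1 : ‖(1 : A)‖ ≤ 1)
    {f : E → A} {z : E} (hf : SmoothAt f z) {k : ℕ} {σ : ℝ} (hσ : 0 ≤ σ) (m : ℕ) :
    jetNorm k σ (fun y => f y ^ m) z ≤ jetNorm k σ f z ^ m := by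
  induction m with
  | zero => simpa [jetNorm_const] using h1
  | succ m ih =>
    simp only [pow_succ]
    refine (jetNorm_mul_le (hf.pow m) hf hσ).trans ?_
    have := jetNorm_nonneg (k := k) hσ (f := f) (z := z)
    gcongr

lemma jetNorm_fderiv_apply_le {f : E → F} {z : E} (hf : SmoothAt f z) (v : E) {k : ℕ}
    {σ : ℝ} (hσ : 0 < σ) :
    jetNorm k σ (fun y => 𝐝 f y v) z ≤ (k + 1) / σ * ‖v‖ * jetNorm (k + 1) σ f z := by
  have hd : SmoothAt (𝐝 f) z := hf.fderiv_right (by simp)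
  have key : ∀ j ∈ range (k + 1), σ ^ j / j.factorial *
      ‖𝐃 j (fun y => 𝐝 f y v) z‖ ≤ (k + 1) / σ * ‖v‖ *
      (σ ^ (j + 1) / (j + 1).factorial * ‖𝐃 (j + 1) f z‖) := by
    intro j hj
    have h1 := norm_iteratedFDeriv_clm_apply_const (c := v) (n := j) hd (mod_cast le_top)
    rw [norm_iteratedFDeriv_fderiv] at h1
    have hjk : (j : ℝ) + 1 ≤ k + 1 := by simp_all
    calc _ ≤ σ ^ j / j.factorial * (‖v‖ * ‖𝐃 (j + 1) f z‖) := by gcongr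
      _ = (j + 1) / σ * ‖v‖ * (σ ^ (j + 1) / (j + 1).factorial * ‖𝐃 (j + 1) f z‖) := by
          rw [Nat.factorial_succ, pow_succ]
          push_cast
          have : (j.factorial : ℝ) ≠ 0 := by positivity
          field_simp
      _ ≤ _ := by gcongr
  calc jetNorm k σ (fun y => 𝐝 f y v) z
      ≤ ∑ j ∈ range (k + 1), (k + 1) / σ * ‖v‖ *
        (σ ^ (j + 1) / (j + 1).factorial * ‖𝐃 (j + 1) f z‖) := sum_le_sum key
    _ ≤ _ := by
        rw [← mul_sum]
        gcongr
        rw [jetNorm, sum_range_succ' _ (k + 1)]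
        exact le_add_of_nonneg_right (by positivity)

lemma iteratedFDeriv_comp_const_add (f : E → F) (c : E) (j : ℕ) :
    𝐃 j (fun y => f (c + y)) = fun y => 𝐃 j f (c + y) := by
  induction j with
  | zero => ext y; simp
  | succ j ih =>
    funext y
    rw [iteratedFDeriv_succ_eq_comp_left, iteratedFDeriv_succ_eq_comp_left]
    simp only [Function.comp_apply, ih]
    congr 1
    exact fderiv_comp_add_left c

/-- Derivatives of the composition with an affine map. -/
lemma iteratedFDeriv_comp_affine (L : G →L[ℝ] E) (c : E) {f : E → F} {y : G}
    (hf : SmoothAt f (c + L y)) (j : ℕ) :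
    𝐃 j (fun y => f (c + L y)) y = (𝐃 j f (c + L y)).compContinuousLinearMap fun _ => L := by
  have hf' : SmoothAt (fun w => f (c + w)) (L y) :=
    ContDiffAt.comp (L y) (g := f) hf (contDiffAt_const.add contDiffAt_id)
  obtain ⟨u, hu, hfu⟩ := (hf'.of_le (m := j) (mod_cast le_top)).contDiffOn le_rfl (by simp)
  obtain ⟨s, hs, hso, hzs⟩ := mem_nhds_iff.1 hu
  have := L.iteratedFDerivWithin_comp_right (hfu.mono hs) hso.uniqueDiffOn
    (hso.preimage L.continuous).uniqueDiffOn hzs (i := j) le_rfl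
  rw [iteratedFDerivWithin_of_isOpen _ hso hzs, iteratedFDeriv_comp_const_add,
    iteratedFDerivWithin_of_isOpen _ (hso.preimage L.continuous) hzs] at this
  exact this

lemma norm_iteratedFDeriv_comp_affine_le (L : G →L[ℝ] E) (hL : ‖L‖ ≤ 1) (c : E) {f : E → F}
    {y : G} (hf : SmoothAt f (c + L y)) (j : ℕ) :
    ‖𝐃 j (fun y => f (c + L y)) y‖ ≤ ‖𝐃 j f (c + L y)‖ := by
  rw [iteratedFDeriv_comp_affine L c hf]
  refine (ContinuousMultilinearMap.norm_compContinuousLinearMap_le _ _).trans ?_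
  refine mul_le_of_le_one_right (norm_nonneg _) ?_
  exact prod_le_one (fun _ _ => norm_nonneg _) fun _ _ => hL

/-- Derivative bounds of the components of a map into a finite product give derivative bounds of
the map. -/
lemma norm_iteratedFDeriv_pi_le {ι : Type*} [Fintype ι] {F : ι → Type*}
    [∀ i, NormedAddCommGroup (F i)] [∀ i, NormedSpace ℝ (F i)] {f : E → ∀ i, F i} {z : E}
    (hf : ∀ i, SmoothAt (fun y => f y i) z) {j : ℕ} {C : ℝ} (hC : 0 ≤ C)
    (h : ∀ i, ‖𝐃 j (fun y => f y i) z‖ ≤ C) : ‖𝐃 j f z‖ ≤ C := by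
  have hf' : SmoothAt f z := contDiffAt_pi.2 hf
  refine ContinuousMultilinearMap.opNorm_le_bound hC fun m => ?_
  refine (pi_norm_le_iff_of_nonneg (by positivity)).2 fun i => ?_
  have h1 : 𝐃 j (fun y => f y i) z =
      (proj (R := ℝ) (φ := F) i).compContinuousMultilinearMap (𝐃 j f z) :=
    (proj (R := ℝ) (φ := F) i).iteratedFDeriv_comp_left hf' (i := j) (mod_cast le_top)
  have h2 : 𝐃 j f z m i = 𝐃 j (fun y => f y i) z m := by rw [h1]; rfl
  rw [h2]
  refine (ContinuousMultilinearMap.le_opNorm _ _).trans ?_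
  gcongr
  exact h i

end Jets

/-! ### Smoothness of series and of parametric integrals -/

section Smooth

variable {E F : Type*} [NormedAddCommGroup E] [NormedSpace ℝ E] [NormedAddCommGroup F]
  [NormedSpace ℝ F]

/-- A function all of whose iterated derivatives are differentiable on an open set is smooth
there. -/
lemma contDiffAt_of_differentiableAt_iteratedFDeriv {f : E → F} {O : Set E} (hO : IsOpen O)
    (h : ∀ j : ℕ, ∀ z ∈ O, DifferentiableAt ℝ (𝐃 j f) z) {z : E} (hz : z ∈ O) :
    SmoothAt f z := by
  have : ContDiffOn ℝ ∞ f O := contDiffOn_of_differentiableOn fun m _ => by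
    intro y hy
    refine ((h m y hy).differentiableWithinAt (s := O)).congr_of_eventuallyEq ?_ ?_
    · filter_upwards [self_mem_nhdsWithin] with w hw using iteratedFDerivWithin_of_isOpen m hO hw
    · exact iteratedFDerivWithin_of_isOpen m hO hy
  exact (this z hz).contDiffAt (hO.mem_nhds hz)

lemma differentiableAt_iteratedFDeriv_of_contDiffAt {f : E → F} {z : E} (h : SmoothAt f z)
    (j : ℕ) : DifferentiableAt ℝ (𝐃 j f) z :=
  (h.iteratedFDeriv_right (i := j) (m := 1) (mod_cast le_top)).differentiableAt one_ne_zero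

section Series

variable [CompleteSpace F] {f : ℕ → E → F} {O : Set E}

/-- The terms of the series `∑ f m` are smooth on the open set `O`, and their derivatives of each
order are locally dominated by summable sequences. -/
structure SmoothSeries (f : ℕ → E → F) (O : Set E) : Prop where
  isOpen : IsOpen O
  smooth : ∀ m, ∀ z ∈ O, SmoothAt (f m) z
  dominated : ∀ j, ∀ z ∈ O, ∃ u ∈ 𝓝 z, ∃ b : ℕ → ℝ, Summable b ∧ ∀ m, ∀ y ∈ u, ‖𝐃 j (f m) y‖ ≤ b m

namespace SmoothSeries

variable (h : SmoothSeries f O)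
include h

lemma hasFDerivAt_iteratedFDeriv (j : ℕ) {z : E} (hz : z ∈ O)
    {S : E → E [×j]→L[ℝ] F} (hS : ∀ y ∈ O, S y = ∑' m, 𝐃 j (f m) y) :
    HasFDerivAt S (∑' m, 𝐝 (𝐃 j (f m)) z) z := by
  obtain ⟨u, hu, b, hbs, hbu⟩ := h.dominated (j + 1) z hz
  obtain ⟨u', hu', b', hbs', hbu'⟩ := h.dominated j z hz
  obtain ⟨r, hr, hball⟩ := Metric.mem_nhds_iff.1 (Filter.inter_mem hu (h.isOpen.mem_nhds hz))
  have key := hasFDerivAt_tsum_of_isPreconnected (𝕜 := ℝ) (s := Metric.ball z r) hbs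
    Metric.isOpen_ball (convex_ball z r).isPreconnected
    (f := fun m => 𝐃 j (f m)) (f' := fun m => 𝐝 (𝐃 j (f m)))
    (fun m y hy => (differentiableAt_iteratedFDeriv_of_contDiffAt
      (h.smooth m y (hball hy).2) j).hasFDerivAt)
    (fun m y hy => by rw [norm_fderiv_iteratedFDeriv]; exact hbu m y (hball hy).1)
    (Metric.mem_ball_self hr)
    (Summable.of_norm_bounded hbs' fun m => hbu' m z (mem_of_mem_nhds hu'))
    (Metric.mem_ball_self hr)
  refine key.congr_of_eventuallyEq ?_
  filter_upwards [h.isOpen.mem_nhds hz] with y hy using hS y hy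

/-- Termwise differentiation. -/
lemma iteratedFDeriv_tsum (j : ℕ) : ∀ z ∈ O, 𝐃 j (fun y => ∑' m, f m y) z = ∑' m, 𝐃 j (f m) z := by
  induction j with
  | zero =>
    intro z _
    simp only [iteratedFDeriv_zero_eq_comp, Function.comp_apply]
    exact ((continuousMultilinearCurryFin0 ℝ E F).symm.toContinuousLinearEquiv.map_tsum)
  | succ j ih =>
    intro z hz
    simp only [iteratedFDeriv_succ_eq_comp_left, Function.comp_apply]
    rw [(h.hasFDerivAt_iteratedFDeriv j hz ih).fderiv]
    exact ((continuousMultilinearCurryLeftEquiv ℝ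
      (fun _ : Fin (j + 1) => E) F).symm.toContinuousLinearEquiv.map_tsum)

lemma contDiffAt_tsum {z : E} (hz : z ∈ O) : SmoothAt (fun y => ∑' m, f m y) z :=
  contDiffAt_of_differentiableAt_iteratedFDeriv h.isOpen (fun j _ hy =>
    (h.hasFDerivAt_iteratedFDeriv j hy (h.iteratedFDeriv_tsum j)).differentiableAt) hz

lemma hasSum_fderiv {z : E} (hz : z ∈ O) :
    HasSum (fun m => 𝐝 (f m) z) (𝐝 (fun y => ∑' m, f m y) z) := by
  let e := continuousMultilinearCurryFin1 ℝ E F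
  obtain ⟨u, hu, b, hbs, hbu⟩ := h.dominated 1 z hz
  have h1 : HasSum (fun m => e (𝐃 1 (f m) z)) (e (∑' m, 𝐃 1 (f m) z)) :=
    e.toContinuousLinearEquiv.toContinuousLinearMap.hasSum
      (Summable.of_norm_bounded hbs fun m => hbu m z (mem_of_mem_nhds hu)).hasSum
  rw [← h.iteratedFDeriv_tsum 1 z hz] at h1
  have h2 : ∀ g : E → F, e (𝐃 1 g z) = 𝐝 g z := fun g => by ext v; exact iteratedFDeriv_one_apply _
  simpa only [h2] using h1

end SmoothSeries

end Series

section Integral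

variable {G : ℝ × E → F} {O : Set (ℝ × E)}

lemma _root_.ContDiffAt.hasFD {E F : Type*} [NormedAddCommGroup E] [NormedSpace ℝ E]
    [NormedAddCommGroup F] [NormedSpace ℝ F] {f : E → F} {x : E} (h : SmoothAt f x) :
    HasFDerivAt f (𝐝 f x) x := (h.differentiableAt (by simp)).hasFDerivAt

lemma unitIntegral_congr {F : Type*} [NormedAddCommGroup F] [NormedSpace ℝ F] {f g : ℝ → F}
    (h : ∀ t ∈ 𝕀, f t = g t) : ∫ t in (0 : ℝ)..1, f t = ∫ t in (0 : ℝ)..1, g t :=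
  integral_congr fun t ht => h t (by rwa [Set.uIcc_of_le zero_le_one] at ht)

lemma isOpen_forall_unitInterval {E : Type*} [TopologicalSpace E] {O : Set (ℝ × E)}
    (hO : IsOpen O) :
    IsOpen {y : E | ∀ t ∈ 𝕀, (t, y) ∈ O} := by
  rw [isOpen_iff_mem_nhds]
  intro y hy
  obtain ⟨u, v, -, hv, hu, hyv, huv⟩ := generalized_tube_lemma (s := 𝕀)
    (t := {y}) isCompact_Icc isCompact_singleton (n := O) hO (by
      rintro ⟨t, y'⟩ ⟨ht, hy'⟩
      obtain rfl : y' = y := hy'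
      exact hy t ht)
  filter_upwards [hv.mem_nhds (hyv rfl)] with w hw t ht using huv ⟨hu ht, hw⟩

lemma contDiffAt_slice {t : ℝ} {y : E} (hG : SmoothAt G (t, y)) : SmoothAt (fun y => G (t, y)) y :=
  ContDiffAt.comp y hG (contDiffAt_const.prodMk contDiffAt_id)

lemma fderiv_slice {t : ℝ} {y : E} (hG : SmoothAt G (t, y)) :
    𝐝 (fun y => G (t, y)) y = (𝐝 G (t, y)).comp (inr ℝ ℝ E) := by
  have h1 : HasFDerivAt (fun y : E => (t, y)) (inr ℝ ℝ E) y := hasFDerivAt_prodMk_right t y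
  exact (hG.hasFD.comp y h1).fderiv

lemma continuousOn_slice (hG : ∀ p ∈ O, SmoothAt G p) {y : E} (hy : ∀ t ∈ 𝕀, (t, y) ∈ O) :
    ContinuousOn (fun t => G (t, y)) (Set.Icc 0 1) := fun t ht =>
  (ContinuousAt.comp (f := fun t : ℝ => (t, y)) (hG _ (hy t ht)).continuousAt
    (by fun_prop)).continuousWithinAt

lemma intervalIntegrable_slice (hG : ∀ p ∈ O, SmoothAt G p) {y : E} (hy : ∀ t ∈ 𝕀, (t, y) ∈ O) :
    IntervalIntegrable (fun t => G (t, y)) MeasureTheory.volume 0 1 :=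
  (continuousOn_slice hG hy).intervalIntegrable_of_Icc zero_le_one

lemma hasFDerivAt_unitIntegral (hO : IsOpen O) (hG : ∀ p ∈ O, SmoothAt G p) {y : E}
    (hy : ∀ t ∈ 𝕀, (t, y) ∈ O) :
    HasFDerivAt (fun y => ∫ t in (0 : ℝ)..1, G (t, y))
      (∫ t in (0 : ℝ)..1, 𝐝 (fun y => G (t, y)) y) y := by
  have hIoc : Set.uIoc (0 : ℝ) 1 ⊆ Set.Icc 0 1 := by grind
  have hd : ∀ p ∈ O, ContinuousAt (𝐝 G) p := fun p hp =>
    ((hG p hp).fderiv_right (m := 0) (by simp)).continuousAt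
  have hcont : ContinuousOn (fun t : ℝ => 𝐝 G (t, y)) (Set.Icc 0 1) := fun t ht =>
    (ContinuousAt.comp (f := fun t : ℝ => (t, y)) (hd _ (hy t ht)) (by fun_prop)).continuousWithinAt
  obtain ⟨C, hC⟩ := isCompact_Icc.exists_bound_of_continuousOn hcont
  set O' : Set (ℝ × E) := {p | p ∈ O ∧ ‖𝐝 G p‖ < C + 1} with hO'
  have hO'o : IsOpen O' := by
    rw [isOpen_iff_mem_nhds]
    rintro p ⟨hp, hp2⟩
    exact Filter.inter_mem (hO.mem_nhds hp) ((hd p hp).norm.eventually_lt_const hp2)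
  have hy' : ∀ t ∈ 𝕀, (t, y) ∈ O' := fun t ht =>
    ⟨hy t ht, (hC t ht).trans_lt (lt_add_one C)⟩
  have hW := (isOpen_forall_unitInterval hO'o).mem_nhds hy'
  refine intervalIntegral.hasFDerivAt_integral_of_dominated_of_fderiv_le
    (F := fun y t => G (t, y)) (F' := fun y t => 𝐝 (fun y => G (t, y)) y)
    (bound := fun _ => C + 1) hW ?_ (intervalIntegrable_slice hG hy) ?_ ?_
    intervalIntegrable_const ?_
  · filter_upwards [hW] with w hw
    exact ((continuousOn_slice hG fun t ht => (hw t ht).1).mono hIoc).aestronglyMeasurable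
      measurableSet_uIoc
  · refine (ContinuousOn.mono (s := Set.Icc 0 1) ?_ hIoc).aestronglyMeasurable measurableSet_uIoc
    refine ContinuousOn.congr (f := fun t =>
      (𝐝 G (t, y)).comp (inr ℝ ℝ E)) ?_ fun t ht =>
        fderiv_slice (hG _ (hy t ht))
    exact hcont.clm_comp continuousOn_const
  · refine Filter.Eventually.of_forall fun t ht w hw => ?_
    have h1 := hw t (hIoc ht)
    rw [fderiv_slice (hG _ h1.1)]
    refine (opNorm_comp_le _ _).trans ?_
    refine (mul_le_of_le_one_right (norm_nonneg _) (norm_inr_le_one ℝ ℝ E)).trans h1.2.le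
  · refine Filter.Eventually.of_forall fun t ht w hw => ?_
    exact (contDiffAt_slice (hG _ (hw t (hIoc ht)).1)).hasFD

lemma iteratedFDeriv_slice {t : ℝ} {y : E} (hG : SmoothAt G (t, y)) (j : ℕ) :
    𝐃 j (fun y => G (t, y)) y = (𝐃 j G (t, y)).compContinuousLinearMap fun _ => inr ℝ ℝ E := by
  have := iteratedFDeriv_comp_affine (inr ℝ ℝ E) (t, (0 : E)) (f := G) (y := y)
    (by simpa using hG) j
  simpa using this

lemma hasFDerivAt_iteratedFDeriv_unitIntegral (hO : IsOpen O)
    (hG : ∀ p ∈ O, SmoothAt G p) (j : ℕ) {S : E → E [×j]→L[ℝ] F}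
    (hS : ∀ y : E, (∀ t ∈ 𝕀, (t, y) ∈ O) →
      S y = ∫ t in (0 : ℝ)..1, 𝐃 j (fun y => G (t, y)) y) {y : E}
    (hy : ∀ t ∈ 𝕀, (t, y) ∈ O) :
    HasFDerivAt S (∫ t in (0 : ℝ)..1, 𝐝 (𝐃 j (fun y => G (t, y))) y) y := by
  let L := ContinuousMultilinearMap.compContinuousLinearMapL (F := F) fun _ : Fin j => inr ℝ ℝ E
  have hIoc : Set.uIcc (0 : ℝ) 1 = Set.Icc 0 1 := Set.uIcc_of_le zero_le_one
  have hH : ∀ p ∈ O, SmoothAt (fun p => L (𝐃 j G p)) p := fun p hp =>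
    L.contDiff.contDiffAt.comp p ((hG p hp).iteratedFDeriv_right (i := j) (mod_cast le_top))
  have key := hasFDerivAt_unitIntegral hO hH hy
  have hL : ∀ p ∈ O, 𝐃 j (fun y => G (p.1, y)) p.2 = L (𝐃 j G p) :=
    fun p hp => iteratedFDeriv_slice (hG p hp) j
  have h1 : (∫ t in (0 : ℝ)..1, 𝐝 (𝐃 j (fun y => G (t, y))) y) =
      ∫ t in (0 : ℝ)..1, 𝐝 (fun y => L (𝐃 j G (t, y))) y := by
    refine integral_congr fun t ht => ?_
    rw [hIoc] at ht
    refine Filter.EventuallyEq.fderiv_eq ?_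
    have : ∀ᶠ w in 𝓝 y, (t, w) ∈ O :=
      (hO.preimage (by fun_prop : Continuous fun w : E => (t, w))).mem_nhds (hy t ht)
    filter_upwards [this] with w hw using hL (t, w) hw
  rw [h1]
  refine key.congr_of_eventuallyEq ?_
  filter_upwards [(isOpen_forall_unitInterval hO).mem_nhds hy] with w hw
  rw [hS w hw]
  refine integral_congr fun t ht => ?_
  rw [hIoc] at ht
  exact hL (t, w) (hw t ht)

lemma isometryEquiv_unitIntegral {E F : Type*} [NormedAddCommGroup E] [NormedSpace ℝ E]
    [NormedAddCommGroup F] [NormedSpace ℝ F] (e : E ≃ₗᵢ[ℝ] F) (f : ℝ → E) :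
    e (∫ t in (0 : ℝ)..1, f t) = ∫ t in (0 : ℝ)..1, e (f t) := by
  simp only [intervalIntegral, map_sub]
  exact congrArg₂ _ (e.toContinuousLinearEquiv.integral_comp_comm f).symm
    (e.toContinuousLinearEquiv.integral_comp_comm f).symm

lemma iteratedFDeriv_unitIntegral (hO : IsOpen O) (hG : ∀ p ∈ O, SmoothAt G p) (j : ℕ) : ∀ y : E,
    (∀ t ∈ 𝕀, (t, y) ∈ O) →
    𝐃 j (fun y => ∫ t in (0 : ℝ)..1, G (t, y)) y =
      ∫ t in (0 : ℝ)..1, 𝐃 j (fun y => G (t, y)) y := by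
  induction j with
  | zero =>
    intro y _
    simp only [iteratedFDeriv_zero_eq_comp, Function.comp_apply]
    exact isometryEquiv_unitIntegral (continuousMultilinearCurryFin0 ℝ E F).symm _
  | succ j ih =>
    intro y hy
    have h := hasFDerivAt_iteratedFDeriv_unitIntegral hO hG j ih hy
    simp only [iteratedFDeriv_succ_eq_comp_left, Function.comp_apply]
    rw [h.fderiv]
    exact isometryEquiv_unitIntegral (E := E →L[ℝ] E [×j]→L[ℝ] F) (F := E [×(j + 1)]→L[ℝ] F)
      (continuousMultilinearCurryLeftEquiv ℝ (fun _ : Fin (j + 1) => E) F).symm _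

lemma contDiffAt_unitIntegral (hO : IsOpen O)
    (hG : ∀ p ∈ O, SmoothAt G p) {y : E} (hy : ∀ t ∈ 𝕀, (t, y) ∈ O) :
    SmoothAt (fun y => ∫ t in (0 : ℝ)..1, G (t, y)) y :=
  contDiffAt_of_differentiableAt_iteratedFDeriv (isOpen_forall_unitInterval hO) (fun j _ hw =>
    (hasFDerivAt_iteratedFDeriv_unitIntegral hO hG j
      (iteratedFDeriv_unitIntegral hO hG j) hw).differentiableAt) hy

lemma norm_iteratedFDeriv_unitIntegral_le (hO : IsOpen O)
    (hG : ∀ p ∈ O, SmoothAt G p) {y : E} (hy : ∀ t ∈ 𝕀, (t, y) ∈ O) (j : ℕ)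
    {C : ℝ} (hC : ∀ t ∈ 𝕀, ‖𝐃 j (fun y => G (t, y)) y‖ ≤ C) :
    ‖𝐃 j (fun y => ∫ t in (0 : ℝ)..1, G (t, y)) y‖ ≤ C := by
  rw [iteratedFDeriv_unitIntegral hO hG j y hy]
  have := norm_integral_le_of_norm_le_const (a := 0) (b := 1) (C := C)
    (f := fun t => 𝐃 j (fun y => G (t, y)) y) fun t ht => hC t (by
      rw [Set.uIoc_of_le zero_le_one] at ht; exact Set.Ioc_subset_Icc_self ht)
  simpa using this

end Integral

end Smooth

/-! ### The inverse square root as a power series -/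

/-- The Taylor coefficients of `(1 - x) ^ (-1 / 2)` at `x = 0`. -/
def invSqrtCoeff (m : ℕ) : ℝ := Ring.choose ((1 / 2 : ℝ) + m - 1) m

lemma abs_invSqrtCoeff_le_one (m : ℕ) : |invSqrtCoeff m| ≤ 1 := by
  have h := Ring.descPochhammer_eq_factorial_smul_choose ((1 / 2 : ℝ) + m - 1) m
  have hp : ∀ (r : ℝ) (n : ℕ), (descPochhammer ℤ n).smeval r = ∏ j ∈ range n, (r - j) := by
    intro r n
    induction n with
    | zero => simp
    | succ n ih =>
      rw [descPochhammer_succ_right, Polynomial.smeval_mul, ih, prod_range_succ]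
      simp [Polynomial.smeval_sub, Polynomial.smeval_natCast]
  rw [hp, nsmul_eq_mul] at h
  have h2 : |∏ j ∈ range m, ((1 / 2 : ℝ) + m - 1 - j)| ≤ m.factorial := by
    rw [abs_prod, ← prod_range_reflect, ← prod_range_add_one_eq_factorial]
    push_cast
    refine prod_le_prod (fun _ _ => abs_nonneg _) fun j hj => ?_
    have hj : j + 1 ≤ m := Finset.mem_range.1 hj
    have : ((m - 1 - j : ℕ) : ℝ) = m - 1 - j := by
      rw [Nat.sub_sub, Nat.cast_sub (by omega)]; push_cast; ring
    rw [this, abs_le]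
    constructor <;> linarith [Nat.cast_nonneg (α := ℝ) j]
  rw [h, abs_mul, Nat.abs_cast] at h2
  have h3 : (0 : ℝ) < m.factorial := by positivity
  exact le_of_mul_le_mul_left (by simpa [invSqrtCoeff] using h2) h3

lemma hasSum_invSqrtCoeff {x : ℝ} (hx : |x| < 1) :
    HasSum (fun m => invSqrtCoeff m * x ^ m) (√(1 - x))⁻¹ := by
  have h := (Real.one_div_one_sub_rpow_hasFPowerSeriesOnBall_zero (1 / 2)).hasSum (y := x) (by
    rw [Metric.mem_eball, edist_zero_right, ← ofReal_norm, Real.norm_eq_abs]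
    simpa using hx)
  simp only [zero_add, FormalMultilinearSeries.ofScalars_apply_eq, smul_eq_mul] at h
  rw [Real.sqrt_eq_rpow, ← one_div]
  exact h

/-- The functional `x ↦ tr (x y)`. Its norm is the trace norm of `y` if `tr` is the trace. -/
def traceFunctional {A : Type*} [NormedRing A] [NormedAlgebra ℝ A] (tr : A →L[ℝ] ℂ) :
    A →L[ℝ] (A →L[ℝ] ℂ) := (compL ℝ A A ℂ tr).comp (mul ℝ A).flip

local notation "Θ[" tr ", " f ", " v "]" => fun y => traceFunctional tr (𝐝 f y v)

section PowerSeries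

variable {E A : Type*} [NormedAddCommGroup E] [NormedSpace ℝ E] [NormedRing A] [NormedAlgebra ℝ A]
  {B : E → A} {O : Set E}

lemma contDiffAt_smul_pow {z : E} (hB : SmoothAt B z) (c : ℝ) (m : ℕ) :
    SmoothAt (fun y => c • B y ^ m) z :=
  (contDiffAt_const (c := c)).smul (hB.pow m)

lemma jetNorm_smul_pow_le (h1 : ‖(1 : A)‖ ≤ 1) {c : ℝ} (hc : |c| ≤ 1) {z : E}
    (hB : SmoothAt B z) {k : ℕ} {σ q : ℝ} (hσ : 0 ≤ σ) (hq : jetNorm k σ B z ≤ q) (m : ℕ) :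
    jetNorm k σ (fun y => c • B y ^ m) z ≤ q ^ m := by
  refine (jetNorm_smul_le (𝕜 := ℝ) hσ c (hB.pow m)).trans ?_
  refine (mul_le_of_le_one_left (jetNorm_nonneg hσ) hc).trans ?_
  refine (jetNorm_pow_le h1 hB hσ m).trans ?_
  exact pow_le_pow_left₀ (jetNorm_nonneg hσ) hq m

/-- If `‖B z‖ < 1`, then the weight of the jets can be chosen such that the jet norm of `B` is
less than one as well. -/
lemma exists_jetNorm_lt (k : ℕ) (C : ℕ → ℝ) {q q' : ℝ} (hq : q < q') :
    ∃ σ : ℝ, 0 < σ ∧ ∀ (E F : Type) [NormedAddCommGroup E] [NormedSpace ℝ E]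
      [NormedAddCommGroup F] [NormedSpace ℝ F] (f : E → F) (z : E),
      ‖f z‖ ≤ q → (∀ j, 1 ≤ j → j ≤ k → ‖𝐃 j f z‖ ≤ C j) →
      jetNorm k σ f z < q' := by
  have hlim : Filter.Tendsto (fun σ : ℝ => q +
      ∑ j ∈ range k, σ ^ (j + 1) / (j + 1).factorial * C (j + 1)) (𝓝[>] 0) (𝓝 q) := by
    have : ContinuousAt (fun σ : ℝ => q +
      ∑ j ∈ range k, σ ^ (j + 1) / (j + 1).factorial * C (j + 1)) 0 := by fun_prop
    have h := this.tendsto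
    simp only [ne_eq, Nat.add_eq_zero_iff, one_ne_zero, and_false, not_false_eq_true, zero_pow,
      zero_div, zero_mul, sum_const_zero, add_zero] at h
    exact h.mono_left nhdsWithin_le_nhds
  obtain ⟨σ, hσ1, hσ2⟩ := ((hlim.eventually_lt_const hq).and self_mem_nhdsWithin).exists
  have hσ : (0 : ℝ) < σ := hσ2
  refine ⟨σ, hσ, fun E F _ _ _ _ f z h0 hj => lt_of_le_of_lt ?_ hσ1⟩
  rw [jetNorm, sum_range_succ', add_comm]
  refine add_le_add (by simpa using h0) (sum_le_sum fun j hjk => ?_)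
  have := hj (j + 1) (by omega) (by have := Finset.mem_range.1 hjk; omega)
  gcongr

lemma continuousAt_jetNorm {F : Type*} [NormedAddCommGroup F] [NormedSpace ℝ F] {f : E → F}
    {z : E} (hf : SmoothAt f z) (k : ℕ) (σ : ℝ) : ContinuousAt (jetNorm k σ f) z := by
  unfold jetNorm
  refine tendsto_finsetSum _ fun j _ => ?_
  exact (((hf.iteratedFDeriv_right (i := j) (m := 0)
    (mod_cast le_top)).continuousAt).norm.const_mul _)

lemma exists_jetNorm_lt_one {z : E} (hz : ‖B z‖ < 1) (k : ℕ) :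
    ∃ σ : ℝ, 0 < σ ∧ jetNorm k σ B z < 1 := by
  have : ContinuousAt (fun σ : ℝ => jetNorm k σ B z) 0 := by unfold jetNorm; fun_prop
  have h0 : jetNorm k 0 B z = ‖B z‖ := by rw [jetNorm, sum_range_succ']; simp
  have h : Filter.Tendsto (fun σ : ℝ => jetNorm k σ B z) (𝓝[>] 0) (𝓝 ‖B z‖) := by
    rw [← h0]; exact this.tendsto.mono_left nhdsWithin_le_nhds
  obtain ⟨σ, hσ1, hσ2⟩ := ((h.eventually_lt_const hz).and self_mem_nhdsWithin).exists
  exact ⟨σ, hσ2, hσ1⟩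

/-- `B` is smooth on the open set `O`, and its values there have norm less than one. -/
structure IsContracting (B : E → A) (O : Set E) : Prop where
  isOpen : IsOpen O
  smooth : ∀ z ∈ O, SmoothAt B z
  lt_one : ∀ z ∈ O, ‖B z‖ < 1

variable {c : ℕ → ℝ}

lemma IsContracting.smoothSeries (hB : IsContracting B O) (h1 : ‖(1 : A)‖ ≤ 1)
    (hc : ∀ m, |c m| ≤ 1) : SmoothSeries (fun m y => c m • B y ^ m) O := by
  refine ⟨hB.isOpen, fun m y hy => contDiffAt_smul_pow (hB.smooth y hy) _ _, fun j z hz => ?_⟩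
  obtain ⟨σ, hσ, hlt⟩ := exists_jetNorm_lt_one (hB.lt_one z hz) j
  obtain ⟨q, hq1, hq2⟩ := exists_between hlt
  have hq0 : 0 ≤ q := (jetNorm_nonneg hσ.le).trans hq1.le
  refine ⟨_, Filter.inter_mem (hB.isOpen.mem_nhds hz)
    ((continuousAt_jetNorm (hB.smooth z hz) j σ).eventually_lt_const hq1),
    fun m => j.factorial / σ ^ j * q ^ m, (summable_geometric_of_lt_one hq0 hq2).mul_left _, ?_⟩
  rintro m y ⟨hyO, hy⟩
  refine (norm_iteratedFDeriv_le_jetNorm le_rfl hσ _ _).trans ?_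
  exact mul_le_mul_of_nonneg_left
    (jetNorm_smul_pow_le h1 (hc m) (hB.smooth y hyO) hσ.le (le_of_lt hy) m) (by positivity)

lemma contDiffAt_powerSeries [CompleteSpace A] (h1 : ‖(1 : A)‖ ≤ 1) (hc : ∀ m, |c m| ≤ 1)
    (hB : IsContracting B O) {z : E} (hz : z ∈ O) : SmoothAt (fun y => ∑' m, c m • B y ^ m) z :=
  (hB.smoothSeries h1 hc).contDiffAt_tsum hz

lemma SmoothSeries.shift {F : Type*} [NormedAddCommGroup F] [NormedSpace ℝ F] {f : ℕ → E → F}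
    (h : SmoothSeries f O) (K : ℕ) : SmoothSeries (fun m => f (m + K)) O :=
  ⟨h.isOpen, fun m => h.smooth _, fun j y hy => by
    obtain ⟨u, hu, b, hbs, hbu⟩ := h.dominated j y hy
    exact ⟨u, hu, fun m => b (m + K), (summable_nat_add_iff K).2 hbs, fun m => hbu _⟩⟩

lemma jetNorm_tsum_le {F : Type*} [NormedAddCommGroup F] [NormedSpace ℝ F] [CompleteSpace F]
    {f : ℕ → E → F} (h : SmoothSeries f O) {z : E} (hz : z ∈ O) {k : ℕ} {σ : ℝ}
    (hσ : 0 ≤ σ) {b : ℕ → ℝ} {T : ℝ} (hT : HasSum b T) (hfb : ∀ m, jetNorm k σ (f m) z ≤ b m) :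
    jetNorm k σ (fun y => ∑' m, f m y) z ≤ T := by
  have hs : ∀ j, Summable fun m => ‖𝐃 j (f m) z‖ := fun j => by
    obtain ⟨u, hu, b', hb's, hb'⟩ := h.dominated j z hz
    exact Summable.of_nonneg_of_le (fun _ => norm_nonneg _)
      (fun m => hb' m z (mem_of_mem_nhds hu)) hb's
  calc jetNorm k σ (fun y => ∑' m, f m y) z
      ≤ ∑ j ∈ range (k + 1), ∑' m, σ ^ j / j.factorial * ‖𝐃 j (f m) z‖ := by
        refine sum_le_sum fun j _ => ?_
        rw [h.iteratedFDeriv_tsum j z hz, tsum_mul_left]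
        gcongr
        exact norm_tsum_le_tsum_norm (hs j)
    _ = ∑' m, jetNorm k σ (f m) z := (Summable.tsum_finsetSum fun j _ => (hs j).mul_left _).symm
    _ ≤ ∑' m, b m :=
        Summable.tsum_le_tsum hfb (summable_sum fun j _ => (hs j).mul_left _) hT.summable
    _ = T := hT.tsum_eq

/-- The series of the derivatives in a direction `v`. -/
lemma SmoothSeries.fderiv {F G : Type*} [NormedAddCommGroup F] [NormedSpace ℝ F]
    [NormedAddCommGroup G] [NormedSpace ℝ G] {f : ℕ → E → F} (h : SmoothSeries f O)
    (L : F →L[ℝ] G) (v : E) : SmoothSeries (fun m y => L (𝐝 (f m) y v)) O := by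
  have hd : ∀ m, ∀ y ∈ O, SmoothAt (𝐝 (f m)) y := fun m y hy =>
    (h.smooth m y hy).fderiv_right (by simp)
  have hd' : ∀ m, ∀ y ∈ O, SmoothAt (fun y => 𝐝 (f m) y v) y := fun m y hy =>
    (hd m y hy).clm_apply contDiffAt_const
  refine ⟨h.isOpen, fun m y hy => L.contDiff.contDiffAt.comp y (hd' m y hy), fun j z hz => ?_⟩
  obtain ⟨u, hu, b, hbs, hbu⟩ := h.dominated (j + 1) z hz
  refine ⟨_, Filter.inter_mem hu (h.isOpen.mem_nhds hz), fun m => ‖L‖ * (‖v‖ * b m),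
    (hbs.mul_left _).mul_left _, ?_⟩
  rintro m y ⟨hyu, hyO⟩
  have e2 := norm_iteratedFDeriv_clm_apply_const (c := v) (n := j) (hd m y hyO) (mod_cast le_top)
  rw [norm_iteratedFDeriv_fderiv] at e2
  refine (L.norm_iteratedFDeriv_comp_left (hd' m y hyO) (mod_cast le_top)).trans ?_
  exact mul_le_mul_of_nonneg_left (e2.trans
    (mul_le_mul_of_nonneg_left (hbu m y hyu) (norm_nonneg _))) (norm_nonneg _)

end PowerSeries

section Remainder

variable {E A : Type*} [NormedAddCommGroup E] [NormedSpace ℝ E] [NormedRing A] [NormedAlgebra ℝ A]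
  {B : E → A} {O : Set E} {c : ℕ → ℝ} {k : ℕ} {σ q : ℝ}

lemma remainder_eq_tsum [CompleteSpace A] (h1 : ‖(1 : A)‖ ≤ 1) (hc : ∀ m, |c m| ≤ 1) {b : A}
    (hb : ‖b‖ < 1) (K : ℕ) :
    (∑' m, c m • b ^ m) - ∑ m ∈ range K, c m • b ^ m = ∑' m, c (m + K) • b ^ (m + K) := by
  have hs : Summable fun m => c m • b ^ m := by
    refine Summable.of_norm_bounded (summable_geometric_of_lt_one (norm_nonneg b) hb) fun m => ?_
    rw [norm_smul]
    refine (mul_le_of_le_one_left (norm_nonneg _) (hc m)).trans ?_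
    induction m with
    | zero => simpa using h1
    | succ m ih =>
      rw [pow_succ, pow_succ]
      exact (norm_mul_le _ _).trans (by gcongr)
  rw [← hs.sum_add_tsum_nat_add K, add_sub_cancel_left]

/-- The jets of the remainder of the power series decay geometrically. -/
lemma jetNorm_powerSeries_remainder_le [CompleteSpace A] (h1 : ‖(1 : A)‖ ≤ 1)
    (hc : ∀ m, |c m| ≤ 1) (hB : IsContracting B O) {z : E} (hz : z ∈ O) (hσ : 0 ≤ σ)
    (hq : jetNorm k σ B z ≤ q) (hq1 : q < 1) (K : ℕ) :
    jetNorm k σ (fun y => (∑' m, c m • B y ^ m) - ∑ m ∈ range K, c m • B y ^ m) z ≤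
      q ^ K / (1 - q) := by
  have hq0 : 0 ≤ q := (jetNorm_nonneg hσ).trans hq
  have : (fun y => (∑' m, c m • B y ^ m) - ∑ m ∈ range K, c m • B y ^ m) =ᶠ[𝓝 z]
      fun y => ∑' m, c (m + K) • B y ^ (m + K) := by
    filter_upwards [hB.isOpen.mem_nhds hz] with y hy using
      remainder_eq_tsum h1 hc (hB.lt_one y hy) K
  rw [jetNorm_congr this]
  refine jetNorm_tsum_le ((hB.smoothSeries h1 hc).shift K) hz hσ (b := fun m => q ^ (m + K)) ?_
    fun m => jetNorm_smul_pow_le h1 (hc _) (hB.smooth z hz) hσ hq _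
  simpa only [pow_add, div_eq_inv_mul] using (hasSum_geometric_of_lt_one hq0 hq1).mul_right (q ^ K)

lemma traceFunctional_apply (tr : A →L[ℝ] ℂ) (x y : A) : traceFunctional tr y x = tr (x * y) := rfl

lemma opNorm_compL_mul_le : ‖((compL ℝ A A ℂ).flip.comp (mul ℝ A)).flip‖ ≤ 1 := by
  rw [opNorm_flip]
  refine opNorm_le_bound _ zero_le_one fun x => ?_
  refine opNorm_le_bound _ (by positivity) fun φ => ?_
  show ‖φ.comp (mul ℝ A x)‖ ≤ _
  refine (opNorm_comp_le _ _).trans ?_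
  rw [mul_comm, one_mul]
  gcongr
  exact opNorm_mul_apply_le ℝ A x

lemma opNorm_compL_mul_flip_le : ‖((compL ℝ A A ℂ).flip.comp (mul ℝ A).flip)‖ ≤ 1 := by
  refine opNorm_le_bound _ zero_le_one fun x => ?_
  refine opNorm_le_bound _ (by positivity) fun φ => ?_
  show ‖φ.comp ((mul ℝ A).flip x)‖ ≤ _
  refine (opNorm_comp_le _ _).trans ?_
  rw [mul_comm, one_mul]
  gcongr
  refine opNorm_le_bound _ (norm_nonneg _) fun y => ?_
  show ‖y * x‖ ≤ _
  rw [mul_comm ‖x‖]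
  exact norm_mul_le _ _

variable {tr : A →L[ℝ] ℂ}

lemma jetNorm_traceFunctional_mul_right_le (htr : ∀ x y, tr (x * y) = tr (y * x))
    {f g : E → A} {z : E} (hf : SmoothAt f z)
    (hg : SmoothAt g z) (hσ : 0 ≤ σ) :
    jetNorm k σ (fun y => traceFunctional tr (f y * g y)) z ≤
      jetNorm k σ (fun y => traceFunctional tr (f y)) z * jetNorm k σ g z := by
  have := jetNorm_bilin_le (k := k) ((compL ℝ A A ℂ).flip.comp (mul ℝ A)).flip
    opNorm_compL_mul_le ((traceFunctional tr).contDiff.contDiffAt.comp z hf) hg hσ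
  have he : (fun y => traceFunctional tr (f y * g y)) = fun y =>
      ((compL ℝ A A ℂ).flip.comp (mul ℝ A)).flip (traceFunctional tr (f y)) (g y) := by
    funext y
    ext x
    show tr (x * (f y * g y)) = tr (g y * x * f y)
    rw [← mul_assoc, htr, mul_assoc]
  rw [he]
  exact this

lemma jetNorm_traceFunctional_mul_left_le {f g : E → A} {z : E} (hf : SmoothAt f z)
    (hg : SmoothAt g z) (hσ : 0 ≤ σ) :
    jetNorm k σ (fun y => traceFunctional tr (f y * g y)) z ≤
      jetNorm k σ f z * jetNorm k σ (fun y => traceFunctional tr (g y)) z := by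
  have := jetNorm_bilin_le (k := k) ((compL ℝ A A ℂ).flip.comp (mul ℝ A).flip)
    opNorm_compL_mul_flip_le hf ((traceFunctional tr).contDiff.contDiffAt.comp z hg) hσ
  have he : (fun y => traceFunctional tr (f y * g y)) = fun y =>
      ((compL ℝ A A ℂ).flip.comp (mul ℝ A).flip) (f y) (traceFunctional tr (g y)) := by
    funext y
    ext x
    show tr (x * (f y * g y)) = tr (x * f y * g y)
    rw [mul_assoc]
  rw [he]
  exact this

lemma fderiv_mul_apply {f g : E → A} {z : E} (hf : SmoothAt f z) (hg : SmoothAt g z) (v : E) :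
    𝐝 (fun y => f y * g y) z v = f z * 𝐝 g z v + 𝐝 f z v * g z := by
  have h := hf.hasFD.mul' hg.hasFD
  rw [HasFDerivAt.fderiv (f := fun y => f y * g y) h]
  simp

lemma contDiffAt_fderiv_apply {F : Type*} [NormedAddCommGroup F] [NormedSpace ℝ F] {f : E → F}
    {z : E} (hf : SmoothAt f z) (v : E) : SmoothAt (fun y => 𝐝 f y v) z :=
  (hf.fderiv_right (m := ∞) (by simp)).clm_apply contDiffAt_const

/-- Leibniz rule for trace norms of jets of directional derivatives. -/
lemma jetNorm_traceFunctional_fderiv_mul_le (htr : ∀ x y, tr (x * y) = tr (y * x))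
    {f g : E → A} (hO : IsOpen O)
    (hf : ∀ z ∈ O, SmoothAt f z) (hg : ∀ z ∈ O, SmoothAt g z) {z : E} (hz : z ∈ O)
    (v : E) {k : ℕ} {σ : ℝ} (hσ : 0 ≤ σ) :
    jetNorm k σ Θ[tr, fun y => f y * g y, v] z ≤ jetNorm k σ f z * jetNorm k σ Θ[tr, g, v] z +
      jetNorm k σ Θ[tr, f, v] z * jetNorm k σ g z := by
  have h : Θ[tr, fun y => f y * g y, v] =ᶠ[𝓝 z] fun y =>
      traceFunctional tr (f y * 𝐝 g y v) + traceFunctional tr (𝐝 f y v * g y) := by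
    filter_upwards [hO.mem_nhds hz] with y hy
    rw [fderiv_mul_apply (hf y hy) (hg y hy), map_add]
  rw [jetNorm_congr h]
  have hf' := contDiffAt_fderiv_apply (hf z hz) v
  have hg' := contDiffAt_fderiv_apply (hg z hz) v
  refine (jetNorm_add_le hσ ((traceFunctional tr).contDiff.contDiffAt.comp z ((hf z hz).mul hg'))
    ((traceFunctional tr).contDiff.contDiffAt.comp z (hf'.mul (hg z hz)))).trans ?_
  exact add_le_add (jetNorm_traceFunctional_mul_left_le (hf z hz) hg' hσ)
    (jetNorm_traceFunctional_mul_right_le htr hf' (hg z hz) hσ)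

lemma jetNorm_traceFunctional_fderiv_pow_le (htr : ∀ x y, tr (x * y) = tr (y * x))
    (h1 : ‖(1 : A)‖ ≤ 1) (hO : IsOpen O)
    (hB : ∀ z ∈ O, SmoothAt B z) {z : E} (hz : z ∈ O) (v : E) {k : ℕ} {σ q τ : ℝ}
    (hσ : 0 ≤ σ) (hq : jetNorm k σ B z ≤ q)
    (hτ : jetNorm k σ Θ[tr, B, v] z ≤ τ) (m : ℕ) :
    jetNorm k σ Θ[tr, fun y => B y ^ m, v] z ≤ m * q ^ (m - 1) * τ := by
  have hq0 : 0 ≤ q := (jetNorm_nonneg hσ).trans hq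
  have hτ0 : 0 ≤ τ := (jetNorm_nonneg hσ).trans hτ
  induction m with
  | zero => simp [jetNorm_const]
  | succ m ih =>
    simp only [pow_succ]
    refine (jetNorm_traceFunctional_fderiv_mul_le htr hO (fun y hy => (hB y hy).pow m) hB hz v
      hσ).trans ?_
    have e1 : jetNorm k σ (fun y => B y ^ m) z ≤ q ^ m :=
      (jetNorm_pow_le h1 (hB z hz) hσ m).trans (pow_le_pow_left₀ (jetNorm_nonneg hσ) hq m)
    have e2 : m * q ^ (m - 1) * τ * q = m * q ^ m * τ := by
      rcases m with _ | m
      · simp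
      · grind
    calc _ ≤ q ^ m * τ + m * q ^ (m - 1) * τ * q := by
          refine add_le_add (mul_le_mul e1 hτ (jetNorm_nonneg hσ) (by positivity))
            (mul_le_mul ih hq (jetNorm_nonneg hσ) (by positivity))
      _ = _ := by rw [e2, Nat.add_sub_cancel]; push_cast; ring

/-- The trace norms of the jets of the derivative of the remainder of the power series decay
geometrically, if the derivative of `B` is bounded in this sense. -/
lemma jetNorm_traceFunctional_fderiv_remainder_le (htr : ∀ x y, tr (x * y) = tr (y * x))
    [CompleteSpace A] (h1 : ‖(1 : A)‖ ≤ 1) (hc : ∀ m, |c m| ≤ 1) (hB : IsContracting B O) {z : E}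
    (hz : z ∈ O) (v : E) {τ M p : ℝ} (hσ : 0 ≤ σ) (hq : jetNorm k σ B z ≤ q)
    (hp0 : 0 ≤ p) (hp1 : p < 1) (hM : ∀ m : ℕ, m * q ^ (m - 1) ≤ M * p ^ m)
    (hτ : jetNorm k σ Θ[tr, B, v] z ≤ τ) (K : ℕ) :
    jetNorm k σ Θ[tr, fun y => (∑' m, c m • B y ^ m) - ∑ m ∈ range K, c m • B y ^ m, v] z ≤
      M * τ * (p ^ K / (1 - p)) := by
  have hO := hB.isOpen
  set f : ℕ → E → A := fun m y => c (m + K) • B y ^ (m + K) with hfdef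
  have hf : SmoothSeries f O := (hB.smoothSeries h1 hc).shift K
  have heq : Θ[tr, fun y => (∑' m, c m • B y ^ m) - ∑ m ∈ range K, c m • B y ^ m, v] =ᶠ[𝓝 z]
      fun y => ∑' m, traceFunctional tr (𝐝 (f m) y v) := by
    filter_upwards [hO.mem_nhds hz] with y hy
    have e1 : (fun y => (∑' m, c m • B y ^ m) - ∑ m ∈ range K, c m • B y ^ m) =ᶠ[𝓝 y]
        fun y => ∑' m, f m y := by
      filter_upwards [hO.mem_nhds hy] with w hw using remainder_eq_tsum h1 hc (hB.lt_one w hw) K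
    rw [e1.fderiv_eq]
    exact (((traceFunctional tr).comp (apply ℝ A v)).hasSum (hf.hasSum_fderiv hy)).tsum_eq.symm
  rw [jetNorm_congr heq]
  refine jetNorm_tsum_le (hf.fderiv _ v) hz hσ (b := fun m => M * τ * p ^ (m + K)) ?_ fun m => ?_
  · have := ((hasSum_geometric_of_lt_one hp0 hp1).mul_right (p ^ K)).mul_left (M * τ)
    simpa only [pow_add, div_eq_inv_mul] using this
  · have e1 : Θ[tr, f m, v] =ᶠ[𝓝 z] fun y =>
        c (m + K) • traceFunctional tr (𝐝 (fun y => B y ^ (m + K)) y v) := by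
      filter_upwards [hO.mem_nhds hz] with y hy
      rw [hfdef, fderiv_fun_const_smul (((hB.smooth y hy).pow _).differentiableAt (by simp)),
        smul_apply, map_smul]
    refine (jetNorm_congr e1 k σ).trans_le ?_
    refine (jetNorm_smul_le (𝕜 := ℝ) hσ _ ((traceFunctional tr).contDiff.contDiffAt.comp z
      (contDiffAt_fderiv_apply ((hB.smooth z hz).pow _) v))).trans ?_
    refine (mul_le_of_le_one_left (jetNorm_nonneg hσ) (hc _)).trans ?_
    refine (jetNorm_traceFunctional_fderiv_pow_le htr h1 hO hB.smooth hz v hσ hq hτ _).trans ?_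
    exact (mul_le_mul_of_nonneg_right (hM _) ((jetNorm_nonneg hσ).trans hτ)).trans_eq (by ring)

end Remainder

section Matrix

variable {ι : Type*} [Fintype ι] [DecidableEq ι]

lemma norm_one_matrix_le : ‖(1 : Matrix ι ι ℂ)‖ ≤ 1 := by
  cases isEmpty_or_nonempty ι
  · rw [Subsingleton.elim (1 : Matrix ι ι ℂ) 0]; simp
  · simp

/-- The inverse square root of a positive matrix `H` is a power series in `1 - v⁻¹ H`. -/
lemma hasSum_cfc_invSqrt {H : Matrix ι ι ℂ} (hH : IsSelfAdjoint H) {v : ℝ} (hv : 0 < v)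
    (hlt : ‖1 - v⁻¹ • H‖ < 1) :
    HasSum (fun m => invSqrtCoeff m • (1 - v⁻¹ • H) ^ m) (√v • cfc (fun x : ℝ => (√x)⁻¹) H) := by
  have hB : cfc (fun x : ℝ => 1 - v⁻¹ * x) H = 1 - v⁻¹ • H := by
    rw [cfc_sub (fun _ => (1 : ℝ)) (fun x => v⁻¹ * x) H, cfc_const_one ℝ H, cfc_const_mul_id v⁻¹ H]
  have hsp : ∀ x ∈ spectrum ℝ H, |1 - v⁻¹ * x| ≤ ‖1 - v⁻¹ • H‖ := fun x hx => by
    rw [← hB]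
    exact norm_apply_le_norm_cfc (fun x : ℝ => 1 - v⁻¹ * x) H hx
  have hterm : ∀ m, cfc (fun x : ℝ => invSqrtCoeff m * (1 - v⁻¹ * x) ^ m) H =
      invSqrtCoeff m • (1 - v⁻¹ • H) ^ m := fun m => by
    rw [cfc_const_mul (invSqrtCoeff m) (fun x => (1 - v⁻¹ * x) ^ m) H,
      cfc_pow (fun x => 1 - v⁻¹ * x) m H, hB]
  have hpart : ∀ K, cfc (fun x : ℝ => ∑ m ∈ range K, invSqrtCoeff m * (1 - v⁻¹ * x) ^ m) H =
      ∑ m ∈ range K, invSqrtCoeff m • (1 - v⁻¹ • H) ^ m := fun K => by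
    have := cfc_sum (fun m (x : ℝ) => invSqrtCoeff m * (1 - v⁻¹ * x) ^ m) H (range K)
    have e : (fun x : ℝ => ∑ m ∈ range K, invSqrtCoeff m * (1 - v⁻¹ * x) ^ m) =
        ∑ m ∈ range K, fun x : ℝ => invSqrtCoeff m * (1 - v⁻¹ * x) ^ m := by
      ext x; simp
    rw [e, this]
    exact sum_congr rfl fun m _ => hterm m
  have hbound : ∀ m, ∀ x ∈ spectrum ℝ H,
      ‖invSqrtCoeff m * (1 - v⁻¹ * x) ^ m‖ ≤ ‖1 - v⁻¹ • H‖ ^ m := fun m x hx => by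
    rw [norm_mul, norm_pow]
    refine (mul_le_of_le_one_left (by positivity) (abs_invSqrtCoeff_le_one m)).trans ?_
    exact pow_le_pow_left₀ (norm_nonneg _) (hsp x hx) m
  have hunif := tendstoUniformlyOn_tsum_nat
    (summable_geometric_of_lt_one (norm_nonneg _) hlt) hbound
  have hlim := tendsto_cfc_fun (a := H) hunif (Filter.Eventually.of_forall fun K => by fun_prop)
  replace hlim := hlim.congr hpart
  have hfun : cfc (fun x : ℝ => ∑' m, invSqrtCoeff m * (1 - v⁻¹ * x) ^ m) H =
      √v • cfc (fun x : ℝ => (√x)⁻¹) H := by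
    have hcont : ContinuousOn (fun x : ℝ => (√x)⁻¹) (spectrum ℝ H) :=
      (finite_real_spectrum (A := H)).continuousOn _
    rw [← cfc_const_mul (√v) (fun x => (√x)⁻¹) H hcont]
    refine cfc_congr fun x hx => ?_
    have := hasSum_invSqrtCoeff ((hsp x hx).trans_lt hlt)
    rw [this.tsum_eq, sub_sub_cancel, Real.sqrt_mul (by positivity), Real.sqrt_inv, mul_inv,
      inv_inv]
  rw [hfun] at hlim
  have hsummable : Summable fun m => invSqrtCoeff m • (1 - v⁻¹ • H) ^ m := by
    refine Summable.of_norm_bounded (summable_geometric_of_lt_one (norm_nonneg _) hlt) fun m => ?_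
    rw [← hterm]
    exact norm_cfc_le (by positivity) (hbound m)
  rw [← tendsto_nhds_unique hsummable.hasSum.tendsto_sum_nat hlim]
  exact hsummable.hasSum

end Matrix

/-! ### The derivative of a continuous representation -/

section Exponential

variable {A : Type*} [NormedRing A] [NormedAlgebra ℝ A] [CompleteSpace A]

lemma exp_add_of_commute_real {x y : A} (h : Commute x y) : exp (x + y) = exp x * exp y := by
  let _ : NormedAlgebra ℚ A := NormedAlgebra.restrictScalars ℚ ℝ A
  exact NormedSpace.exp_add_of_commute h

lemma exp_smul_add (x : A) (s t : ℝ) : exp ((s + t) • x) = exp (s • x) * exp (t • x) := by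
  rw [add_smul]
  exact exp_add_of_commute_real (((Commute.refl x).smul_left s).smul_right t)

lemma exp_neg_mul_exp (x : A) : exp (-x) * exp x = 1 := by
  rw [← exp_add_of_commute_real ((Commute.refl x).neg_left), neg_add_cancel, NormedSpace.exp_zero]

lemma exp_mul_exp_neg (x : A) : exp x * exp (-x) = 1 := by
  rw [← exp_add_of_commute_real ((Commute.refl x).neg_right), add_neg_cancel, NormedSpace.exp_zero]

lemma hasDerivAt_exp_smul_zero (x : A) : HasDerivAt (fun t : ℝ => exp (t • x)) x 0 := by
  simpa using hasDerivAt_exp_smul_const (𝕂 := ℝ) x 0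

lemma eq_of_exp_smul_eq {x y : A} (h : ∀ t : ℝ, exp (t • x) = exp (t • y)) : x = y := by
  have h1 := hasDerivAt_exp_smul_zero x
  simp only [h] at h1
  exact h1.unique (hasDerivAt_exp_smul_zero y)

lemma contDiff_exp {n : WithTop ℕ∞} : ContDiff ℝ n (exp : A → A) :=
  AnalyticOnNhd.contDiff fun x _ => NormedSpace.exp_analytic x

/-- A continuous one-parameter group in a Banach algebra is differentiable: averages over short
intervals are differentiable and invertible. -/
lemma exists_generator_of_continuous {V : ℝ → A} (hV : Continuous V) (h0 : V 0 = 1)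
    (hadd : ∀ s t, V (s + t) = V s * V t) :
    ∃ K : A, ∀ t, V t = exp (t • K) := by
  have hint : HasDerivAt (fun t => ∫ s in (0 : ℝ)..t, V s) 1 0 := by
    rw [← h0]
    exact integral_hasDerivAt_right (by simp)
      hV.aestronglyMeasurable.stronglyMeasurableAtFilter hV.continuousAt
  obtain ⟨h, hh, hM⟩ : ∃ h : ℝ, h ≠ 0 ∧ ‖h⁻¹ • (∫ s in (0 : ℝ)..h, V s) - 1‖ < 1 := by
    have := hasDerivAt_iff_tendsto_slope.1 hint
    have h2 := (this.eventually (Metric.ball_mem_nhds (1 : A) one_pos)).and self_mem_nhdsWithin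
    obtain ⟨h, h3, h4⟩ := h2.exists
    refine ⟨h, h4, ?_⟩
    rw [dist_eq_norm] at h3
    simpa [slope] using h3
  set M := ∫ s in (0 : ℝ)..h, V s with hMdef
  obtain ⟨M', hM'⟩ : ∃ M' : A, M * M' = 1 := by
    have hu : IsUnit (h⁻¹ • M) := by
      have := isUnit_one_sub_of_norm_lt_one (x := 1 - h⁻¹ • M) (by rwa [norm_sub_rev])
      simpa using this
    obtain ⟨u, hu⟩ := hu
    refine ⟨h⁻¹ • (↑u⁻¹ : A), ?_⟩
    rw [mul_smul_comm, ← smul_mul_assoc, ← hu, Units.mul_inv]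
  have hVM : ∀ t, V t * M = ∫ s in t..t + h, V s := by
    intro t
    have e := (mul ℝ A (V t)).intervalIntegral_comp_comm
      (hV.intervalIntegrable (μ := MeasureTheory.volume) 0 h)
    simp only [ContinuousLinearMap.mul_apply'] at e
    rw [hMdef, ← e]
    simp_rw [← hadd]
    rw [integral_comp_add_left (fun s => V s) t, add_zero]
  set K := (V h - 1) * M' with hK
  have hderiv : ∀ t, HasDerivAt V (V t * K) t := by
    intro t
    have e1 : ∀ t, HasDerivAt (fun t => ∫ s in (0 : ℝ)..t, V s) (V t) t := fun t =>
      integral_hasDerivAt_right (hV.intervalIntegrable _ _)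
        hV.aestronglyMeasurable.stronglyMeasurableAtFilter hV.continuousAt
    have e2 : HasDerivAt (fun t => (∫ s in (0 : ℝ)..(t + h), V s) - ∫ s in (0 : ℝ)..t, V s)
        (V (t + h) - V t) t := (HasDerivAt.comp_add_const t h (e1 (t + h))).sub (e1 t)
    have e3 : (fun t => (∫ s in (0 : ℝ)..(t + h), V s) - ∫ s in (0 : ℝ)..t, V s) =
        fun t => V t * M := by
      funext t
      rw [hVM, integral_interval_sub_left (hV.intervalIntegrable _ _) (hV.intervalIntegrable _ _)]
    rw [e3] at e2
    have e4 := e2.mul_const M'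
    simp only [mul_assoc, hM', mul_one] at e4
    convert e4 using 1
    rw [hK, hadd, ← mul_assoc, mul_sub, mul_one]
  refine ⟨K, fun t => ?_⟩
  have hconst : ∀ t, HasDerivAt (fun t => V t * exp ((-t) • K)) 0 t := by
    intro t
    have e1 : HasDerivAt (fun t : ℝ => exp ((-t) • K)) (-(K * exp ((-t) • K))) t := by
      have := (hasDerivAt_exp_smul_const' (𝕂 := ℝ) K (-t)).scomp t (hasDerivAt_neg t)
      simpa [Function.comp_def] using this
    have e2 : HasDerivAt (fun t => V t * exp ((-t) • K)) _ t := (hderiv t).mul e1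
    convert e2 using 1
    noncomm_ring
  have hc := is_const_of_deriv_eq_zero (fun t => (hconst t).differentiableAt)
    (fun t => (hconst t).deriv) t 0
  simp only [h0, neg_zero, zero_smul, NormedSpace.exp_zero, mul_one] at hc
  calc V t = V t * (exp (-(t • K)) * exp (t • K)) := by
        rw [exp_neg_mul_exp, mul_one]
    _ = _ := by rw [← mul_assoc, ← neg_smul, hc, one_mul]

lemma norm_pow_sub_pow_le_of_contraction {a b : A} (h1 : ‖(1 : A)‖ ≤ 1) (ha : ‖a‖ ≤ 1)
    (hb : ‖b‖ ≤ 1) (n : ℕ) : ‖a ^ n - b ^ n‖ ≤ n * ‖a - b‖ := by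
  have hbn : ∀ n : ℕ, ‖b ^ n‖ ≤ 1 := by
    intro n
    induction n with
    | zero => simpa using h1
    | succ n ih =>
      rw [pow_succ]
      exact (norm_mul_le _ _).trans (mul_le_one₀ ih (norm_nonneg _) hb)
  induction n with
  | zero => simp
  | succ n ih =>
    have e : a ^ (n + 1) - b ^ (n + 1) = a * (a ^ n - b ^ n) + (a - b) * b ^ n := by
      rw [pow_succ', pow_succ']; noncomm_ring
    rw [e]
    refine (norm_add_le _ _).trans ?_
    have e1 : ‖a * (a ^ n - b ^ n)‖ ≤ n * ‖a - b‖ :=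
      (norm_mul_le _ _).trans ((mul_le_of_le_one_left (norm_nonneg _) ha).trans ih)
    have e2 : ‖(a - b) * b ^ n‖ ≤ ‖a - b‖ :=
      (norm_mul_le _ _).trans (mul_le_of_le_one_right (norm_nonneg _) (hbn n))
    push_cast
    linarith

/-- The Lie product formula, for one-parameter groups of contractions. -/
lemma tendsto_lie_product {x y : A} (h1 : ‖(1 : A)‖ ≤ 1)
    (hx : ∀ t : ℝ, ‖exp (t • x)‖ ≤ 1) (hy : ∀ t : ℝ, ‖exp (t • y)‖ ≤ 1)
    (hxy : ∀ t : ℝ, ‖exp (t • (x + y))‖ ≤ 1) :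
    Filter.Tendsto (fun n : ℕ => (exp (((n : ℝ) + 1)⁻¹ • x) *
      exp (((n : ℝ) + 1)⁻¹ • y)) ^ (n + 1)) Filter.atTop
      (𝓝 (exp (x + y))) := by
  have hpow : ∀ n : ℕ, exp (x + y) = exp (((n : ℝ) + 1)⁻¹ • (x + y)) ^ (n + 1) := by
    intro n
    let _ : NormedAlgebra ℚ A := NormedAlgebra.restrictScalars ℚ ℝ A
    rw [← NormedSpace.exp_nsmul, ← Nat.cast_smul_eq_nsmul ℝ, smul_smul, Nat.cast_succ,
      mul_inv_cancel₀ (by positivity), one_smul]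
  have hder : HasDerivAt (fun s : ℝ => exp (s • x) * exp (s • y) - exp (s • (x + y))) 0 0 := by
    have : HasDerivAt (fun s : ℝ => exp (s • x) * exp (s • y) - exp (s • (x + y))) _ 0 :=
      ((hasDerivAt_exp_smul_zero x).mul (hasDerivAt_exp_smul_zero y)).sub
        (hasDerivAt_exp_smul_zero (x + y))
    simpa using this
  have hseq : Filter.Tendsto (fun n : ℕ => ((n : ℝ) + 1)⁻¹) Filter.atTop (𝓝[≠] 0) := by
    refine tendsto_nhdsWithin_iff.2 ⟨?_, Filter.Eventually.of_forall fun n => ?_⟩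
    · simpa [one_div] using tendsto_one_div_add_atTop_nhds_zero_nat (𝕜 := ℝ)
    · grind
  have hlim := (hasDerivAt_iff_tendsto_slope.1 hder).comp hseq
  rw [tendsto_iff_norm_sub_tendsto_zero]
  refine squeeze_zero (fun _ => norm_nonneg _) (fun n => ?_) (hlim.norm.trans (by simp))
  rw [hpow n]
  have hab : ‖exp (((n : ℝ) + 1)⁻¹ • x) * exp (((n : ℝ) + 1)⁻¹ • y)‖ ≤ 1 :=
    (norm_mul_le _ _).trans (mul_le_one₀ (hx _) (norm_nonneg _) (hy _))
  refine (norm_pow_sub_pow_le_of_contraction h1 hab (hxy _) _).trans_eq ?_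
  simp only [Function.comp_apply, slope, vsub_eq_sub, zero_smul, NormedSpace.exp_zero, mul_one,
    sub_self, sub_zero, inv_inv, norm_smul]
  rw [Real.norm_of_nonneg (by positivity)]
  push_cast
  rfl

end Exponential

section Representation

variable {N d : ℕ}

lemma norm_unitary_le {m : Type*} [Fintype m] [DecidableEq m] {U : Matrix m m ℂ}
    (hU : U ∈ unitaryGroup m ℂ) : ‖U‖ ≤ 1 := by
  have h : Uᴴ * U = 1 := Matrix.mem_unitaryGroup_iff'.1 hU
  have h2 := l2_opNorm_conjTranspose_mul_self U
  rw [h] at h2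
  nlinarith [norm_one_matrix_le (ι := m), norm_nonneg U]

lemma expSU_add_smul (X : su N) (s t : ℝ) : expSU ((s + t) • X) = expSU (s • X) * expSU (t • X) :=
  Subtype.ext (exp_smul_add X.1 s t)

lemma expSU_zero : expSU (0 : su N) = 1 := Subtype.ext NormedSpace.exp_zero

lemma continuous_expSU : Continuous (expSU : su N → SU N) :=
  Continuous.subtype_mk ((contDiff_exp (n := 0)).continuous.comp continuous_subtype_val) _

lemma norm_exp_smul_su_le (X : su N) (t : ℝ) : ‖exp (t • X.1)‖ ≤ 1 :=
  norm_unitary_le (specialUnitaryGroup_le_unitaryGroup (expSU (t • X)).2)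

lemma exp_mem_unitary_of_skew {m : Type*} [Fintype m] [DecidableEq m] {K : Matrix m m ℂ}
    (hK : Kᴴ = -K) : exp K ∈ unitaryGroup m ℂ := by
  let _ : NormedAlgebra ℚ (Matrix m m ℂ) := NormedAlgebra.restrictScalars ℚ ℂ _
  exact NormedSpace.exp_mem_unitary_of_mem_skewAdjoint (by rw [skewAdjoint.mem_iff]; exact hK)

lemma conjTranspose_exp {m : Type*} [Fintype m] [DecidableEq m] (K : Matrix m m ℂ) :
    (exp K)ᴴ = exp Kᴴ := (exp_conjTranspose K).symm

lemma skew_of_exp_mem_unitary {m : Type*} [Fintype m] [DecidableEq m] {K : Matrix m m ℂ}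
    (h : ∀ t : ℝ, exp (t • K) ∈ unitaryGroup m ℂ) : Kᴴ = -K := by
  refine eq_of_exp_smul_eq fun t => ?_
  have h1 : (exp (t • K))ᴴ * exp (t • K) = 1 := Matrix.mem_unitaryGroup_iff'.1 (h t)
  rw [conjTranspose_exp, conjTranspose_smul, star_trivial] at h1
  calc exp (t • Kᴴ)
      = exp (t • Kᴴ) * (exp (t • K) * exp (-(t • K))) := by rw [exp_mul_exp_neg, mul_one]
    _ = exp (t • -K) := by rw [← mul_assoc, h1, one_mul, smul_neg]

/-- A continuous representation is the exponential of a linear map on the Lie algebra. -/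
lemma exists_linear_generator (R : Rep N d) (hR : Continuous R) : ∃ ρ : su N →ₗ[ℝ] Mat d,
      (∀ X, (R (expSU X) : Mat d) = exp (ρ X)) ∧
      ∀ X, (ρ X)ᴴ = -ρ X := by
  have hex : ∀ X : su N, ∃ K : Mat d, ∀ t : ℝ, (R (expSU (t • X)) : Mat d) = exp (t • K) := by
    intro X
    refine exists_generator_of_continuous (V := fun t : ℝ => (R (expSU (t • X)) : Mat d)) ?_ ?_ ?_
    · exact continuous_subtype_val.comp (hR.comp (continuous_expSU.comp (by fun_prop)))
    · simp only [zero_smul, expSU_zero, map_one]; rfl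
    · intro s t
      rw [expSU_add_smul, map_mul]; rfl
  choose ρ hρ using hex
  have hskew : ∀ X, (ρ X)ᴴ = -ρ X := fun X => skew_of_exp_mem_unitary fun t => by
    rw [← hρ]; exact (R _).2
  have hle : ∀ (X : su N) (t : ℝ), ‖exp (t • ρ X)‖ ≤ 1 := fun X t => by
    rw [← hρ]; exact norm_unitary_le (R _).2
  refine ⟨⟨⟨ρ, fun X Y => ?_⟩, fun c X => ?_⟩, fun X => by simpa using hρ X 1, hskew⟩
  · refine eq_of_exp_smul_eq fun t => ?_
    rw [← hρ]
    have hcont : Continuous fun g : SU N => (R g : Mat d) := continuous_subtype_val.comp hR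
    have h1 : Filter.Tendsto (fun n : ℕ => (expSU (((n : ℝ) + 1)⁻¹ • t • X) *
        expSU (((n : ℝ) + 1)⁻¹ • t • Y)) ^ (n + 1)) Filter.atTop (𝓝 (expSU (t • (X + Y)))) := by
      rw [tendsto_subtype_rng]
      have := tendsto_lie_product (x := t • X.1) (y := t • Y.1) norm_one_matrix_le
        (fun s => by rw [smul_smul]; exact norm_exp_smul_su_le X _)
        (fun s => by rw [smul_smul]; exact norm_exp_smul_su_le Y _)
        (fun s => by rw [← smul_add, smul_smul]; exact norm_exp_smul_su_le (X + Y) _)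
      rw [← smul_add] at this
      exact this
    have h2 := (hcont.tendsto _).comp h1
    have hs : ∀ s : ℝ, ‖exp (s • (t • ρ X + t • ρ Y))‖ ≤ 1 := by
      intro s
      rw [← smul_add, smul_smul]
      refine norm_unitary_le (exp_mem_unitary_of_skew ?_)
      rw [conjTranspose_smul, conjTranspose_add, hskew, hskew, star_trivial, ← neg_add, smul_neg]
    have h3 := tendsto_lie_product (x := t • ρ X) (y := t • ρ Y) norm_one_matrix_le
        (fun s => by rw [smul_smul]; exact hle X _)
        (fun s => by rw [smul_smul]; exact hle Y _) hs
    show _ = exp (t • (ρ X + ρ Y))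
    rw [smul_add t (ρ X)]
    refine tendsto_nhds_unique h2 (h3.congr fun n => ?_)
    simp only [Function.comp_apply, map_pow, map_mul, smul_smul, hρ, SubmonoidClass.coe_pow,
      Submonoid.coe_mul]
  · refine eq_of_exp_smul_eq fun t => ?_
    rw [← hρ, RingHom.id_apply, smul_smul, smul_smul, hρ]

end Representation

/-! ### Logarithms of unitary matrices -/

section UnitaryLog

lemma norm_entry_le {m n : Type*} [Fintype m] [Fintype n] [DecidableEq n]
    (M : Matrix m n ℂ) (i : m) (j : n) : ‖M i j‖ ≤ ‖M‖ := by
  have h1 := M.l2_opNorm_mulVec (WithLp.toLp 2 (Pi.single j 1))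
  have h2 := (PiLp.norm_apply_le ((EuclideanSpace.equiv m ℂ).symm (M *ᵥ Pi.single j 1)) i).trans h1
  simpa using h2

variable {m : Type*} [Fintype m] [DecidableEq m]

/-- The principal logarithm `V diag(iθ) V⁻¹` of a unitary matrix `V diag(e^{iθ}) V⁻¹`. -/
def unitaryLog (u : Matrix m m ℂ) : Matrix m m ℂ := I • cfc (fun z : ℂ => (arg z : ℂ)) u

lemma unitaryLog_eq {u : Matrix m m ℂ} (hu : u ∈ unitary (Matrix m m ℂ)) :
    unitaryLog u = I • (Unitary.argSelfAdjoint ⟨u, hu⟩ : Matrix m m ℂ) := rfl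

lemma norm_unitaryLog {u : Matrix m m ℂ} (hu : u ∈ unitary (Matrix m m ℂ)) :
    ‖unitaryLog u‖ = ‖Unitary.argSelfAdjoint ⟨u, hu⟩‖ := by
  rw [unitaryLog_eq hu, norm_smul, norm_I, one_mul]; rfl

lemma conjTranspose_unitaryLog {u : Matrix m m ℂ} (hu : u ∈ unitary (Matrix m m ℂ)) :
    (unitaryLog u)ᴴ = -unitaryLog u := by
  have h : (Unitary.argSelfAdjoint ⟨u, hu⟩ : Matrix m m ℂ)ᴴ =
    (Unitary.argSelfAdjoint ⟨u, hu⟩ : Matrix m m ℂ) := (Unitary.argSelfAdjoint ⟨u, hu⟩).2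
  rw [unitaryLog_eq hu, conjTranspose_smul, h]
  simp

lemma exp_unitaryLog {u : Matrix m m ℂ} (hu : u ∈ unitary (Matrix m m ℂ)) (h : ‖u - 1‖ < 2) :
    exp (unitaryLog u) = u :=
  congrArg Subtype.val (expUnitary_argSelfAdjoint (u := ⟨u, hu⟩) h)

lemma two_mul_one_sub_cos_norm_unitaryLog {u : Matrix m m ℂ}
    (hu : u ∈ unitary (Matrix m m ℂ)) (h : ‖u - 1‖ < 2) :
    2 * (1 - Real.cos ‖unitaryLog u‖) = ‖u - 1‖ ^ 2 := by
  rw [norm_unitaryLog hu]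
  exact Unitary.two_mul_one_sub_cos_norm_argSelfAdjoint (u := ⟨u, hu⟩) h

lemma norm_unitaryLog_le_pi {u : Matrix m m ℂ} (hu : u ∈ unitary (Matrix m m ℂ)) :
    ‖unitaryLog u‖ ≤ π := by
  rw [norm_unitaryLog hu]; exact Unitary.norm_argSelfAdjoint_le_pi _

lemma norm_exp_smul_unitaryLog_sub_one_le {u : Matrix m m ℂ}
    (hu : u ∈ unitary (Matrix m m ℂ)) (h : ‖u - 1‖ < 2) {t : ℝ} (ht : t ∈ 𝕀) :
    ‖exp (t • unitaryLog u) - 1‖ ≤ ‖u - 1‖ := by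
  have := Unitary.norm_expUnitary_smul_argSelfAdjoint_sub_one_le ⟨u, hu⟩ ht h
  convert this using 3
  rw [selfAdjoint.expUnitary_coe, unitaryLog_eq hu, smul_comm]
  rfl

lemma unitaryLog_exp {K : Matrix m m ℂ} (hK : Kᴴ = -K) (h : ‖K‖ < π) : unitaryLog (exp K) = K := by
  have hs : (-I) • K ∈ selfAdjoint (Matrix m m ℂ) := by
    rw [selfAdjoint.mem_iff, star_smul, star_eq_conjTranspose, hK]; simp
  have e : I • ((-I) • K) = K := by simp [smul_smul]
  have h1 := argSelfAdjoint_expUnitary (x := (⟨_, hs⟩ : selfAdjoint (Matrix m m ℂ)))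
    (by show ‖(-I) • K‖ < π; rw [norm_smul]; simpa using h)
  have h2 := congrArg (fun x : selfAdjoint (Matrix m m ℂ) => I • (x : Matrix m m ℂ)) h1
  simp only [Unitary.argSelfAdjoint_coe, selfAdjoint.expUnitary_coe, e] at h2
  exact h2

/-- `‖1 - u‖` controls the angle of a unitary matrix. -/
lemma norm_unitaryLog_le {u : Matrix m m ℂ} (hu : u ∈ unitary (Matrix m m ℂ))
    (h : ‖u - 1‖ < 2) : ‖unitaryLog u‖ ≤ 2 * ‖u - 1‖ := by
  have h1 := two_mul_one_sub_cos_norm_unitaryLog hu h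
  have h2 := Real.cos_le_one_sub_mul_cos_sq (x := ‖unitaryLog u‖)
    (by rw [abs_of_nonneg (norm_nonneg _)]; exact norm_unitaryLog_le_pi hu)
  have h3 : 4 / π ^ 2 * ‖unitaryLog u‖ ^ 2 ≤ ‖u - 1‖ ^ 2 := by grind
  have h4 : (1 / 4 : ℝ) ≤ 4 / π ^ 2 := by
    rw [le_div_iff₀ (by positivity)]
    nlinarith [Real.pi_le_four, Real.pi_pos]
  refine abs_le_of_sq_le_sq' ?_ (by positivity) |>.2
  nlinarith [sq_nonneg ‖unitaryLog u‖]

lemma exp_smul_unitaryLog {u : Matrix m m ℂ} (hu : u ∈ unitary (Matrix m m ℂ))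
    (h : ‖u - 1‖ < 2) (t : ℝ) :
    cfc (fun z : ℂ => Complex.exp (I * t * arg z)) u = exp (t • unitaryLog u) := by
  have hn : IsStarNormal u := (Unitary.mem_iff.1 hu).1.trans (Unitary.mem_iff.1 hu).2.symm |>
    fun h => ⟨h⟩
  have hc : ContinuousOn arg (spectrum ℂ u) :=
    Complex.continuousOn_arg.mono <| (Unitary.spectrum_subset_slitPlane_iff_norm_lt_two hu).mpr h
  have e : t • unitaryLog u = (I * t) • cfc (fun z : ℂ => (arg z : ℂ)) u := by
    rw [unitaryLog, ← Complex.coe_smul, smul_smul, mul_comm]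
  rw [e, ← CFC.exp_eq_normedSpace_exp (𝕜 := ℂ), ← cfc_smul .., ← cfc_comp' ..]
  refine cfc_congr fun y _ => ?_
  simp only [smul_eq_mul, ← Complex.exp_eq_exp_ℂ]

/-- Spectral theorem for anti-Hermitian matrices. -/
lemma exists_unitary_diagonal_of_skew {K : Matrix m m ℂ} (hK : Kᴴ = -K) :
    ∃ (V : Matrix m m ℂ) (θ : m → ℝ), Vᴴ * V = 1 ∧ V * Vᴴ = 1 ∧
      K = V * diagonal (fun i => I * (θ i : ℂ)) * Vᴴ ∧ ∀ i, |θ i| ≤ ‖K‖ := by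
  have hH : ((-I) • K).IsHermitian := by rw [IsHermitian, conjTranspose_smul, hK]; simp
  have h1 := Unitary.star_mul_self_of_mem hH.eigenvectorUnitary.2
  have h2 := Unitary.mul_star_self_of_mem hH.eigenvectorUnitary.2
  have h3 : K = (hH.eigenvectorUnitary : Matrix m m ℂ) *
      diagonal (fun i => I * (hH.eigenvalues i : ℂ)) *
      (hH.eigenvectorUnitary : Matrix m m ℂ)ᴴ := by
    have hs := hH.spectral_theorem
    rw [Unitary.conjStarAlgAut_apply] at hs
    have hd : diagonal (fun i => I * (hH.eigenvalues i : ℂ)) =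
        I • diagonal (RCLike.ofReal ∘ hH.eigenvalues : m → ℂ) := by
      rw [← diagonal_smul]; rfl
    rw [hd, Matrix.mul_smul, smul_mul]
    calc K = I • ((-I) • K) := by simp [smul_smul]
      _ = _ := congrArg _ hs
  refine ⟨_, hH.eigenvalues, h1, h2, h3, fun i => ?_⟩
  set V : Matrix m m ℂ := (hH.eigenvectorUnitary : Matrix m m ℂ)
  have h4 : diagonal (fun i => I * (hH.eigenvalues i : ℂ)) = Vᴴ * K * V := by
    have h1' : Vᴴ * V = 1 := h1
    conv_rhs => rw [h3]
    simp only [← Matrix.mul_assoc, h1', Matrix.one_mul]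
    rw [Matrix.mul_assoc, h1', Matrix.mul_one]
  have h5 : ‖Vᴴ * K * V‖ ≤ ‖K‖ := by
    have hV : ‖V‖ ≤ 1 := norm_unitary_le hH.eigenvectorUnitary.2
    have hV' : ‖Vᴴ‖ ≤ 1 := by rw [l2_opNorm_conjTranspose]; exact hV
    calc ‖Vᴴ * K * V‖ ≤ ‖Vᴴ‖ * ‖K‖ * ‖V‖ :=
        (norm_mul_le _ _).trans (by gcongr; exact norm_mul_le _ _)
      _ ≤ 1 * ‖K‖ * 1 := by gcongr
      _ = _ := by ring
  rw [← h4, l2_opNorm_diagonal] at h5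
  calc |hH.eigenvalues i| = ‖I * (hH.eigenvalues i : ℂ)‖ := by simp
    _ ≤ _ := (norm_le_pi_norm (fun i => I * (hH.eigenvalues i : ℂ)) i).trans h5

lemma exp_conj_diagonal {V : Matrix m m ℂ} (h1 : Vᴴ * V = 1) (h2 : V * Vᴴ = 1) (f : m → ℂ) :
    exp (V * diagonal f * Vᴴ) = V * diagonal (fun i => Complex.exp (f i)) * Vᴴ := by
  have hinv : V⁻¹ = Vᴴ := inv_eq_right_inv h2
  have hU : IsUnit V := ⟨⟨V, Vᴴ, h2, h1⟩, rfl⟩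
  rw [← hinv, Matrix.exp_conj _ _ hU, exp_diagonal]
  congr 3
  ext i
  rw [Pi.coe_exp, Complex.exp_eq_exp_ℂ]

/-- An anti-Hermitian matrix of small norm whose exponential has determinant one is traceless. -/
lemma trace_eq_zero_of_det_exp {K : Matrix m m ℂ} (hK : Kᴴ = -K)
    (hdet : (exp K).det = 1) (hn : Fintype.card m * ‖K‖ < 2 * π) :
    K.trace = 0 := by
  obtain ⟨V, θ, h1, h2, h3, h4⟩ := exists_unitary_diagonal_of_skew hK
  have htr : K.trace = I * ((∑ i, θ i : ℝ) : ℂ) := by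
    rw [h3, trace_mul_comm, ← Matrix.mul_assoc, h1, Matrix.one_mul, trace_diagonal, ← mul_sum]
    push_cast; rfl
  have hd : Complex.exp (I * ((∑ i, θ i : ℝ) : ℂ)) = 1 := by
    rw [← hdet, h3, exp_conj_diagonal h1 h2, det_mul, det_mul, mul_right_comm,
      ← det_mul, h2, det_one, one_mul, det_diagonal, ← Complex.exp_sum,
      ← mul_sum]
    push_cast; rfl
  obtain ⟨k, hk⟩ := Complex.exp_eq_one_iff.1 hd
  have hk' : ∑ i, θ i = k * (2 * π) := by
    have : I * ((∑ i, θ i : ℝ) : ℂ) = I * ((k * (2 * π) : ℝ) : ℂ) := by rw [hk]; push_cast; ring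
    exact_mod_cast mul_left_cancel₀ I_ne_zero this
  have hle : |∑ i, θ i| < 2 * π := by
    refine lt_of_le_of_lt ((abs_sum_le_sum_abs _ _).trans (sum_le_sum fun i _ => h4 i)) ?_
    simpa using hn
  have hk0 : k = 0 := by
    rw [hk', abs_mul, abs_of_pos (by positivity : (0 : ℝ) < 2 * π)] at hle
    have : |(k : ℝ)| < 1 := by
      by_contra! hcon
      nlinarith [Real.pi_pos]
    exact Int.abs_lt_one_iff.1 (by exact_mod_cast this)
  rw [htr, hk', hk0]; simp

/-- An anti-Hermitian logarithm of `1` vanishes if it is sufficiently close, in the trace inner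
product, to an anti-Hermitian matrix of norm less than `2π`. -/
lemma eq_zero_of_exp_eq_one {Z L : Matrix m m ℂ} (hZ : Zᴴ = -Z)
    (hexp : exp Z = 1) (hL : ‖L‖ < 2 * π)
    (htr : (Z * Z).trace = -(Z * L).trace) : Z = 0 := by
  obtain ⟨V, θ, h1, h2, h3, -⟩ := exists_unitary_diagonal_of_skew hZ
  set D := diagonal (fun i => I * (θ i : ℂ)) with hD
  have hθ : ∀ i, ∃ k : ℤ, θ i = k * (2 * π) := by
    intro i
    have e : diagonal (fun i => Complex.exp (I * (θ i : ℂ))) = 1 := by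
      rw [h3, hD, exp_conj_diagonal h1 h2] at hexp
      calc _ = (Vᴴ * V) * diagonal (fun i => Complex.exp (I * (θ i : ℂ))) *
            (Vᴴ * V) := by rw [h1, Matrix.one_mul, Matrix.mul_one]
        _ = Vᴴ * (V * diagonal (fun i => Complex.exp (I * (θ i : ℂ))) * Vᴴ) * V := by
            simp only [Matrix.mul_assoc]
        _ = 1 := by rw [hexp, Matrix.mul_one, h1]
    have e2 := congrFun (congrFun e i) i
    rw [diagonal_apply_eq, one_apply_eq] at e2
    obtain ⟨k, hk⟩ := Complex.exp_eq_one_iff.1 e2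
    refine ⟨k, ?_⟩
    have : I * (θ i : ℂ) = I * ((k * (2 * π) : ℝ) : ℂ) := by rw [hk]; push_cast; ring
    exact_mod_cast mul_left_cancel₀ I_ne_zero this
  have hzz : (Z * Z).trace = -((∑ i, θ i ^ 2 : ℝ) : ℂ) := by
    have e : Z * Z = V * (D * D) * Vᴴ := by
      rw [h3]
      calc V * D * Vᴴ * (V * D * Vᴴ) = V * D * (Vᴴ * V) * D * Vᴴ := by simp only [Matrix.mul_assoc]
        _ = _ := by rw [h1, Matrix.mul_one]; simp only [Matrix.mul_assoc]
    rw [e, trace_mul_comm, ← Matrix.mul_assoc, h1, Matrix.one_mul, hD,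
      diagonal_mul_diagonal, trace_diagonal]
    push_cast
    rw [← sum_neg_distrib]
    refine sum_congr rfl fun i _ => ?_
    linear_combination (θ i : ℂ) ^ 2 * I_sq
  have hzl : (Z * L).trace = ∑ i, I * (θ i : ℂ) * (Vᴴ * L * V) i i := by
    have e : (Z * L).trace = (D * (Vᴴ * L * V)).trace := by
      rw [h3, Matrix.mul_assoc, Matrix.mul_assoc, trace_mul_comm]
      simp only [Matrix.mul_assoc]
    rw [e, trace]
    simp [hD, diagonal_mul]
  have hent : ∀ i, ‖(Vᴴ * L * V) i i‖ ≤ ‖L‖ := by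
    intro i
    have hV : ‖V‖ ≤ 1 := norm_unitary_le (Matrix.mem_unitaryGroup_iff.2 h2)
    have hV' : ‖Vᴴ‖ ≤ 1 := by rw [l2_opNorm_conjTranspose]; exact hV
    refine (norm_entry_le _ i i).trans ?_
    calc ‖Vᴴ * L * V‖ ≤ ‖Vᴴ‖ * ‖L‖ * ‖V‖ :=
        (norm_mul_le _ _).trans (by gcongr; exact norm_mul_le _ _)
      _ ≤ 1 * ‖L‖ * 1 := by gcongr
      _ = _ := by ring
  have hsum : ∑ i, θ i ^ 2 ≤ ∑ i, |θ i| * ‖L‖ := by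
    have e : ‖(Z * Z).trace‖ = ∑ i, θ i ^ 2 := by
      rw [hzz, norm_neg, norm_real, Real.norm_of_nonneg (by positivity)]
    rw [← e, htr, norm_neg, hzl]
    refine (norm_sum_le _ _).trans (sum_le_sum fun i _ => ?_)
    rw [norm_mul, norm_mul, norm_I, one_mul, norm_real, Real.norm_eq_abs]
    exact mul_le_mul_of_nonneg_left (hent i) (abs_nonneg _)
  have hge : ∀ i, |θ i| * (2 * π) ≤ θ i ^ 2 := by
    intro i
    obtain ⟨k, hk⟩ := hθ i
    rcases eq_or_ne k 0 with rfl | hk0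
    · simp [hk]
    · have : (1 : ℝ) ≤ |(k : ℝ)| := by exact_mod_cast Int.one_le_abs hk0
      rw [← sq_abs, sq]
      refine mul_le_mul_of_nonneg_left ?_ (abs_nonneg _)
      rw [hk, abs_mul, abs_of_pos (by positivity : (0 : ℝ) < 2 * π)]
      nlinarith [Real.pi_pos]
  have hz : ∀ i, θ i = 0 := by
    have h5 : ∑ i, |θ i| * (2 * π - ‖L‖) ≤ 0 := by
      have := sum_le_sum fun i (_ : i ∈ univ) => hge i
      simp only [mul_sub, sum_sub_distrib]
      linarith
    have h6 : ∀ i ∈ univ, 0 ≤ |θ i| * (2 * π - ‖L‖) := fun i _ =>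
      mul_nonneg (abs_nonneg _) (by linarith)
    intro i
    have := (sum_eq_zero_iff_of_nonneg h6).1 (le_antisymm h5 (sum_nonneg h6)) i (mem_univ _)
    rcases mul_eq_zero.1 this with h | h
    · exact abs_eq_zero.1 h
    · linarith
  rw [h3, hD]
  simp [hz]

end UnitaryLog

/-! ### The Lie algebra `su(N)` and its representation -/

section LieAlgebra

variable {N d : ℕ}

lemma su_conjTranspose (X : su N) : X.1ᴴ = -X.1 := X.2.1

lemma su_trace (X : su N) : X.1.trace = 0 := X.2.2

lemma su_mem_unitary (u : SU N) : u.1 ∈ unitary (Mat N) := specialUnitaryGroup_le_unitaryGroup u.2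

lemma su_star_mul (u : SU N) : u.1ᴴ * u.1 = 1 := Unitary.star_mul_self_of_mem (su_mem_unitary u)

lemma su_mul_star (u : SU N) : u.1 * u.1ᴴ = 1 := Unitary.mul_star_self_of_mem (su_mem_unitary u)

/-- The projection of all matrices onto `su(N)`: the traceless part of the anti-Hermitian part. -/
def suProj (N : ℕ) [NeZero N] : Mat N →ₗ[ℝ] su N where
  toFun M := ⟨(1 / 2 : ℝ) • (M - Mᴴ) - ((M - Mᴴ).trace / (2 * N : ℂ)) • (1 : Matrix _ _ ℂ), by
    refine ⟨?_, ?_⟩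
    · have h : star (M - Mᴴ).trace = -(M - Mᴴ).trace := by simp
      rw [conjTranspose_sub, conjTranspose_smul, conjTranspose_smul,
        conjTranspose_sub, conjTranspose_conjTranspose, star_trivial,
        star_div₀, h]
      simp only [conjTranspose_one, star_mul', star_ofNat, star_natCast]
      rw [neg_div, neg_smul, ← neg_sub M, smul_neg]
      abel
    · have hN : (N : ℂ) ≠ 0 := Nat.cast_ne_zero.2 (NeZero.ne N)
      rw [trace_sub, trace_smul, trace_smul, trace_one, smul_eq_mul, Fintype.card_fin, real_smul]
      push_cast
      field_simp
      ring⟩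
  map_add' A B := by
    ext1
    simp only [conjTranspose_add, trace_sub, trace_add, Submodule.coe_add]
    rw [show A.trace + B.trace - (Aᴴ.trace + Bᴴ.trace) =
      (A.trace - Aᴴ.trace) + (B.trace - Bᴴ.trace) by ring, add_div]
    module
  map_smul' c A := by
    ext1
    simp only [conjTranspose_smul, star_trivial, trace_sub, trace_smul,
      SetLike.val_smul, RingHom.id_apply, ← smul_sub, smul_div_assoc, smul_assoc]
    rw [smul_comm (1 / 2 : ℝ) c, ← smul_sub]

lemma suProj_coe [NeZero N] (X : su N) : suProj N X.1 = X := by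
  ext1
  show (1 / 2 : ℝ) • (X.1 - X.1ᴴ) - ((X.1 - X.1ᴴ).trace / (2 * N : ℂ)) • (1 : Matrix _ _ ℂ) = X.1
  rw [su_conjTranspose, sub_neg_eq_add, trace_add, su_trace]
  simp only [add_zero, zero_div, zero_smul, sub_zero]
  module

/-- The adjoint action of `SU(N)` on its Lie algebra. -/
def suConj (u : SU N) (Y : su N) : su N :=
  ⟨u.1 * Y.1 * u.1ᴴ, by
    refine ⟨?_, ?_⟩
    · simp only [conjTranspose_mul, conjTranspose_conjTranspose, su_conjTranspose,
        Matrix.mul_neg, Matrix.neg_mul, mul_assoc]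
    · rw [trace_mul_comm, ← mul_assoc, su_star_mul, Matrix.one_mul, su_trace]⟩

lemma exp_conj_unitary {m : Type*} [Fintype m] [DecidableEq m] {V : Matrix m m ℂ}
    (h1 : Vᴴ * V = 1) (h2 : V * Vᴴ = 1) (K : Matrix m m ℂ) :
    exp (V * K * Vᴴ) = V * exp K * Vᴴ := by
  rw [← inv_eq_right_inv h2]
  exact Matrix.exp_conj _ _ ⟨⟨V, Vᴴ, h2, h1⟩, rfl⟩

lemma expSU_suConj (u : SU N) (Y : su N) : expSU (suConj u Y) = u * expSU Y * u⁻¹ :=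
  Subtype.ext (exp_conj_unitary (su_star_mul u) (su_mul_star u) Y.1)

variable {R : Rep N d} {ρ : su N →ₗ[ℝ] Mat d}

lemma rep_star_mul (R : Rep N d) (u : SU N) : (R u).1ᴴ * (R u).1 = 1 :=
  Unitary.star_mul_self_of_mem (R u).2

lemma rep_mul_star (R : Rep N d) (u : SU N) : (R u).1 * (R u).1ᴴ = 1 :=
  Unitary.mul_star_self_of_mem (R u).2

lemma rho_suConj (hρ : ∀ X, (R (expSU X) : Mat d) = exp (ρ X))
    (u : SU N) (Y : su N) : ρ (suConj u Y) = (R u).1 * ρ Y * (R u).1ᴴ := by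
  refine eq_of_exp_smul_eq fun t => ?_
  have h : suConj u (t • Y) = t • suConj u Y := by
    ext1; simp only [suConj, SetLike.val_smul, Matrix.mul_smul, smul_mul]
  rw [← map_smul, ← hρ, ← h, expSU_suConj, map_mul, map_mul, map_inv]
  rw [← smul_mul, ← Matrix.mul_smul, exp_conj_unitary (rep_star_mul R u) (rep_mul_star R u),
    ← map_smul, ← hρ]
  rfl

lemma hasDerivAt_exp_neg_smul {A : Type*} [NormedRing A] [NormedAlgebra ℝ A] [CompleteSpace A]
    (X : A) (s : ℝ) : HasDerivAt (fun s : ℝ => exp (-(s • X))) (-(X * exp (-(s • X)))) s := by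
  simpa [Function.comp_def] using
    (hasDerivAt_exp_smul_const' (𝕂 := ℝ) X (-s)).scomp s (hasDerivAt_neg s)

lemma hasDerivAt_exp_conj {A : Type*} [NormedRing A] [NormedAlgebra ℝ A] [CompleteSpace A]
    (X Y : A) (s : ℝ) : HasDerivAt (fun s : ℝ => exp (s • X) * Y * exp (-(s • X)))
      (X * (exp (s • X) * Y * exp (-(s • X))) - exp (s • X) * Y * exp (-(s • X)) * X) s := by
  have h : HasDerivAt (fun s : ℝ => exp (s • X) * Y * exp (-(s • X))) _ s :=
    ((hasDerivAt_exp_smul_const' (𝕂 := ℝ) X s).mul_const Y).mul (hasDerivAt_exp_neg_smul X s)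
  have c : X * exp (-(s • X)) = exp (-(s • X)) * X :=
    (((Commute.refl X).smul_right s).neg_right).exp_right
  convert h using 1
  rw [c]
  noncomm_ring

lemma conjTranspose_exp_smul {m : Type*} [Fintype m] [DecidableEq m] {K : Matrix m m ℂ}
    (hK : Kᴴ = -K) (s : ℝ) : (exp (s • K))ᴴ = exp (-(s • K)) := by
  rw [conjTranspose_exp, conjTranspose_smul, hK, star_trivial, smul_neg]

lemma coe_suConj_expSU (X Y : su N) (s : ℝ) :
    (suConj (expSU (s • X)) Y).1 = exp (s • X.1) * Y.1 * exp (-(s • X.1)) := by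
  rw [← conjTranspose_exp_smul (su_conjTranspose X)]
  rfl

lemma suConj_expSU_zero (X Y : su N) : suConj (expSU ((0 : ℝ) • X)) Y = Y := by
  ext1; rw [coe_suConj_expSU]; simp

lemma hasDerivAt_rho_suConj [NeZero N] (ρ : su N →ₗ[ℝ] Mat d) (X Y : su N) (s : ℝ) :
    HasDerivAt (fun s : ℝ => ρ (suConj (expSU (s • X)) Y))
      (ρ (suBracket X (suConj (expSU (s • X)) Y))) s := by
  have hP : ∀ Z : su N, (ρ ∘ₗ suProj N).toContinuousLinearMap Z.1 = ρ Z := fun Z =>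
    congrArg ρ (suProj_coe Z)
  have h := (ρ ∘ₗ suProj N).toContinuousLinearMap.hasFDerivAt.comp_hasDerivAt s
    (hasDerivAt_exp_conj X.1 Y.1 s)
  simp only [Function.comp_def, ← coe_suConj_expSU, hP] at h
  rwa [← hP]

/-- The representation of the Lie algebra preserves brackets. -/
lemma rho_suBracket [NeZero N] (hρ : ∀ X, (R (expSU X) : Mat d) = exp (ρ X))
    (hsk : ∀ X, (ρ X)ᴴ = -ρ X) (X Y : su N) :
    ρ (suBracket X Y) = ρ X * ρ Y - ρ Y * ρ X := by
  have h1 := hasDerivAt_rho_suConj ρ X Y 0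
  have e : (fun s : ℝ => ρ (suConj (expSU (s • X)) Y)) =
      fun s : ℝ => exp (s • ρ X) * ρ Y * exp (-(s • ρ X)) := by
    funext s
    rw [rho_suConj hρ, hρ, map_smul, conjTranspose_exp_smul (hsk X)]
  rw [suConj_expSU_zero, e] at h1
  simpa using h1.unique (hasDerivAt_exp_conj (ρ X) (ρ Y) 0)

local notation "E[" j ", " k "]" => Matrix.single j k (1 : ℂ)

/-- The sum of the squares of the adjoint actions of the matrices `E_jk - E_kj` and
`i (E_jk + E_kj)` is `-8N` on traceless matrices. -/
lemma sum_double_commutator (X : Mat N) (hX : X.trace = 0) :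
    ∑ j : Fin N, ∑ k : Fin N, (⁅E[j, k] - E[k, j], ⁅E[j, k] - E[k, j], X⁆⁆ +
      ⁅I • (E[j, k] + E[k, j]), ⁅I • (E[j, k] + E[k, j]), X⁆⁆) = -(8 * N : ℂ) • X := by
  have h1 : ∀ E F : Mat N, ⁅E - F, ⁅E - F, X⁆⁆ + ⁅I • (E + F), ⁅I • (E + F), X⁆⁆ =
      -(2 : ℂ) • ((E * F + F * E) * X + X * (E * F + F * E)) +
        (4 : ℂ) • (E * X * F + F * X * E) := by
    intro E F
    have e4 : ∀ M : Mat N, (4 : ℂ) • M = M + M + (M + M) := fun M => by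
      rw [← two_smul ℂ M, ← two_smul ℂ (_ • M), smul_smul]; norm_num
    simp only [Ring.lie_def, smul_mul, Matrix.mul_smul, ← smul_sub, smul_smul, I_mul_I,
      neg_smul, one_smul]
    rw [two_smul, e4]
    noncomm_ring
  have h2 : ∑ j : Fin N, E[j, j] = 1 := by
    ext a b; simp [Matrix.sum_apply, Matrix.single_apply, Matrix.one_apply, ite_and]
  have h3 : ∑ j : Fin N, ∑ k, E[j, k] * X * E[k, j] = 0 := by
    have : ∀ j k : Fin N, E[j, k] * X * E[k, j] = X k k • E[j, j] := fun j k => by simp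
    have e : ∑ k, X k k = X.trace := rfl
    simp_rw [this, ← sum_smul, e, hX, zero_smul, sum_const_zero]
  have h4 : ∑ j : Fin N, ∑ k : Fin N, E[k, j] * X * E[j, k] = 0 := by rw [sum_comm]; exact h3
  have h5 : ∑ j : Fin N, ∑ k : Fin N, (E[j, k] * E[k, j] + E[k, j] * E[j, k]) =
      (2 * N : ℂ) • 1 := by
    simp only [single_mul_single_same, mul_one, sum_add_distrib, sum_const, card_univ,
      Fintype.card_fin, h2, ← smul_sum]
    rw [← Nat.cast_smul_eq_nsmul ℂ, ← add_smul]; ring_nf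
  have h6 : ∀ S T T' : Mat N, S = (2 * N : ℂ) • 1 → T = 0 → T' = 0 →
      -(2 : ℂ) • (S * X + X * S) + (4 : ℂ) • (T + T') = -(8 * N : ℂ) • X := by
    rintro S T T' rfl rfl rfl
    simp only [smul_mul, Matrix.mul_smul, one_mul, mul_one, smul_zero, add_zero]
    module
  rw [← h6 _ _ _ h5 h3 h4, sum_congr rfl fun j _ => sum_congr rfl fun k _ => h1 E[j, k] E[k, j]]
  simp only [sum_mul, mul_sum, smul_sum, sum_add_distrib, smul_add, add_mul, mul_add]

end LieAlgebra

/-! ### The representation of logarithms -/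

section LogRep

variable {N d : ℕ}

lemma suBracket_suProj [NeZero N] {S T : Mat N} (hS : Sᴴ = -S) (hT : Tᴴ = -T) :
    suBracket (suProj N S) (suProj N T) = suProj N (S * T - T * S) := by
  have h : ∀ {S : Mat N}, Sᴴ = -S → ∃ c : ℂ, (suProj N S).1 = S - c • 1 := by
    intro S hS
    refine ⟨(S - Sᴴ).trace / (2 * N : ℂ), ?_⟩
    show (1 / 2 : ℝ) • (S - Sᴴ) - _ = _
    rw [hS]
    congr 1
    module
  have h2 : suProj N (S * T - T * S) = ⟨S * T - T * S, by
      simp only [conjTranspose_sub, conjTranspose_mul, hS, hT]; noncomm_ring, by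
      simp only [trace_sub, trace_mul_comm S T, sub_self]⟩ := suProj_coe ⟨_, _⟩
  obtain ⟨c, hc⟩ := h hS
  obtain ⟨c', hc'⟩ := h hT
  ext1
  rw [h2]
  simp only [suBracket, hc, hc']
  simp only [Matrix.sub_mul, Matrix.mul_sub, smul_mul, Matrix.mul_smul, Matrix.one_mul,
    Matrix.mul_one]
  module

/-- `su(N)` is perfect: a linear functional that vanishes on brackets is zero. -/
lemma eq_zero_of_suBracket [NeZero N] (f : su N →ₗ[ℝ] ℂ) (hf : ∀ X Y, f (suBracket X Y) = 0) :
    f = 0 := by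
  ext X
  have h1 : ∀ S : Mat N, Sᴴ = -S → f (suProj N ⁅S, ⁅S, X.1⁆⁆) = 0 := by
    intro S hS
    have hX := su_conjTranspose X
    rw [Ring.lie_def S ⁅S, X.1⁆, ← suBracket_suProj hS, hf]
    rw [Ring.lie_def]
    simp only [conjTranspose_sub, conjTranspose_mul, hS, hX]; noncomm_ring
  have h2 := congrArg (fun M => f (suProj N M)) (sum_double_commutator X.1 (su_trace X))
  simp only [map_sum, map_add] at h2
  have h3 : f (suProj N (-(8 * N : ℂ) • X.1)) = -(8 * N : ℝ) • f X := by
    rw [← map_smul, ← suProj_coe X, ← map_smul, suProj_coe]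
    congr 2
    rw [← Complex.coe_smul]
    push_cast
    rfl
  rw [h3] at h2
  have h4 : -(8 * N : ℝ) • f X = 0 := by
    rw [← h2]
    refine sum_eq_zero fun j _ => sum_eq_zero fun k _ => ?_
    rw [h1, h1, add_zero]
    · rw [conjTranspose_smul, conjTranspose_add, conjTranspose_single,
        conjTranspose_single, star_one, star_def, conj_I, neg_smul, add_comm]
    · simp
  rcases smul_eq_zero.1 h4 with h | h
  · have : (N : ℝ) ≠ 0 := Nat.cast_ne_zero.2 (NeZero.ne N)
    simp [this] at h
  · exact h

variable {R : Rep N d} {ρ : su N →ₗ[ℝ] Mat d}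

lemma norm_conj_sub_le {m : Type*} [Fintype m] [DecidableEq m] {V : Matrix m m ℂ}
    (hV : V ∈ unitaryGroup m ℂ) (M : Matrix m m ℂ) :
    ‖V * M * Vᴴ - M‖ ≤ 2 * ‖V - 1‖ * ‖M‖ := by
  have h1 : V * M * Vᴴ - M = (V - 1) * M * Vᴴ + M * (V - 1)ᴴ := by
    rw [conjTranspose_sub, conjTranspose_one]; noncomm_ring
  have h2 : ‖Vᴴ‖ ≤ 1 := by rw [l2_opNorm_conjTranspose]; exact norm_unitary_le hV
  rw [h1]
  calc _ ≤ ‖(V - 1) * M * Vᴴ‖ + ‖M * (V - 1)ᴴ‖ := norm_add_le _ _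
    _ ≤ ‖V - 1‖ * ‖M‖ * 1 + ‖M‖ * ‖V - 1‖ := by
        refine add_le_add ((norm_mul_le _ _).trans ?_) ((norm_mul_le _ _).trans ?_)
        · exact mul_le_mul (norm_mul_le _ _) h2 (norm_nonneg _) (by positivity)
        · rw [l2_opNorm_conjTranspose]
    _ = _ := by ring

/-- If `X` and `L` are the principal logarithms of `U` and `R(U)`, both close to the identity, then
`L` acts on `ρ(su(N))` in the same way as `ρ(X)`: the defect `Q(Y) = [L, ρ(Y)] - ρ([X, Y])` has
vanishing average along the conjugation by the one-parameter groups, but is nearly constant. -/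
lemma commutator_log_eq [NeZero N] (hρ : ∀ X, (R (expSU X) : Mat d) = exp (ρ X))
    {κ : ℝ} (hκ : 4 * κ < 1) (X : su N) {L : Mat d} (hLs : Lᴴ = -L)
    (hL : exp L = (R (expSU X)).1)
    (hX1 : ∀ s ∈ 𝕀, ‖exp (s • X.1) - 1‖ ≤ κ)
    (hL1 : ∀ s ∈ 𝕀, ‖exp (s • L) - 1‖ ≤ κ) (Y : su N) :
    L * ρ Y - ρ Y * L = ρ (suBracket X Y) := by
  let Ql : su N →ₗ[ℝ] Mat d :=
    { toFun := fun Y => L * ρ Y - ρ Y * L - ρ (suBracket X Y)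
      map_add' := fun Y Z => by
        have : suBracket X (Y + Z) = suBracket X Y + suBracket X Z := by
          ext1; simp only [suBracket, Submodule.coe_add]; noncomm_ring
        simp only [this, map_add]; noncomm_ring
      map_smul' := fun c Y => by
        have : suBracket X (c • Y) = c • suBracket X Y := by
          ext1; simp only [suBracket, SetLike.val_smul, Matrix.mul_smul, smul_mul, smul_sub]
        simp only [this, map_smul, Matrix.mul_smul, smul_mul, smul_sub, RingHom.id_apply] }
  set Q := Ql.toContinuousLinearMap with hQ
  have hQY : ∀ Y, Q Y = L * ρ Y - ρ Y * L - ρ (suBracket X Y) := fun Y => rfl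
  have hest : ∀ Y, ‖Q Y‖ ≤ 4 * κ * ‖Q‖ * ‖Y‖ := by
    intro Y
    -- the path along which the defect is averaged
    let Yp : ℝ → su N := fun s => suConj (expSU (s • -X)) Y
    have hYp : ∀ s, (Yp s).1 = exp (s • -X.1) * Y.1 * exp (-(s • -X.1)) :=
      coe_suConj_expSU (-X) Y
    have hneg : ∀ Z, ρ (suBracket (-X) Z) = -ρ (suBracket X Z) := fun Z => by
      rw [← map_neg]
      congr 1
      ext1
      simp only [suBracket, Submodule.coe_neg]
      noncomm_ring
    let F : ℝ → Mat d := fun s =>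
      exp (s • L) * ρ (Yp s) * exp (-(s • L))
    have hder2 : ∀ s, HasDerivAt F (exp (s • L) * Q (Yp s) * exp (-(s • L))) s := by
      intro s
      have h3 : HasDerivAt F _ s := ((hasDerivAt_exp_smul_const (𝕂 := ℝ) L s).mul
        (hasDerivAt_rho_suConj ρ (-X) Y s)).mul (hasDerivAt_exp_neg_smul L s)
      convert h3 using 1
      rw [hQY, Pi.mul_apply, hneg]
      noncomm_ring
    have hF0 : F 0 = ρ Y := by
      have : Yp 0 = Y := suConj_expSU_zero _ _
      simp [F, this]
    have hF1 : F 1 = ρ Y := by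
      show exp ((1 : ℝ) • L) * ρ (Yp 1) * exp (-((1 : ℝ) • L)) = _
      rw [← conjTranspose_exp_smul hLs, one_smul, hL, ← rho_suConj hρ]
      congr 1
      ext1
      show exp X.1 * (Yp 1).1 * (exp X.1)ᴴ = _
      have e := conjTranspose_exp_smul (su_conjTranspose X) 1
      rw [one_smul] at e
      rw [hYp, one_smul, neg_neg, e]
      calc _ = (exp X.1 * exp (-X.1)) * Y.1 *
            (exp X.1 * exp (-X.1)) := by noncomm_ring
        _ = _ := by rw [exp_mul_exp_neg]; simp
    have hb : ∀ s ∈ 𝕀, ‖exp (s • L) * Q (Yp s) * exp (-(s • L)) - Q Y‖ ≤ 4 * κ * ‖Q‖ * ‖Y‖ := by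
      intro s hs
      have hu : exp (s • L) ∈ unitaryGroup (Fin d) ℂ :=
        exp_mem_unitary_of_skew (by rw [conjTranspose_smul, hLs, star_trivial, smul_neg])
      have hv : exp (s • -X.1) ∈ unitaryGroup (Fin N) ℂ := su_mem_unitary (expSU (s • -X))
      have hn : ‖exp (s • -X.1) - 1‖ ≤ κ := by
        rw [smul_neg, ← conjTranspose_exp_smul (su_conjTranspose X), ← conjTranspose_one,
          ← conjTranspose_sub,
          l2_opNorm_conjTranspose]
        exact hX1 s hs
      have hκ0 : 0 ≤ κ := (norm_nonneg _).trans hn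
      have e1 : ‖Yp s - Y‖ ≤ 2 * κ * ‖Y‖ := by
        refine (norm_conj_sub_le hv Y.1).trans ?_
        show _ ≤ 2 * κ * ‖Y.1‖
        gcongr
      have e2 : ‖exp (s • L) * Q Y * (exp (s • L))ᴴ - Q Y‖ ≤ 2 * κ * (‖Q‖ * ‖Y‖) := by
        refine (norm_conj_sub_le hu _).trans ?_
        have := hL1 s hs
        gcongr
        exact Q.le_opNorm Y
      have e3 : ‖exp (s • L) * (Q (Yp s) - Q Y) * (exp (s • L))ᴴ‖ ≤ ‖Q‖ * (2 * κ * ‖Y‖) := by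
        have h1 := norm_unitary_le hu
        have h2 : ‖(exp (s • L))ᴴ‖ ≤ 1 := by rwa [l2_opNorm_conjTranspose]
        calc _ ≤ ‖exp (s • L)‖ * ‖Q (Yp s) - Q Y‖ * ‖(exp (s • L))ᴴ‖ :=
              (norm_mul_le _ _).trans (by gcongr; exact norm_mul_le _ _)
          _ ≤ 1 * (‖Q‖ * (2 * κ * ‖Y‖)) * 1 := by
              gcongr
              rw [← map_sub]
              exact (Q.le_opNorm _).trans (by gcongr)
          _ = _ := by ring
      rw [← conjTranspose_exp_smul hLs]
      calc _ = ‖exp (s • L) * (Q (Yp s) - Q Y) * (exp (s • L))ᴴ +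
            (exp (s • L) * Q Y * (exp (s • L))ᴴ - Q Y)‖ := by
            congr 1; noncomm_ring
        _ ≤ _ := (norm_add_le _ _).trans (add_le_add e3 e2)
        _ = _ := by ring
    have hmv := Convex.norm_image_sub_le_of_norm_hasDerivWithin_le (s := 𝕀)
      (f := fun s => F s - s • Q Y) (fun s hs => ((hder2 s).sub
        ((hasDerivAt_id s).smul_const (Q Y))).hasDerivWithinAt) (C := 4 * κ * ‖Q‖ * ‖Y‖)
      (fun s hs => by simpa using hb s hs) (convex_Icc 0 1) (Set.left_mem_Icc.2 zero_le_one)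
      (Set.right_mem_Icc.2 zero_le_one)
    simpa [hF0, hF1] using hmv
  have hQ0 : ‖Q‖ = 0 := by
    by_cases hκ0 : 0 ≤ κ
    · have h := Q.opNorm_le_bound (by positivity) hest
      nlinarith [norm_nonneg Q]
    · exact absurd ((norm_nonneg _).trans (hX1 0 ⟨le_rfl, zero_le_one⟩)) hκ0
  have hQz : Q Y = 0 := norm_le_zero_iff.1 ((Q.le_opNorm Y).trans (by rw [hQ0, zero_mul]))
  rw [hQY] at hQz
  exact sub_eq_zero.1 hQz

/-- The representation maps small logarithms to logarithms. -/
lemma rho_eq_log [NeZero N] (hρ : ∀ X, (R (expSU X) : Mat d) = exp (ρ X)) (hsk : ∀ X, (ρ X)ᴴ = -ρ X)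
    {κ : ℝ} (hκ : 4 * κ < 1) (X : su N) {L : Mat d} (hLs : Lᴴ = -L)
    (hL : exp L = (R (expSU X)).1) (hLn : ‖L‖ < 2 * π)
    (hX1 : ∀ s ∈ 𝕀, ‖exp (s • X.1) - 1‖ ≤ κ)
    (hL1 : ∀ s ∈ 𝕀, ‖exp (s • L) - 1‖ ≤ κ) : ρ X = L := by
  have hc : ∀ Y, (ρ X - L) * ρ Y = ρ Y * (ρ X - L) := by
    intro Y
    have h1 := commutator_log_eq hρ hκ X hLs hL hX1 hL1 Y
    rw [rho_suBracket hρ hsk] at h1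
    rw [sub_mul, mul_sub, sub_eq_sub_iff_add_eq_add]
    rw [sub_eq_sub_iff_add_eq_add] at h1
    rw [← h1]; abel
  have hcL : Commute (ρ X) L := by
    have := hc X
    rw [sub_mul, mul_sub] at this
    exact (sub_right_injective this).symm
  rw [← sub_eq_zero]
  refine eq_zero_of_exp_eq_one (L := L) ?_ ?_ hLn ?_
  · rw [conjTranspose_sub, hsk, hLs]; abel
  · rw [sub_eq_add_neg, exp_add_of_commute_real hcL.neg_right, ← hρ, ← hL, exp_mul_exp_neg]
  · have h0 : (((ρ X - L) * ρ X).trace) = 0 := by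
      let f : su N →ₗ[ℝ] ℂ :=
        { toFun := fun Y => ((ρ X - L) * ρ Y).trace
          map_add' := fun Y Z => by rw [map_add, mul_add, trace_add]
          map_smul' := fun c Y => by simp }
      have hf : f = 0 := eq_zero_of_suBracket f fun S T => by
        show ((ρ X - L) * ρ (suBracket S T)).trace = 0
        rw [rho_suBracket hρ hsk, mul_sub, trace_sub, ← mul_assoc, hc S, mul_assoc,
          trace_mul_comm, mul_assoc, sub_self]
      exact LinearMap.congr_fun hf X
    rw [mul_sub, trace_sub, h0, zero_sub]

end LogRep

/-! ### The smooth logarithm and small link variables -/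

section LogSeries

variable {m : Type*} [Fintype m] [DecidableEq m]

/-- The Taylor coefficients of `log (1 + x)` at `x = 0`. -/
def logCoeff (k : ℕ) : ℝ := (-1) ^ (k + 1) / k

lemma abs_logCoeff_le_one (k : ℕ) : |logCoeff k| ≤ 1 := by
  rw [logCoeff, abs_div, abs_pow, abs_neg, abs_one, one_pow, Nat.abs_cast]
  rcases k with _ | k
  · simp
  · exact div_le_one_of_le₀ (by push_cast; linarith [Nat.cast_nonneg (α := ℝ) k]) (by positivity)

/-- The logarithm of a matrix in the unit ball around the identity, as a power series. -/
def logMat (M : Matrix m m ℂ) : Matrix m m ℂ := ∑' k, logCoeff k • (M - 1) ^ k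

lemma contDiffAt_logMat {M : Matrix m m ℂ} (hM : ‖M - 1‖ < 1) :
    SmoothAt (logMat : Matrix m m ℂ → Matrix m m ℂ) M :=
  contDiffAt_powerSeries (B := fun M : Matrix m m ℂ => M - 1) (O := {M | ‖M - 1‖ < 1})
    norm_one_matrix_le abs_logCoeff_le_one
    ⟨isOpen_lt (by fun_prop) continuous_const, fun _ _ => by fun_prop, fun _ h => h⟩ hM

lemma conj_pow_of_star_mul {V : Matrix m m ℂ} (h1 : Vᴴ * V = 1) (h2 : V * Vᴴ = 1)
    (M : Matrix m m ℂ) (k : ℕ) : (V * M * Vᴴ) ^ k = V * M ^ k * Vᴴ := by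
  induction k with
  | zero => simp [h2]
  | succ k ih =>
    rw [pow_succ, ih, pow_succ]
    calc V * M ^ k * Vᴴ * (V * M * Vᴴ) = V * M ^ k * (Vᴴ * V) * M * Vᴴ := by noncomm_ring
      _ = _ := by rw [h1, mul_one]; noncomm_ring

lemma logMat_eq_unitaryLog {u : Matrix m m ℂ} (hu : u ∈ unitary (Matrix m m ℂ))
    (h : ‖u - 1‖ < 1) : logMat u = unitaryLog u := by
  have hK := conjTranspose_unitaryLog hu
  have hexp := exp_unitaryLog hu (h.trans one_lt_two)
  have hn := norm_unitaryLog_le hu (h.trans one_lt_two)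
  generalize unitaryLog u = K at hK hexp hn ⊢
  obtain ⟨V, θ, h1, h2, h3, h4⟩ := exists_unitary_diagonal_of_skew hK
  have hθ : ∀ i, |θ i| < π := fun i => by linarith [h4 i, Real.pi_gt_three]
  set z : m → ℂ := fun i => Complex.exp (I * (θ i : ℂ)) - 1 with hz
  have hu1 : u - 1 = V * diagonal z * Vᴴ := by
    have : diagonal z = diagonal (fun i => Complex.exp (I * (θ i : ℂ))) - 1 := by
      rw [← diagonal_one, diagonal_sub]
    rw [this, mul_sub, sub_mul, mul_one, h2, ← exp_conj_diagonal h1 h2, ← h3, hexp]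
  have hzn : ∀ i, ‖z i‖ < 1 := by
    intro i
    have hV : ‖V‖ ≤ 1 := norm_unitary_le (Matrix.mem_unitaryGroup_iff.2 h2)
    have hV' : ‖Vᴴ‖ ≤ 1 := by rw [l2_opNorm_conjTranspose]; exact hV
    have e : diagonal z = Vᴴ * (u - 1) * V := by grind
    refine (norm_le_pi_norm z i).trans_lt ?_
    rw [← l2_opNorm_diagonal, e]
    calc _ ≤ ‖Vᴴ‖ * ‖u - 1‖ * ‖V‖ := (norm_mul_le _ _).trans (by gcongr; exact norm_mul_le _ _)
      _ ≤ 1 * ‖u - 1‖ * 1 := by gcongr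
      _ < 1 := by simpa using h
  have hsum : HasSum (fun k => fun i => logCoeff k • z i ^ k) (fun i => I * (θ i : ℂ)) := by
    rw [Pi.hasSum]
    intro i
    have h5 := hasSum_taylorSeries_log (hzn i)
    have h6 : log (1 + z i) = I * (θ i : ℂ) := by
      rw [hz]
      simp only [add_sub_cancel]
      have := abs_lt.1 (hθ i)
      rw [log_exp] <;> simp <;> linarith
    rw [h6] at h5
    refine h5.congr_fun fun k => ?_
    simp only [logCoeff, real_smul]
    push_cast
    ring
  let L : (m → ℂ) →ₗ[ℝ] Matrix m m ℂ :=
    { toFun := fun f => V * diagonal f * Vᴴ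
      map_add' := fun f g => by rw [← add_mul, ← mul_add, diagonal_add]; rfl
      map_smul' := fun c f => by simp }
  have h7 := hsum.map L.toAddMonoidHom L.continuous_of_finiteDimensional
  rw [logMat, h3]
  refine HasSum.tsum_eq (h7.congr_fun fun k => ?_)
  rw [hu1, conj_pow_of_star_mul h1 h2, diagonal_pow]
  exact (map_smul L (logCoeff k) (z ^ k)).symm

end LogSeries

/-- A representation of `SU(N)` with generator `ρ`, and a radius `δ` so small that the logarithm of
link variables within distance `δ` of the identity is well behaved. -/
structure SmallRep {N d : ℕ} (R : Rep N d) (ρ : su N →ₗ[ℝ] Mat d) (δ : ℝ) : Prop where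
  rep : ∀ X, (R (expSU X) : Mat d) = exp (ρ X)
  skew : ∀ X, (ρ X)ᴴ = -ρ X
  small : δ ≤ 1 / 80
  two_le : 2 ≤ N
  traceless : δ ≤ √2 * √(1 - Real.cos (π / ((N : ℝ) - 1)))

lemma exists_smallRep {N d : ℕ} (hN : 2 ≤ N) (R : Rep N d) (hR : Continuous R) {ε δ : ℝ}
    (hε : ε < 1 / (6 * (2 + √2))) (hδ : 0 < δ)
    (hδ₁ : δ ≤ √2 * √(1 - Real.cos (π / ((N : ℝ) - 1))))
    (hδ₂ : 4 * δ + 6 * δ ^ 2 + 4 * δ ^ 3 + δ ^ 4 ≤ ε) :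
    ∃ ρ : su N →ₗ[ℝ] Mat d, SmallRep R ρ δ := by
  obtain ⟨ρ, h1, h2⟩ := exists_linear_generator R hR
  refine ⟨ρ, h1, h2, ?_, hN, hδ₁⟩
  have h3 : (1.4 : ℝ) ≤ √2 := Real.le_sqrt_of_sq_le (by norm_num)
  have h4 : 1 / (6 * (2 + √2)) ≤ 1 / 20.4 := one_div_le_one_div_of_le (by norm_num) (by linarith)
  have h5 : 0 ≤ 6 * δ ^ 2 + 4 * δ ^ 3 + δ ^ 4 := by positivity
  have h6 : (1 : ℝ) / 20.4 ≤ 1 / 20 := by norm_num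
  linarith

/-- Link variables within distance `δ` of the identity, in the fundamental representation and in
the representation `R`. -/
def IsSmallLink {N d : ℕ} (R : Rep N d) (δ : ℝ) (u : SU N) : Prop :=
  ‖1 - (u : Mat N)‖ < δ ∧ ‖1 - (R u : Mat d)‖ < δ

/-- The logarithm of a link variable close to the identity. -/
def suLog {N : ℕ} [NeZero N] (u : SU N) : su N := suProj N (logMat u.1)

lemma suLog_one (N : ℕ) [NeZero N] : suLog (1 : SU N) = 0 := by
  have : logMat (1 : Mat N) = 0 := by
    rw [logMat, ← tsum_zero (β := ℕ)]
    congr 1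
    funext k
    rcases k with _ | k <;> simp [logCoeff]
  rw [suLog, OneMemClass.coe_one, this, map_zero]

namespace SmallRep

variable {N d : ℕ} {R : Rep N d} {ρ : su N →ₗ[ℝ] Mat d} {δ : ℝ} {u : SU N}
  (h : SmallRep R ρ δ) (hu : IsSmallLink R δ u)

include h hu

lemma norm_sub_one_lt : ‖u.1 - 1‖ < 1 / 80 := by rw [norm_sub_rev]; exact hu.1.trans_le h.small

lemma norm_rep_sub_one_lt : ‖(R u).1 - 1‖ < 1 / 80 := by
  rw [norm_sub_rev]; exact hu.2.trans_le h.small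

variable [NeZero N]

lemma trace_unitaryLog : (unitaryLog u.1).trace = 0 := by
  have h1 := h.norm_sub_one_lt hu
  have hm := su_mem_unitary u
  have h2 : ‖u.1 - 1‖ < 2 := h1.trans (by norm_num)
  refine trace_eq_zero_of_det_exp (conjTranspose_unitaryLog hm) ?_ ?_
  · rw [exp_unitaryLog hm h2]
    exact (Matrix.mem_specialUnitaryGroup_iff.1 u.2).2
  · have hN : (1 : ℝ) ≤ (N : ℝ) - 1 := by
      have : (2 : ℝ) ≤ N := by exact_mod_cast h.two_le
      linarith
    have hN0 : (0 : ℝ) < (N : ℝ) - 1 := by linarith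
    have h3 : ‖u.1 - 1‖ ^ 2 < 2 * (1 - Real.cos (π / ((N : ℝ) - 1))) := by
      have e : ‖u.1 - 1‖ < √2 * √(1 - Real.cos (π / ((N : ℝ) - 1))) := by
        rw [norm_sub_rev]; exact hu.1.trans_le h.traceless
      calc ‖u.1 - 1‖ ^ 2 < (√2 * √(1 - Real.cos (π / ((N : ℝ) - 1)))) ^ 2 :=
            pow_lt_pow_left₀ e (norm_nonneg _) two_ne_zero
        _ = _ := by
            rw [mul_pow, Real.sq_sqrt (by norm_num), Real.sq_sqrt]
            linarith [Real.cos_le_one (π / ((N : ℝ) - 1))]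
    rw [← two_mul_one_sub_cos_norm_unitaryLog hm h2] at h3
    have h4 : ‖unitaryLog u.1‖ < π / ((N : ℝ) - 1) := by
      by_contra! hcon
      have := Real.cos_le_cos_of_nonneg_of_le_pi (by positivity) (norm_unitaryLog_le_pi hm) hcon
      linarith
    rw [Fintype.card_fin]
    calc (N : ℝ) * ‖unitaryLog u.1‖ < N * (π / ((N : ℝ) - 1)) := by
          have : (0 : ℝ) < N := by linarith
          gcongr
      _ ≤ 2 * π := by
          rw [mul_div_assoc', div_le_iff₀ hN0]
          nlinarith [Real.pi_pos]

lemma coe_suLog : (suLog u).1 = unitaryLog u.1 := by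
  have hm := su_mem_unitary u
  have := suProj_coe (N := N) ⟨unitaryLog u.1, conjTranspose_unitaryLog hm, h.trace_unitaryLog hu⟩
  rw [suLog, logMat_eq_unitaryLog hm ((h.norm_sub_one_lt hu).trans (by norm_num)), this]

lemma expSU_suLog : expSU (suLog u) = u := by
  ext1
  show exp (suLog u).1 = u.1
  rw [h.coe_suLog hu]
  exact exp_unitaryLog (su_mem_unitary u) ((h.norm_sub_one_lt hu).trans (by norm_num))

lemma powMatrix_eq (t : ℝ) : powMatrix t u = (expSU (t • suLog u)).1 := by
  show powMatrix t u = exp (t • (suLog u).1)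
  rw [h.coe_suLog hu]
  exact exp_smul_unitaryLog (su_mem_unitary u) ((h.norm_sub_one_lt hu).trans (by norm_num)) t

lemma powSU_eq (t : ℝ) : powSU t u = expSU (t • suLog u) := by
  rw [powSU, dif_pos (by rw [h.powMatrix_eq hu]; exact (expSU _).2)]
  exact Subtype.ext (h.powMatrix_eq hu t)

lemma norm_suLog_le : ‖suLog u‖ ≤ 1 / 40 := by
  show ‖(suLog u).1‖ ≤ _
  rw [h.coe_suLog hu]
  have h1 := h.norm_sub_one_lt hu
  refine (norm_unitaryLog_le (su_mem_unitary u) (h1.trans (by norm_num))).trans ?_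
  linarith

lemma norm_expSU_smul_sub_one_le {t : ℝ} (ht : t ∈ 𝕀) :
    ‖exp (t • (suLog u).1) - 1‖ ≤ ‖u.1 - 1‖ := by
  rw [h.coe_suLog hu]
  exact norm_exp_smul_unitaryLog_sub_one_le (su_mem_unitary u)
    ((h.norm_sub_one_lt hu).trans (by norm_num)) ht

lemma rho_suLog : ρ (suLog u) = unitaryLog (R u).1 := by
  have h1 := h.norm_sub_one_lt hu
  have h2 := h.norm_rep_sub_one_lt hu
  have h2' : ‖(R u).1 - 1‖ < 2 := h2.trans (by norm_num)
  refine rho_eq_log h.rep h.skew (κ := 1 / 80) (by norm_num) (suLog u)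
    (conjTranspose_unitaryLog (R u).2) ?_ ?_ ?_ ?_
  · rw [h.expSU_suLog hu]; exact exp_unitaryLog (R u).2 h2'
  · linarith [norm_unitaryLog_le_pi (R u).2, Real.pi_pos]
  · exact fun s hs => (h.norm_expSU_smul_sub_one_le hu hs).trans h1.le
  · exact fun s hs => (norm_exp_smul_unitaryLog_sub_one_le (R u).2 h2' hs).trans h2.le

lemma isSmallLink_expSU {t : ℝ} (ht : t ∈ 𝕀) : IsSmallLink R δ (expSU (t • suLog u)) := by
  constructor
  · rw [norm_sub_rev]
    refine (h.norm_expSU_smul_sub_one_le hu ht).trans_lt ?_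
    rw [norm_sub_rev]; exact hu.1
  · rw [h.rep, map_smul, h.rho_suLog hu, norm_sub_rev]
    refine (norm_exp_smul_unitaryLog_sub_one_le (R u).2
      ((h.norm_rep_sub_one_lt hu).trans (by norm_num)) ht).trans_lt ?_
    rw [norm_sub_rev]; exact hu.2

lemma suLog_expSU_smul {t : ℝ} (ht : t ∈ 𝕀) : suLog (expSU (t • suLog u)) = t • suLog u := by
  ext1
  rw [h.coe_suLog (h.isSmallLink_expSU hu ht)]
  refine unitaryLog_exp (su_conjTranspose (t • suLog u)) ?_
  have h1 := h.norm_suLog_le hu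
  have h2 : ‖t • suLog u‖ ≤ ‖suLog u‖ := by
    rw [norm_smul, Real.norm_of_nonneg ht.1]
    exact mul_le_of_le_one_left (norm_nonneg _) ht.2
  show ‖t • suLog u‖ < π
  linarith [Real.pi_gt_three]

end SmallRep

/-! ### Operator norms and quadratic forms -/

section Norms

variable {m n : Type*} [Fintype m] [Fintype n] [DecidableEq m] [DecidableEq n]

lemma opNorm_le_of_mulVec {M : Matrix m n ℂ} {c : ℝ} (hc : 0 ≤ c)
    (h : ∀ ψ : n → ℂ, ∑ i, ‖(M *ᵥ ψ) i‖ ^ 2 ≤ c ^ 2 * ∑ j, ‖ψ j‖ ^ 2) : ‖M‖ ≤ c := by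
  rw [l2_opNorm_def]
  refine opNorm_le_bound _ hc fun ψ => ?_
  refine abs_le_of_sq_le_sq' ?_ (by positivity) |>.2
  rw [mul_pow, EuclideanSpace.norm_sq_eq, EuclideanSpace.norm_sq_eq]
  exact h ψ.ofLp

lemma sum_norm_mulVec_sq_le (M : Matrix m n ℂ) (ψ : n → ℂ) :
    ∑ i, ‖(M *ᵥ ψ) i‖ ^ 2 ≤ ‖M‖ ^ 2 * ∑ j, ‖ψ j‖ ^ 2 := by
  have h := pow_le_pow_left₀ (norm_nonneg _) (M.l2_opNorm_mulVec (WithLp.toLp 2 ψ)) 2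
  rw [mul_pow, EuclideanSpace.norm_sq_eq, EuclideanSpace.norm_sq_eq] at h
  exact h

lemma star_dotProduct_self (ψ : n → ℂ) : star ψ ⬝ᵥ ψ = ((∑ j, ‖ψ j‖ ^ 2 : ℝ) : ℂ) := by
  simp only [dotProduct, Pi.star_apply, RCLike.star_def, conj_mul']
  push_cast; rfl

lemma star_dotProduct_conjTranspose_mul (M : Matrix m n ℂ) (ψ : n → ℂ) :
    star ψ ⬝ᵥ ((Mᴴ * M) *ᵥ ψ) = ((∑ i, ‖(M *ᵥ ψ) i‖ ^ 2 : ℝ) : ℂ) := by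
  rw [← star_dotProduct_self, star_mulVec, ← mulVec_mulVec, dotProduct_mulVec]

/-- A Hermitian matrix whose quadratic form lies between `0` and `c` has norm at most `c`. -/
lemma norm_le_of_quadraticForm {M : Matrix n n ℂ} (hM : Mᴴ = M) {c : ℝ} (hc : 0 ≤ c)
    (h : ∀ ψ : n → ℂ, |(star ψ ⬝ᵥ (M *ᵥ ψ)).re| ≤ c * ∑ j, ‖ψ j‖ ^ 2) : ‖M‖ ≤ c := by
  obtain ⟨V, θ, h1, h2, h3, -⟩ := exists_unitary_diagonal_of_skew (K := I • M) (by
    rw [conjTranspose_smul, hM]; simp)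
  have h4 : M = V * diagonal (fun i => (θ i : ℂ)) * Vᴴ := by
    have e : diagonal (fun i => I * (θ i : ℂ)) = I • diagonal (fun i => (θ i : ℂ)) := by
      rw [← diagonal_smul]; rfl
    rw [e, Matrix.mul_smul, smul_mul] at h3
    exact smul_right_injective _ I_ne_zero h3
  have hθ : ∀ i, |θ i| ≤ c := by
    intro i
    have h5 := h (V *ᵥ Pi.single i 1)
    have e1 : star (V *ᵥ Pi.single i 1) ⬝ᵥ (M *ᵥ (V *ᵥ Pi.single i 1)) = θ i := by
      have : Vᴴ * (M * V) = diagonal (fun i => (θ i : ℂ)) := by grind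
      rw [star_mulVec, ← dotProduct_mulVec, mulVec_mulVec, mulVec_mulVec, mul_assoc, this]
      simp
    have e2 : (∑ j, ‖(V *ᵥ Pi.single i 1) j‖ ^ 2 : ℝ) = 1 := by
      have := star_dotProduct_conjTranspose_mul V (Pi.single i 1)
      rw [h1, one_mulVec] at this
      have e : star (Pi.single i (1 : ℂ)) ⬝ᵥ Pi.single i 1 = 1 := by simp
      rw [e] at this
      exact_mod_cast this.symm
    rw [e1, e2, ofReal_re, mul_one] at h5
    exact h5
  have hV : ‖V‖ ≤ 1 := norm_unitary_le (Matrix.mem_unitaryGroup_iff.2 h2)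
  have hV' : ‖Vᴴ‖ ≤ 1 := by rw [l2_opNorm_conjTranspose]; exact hV
  rw [h4]
  calc _ ≤ ‖V‖ * ‖diagonal (fun i => (θ i : ℂ))‖ * ‖Vᴴ‖ :=
        (norm_mul_le _ _).trans (by gcongr; exact norm_mul_le _ _)
    _ ≤ 1 * c * 1 := by
        gcongr
        rw [l2_opNorm_diagonal]
        refine (pi_norm_le_iff_of_nonneg hc).2 fun i => ?_
        simpa using hθ i
    _ = c := by ring

end Norms

/-! ### The Wilson operator in terms of the represented link variables -/

section Gamma

lemma gamma_mul_self (μ : Fin 4) : gamma μ * gamma μ = 1 := by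
  fin_cases μ <;> simp [gamma, ← ext_iff, Fin.forall_fin_succ]

lemma gamma_conjTranspose (μ : Fin 4) : (gamma μ)ᴴ = gamma μ := by
  fin_cases μ <;> simp [gamma, ← ext_iff, Fin.forall_fin_succ]

lemma gamma_anticomm_of_lt {μ ν : Fin 4} (h : μ < ν) :
    gamma μ * gamma ν = -(gamma ν * gamma μ) := by
  fin_cases μ <;> fin_cases ν <;> first
    | exact absurd h (by decide)
    | simp [gamma, vecHead, vecTail, ← ext_iff, Fin.forall_fin_succ]

lemma gamma_anticomm {μ ν : Fin 4} (h : μ ≠ ν) : gamma μ * gamma ν = -(gamma ν * gamma μ) := by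
  rcases lt_or_gt_of_ne h with h | h
  · exact gamma_anticomm_of_lt h
  · rw [gamma_anticomm_of_lt h, neg_neg]

lemma diagonal_gammaFive : diagonal (![1, 1, -1, -1] : Fin 4 → ℂ) =
    !![1, 0, 0, 0; 0, 1, 0, 0; 0, 0, -1, 0; 0, 0, 0, -1] := by
  ext i j; fin_cases i <;> fin_cases j <;> simp

lemma gammaFive_eq : gamma 0 * gamma 1 * gamma 2 * gamma 3 = diagonal ![1, 1, -1, -1] := by
  rw [diagonal_gammaFive]
  simp [gamma, vecHead, vecTail]

lemma gammaFive_anticomm (μ : Fin 4) :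
    diagonal ![1, 1, -1, -1] * gamma μ = -(gamma μ * diagonal ![1, 1, -1, -1]) := by
  rw [diagonal_gammaFive]
  fin_cases μ <;> simp [gamma, vecHead, vecTail, ← ext_iff, Fin.forall_fin_succ]

end Gamma

section SpinOp

variable {n d : ℕ} [NeZero n]

lemma spinOp_mul (M M' : Mat 4) : spinOp n d M * spinOp n d M' = spinOp n d (M * M') := by
  simp [spinOp, ← mul_kronecker_mul]

lemma spinOp_one : spinOp n d 1 = 1 := by simp [spinOp]

lemma spinOp_neg (M : Mat 4) : spinOp n d (-M) = -spinOp n d M := by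
  ext p q
  simp [spinOp, kroneckerMap_apply]

lemma spinOp_conjTranspose (M : Mat 4) : (spinOp n d M)ᴴ = spinOp n d Mᴴ := by
  simp [spinOp, conjTranspose_kronecker]

lemma spinOp_gamma_sq (μ : Fin 4) : spinOp n d (gamma μ) * spinOp n d (gamma μ) = 1 := by
  rw [spinOp_mul, gamma_mul_self, spinOp_one]

lemma spinOp_gamma_anticomm {μ ν : Fin 4} (h : μ ≠ ν) :
    spinOp n d (gamma μ) * spinOp n d (gamma ν) =
      -(spinOp n d (gamma ν) * spinOp n d (gamma μ)) := by
  rw [spinOp_mul, spinOp_mul, gamma_anticomm h, spinOp_neg]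

lemma spinOp_gamma_conjTranspose (μ : Fin 4) : (spinOp n d (gamma μ))ᴴ = spinOp n d (gamma μ) := by
  rw [spinOp_conjTranspose, gamma_conjTranspose]

lemma gamma5_eq : gamma5 n d = spinOp n d (diagonal ![1, 1, -1, -1]) := by rw [gamma5, gammaFive_eq]

lemma gamma5_sq : gamma5 n d * gamma5 n d = 1 := by
  rw [gamma5_eq, spinOp_mul, diagonal_mul_diagonal, ← spinOp_one, ← diagonal_one]
  congr 2
  ext i; fin_cases i <;> simp

lemma gamma5_conjTranspose : (gamma5 n d)ᴴ = gamma5 n d := by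
  rw [gamma5_eq, spinOp_conjTranspose, diagonal_conjTranspose]
  congr 2
  ext i; fin_cases i <;> simp

lemma gamma5_gamma_anticomm (μ : Fin 4) :
    gamma5 n d * spinOp n d (gamma μ) = -(spinOp n d (gamma μ) * gamma5 n d) := by
  rw [gamma5_eq, spinOp_mul, spinOp_mul, gammaFive_anticomm, spinOp_neg]

lemma trace_gamma5 : (gamma5 n d).trace = 0 := by
  rw [gamma5_eq, spinOp, trace_kronecker, trace_kronecker, trace_diagonal, Fin.sum_univ_four]
  simp

lemma norm_spinOp_gamma_le (μ : Fin 4) : ‖spinOp n d (gamma μ)‖ ≤ 1 := by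
  refine norm_unitary_le (Matrix.mem_unitaryGroup_iff.2 ?_)
  rw [star_eq_conjTranspose, spinOp_gamma_conjTranspose, spinOp_gamma_sq]

lemma norm_gamma5_le : ‖gamma5 n d‖ ≤ 1 := by
  refine norm_unitary_le (Matrix.mem_unitaryGroup_iff.2 ?_)
  rw [star_eq_conjTranspose, gamma5_conjTranspose, gamma5_sq]

end SpinOp

/-- Fields of `d × d` matrices on the links of the lattice. -/
abbrev Blocks (n d : ℕ) : Type := Site n → Fin 4 → Mat d

/-- The phase picked up by the fermion field on the link `(x, μ)`. -/
def bdyPhase {n : ℕ} (b : Fin 4 → Circle) (x : Site n) (μ : Fin 4) : ℂ :=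
  if x μ + 1 = 0 then (b μ : ℂ) else 1

lemma norm_bdyPhase {n : ℕ} (b : Fin 4 → Circle) (x : Site n) (μ : Fin 4) :
    ‖bdyPhase b x μ‖ = 1 := by
  rw [bdyPhase]; split_ifs
  · exact Circle.norm_coe _
  · exact norm_one

/-- The covariant shift with the link matrices `φ(x, μ)`. -/
def blockShift {n d : ℕ} (b : Fin 4 → Circle) (φ : Blocks n d) (μ : Fin 4) : Op n d :=
  fun p q => if q.1 = step p.1 μ ∧ p.2.1 = q.2.1 then
    bdyPhase b p.1 μ * φ p.1 μ p.2.2 q.2.2 else 0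

/-- The translation of sites by one lattice unit. -/
def stepEquiv (n : ℕ) (μ : Fin 4) : Site n ≃ Site n := Equiv.addRight (Pi.single μ 1)

section BlockShift

variable {n d : ℕ} [NeZero n] (b : Fin 4 → Circle)

lemma blockShift_mulVec (φ : Blocks n d) (μ : Fin 4) (ψ : Idx n d → ℂ) (x : Site n) (α : Fin 4)
    (i : Fin d) : (blockShift b φ μ *ᵥ ψ) (x, α, i) =
      bdyPhase b x μ * (φ x μ *ᵥ fun j => ψ (step x μ, α, j)) i := by
  simp only [mulVec, dotProduct, blockShift, Fintype.sum_prod_type, mul_sum]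
  rw [sum_eq_single (step x μ), sum_eq_single α]
  · simp [mul_assoc]
  · intro β _ hβ; simp [Ne.symm hβ]
  · simp
  · intro y _ hy; simp [hy]
  · simp

lemma norm_blockShift_le (φ : Blocks n d) (μ : Fin 4) : ‖blockShift b φ μ‖ ≤ ‖φ‖ := by
  refine opNorm_le_of_mulVec (norm_nonneg _) fun ψ => ?_
  have h1 : ∀ x α, ∑ i, ‖(blockShift b φ μ *ᵥ ψ) (x, α, i)‖ ^ 2 ≤
      ‖φ‖ ^ 2 * ∑ i, ‖ψ (step x μ, α, i)‖ ^ 2 := by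
    intro x α
    simp only [blockShift_mulVec, norm_mul, norm_bdyPhase, one_mul]
    refine (sum_norm_mulVec_sq_le _ _).trans ?_
    gcongr
    exact (norm_le_pi_norm (φ x) μ).trans (norm_le_pi_norm φ x)
  simp only [Fintype.sum_prod_type]
  calc _ ≤ ∑ x, ∑ α, ‖φ‖ ^ 2 * ∑ i, ‖ψ (step x μ, α, i)‖ ^ 2 :=
        sum_le_sum fun x _ => sum_le_sum fun α _ => h1 x α
    _ = ‖φ‖ ^ 2 * ∑ x, ∑ α, ∑ i, ‖ψ (stepEquiv n μ x, α, i)‖ ^ 2 := by simp only [mul_sum]; rfl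
    _ = _ := by rw [(stepEquiv n μ).sum_comp (fun x => ∑ α, ∑ i, ‖ψ (x, α, i)‖ ^ 2)]

lemma spinOp_mul_blockShift (M : Mat 4) (φ : Blocks n d) (μ : Fin 4) :
    spinOp n d M * blockShift b φ μ = blockShift b φ μ * spinOp n d M := by
  have hspin : ∀ p q : Idx n d, spinOp n d M p q =
      if p.1 = q.1 then (if p.2.2 = q.2.2 then M p.2.1 q.2.1 else 0) else 0 := by
    rintro ⟨x, α, i⟩ ⟨y, β, j⟩
    simp only [spinOp, kroneckerMap_apply, Matrix.one_apply]
    split_ifs <;> simp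
  ext ⟨x, α, i⟩ ⟨y, β, j⟩
  simp only [Matrix.mul_apply, hspin, blockShift, Fintype.sum_prod_type]
  rw [sum_eq_single x, sum_eq_single β, sum_eq_single i,
    sum_eq_single y, sum_eq_single α, sum_eq_single j]
  · ring
  all_goals try simp
  all_goals intro c hc
  all_goals try simp [hc, Ne.symm hc]

/-- The part of `A` that is linear in the link matrices. -/
def hopping (φ : Blocks n d) : Op n d :=
  (1 / 2 : ℂ) • ∑ μ, ((1 - spinOp n d (gamma μ)) * blockShift b φ μ +
    (1 + spinOp n d (gamma μ)) * (blockShift b φ μ)ᴴ)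

/-- The operator `A = 1 - a D_w` as a function of the represented link variables. -/
def blockA (φ : Blocks n d) : Op n d := hopping b φ - 3

lemma blockShift_add (φ φ' : Blocks n d) (μ : Fin 4) :
    blockShift b (φ + φ') μ = blockShift b φ μ + blockShift b φ' μ := by
  ext p q
  simp only [blockShift, Pi.add_apply, Matrix.add_apply, mul_add]
  split_ifs <;> simp

lemma blockShift_smul (c : ℝ) (φ : Blocks n d) (μ : Fin 4) :
    blockShift b (c • φ) μ = c • blockShift b φ μ := by
  ext p q
  simp only [blockShift, Pi.smul_apply, Matrix.smul_apply, mul_smul_comm]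
  split_ifs <;> simp

lemma norm_hopping_le (φ : Blocks n d) : ‖hopping b φ‖ ≤ 8 * ‖φ‖ := by
  have h1 : ∀ μ, ‖(1 - spinOp n d (gamma μ)) * blockShift b φ μ +
      (1 + spinOp n d (gamma μ)) * (blockShift b φ μ)ᴴ‖ ≤ 4 * ‖φ‖ := by
    intro μ
    have hs := norm_spinOp_gamma_le (n := n) (d := d) μ
    have ho := norm_one_matrix_le (ι := Idx n d)
    have h2 : ‖(1 : Op n d) - spinOp n d (gamma μ)‖ ≤ 2 := (norm_sub_le _ _).trans (by linarith)
    have h3 : ‖(1 : Op n d) + spinOp n d (gamma μ)‖ ≤ 2 := (norm_add_le _ _).trans (by linarith)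
    have h4 := norm_blockShift_le b φ μ
    refine (norm_add_le _ _).trans ?_
    calc _ ≤ 2 * ‖φ‖ + 2 * ‖φ‖ := by
          refine add_le_add ((norm_mul_le _ _).trans ?_) ((norm_mul_le _ _).trans ?_)
          · gcongr
          · rw [l2_opNorm_conjTranspose]; gcongr
      _ = _ := by ring
  rw [hopping, norm_smul]
  calc _ ≤ ‖(1 / 2 : ℂ)‖ * ∑ μ : Fin 4, 4 * ‖φ‖ := by
        gcongr
        exact (norm_sum_le _ _).trans (sum_le_sum fun μ _ => h1 μ)
    _ = _ := by simp; ring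

/-- `hopping` as a continuous real linear map. -/
def hoppingL : Blocks n d →L[ℝ] Op n d :=
  LinearMap.mkContinuous
    { toFun := hopping b
      map_add' := fun φ φ' => by
        simp only [hopping, blockShift_add, conjTranspose_add, mul_add, ← smul_add,
          ← sum_add_distrib]
        congr 1
        exact sum_congr rfl fun μ _ => by abel
      map_smul' := fun c φ => by
        simp only [hopping, blockShift_smul, conjTranspose_smul, star_trivial,
          mul_smul_comm, ← smul_add, ← smul_sum, RingHom.id_apply, smul_comm c] } 8
    (norm_hopping_le b)

lemma hoppingL_apply (φ : Blocks n d) : hoppingL b φ = hopping b φ := rfl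

lemma norm_hoppingL_le : ‖hoppingL (n := n) (d := d) b‖ ≤ 8 :=
  LinearMap.mkContinuous_norm_le _ (by norm_num) _

lemma spinOp_mul_blockShift_conjTranspose (M : Mat 4) (φ : Blocks n d)
    (μ : Fin 4) : spinOp n d M * (blockShift b φ μ)ᴴ = (blockShift b φ μ)ᴴ * spinOp n d M := by
  have := congrArg conjTranspose (spinOp_mul_blockShift b Mᴴ φ μ)
  rw [conjTranspose_mul, conjTranspose_mul, spinOp_conjTranspose,
    conjTranspose_conjTranspose] at this
  exact this.symm

lemma conjTranspose_hopping (φ : Blocks n d) :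
    (hopping b φ)ᴴ = (1 / 2 : ℂ) • ∑ μ, ((1 + spinOp n d (gamma μ)) * blockShift b φ μ +
      (1 - spinOp n d (gamma μ)) * (blockShift b φ μ)ᴴ) := by
  have h2 : ∀ μ, ((1 - spinOp n d (gamma μ)) * blockShift b φ μ +
      (1 + spinOp n d (gamma μ)) * (blockShift b φ μ)ᴴ)ᴴ =
      (1 + spinOp n d (gamma μ)) * blockShift b φ μ +
      (1 - spinOp n d (gamma μ)) * (blockShift b φ μ)ᴴ := by
    intro μ
    have e1 := spinOp_mul_blockShift b (gamma μ) φ μ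
    have e2 := spinOp_mul_blockShift_conjTranspose b (gamma μ) φ μ
    simp only [conjTranspose_add, conjTranspose_mul, conjTranspose_sub,
      conjTranspose_one, conjTranspose_conjTranspose, spinOp_gamma_conjTranspose]
    rw [mul_sub, mul_add, ← e1, ← e2]
    noncomm_ring
  rw [hopping, conjTranspose_smul, conjTranspose_sum]
  simp only [h2]
  simp

lemma hopping_conjTranspose (φ : Blocks n d) :
    (hopping b φ)ᴴ = gamma5 n d * hopping b φ * gamma5 n d := by
  have h1 : ∀ μ, gamma5 n d * ((1 - spinOp n d (gamma μ)) * blockShift b φ μ +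
      (1 + spinOp n d (gamma μ)) * (blockShift b φ μ)ᴴ) * gamma5 n d =
      (1 + spinOp n d (gamma μ)) * blockShift b φ μ +
      (1 - spinOp n d (gamma μ)) * (blockShift b φ μ)ᴴ := by
    intro μ
    have e1 : gamma5 n d * blockShift b φ μ = blockShift b φ μ * gamma5 n d :=
      spinOp_mul_blockShift b _ φ μ
    have e2 : gamma5 n d * (blockShift b φ μ)ᴴ = (blockShift b φ μ)ᴴ * gamma5 n d :=
      spinOp_mul_blockShift_conjTranspose b _ φ μ
    have e3 := gamma5_gamma_anticomm (n := n) (d := d) μ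
    have e4 : gamma5 n d * (1 - spinOp n d (gamma μ)) = (1 + spinOp n d (gamma μ)) *
        gamma5 n d := by
      rw [mul_sub, e3]; noncomm_ring
    have e5 : gamma5 n d * (1 + spinOp n d (gamma μ)) = (1 - spinOp n d (gamma μ)) *
        gamma5 n d := by
      rw [mul_add, e3]; noncomm_ring
    rw [mul_add, add_mul, ← mul_assoc, ← mul_assoc, e4, e5, mul_assoc _ (gamma5 n d), e1,
      mul_assoc _ (gamma5 n d), e2]
    simp only [mul_assoc, gamma5_sq, mul_one]
  rw [conjTranspose_hopping, hopping, mul_smul_comm, smul_mul_assoc, mul_sum, sum_mul]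
  simp only [h1]

lemma blockA_conjTranspose (φ : Blocks n d) :
    (blockA b φ)ᴴ = gamma5 n d * blockA b φ * gamma5 n d := by
  have e : gamma5 n d * (3 : Op n d) * gamma5 n d = 3 := by
    have : (3 : Op n d) = (3 : ℂ) • 1 := by
      rw [← Algebra.algebraMap_eq_smul_one]; exact (map_ofNat (algebraMap ℂ (Op n d)) 3).symm
    rw [this]; simp [gamma5_sq]
  rw [blockA, conjTranspose_sub, hopping_conjTranspose, mul_sub, sub_mul, e]
  congr 1
  exact conjTranspose_ofNat 3

/-- `H = γ₅ A` is Hermitian. -/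
lemma gamma5_mul_blockA_conjTranspose (φ : Blocks n d) :
    (gamma5 n d * blockA b φ)ᴴ = gamma5 n d * blockA b φ := by
  rw [conjTranspose_mul, blockA_conjTranspose, gamma5_conjTranspose, mul_assoc, gamma5_sq, mul_one]

lemma gamma5_mul_blockA_sq (φ : Blocks n d) :
    (gamma5 n d * blockA b φ) * (gamma5 n d * blockA b φ) = (blockA b φ)ᴴ * blockA b φ := by
  rw [blockA_conjTranspose]; noncomm_ring

end BlockShift

/-! ### The spectral gap of the Wilson operator -/

section Gap

variable {n d : ℕ} [NeZero n] (b : Fin 4 → Circle)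

lemma blockShift_mul_conjTranspose {φ : Blocks n d} (hφ : ∀ x μ, φ x μ * (φ x μ)ᴴ = 1) (μ : Fin 4) :
    blockShift b φ μ * (blockShift b φ μ)ᴴ = 1 := by
  ext ⟨x, α, i⟩ ⟨y, β, j⟩
  have key : (blockShift b φ μ * (blockShift b φ μ)ᴴ) (x, α, i) (y, β, j) =
      if x = y ∧ α = β then (φ x μ * (φ y μ)ᴴ) i j else 0 := by
    simp only [Matrix.mul_apply, conjTranspose_apply, Fintype.sum_prod_type, blockShift]
    rw [sum_eq_single (step x μ), sum_eq_single α]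
    · by_cases h : x = y ∧ α = β
      · obtain ⟨rfl, rfl⟩ := h
        simp only [and_self, if_true]
        refine sum_congr rfl fun k _ => ?_
        have h1 : bdyPhase b x μ * star (bdyPhase b x μ) = 1 := by
          rw [star_def, mul_conj', norm_bdyPhase]; simp
        rw [star_mul']
        linear_combination (φ x μ i k * star (φ x μ j k)) * h1
      · rw [if_neg h]
        refine sum_eq_zero fun k _ => ?_
        have h2 : ¬ (step x μ = step y μ ∧ β = α) := by
          rintro ⟨h1, h2⟩
          exact h ⟨add_right_cancel h1, h2.symm⟩
        rw [if_neg h2, star_zero, mul_zero]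
    · intro γ _ hγ
      exact sum_eq_zero fun k _ => by simp [Ne.symm hγ]
    · simp
    · simp_all
    · simp
  rw [key, Matrix.one_apply]
  by_cases h : x = y ∧ α = β
  · obtain ⟨rfl, rfl⟩ := h
    simp [hφ, Matrix.one_apply]
  · grind

lemma conjTranspose_mul_blockShift {φ : Blocks n d} (hφ : ∀ x μ, φ x μ * (φ x μ)ᴴ = 1) (μ : Fin 4) :
    (blockShift b φ μ)ᴴ * blockShift b φ μ = 1 :=
  mul_eq_one_comm.1 (blockShift_mul_conjTranspose b hφ μ)

/-- The represented link variables. -/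
def repBlocks {N : ℕ} (R : Rep N d) (U : Config n N) : Blocks n d := fun x μ => (R (U x μ)).1

lemma overlapA_eq {N : ℕ} (R : Rep N d) {a : ℝ} (ha : a ≠ 0) (U : Config n N) :
    overlapA R a b U = blockA b (repBlocks R U) := by
  have hT : ∀ μ, shiftOp R b U μ = blockShift b (repBlocks R U) μ := fun μ => rfl
  have ha' : (a : ℂ) ≠ 0 := Complex.ofReal_ne_zero.2 ha
  have h1 : ∀ μ, (a : ℂ) • ((1 / 2 : ℂ) • (spinOp n d (gamma μ) *
      (nablaBwd R a b U μ + nablaFwd R a b U μ) -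
      (a : ℂ) • (nablaBwd R a b U μ * nablaFwd R a b U μ))) =
      1 - (1 / 2 : ℂ) • ((1 - spinOp n d (gamma μ)) * blockShift b (repBlocks R U) μ +
        (1 + spinOp n d (gamma μ)) * (blockShift b (repBlocks R U) μ)ᴴ) := by
    intro μ
    have h2 := conjTranspose_mul_blockShift b (φ := repBlocks R U)
      (fun x μ => rep_mul_star R (U x μ)) μ
    have e0 : spinOp n d (gamma μ) * (nablaBwd R a b U μ + nablaFwd R a b U μ) =
        (a : ℂ)⁻¹ • (spinOp n d (gamma μ) * (blockShift b (repBlocks R U) μ -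
          (blockShift b (repBlocks R U) μ)ᴴ)) := by
      rw [nablaBwd, nablaFwd, hT, ← smul_add, mul_smul_comm]
      congr 2
      abel
    rw [e0]
    simp only [nablaBwd, nablaFwd, hT, smul_mul_assoc, mul_smul_comm]
    rw [smul_sub, smul_sub]
    simp only [smul_smul]
    have e1 : (a : ℂ) * (1 / 2 * (a : ℂ)⁻¹) = 1 / 2 := by field_simp
    have e2 : (a : ℂ) * (1 / 2 * ((a : ℂ) * ((a : ℂ)⁻¹ * (a : ℂ)⁻¹))) = 1 / 2 := by field_simp
    have e3 : (1 - (blockShift b (repBlocks R U) μ)ᴴ) * (blockShift b (repBlocks R U) μ - 1) =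
        blockShift b (repBlocks R U) μ + (blockShift b (repBlocks R U) μ)ᴴ - 2 := by
      rw [sub_mul, mul_sub, mul_sub, h2, ← one_add_one_eq_two]; noncomm_ring
    rw [e1, e2, e3]
    have e4 : (1 : Op n d) = (1 / 2 : ℂ) • 2 := by
      have : (2 : Op n d) = (2 : ℂ) • 1 := by rw [two_smul]; norm_num
      rw [this, smul_smul]; norm_num
    have e6 : ∀ X : Op n d, 1 - (1 / 2 : ℂ) • X = (1 / 2 : ℂ) • (2 - X) := fun X => by
      rw [smul_sub, ← e4]
    rw [e6, ← smul_sub]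
    congr 1
    noncomm_ring
  rw [overlapA, wilsonD, smul_sum, blockA, hopping]
  simp only [h1, sum_sub_distrib, sum_const, card_univ, Fintype.card_fin, ← smul_sum]
  have e5 : (4 • (1 : Op n d)) = 1 + 3 := by norm_num
  rw [e5]
  abel

lemma blockShift_one_mulVec (μ : Fin 4) (ψ : Idx n d → ℂ) (x : Site n) (s : Fin 4 × Fin d) :
    (blockShift b 1 μ *ᵥ ψ) (x, s) = bdyPhase b x μ * ψ (step x μ, s) := by
  obtain ⟨α, i⟩ := s
  rw [blockShift_mulVec]
  simp

lemma blockShift_one_commute {μ ν : Fin 4} (h : μ ≠ ν) :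
    Commute (blockShift (n := n) (d := d) b 1 μ) (blockShift b 1 ν) := by
  refine Matrix.toLin'.injective (LinearMap.ext fun ψ => funext fun ⟨x, s⟩ => ?_)
  rw [toLin'_apply, toLin'_apply, ← mulVec_mulVec, ← mulVec_mulVec]
  simp only [blockShift_one_mulVec]
  have e1 : step (step x μ) ν = step (step x ν) μ := by simp only [step]; abel
  have e2 : bdyPhase b (step x μ) ν = bdyPhase b x ν := by
    simp [bdyPhase, step, Pi.single_eq_of_ne (Ne.symm h)]
  have e3 : bdyPhase b (step x ν) μ = bdyPhase b x μ := by
    simp [bdyPhase, step, Pi.single_eq_of_ne h]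
  rw [e1, e2, e3]; ring

lemma sum_mul_self_of_anticomm {A : Type*} [Ring A] [Algebra ℝ A] (g : Fin 4 → A)
    (h : ∀ μ ν, μ ≠ ν → g μ * g ν = -(g ν * g μ)) :
    (∑ μ, g μ) * (∑ μ, g μ) = ∑ μ, g μ * g μ := by
  simp only [Fin.sum_univ_four, add_mul, mul_add]
  rw [h 1 0 (by decide), h 2 0 (by decide), h 3 0 (by decide), h 2 1 (by decide),
    h 3 1 (by decide), h 3 2 (by decide)]
  abel

/-- The algebra behind the spectral gap of the free Wilson operator: with
`W_μ = ½ (1 - T_μ)† (1 - T_μ)` one has `A† A = 1 + ∑_{μ ≠ ν} W_μ W_ν`. -/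
lemma free_wilson_algebra {A : Type*} [Ring A] [Algebra ℂ A] (T T' G : Fin 4 → A)
    (hu : ∀ μ, T' μ * T μ = 1) (hu' : ∀ μ, T μ * T' μ = 1)
    (hc : ∀ μ ν, T μ * T ν = T ν * T μ) (hc' : ∀ μ ν, T' μ * T ν = T ν * T' μ)
    (hcc : ∀ μ ν, T' μ * T' ν = T' ν * T' μ)
    (hGT : ∀ μ ν, G μ * T ν = T ν * G μ) (hGT' : ∀ μ ν, G μ * T' ν = T' ν * G μ)
    (hGG : ∀ μ, G μ * G μ = 1) (hGa : ∀ μ ν, μ ≠ ν → G μ * G ν = -(G ν * G μ)) :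
    ((1 / 2 : ℂ) • (∑ μ, ((1 + G μ) * T μ + (1 - G μ) * T' μ)) - 3) *
      ((1 / 2 : ℂ) • (∑ μ, ((1 - G μ) * T μ + (1 + G μ) * T' μ)) - 3) =
    1 + ∑ μ, ∑ ν, if μ = ν then 0 else
      (1 / 4 : ℂ) • (((1 - T' μ) * (1 - T' ν)) * ((1 - T ν) * (1 - T μ))) := by
  -- the non-negative operators and the anti-Hermitian difference operators
  obtain ⟨W, hW⟩ : ∃ W : Fin 4 → A, ∀ μ, W μ = (1 / 2 : ℂ) • ((1 - T' μ) * (1 - T μ)) :=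
    ⟨_, fun _ => rfl⟩
  obtain ⟨S, hS⟩ : ∃ S : Fin 4 → A, ∀ μ, S μ = (1 / 2 : ℂ) • (T μ - T' μ) := ⟨_, fun _ => rfl⟩
  have hWe : ∀ μ, W μ = 1 - (1 / 2 : ℂ) • (T μ + T' μ) := by
    intro μ
    have : (1 - T' μ) * (1 - T μ) = (2 : ℂ) • 1 - (T μ + T' μ) := by
      rw [sub_mul, mul_sub, mul_sub, hu, two_smul]; noncomm_ring
    rw [hW, this]
    module
  have hGS : ∀ μ ν, G μ * S ν = S ν * G μ := by
    intro μ ν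
    simp only [hS, mul_smul_comm, smul_mul_assoc, mul_sub, sub_mul, hGT, hGT']
  have hSS : ∀ μ ν, S μ * S ν = S ν * S μ := by
    intro μ ν
    have e : (T μ - T' μ) * (T ν - T' ν) = (T ν - T' ν) * (T μ - T' μ) := by
      simp only [mul_sub, sub_mul]
      rw [hc μ ν, hcc μ ν, hc' μ ν, ← hc' ν μ]
      abel
    rw [hS, hS, smul_mul_smul_comm, smul_mul_smul_comm, e]
  have hWS : ∀ μ ν, W μ * S ν = S ν * W μ := by
    intro μ ν
    have e : (T μ + T' μ) * (T ν - T' ν) = (T ν - T' ν) * (T μ + T' μ) := by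
      simp only [mul_sub, sub_mul, mul_add, add_mul]
      rw [hc μ ν, hcc μ ν, hc' μ ν, ← hc' ν μ]
      abel
    rw [hWe, hS, sub_mul, mul_sub, one_mul, mul_one, smul_mul_smul_comm, smul_mul_smul_comm, e]
  have hGW : ∀ μ ν, G μ * W ν = W ν * G μ := by
    intro μ ν
    have e : G μ * (T ν + T' ν) = (T ν + T' ν) * G μ := by rw [mul_add, add_mul, hGT, hGT']
    rw [hWe, mul_sub, sub_mul, one_mul, mul_one, mul_smul_comm, smul_mul_assoc, e]
  have hSsq : ∀ μ, S μ * S μ = W μ * W μ - (2 : ℂ) • W μ := by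
    intro μ
    have e1 : (T μ - T' μ) * (T μ - T' μ) = (T μ + T' μ) * (T μ + T' μ) - (4 : ℂ) • 1 := by
      have : (4 : ℂ) • (1 : A) = 1 + 1 + 1 + 1 := by
        rw [← Algebra.algebraMap_eq_smul_one, map_ofNat]; norm_num
      rw [this, sub_mul, mul_sub, mul_sub, add_mul, mul_add, mul_add, hu, hu']; abel
    rw [hS, hWe, smul_mul_smul_comm, e1, sub_mul, mul_sub, mul_sub, one_mul, one_mul, mul_one,
      smul_mul_smul_comm]
    module
  have e5 : (3 : A) = ∑ _μ : Fin 4, (1 : A) - 1 := by norm_num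
  have hA : ∀ H : Fin 4 → A, (1 / 2 : ℂ) • (∑ μ, ((1 - H μ) * T μ + (1 + H μ) * T' μ)) - 3 =
      1 - ∑ μ, W μ - ∑ μ, H μ * S μ := by
    intro H
    have e : ∀ μ, (1 / 2 : ℂ) • ((1 - H μ) * T μ + (1 + H μ) * T' μ) = 1 - W μ - H μ * S μ := by
      intro μ
      rw [hWe, hS, mul_smul_comm, mul_sub, sub_mul, add_mul, one_mul, one_mul]
      module
    rw [smul_sum, sum_congr rfl fun μ _ => e μ, sum_sub_distrib, sum_sub_distrib, e5]
    abel
  have hAH := hA fun μ => -G μ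
  simp only [sub_neg_eq_add, ← sub_eq_add_neg, neg_mul, sum_neg_distrib] at hAH
  have hcomm : (∑ μ, W μ) * (∑ μ, G μ * S μ) = (∑ μ, G μ * S μ) * (∑ μ, W μ) := by
    rw [sum_mul_sum, sum_mul_sum, sum_comm]
    refine sum_congr rfl fun μ _ => sum_congr rfl fun ν _ => ?_
    rw [← mul_assoc, ← hGW, mul_assoc, hWS, mul_assoc]
  have hg : (∑ μ, G μ * S μ) * (∑ μ, G μ * S μ) = ∑ μ, (W μ * W μ - (2 : ℂ) • W μ) := by
    rw [sum_mul_self_of_anticomm]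
    · refine sum_congr rfl fun μ _ => ?_
      rw [mul_assoc, ← mul_assoc (S μ), ← hGS, mul_assoc, ← mul_assoc, hGG, one_mul, hSsq]
    · intro μ ν h
      calc G μ * S μ * (G ν * S ν) = G μ * (S μ * G ν) * S ν := by simp only [mul_assoc]
        _ = (G μ * G ν) * (S μ * S ν) := by rw [← hGS]; simp only [mul_assoc]
        _ = -(G ν * (G μ * S ν) * S μ) := by rw [hGa μ ν h, hSS]; simp only [mul_assoc, neg_mul]
        _ = _ := by rw [hGS]; simp only [mul_assoc]
  have hWW : ∀ μ ν, W μ * W ν =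
      (1 / 4 : ℂ) • (((1 - T' μ) * (1 - T' ν)) * ((1 - T ν) * (1 - T μ))) := by
    intro μ ν
    have e1 : (1 - T μ) * (1 - T' ν) = (1 - T' ν) * (1 - T μ) := by
      simp only [mul_sub, sub_mul, one_mul, mul_one, hc' ν μ]; abel
    have e2 : (1 - T μ) * (1 - T ν) = (1 - T ν) * (1 - T μ) := by
      simp only [mul_sub, sub_mul, one_mul, mul_one, hc μ ν]; abel
    rw [hW, hW, smul_mul_smul_comm, ← e2]
    congr 1
    · norm_num
    calc _ = (1 - T' μ) * ((1 - T μ) * (1 - T' ν)) * (1 - T ν) := by simp only [mul_assoc]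
      _ = _ := by rw [e1]; simp only [mul_assoc]
  have hsum : (∑ μ, ∑ ν, if μ = ν then 0 else W μ * W ν) =
      (∑ μ, W μ) * (∑ μ, W μ) - ∑ μ, W μ * W μ := by
    rw [sum_mul_sum, ← sum_sub_distrib]
    refine sum_congr rfl fun μ _ => ?_
    rw [← add_sum_erase _ _ (mem_univ μ), if_pos rfl, zero_add,
      ← add_sum_erase (a := μ) univ (fun ν => W μ * W ν) (mem_univ μ),
      add_sub_cancel_left]
    exact sum_congr rfl fun ν hν => if_neg (ne_of_mem_erase hν).symm
  simp only [← hWW]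
  rw [hsum, hAH, hA]
  rw [sum_sub_distrib, ← smul_sum] at hg
  have key : ∀ M g Q : A, M * g = g * M → g * g = Q - (2 : ℂ) • M →
      (1 - M + g) * (1 - M - g) = 1 + (M * M - Q) := by
    intro M g Q h1 h2
    calc (1 - M + g) * (1 - M - g) = 1 - M - M + M * M + (M * g - g * M) - g * g := by noncomm_ring
      _ = _ := by
        rw [h1, h2, two_smul]
        abel
  exact key _ _ _ hcomm hg

lemma free_conjTranspose_mul_self :
    (blockA (n := n) (d := d) b 1)ᴴ * blockA b 1 = 1 + ∑ μ, ∑ ν, if μ = ν then 0 else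
      (1 / 4 : ℂ) • (((1 - blockShift b 1 ν) * (1 - blockShift b 1 μ))ᴴ *
        ((1 - blockShift b 1 ν) * (1 - blockShift b 1 μ))) := by
  have hu : ∀ μ, (blockShift (n := n) (d := d) b 1 μ)ᴴ * blockShift b 1 μ = 1 :=
    conjTranspose_mul_blockShift b (fun x μ => by simp)
  have hu' : ∀ μ, blockShift (n := n) (d := d) b 1 μ * (blockShift b 1 μ)ᴴ = 1 :=
    blockShift_mul_conjTranspose b (fun x μ => by simp)
  have hc : ∀ μ ν, blockShift (n := n) (d := d) b 1 μ * blockShift b 1 ν =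
      blockShift b 1 ν * blockShift b 1 μ := by
    intro μ ν
    rcases eq_or_ne μ ν with rfl | h
    · rfl
    · exact blockShift_one_commute b h
  have key := free_wilson_algebra (fun μ => blockShift (n := n) (d := d) b 1 μ)
    (fun μ => (blockShift b 1 μ)ᴴ) (fun μ => spinOp n d (gamma μ)) hu hu' hc
    (fun μ ν => by
      calc (blockShift b 1 μ)ᴴ * blockShift b 1 ν
          = (blockShift b 1 μ)ᴴ * (blockShift b 1 ν * blockShift b 1 μ) * (blockShift b 1 μ)ᴴ := by
            rw [mul_assoc, mul_assoc, hu', mul_one]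
        _ = ((blockShift b 1 μ)ᴴ * blockShift b 1 μ) * blockShift b 1 ν * (blockShift b 1 μ)ᴴ := by
            rw [hc ν μ]; simp only [mul_assoc]
        _ = _ := by rw [hu, one_mul])
    (fun μ ν => by rw [← conjTranspose_mul, hc, conjTranspose_mul])
    (fun μ ν => spinOp_mul_blockShift b _ _ _)
    (fun μ ν => spinOp_mul_blockShift_conjTranspose b _ _ _)
    spinOp_gamma_sq (fun μ ν h => spinOp_gamma_anticomm h)
  have h3 : (3 : Op n d)ᴴ = 3 := conjTranspose_ofNat 3
  rw [blockA, conjTranspose_sub, conjTranspose_hopping, hopping, h3, key]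
  simp only [conjTranspose_mul, conjTranspose_sub, conjTranspose_one]

lemma sum_norm_sq_le_free (ψ : Idx n d → ℂ) : ∑ i, ‖ψ i‖ ^ 2 ≤ ∑ i, ‖(blockA b 1 *ᵥ ψ) i‖ ^ 2 := by
  have h1 := star_dotProduct_conjTranspose_mul (blockA (n := n) (d := d) b 1) ψ
  rw [free_conjTranspose_mul_self, add_mulVec, one_mulVec, dotProduct_add,
    star_dotProduct_self] at h1
  have h2 : 0 ≤ (star ψ ⬝ᵥ ((∑ μ, ∑ ν, if μ = ν then 0 else
      (1 / 4 : ℂ) • (((1 - blockShift b 1 ν) * (1 - blockShift (n := n) (d := d) b 1 μ))ᴴ *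
        ((1 - blockShift b 1 ν) * (1 - blockShift b 1 μ)))) *ᵥ ψ)).re := by
    simp only [sum_mulVec, dotProduct_sum, re_sum]
    refine sum_nonneg fun μ _ => sum_nonneg fun ν _ => ?_
    split_ifs
    · simp
    · rw [smul_mulVec, dotProduct_smul, star_dotProduct_conjTranspose_mul]
      have : (1 / 4 : ℂ) = ((1 / 4 : ℝ) : ℂ) := by norm_num
      rw [this, smul_eq_mul, ← ofReal_mul, ofReal_re]
      positivity
  have h3 := congrArg re h1
  rw [add_re, ofReal_re, ofReal_re] at h3
  linarith

lemma norm_le_norm_free (v : EuclideanSpace ℂ (Idx n d)) :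
    ‖v‖ ≤ ‖toEuclideanCLM (𝕜 := ℂ) (blockA b 1) v‖ := by
  refine abs_le_of_sq_le_sq' ?_ (by positivity) |>.2
  rw [EuclideanSpace.norm_sq_eq, EuclideanSpace.norm_sq_eq]
  exact sum_norm_sq_le_free b v.ofLp

/-- `1 - A† A / 128`. -/
def gapB (φ : Blocks n d) : Op n d := 1 - (128 : ℝ)⁻¹ • ((blockA b φ)ᴴ * blockA b φ)

lemma gapB_conjTranspose (φ : Blocks n d) : (gapB b φ)ᴴ = gapB b φ := by
  rw [gapB, conjTranspose_sub, conjTranspose_smul, conjTranspose_mul,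
    conjTranspose_conjTranspose, conjTranspose_one, star_trivial]

lemma norm_blockA_sub_le (φ φ' : Blocks n d) : ‖blockA b φ - blockA b φ'‖ ≤ 8 * ‖φ - φ'‖ := by
  have : blockA b φ - blockA b φ' = hoppingL b (φ - φ') := by
    rw [map_sub, hoppingL_apply, hoppingL_apply, blockA, blockA]; abel
  rw [this]
  exact norm_hopping_le b _

lemma norm_one_blocks_le : ‖(1 : Blocks n d)‖ ≤ 1 :=
  (pi_norm_le_iff_of_nonneg zero_le_one).2 fun _ =>
    (pi_norm_le_iff_of_nonneg zero_le_one).2 fun _ => norm_one_matrix_le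

lemma norm_three_op_le : ‖(3 : Op n d)‖ ≤ 3 := by
  have : (3 : Op n d) = (3 : ℂ) • 1 := by
    rw [← Algebra.algebraMap_eq_smul_one]; exact (map_ofNat (algebraMap ℂ (Op n d)) 3).symm
  rw [this, norm_smul]
  have := norm_one_matrix_le (ι := Idx n d)
  simp only [norm_ofNat]
  linarith

lemma norm_blockA_le {φ : Blocks n d} (hφ : ‖φ - 1‖ ≤ 1 / 80) : ‖blockA b φ‖ ≤ 11.1 := by
  have h1 : ‖φ‖ ≤ 81 / 80 := by
    calc ‖φ‖ = ‖(φ - 1) + 1‖ := by rw [sub_add_cancel]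
      _ ≤ 1 / 80 + 1 := (norm_add_le _ _).trans (add_le_add hφ norm_one_blocks_le)
      _ = _ := by norm_num
  rw [blockA]
  refine (norm_sub_le _ _).trans ?_
  linarith [norm_hopping_le b φ, norm_three_op_le (n := n) (d := d)]

/-- Close to the free field, the operator `A† A` is bounded and has a spectral gap, uniformly in the
lattice size. -/
lemma norm_gapB_le {φ : Blocks n d} (hφ : ‖φ - 1‖ ≤ 1 / 80) : ‖gapB b φ‖ ≤ 199 / 200 := by
  refine norm_le_of_quadraticForm (gapB_conjTranspose b φ) (by norm_num) fun ψ => ?_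
  have e : (star ψ ⬝ᵥ (gapB b φ *ᵥ ψ)).re =
      ∑ i, ‖ψ i‖ ^ 2 - 128⁻¹ * ∑ i, ‖(blockA b φ *ᵥ ψ) i‖ ^ 2 := by
    rw [gapB, sub_mulVec, dotProduct_sub, one_mulVec, star_dotProduct_self,
      smul_mulVec, dotProduct_smul, star_dotProduct_conjTranspose_mul, sub_re,
      ofReal_re, smul_re, ofReal_re, smul_eq_mul]
  have hup := (sum_norm_mulVec_sq_le (blockA b φ) ψ).trans
    (mul_le_mul_of_nonneg_right (pow_le_pow_left₀ (norm_nonneg _) (norm_blockA_le b hφ) 2)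
      (sum_nonneg fun i _ => sq_nonneg ‖ψ i‖))
  have hlow : (9 / 10) ^ 2 * ∑ i, ‖ψ i‖ ^ 2 ≤ ∑ i, ‖(blockA b φ *ᵥ ψ) i‖ ^ 2 := by
    set v : EuclideanSpace ℂ (Idx n d) := WithLp.toLp 2 ψ with hv
    have h1 : ‖toEuclideanCLM (𝕜 := ℂ) (blockA b φ - blockA b 1) v‖ ≤ 8 * (1 / 80) * ‖v‖ := by
      refine (le_opNorm _ _).trans ?_
      rw [l2_opNorm_toEuclideanCLM]
      gcongr
      exact (norm_blockA_sub_le b φ 1).trans (by gcongr)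
    have h2 := norm_le_norm_free b v
    have h3 : toEuclideanCLM (𝕜 := ℂ) (blockA b 1) v = toEuclideanCLM (𝕜 := ℂ)
        (blockA b φ) v - toEuclideanCLM (𝕜 := ℂ) (blockA b φ - blockA b 1) v := by
      rw [map_sub, sub_apply]; abel
    have h4 : 9 / 10 * ‖v‖ ≤ ‖toEuclideanCLM (𝕜 := ℂ) (blockA b φ) v‖ := by
      have := norm_sub_le (toEuclideanCLM (𝕜 := ℂ) (blockA b φ) v)
        (toEuclideanCLM (𝕜 := ℂ) (blockA b φ - blockA b 1) v)
      rw [← h3] at this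
      linarith
    have h5 := pow_le_pow_left₀ (by positivity) h4 2
    rw [mul_pow, EuclideanSpace.norm_sq_eq, EuclideanSpace.norm_sq_eq] at h5
    exact h5
  have h0 : 0 ≤ ∑ i, ‖ψ i‖ ^ 2 := sum_nonneg fun i _ => sq_nonneg ‖ψ i‖
  rw [e, abs_le]
  norm_num at hup hlow ⊢
  constructor <;> linarith

end Gap

/-! ### The chiral projectors of the overlap operator -/

section Projector

variable {n d : ℕ} [NeZero n] (b : Fin 4 → Circle)

/-- `√128 (A† A)^{-1/2}`, as a power series in `1 - A† A / 128`. -/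
def blockS (φ : Blocks n d) : Op n d := ∑' m, invSqrtCoeff m • gapB b φ ^ m

/-- `γ̂₅` as a function of the represented link variables. -/
def blockG (φ : Blocks n d) : Op n d := (√128)⁻¹ • (gamma5 n d * blockA b φ * blockS b φ)

/-- `P̂₋` as a function of the represented link variables. -/
def blockP (φ : Blocks n d) : Op n d := (1 / 2 : ℂ) • (1 - blockG b φ)

variable {φ : Blocks n d}

lemma isSelfAdjoint_conjTranspose_mul_blockA (φ : Blocks n d) :
    IsSelfAdjoint ((blockA b φ)ᴴ * blockA b φ) := by
  rw [isSelfAdjoint_iff, star_eq_conjTranspose, conjTranspose_mul, conjTranspose_conjTranspose]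

lemma hasSum_blockS (hB : ‖gapB b φ‖ < 1) : HasSum (fun m => invSqrtCoeff m • gapB b φ ^ m) (√128 •
      cfc (fun x : ℝ => (√x)⁻¹) ((blockA b φ)ᴴ * blockA b φ)) :=
  hasSum_cfc_invSqrt (isSelfAdjoint_conjTranspose_mul_blockA b φ) (by norm_num) hB

lemma blockS_eq (hB : ‖gapB b φ‖ < 1) : blockS b φ = √128 •
      cfc (fun x : ℝ => (√x)⁻¹) ((blockA b φ)ᴴ * blockA b φ) :=
  (hasSum_blockS b hB).tsum_eq

lemma blockG_eq (hB : ‖gapB b φ‖ < 1) : blockG b φ = gamma5 n d * blockA b φ *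
      cfc (fun x : ℝ => (√x)⁻¹) ((blockA b φ)ᴴ * blockA b φ) := by
  rw [blockG, blockS_eq b hB, mul_smul_comm, smul_smul, inv_mul_cancel₀ (by positivity), one_smul]

/-- The spectrum of `A† A` is bounded away from zero. -/
lemma le_of_mem_spectrum {q : ℝ} (hB : ‖gapB b φ‖ ≤ q) {x : ℝ}
    (hx : x ∈ spectrum ℝ ((blockA b φ)ᴴ * blockA b φ)) : 128 * (1 - q) ≤ x := by
  have hH := isSelfAdjoint_conjTranspose_mul_blockA b φ
  have h1 : cfc (fun x : ℝ => 1 - 128⁻¹ * x) ((blockA b φ)ᴴ * blockA b φ) = gapB b φ := by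
    rw [cfc_sub (fun _ => (1 : ℝ)) (fun x => (128 : ℝ)⁻¹ * x) _, cfc_const_one ℝ _,
      cfc_const_mul_id (128 : ℝ)⁻¹ _, gapB]
  have h2 := norm_apply_le_norm_cfc (fun x : ℝ => 1 - 128⁻¹ * x) _ hx
  rw [h1, Real.norm_eq_abs] at h2
  have := (abs_le.1 (h2.trans hB)).2
  linarith

lemma pos_of_mem_spectrum (hB : ‖gapB b φ‖ < 1) {x : ℝ}
    (hx : x ∈ spectrum ℝ ((blockA b φ)ᴴ * blockA b φ)) : 0 < x := by
  have := le_of_mem_spectrum b le_rfl hx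
  linarith

lemma continuousOn_spectrum (f : ℝ → ℝ) :
    ContinuousOn f (spectrum ℝ ((blockA b φ)ᴴ * blockA b φ)) :=
  (finite_real_spectrum (A := (blockA b φ)ᴴ * blockA b φ)).continuousOn _

lemma cfc_conjTranspose {ι : Type*} [Fintype ι] [DecidableEq ι] (f : ℝ → ℝ) (H : Matrix ι ι ℂ) :
    (cfc f H)ᴴ = cfc f H := by
  have := cfc_predicate f H
  rw [isSelfAdjoint_iff, star_eq_conjTranspose] at this
  exact this

lemma gamma5A_commute (f : ℝ → ℝ) : gamma5 n d * blockA b φ * cfc f ((blockA b φ)ᴴ * blockA b φ) =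
      cfc f ((blockA b φ)ᴴ * blockA b φ) * (gamma5 n d * blockA b φ) := by
  have h : Commute ((blockA b φ)ᴴ * blockA b φ) (gamma5 n d * blockA b φ) := by
    rw [← gamma5_mul_blockA_sq]
    exact (Commute.refl _).mul_left (Commute.refl _)
  exact (h.cfc_real f).eq.symm

lemma blockG_conjTranspose (hB : ‖gapB b φ‖ < 1) : (blockG b φ)ᴴ = blockG b φ := by
  rw [blockG_eq b hB, conjTranspose_mul, gamma5_mul_blockA_conjTranspose, cfc_conjTranspose,
    gamma5A_commute]

lemma invSqrt_mul_mul_invSqrt {ι : Type*} [Fintype ι] [DecidableEq ι] {H : Matrix ι ι ℂ}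
    (hH : IsSelfAdjoint H) (hpos : ∀ x ∈ spectrum ℝ H, 0 < x) :
    cfc (fun x : ℝ => (√x)⁻¹) H * H * cfc (fun x : ℝ => (√x)⁻¹) H = 1 := by
  have hc : ∀ f : ℝ → ℝ, ContinuousOn f (spectrum ℝ H) := fun f =>
    (finite_real_spectrum (A := H)).continuousOn _
  conv_lhs => enter [1, 2]; rw [← cfc_id' ℝ H]
  rw [← cfc_mul _ _ _ (hc _) (hc _), ← cfc_mul _ _ _ (hc _) (hc _), ← cfc_one ℝ _ hH]
  refine cfc_congr fun x hx => ?_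
  have := Real.mul_self_sqrt (hpos x hx).le
  have h2 : √x ≠ 0 := (Real.sqrt_pos.2 (hpos x hx)).ne'
  simp only [Pi.one_apply]
  field_simp
  rw [sq, this]

lemma blockG_sq (hB : ‖gapB b φ‖ < 1) : blockG b φ * blockG b φ = 1 := by
  rw [blockG_eq b hB]
  conv_lhs => enter [1]; rw [gamma5A_commute]
  rw [← mul_assoc, mul_assoc (cfc _ _), gamma5_mul_blockA_sq, invSqrt_mul_mul_invSqrt
    (isSelfAdjoint_conjTranspose_mul_blockA b φ) fun _ => pos_of_mem_spectrum b hB]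

lemma blockP_conjTranspose (hB : ‖gapB b φ‖ < 1) : (blockP b φ)ᴴ = blockP b φ := by
  rw [blockP, conjTranspose_smul, conjTranspose_sub, blockG_conjTranspose b hB, conjTranspose_one]
  congr 1
  simp

lemma half_smul_one_sub_idem {A : Type*} [Ring A] [Algebra ℂ A] {g : A} (hg : g * g = 1) :
    ((1 / 2 : ℂ) • (1 - g)) * ((1 / 2 : ℂ) • (1 - g)) = (1 / 2 : ℂ) • (1 - g) := by
  rw [smul_mul_smul_comm, sub_mul, mul_sub, mul_sub, hg, one_mul, one_mul, mul_one]
  module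

lemma blockP_idem (hB : ‖gapB b φ‖ < 1) : blockP b φ * blockP b φ = blockP b φ :=
  half_smul_one_sub_idem (blockG_sq b hB)

/-- `|H| = H γ̂₅` is bounded from below. -/
lemma quadraticForm_abs_ge (hB : ‖gapB b φ‖ ≤ 199 / 200) (ψ : Idx n d → ℂ) :
    4 / 5 * ∑ i, ‖ψ i‖ ^ 2 ≤ (star ψ ⬝ᵥ ((blockG b φ * (gamma5 n d * blockA b φ)) *ᵥ ψ)).re := by
  have hB' : ‖gapB b φ‖ < 1 := hB.trans_lt (by norm_num)
  have hH := isSelfAdjoint_conjTranspose_mul_blockA b φ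
  set X := (blockA b φ)ᴴ * blockA b φ with hX
  have hsp : ∀ x ∈ spectrum ℝ X, 4 / 5 ≤ √x := by
    intro x hx
    have := le_of_mem_spectrum b hB hx
    refine Real.le_sqrt_of_sq_le ?_
    norm_num at this ⊢
    linarith
  have h1 : blockG b φ * (gamma5 n d * blockA b φ) = cfc Real.sqrt X := by
    rw [blockG_eq b hB']
    conv_lhs => enter [1]; rw [gamma5A_commute]
    rw [mul_assoc, gamma5_mul_blockA_sq, ← hX]
    conv_lhs => enter [2]; rw [← cfc_id' ℝ X]
    rw [← cfc_mul _ _ _ (continuousOn_spectrum b _) (continuousOn_spectrum b _)]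
    refine cfc_congr fun x hx => ?_
    have hx0 := pos_of_mem_spectrum b hB' hx
    have := Real.mul_self_sqrt hx0.le
    have h2 : √x ≠ 0 := (Real.sqrt_pos.2 hx0).ne'
    field_simp
    rw [sq, this]
  have h2 : cfc Real.sqrt X = (4 / 5 : ℝ) • 1 + (cfc (fun x : ℝ => √(√x - 4 / 5)) X)ᴴ *
      cfc (fun x : ℝ => √(√x - 4 / 5)) X := by
    rw [cfc_conjTranspose, ← cfc_mul _ _ _ (continuousOn_spectrum b _) (continuousOn_spectrum b _),
      ← Algebra.algebraMap_eq_smul_one, ← cfc_const (4 / 5 : ℝ) X,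
      ← cfc_add _ _ _ (continuousOn_spectrum b _) (continuousOn_spectrum b _)]
    refine cfc_congr fun x hx => ?_
    rw [Real.mul_self_sqrt (by linarith [hsp x hx])]
    ring
  rw [h1, h2, add_mulVec, dotProduct_add, star_dotProduct_conjTranspose_mul,
    smul_mulVec, dotProduct_smul, one_mulVec, star_dotProduct_self, add_re,
    smul_re, ofReal_re, ofReal_re, smul_eq_mul]
  have : 0 ≤ ∑ i, ‖(cfc (fun x : ℝ => √(√x - 4 / 5)) X *ᵥ ψ) i‖ ^ 2 :=
    sum_nonneg fun i _ => sq_nonneg _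
  linarith

lemma mulVec_blockG_of_blockP {ψ : Idx n d → ℂ} (h : blockP b φ *ᵥ ψ = ψ) :
    blockG b φ *ᵥ ψ = -ψ := by
  have h1 : blockG b φ = 1 - (2 : ℂ) • blockP b φ := by rw [blockP]; module
  rw [h1, sub_mulVec, smul_mulVec, h, one_mulVec]
  module

lemma mulVec_blockG_of_blockP_eq_zero {ψ : Idx n d → ℂ} (h : blockP b φ *ᵥ ψ = 0) :
    blockG b φ *ᵥ ψ = ψ := by
  have h1 : blockG b φ = 1 - (2 : ℂ) • blockP b φ := by rw [blockP]; module
  rw [h1, sub_mulVec, smul_mulVec, h, one_mulVec]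
  simp

lemma star_dotProduct_mulVec_mul {ι : Type*} [Fintype ι] [DecidableEq ι] {G H : Matrix ι ι ℂ}
    (hG : Gᴴ = G) (ψ : ι → ℂ) :
    star ψ ⬝ᵥ ((G * H) *ᵥ ψ) = star (G *ᵥ ψ) ⬝ᵥ (H *ᵥ ψ) := by
  rw [star_mulVec, hG, ← dotProduct_mulVec, mulVec_mulVec]

/-- The ranges of the projectors at two link fields close to the free field are not orthogonal in
any direction. -/
lemma eq_zero_of_blockP {φ φ' : Blocks n d} (hφ : ‖φ - 1‖ ≤ 1 / 80) (hφ' : ‖φ' - 1‖ ≤ 1 / 80)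
    {ψ : Idx n d → ℂ} (h : blockP b φ *ᵥ ψ = ψ) (h' : blockP b φ' *ᵥ ψ = 0) : ψ = 0 := by
  have hB := norm_gapB_le b hφ
  have hB' := norm_gapB_le b hφ'
  have e1 := quadraticForm_abs_ge b hB ψ
  have e2 := quadraticForm_abs_ge b hB' ψ
  rw [star_dotProduct_mulVec_mul (blockG_conjTranspose b (hB.trans_lt (by norm_num))),
    mulVec_blockG_of_blockP b h, star_neg, neg_dotProduct, neg_re] at e1
  rw [star_dotProduct_mulVec_mul (blockG_conjTranspose b (hB'.trans_lt (by norm_num))),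
    mulVec_blockG_of_blockP_eq_zero b h'] at e2
  set s := ∑ i, ‖ψ i‖ ^ 2 with hs
  have hs0 : 0 ≤ s := sum_nonneg fun i _ => sq_nonneg _
  have e3 : (star ψ ⬝ᵥ ((gamma5 n d * blockA b φ' - gamma5 n d * blockA b φ) *ᵥ ψ)).re ≤
      1 / 5 * s := by
    set v : EuclideanSpace ℂ (Idx n d) := WithLp.toLp 2 ψ with hv
    set M := gamma5 n d * blockA b φ' - gamma5 n d * blockA b φ with hM
    have hMn : ‖M‖ ≤ 1 / 5 := by
      rw [hM, ← mul_sub]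
      have h3 : ‖φ' - φ‖ ≤ 1 / 40 := by
        calc ‖φ' - φ‖ = ‖(φ' - 1) - (φ - 1)‖ := by rw [sub_sub_sub_cancel_right]
          _ ≤ 1 / 80 + 1 / 80 := (norm_sub_le _ _).trans (add_le_add hφ' hφ)
          _ = _ := by norm_num
      calc _ ≤ ‖gamma5 n d‖ * ‖blockA b φ' - blockA b φ‖ := norm_mul_le _ _
        _ ≤ 1 * (8 * (1 / 40)) := by
            gcongr
            · exact norm_gamma5_le
            · exact (norm_blockA_sub_le b _ _).trans (by gcongr)
        _ = _ := by norm_num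
    have h4 : star ψ ⬝ᵥ (M *ᵥ ψ) = inner ℂ v (toEuclideanCLM (𝕜 := ℂ) M v) := by
      rw [EuclideanSpace.inner_eq_star_dotProduct, dotProduct_comm]
      rfl
    have h5 : s = ‖v‖ ^ 2 := (EuclideanSpace.norm_sq_eq v).symm
    rw [h4, h5]
    calc _ ≤ ‖inner ℂ v (toEuclideanCLM (𝕜 := ℂ) M v)‖ := re_le_norm _
      _ ≤ ‖v‖ * ‖toEuclideanCLM (𝕜 := ℂ) M v‖ := norm_inner_le_norm _ _
      _ ≤ ‖v‖ * (1 / 5 * ‖v‖) := by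
          gcongr
          refine (le_opNorm _ _).trans ?_
          rw [l2_opNorm_toEuclideanCLM]
          gcongr
      _ = _ := by ring
  rw [sub_mulVec, dotProduct_sub, sub_re] at e3
  have hs1 : s = 0 := by linarith
  funext i
  have := (sum_eq_zero_iff_of_nonneg (fun i _ => sq_nonneg ‖ψ i‖)).1 hs1 i (mem_univ i)
  simpa using this

end Projector

section Overlap

variable {N n d : ℕ} [NeZero n] (b : Fin 4 → Circle) (R : Rep N d) {a : ℝ} {U : Config n N}

lemma overlapD_eq (ha : a ≠ 0) (hB : ‖gapB b (repBlocks R U)‖ < 1) :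
    overlapD R a b U = (a : ℂ)⁻¹ • (1 - gamma5 n d * blockG b (repBlocks R U)) := by
  rw [overlapD, overlapA_eq b R ha, blockG_eq b hB, ← mul_assoc, ← mul_assoc, gamma5_sq, one_mul]

lemma hatGamma5_eq (ha : a ≠ 0) (hB : ‖gapB b (repBlocks R U)‖ < 1) :
    hatGamma5 R a b U = blockG b (repBlocks R U) := by
  rw [hatGamma5, overlapD_eq b R ha hB, smul_smul, mul_inv_cancel₀ (Complex.ofReal_ne_zero.2 ha),
    one_smul, sub_sub_cancel, ← mul_assoc, gamma5_sq, one_mul]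

lemma hatPMinus_eq (ha : a ≠ 0) (hB : ‖gapB b (repBlocks R U)‖ < 1) :
    hatPMinus R a b U = blockP b (repBlocks R U) := by
  rw [hatPMinus, hatGamma5_eq b R ha hB, blockP]

/-- The Ginsparg-Wilson relation. -/
lemma pPlus_mul_overlapD (ha : a ≠ 0) (hB : ‖gapB b (repBlocks R U)‖ < 1) :
    pPlus n d * overlapD R a b U = overlapD R a b U * hatPMinus R a b U := by
  rw [hatPMinus_eq b R ha hB, overlapD_eq b R ha hB, pPlus, blockP, smul_mul_smul_comm,
    smul_mul_smul_comm, mul_comm (1 / 2 : ℂ)]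
  congr 1
  have h1 := gamma5_sq (n := n) (d := d)
  have h2 := blockG_sq b hB
  calc (1 + gamma5 n d) * (1 - gamma5 n d * blockG b (repBlocks R U))
      = 1 + gamma5 n d - gamma5 n d * blockG b (repBlocks R U) -
        gamma5 n d * gamma5 n d * blockG b (repBlocks R U) := by noncomm_ring
    _ = 1 - blockG b (repBlocks R U) - gamma5 n d * blockG b (repBlocks R U) +
        gamma5 n d * (blockG b (repBlocks R U) * blockG b (repBlocks R U)) := by
        grind
    _ = _ := by noncomm_ring

end Overlap

/-! ### Ranks of the chiral projectors -/

section Rank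

lemma trace_mul_eq_zero_of_anticomm {ι : Type*} [Fintype ι] [DecidableEq ι]
    {γ g X : Matrix ι ι ℂ} (hg : g * g = 1) (hγ : γ * g = -(g * γ)) (hX : g * X = X * g) :
    (γ * X).trace = 0 := by
  have h : (γ * X).trace = -(γ * X).trace := by
    calc (γ * X).trace = (γ * X * g * g).trace := by rw [mul_assoc (γ * X), hg, mul_one]
      _ = (g * γ * (X * g)).trace := by rw [trace_mul_comm]; simp only [mul_assoc]
      _ = -(γ * g * (X * g)).trace := by rw [hγ, neg_mul, trace_neg, neg_neg]
      _ = -(γ * (X * g) * g).trace := by rw [mul_assoc γ g, ← mul_assoc g, hX, ← mul_assoc]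
      _ = -(γ * X).trace := by rw [mul_assoc γ, mul_assoc X, hg, mul_one]
  exact self_eq_neg.1 h

variable {n d : ℕ} [NeZero n] (b : Fin 4 → Circle)

lemma norm_gapB_one_lt : ‖gapB (n := n) (d := d) b 1‖ < 1 :=
  (norm_gapB_le b (by rw [sub_self, norm_zero]; norm_num)).trans_lt (by norm_num)

/-- At vanishing gauge field `A† A` involves no Dirac matrices. -/
lemma spinOp_mul_free (M : Mat 4) :
    Commute ((blockA (n := n) (d := d) b 1)ᴴ * blockA b 1) (spinOp n d M) := by
  have hT : ∀ μ, Commute (1 - blockShift (n := n) (d := d) b 1 μ) (spinOp n d M) := fun μ =>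
    (Commute.one_left _).sub_left (spinOp_mul_blockShift b M 1 μ).symm
  have hT' : ∀ μ, Commute (1 - blockShift (n := n) (d := d) b 1 μ)ᴴ (spinOp n d M) := fun μ => by
    rw [conjTranspose_sub, conjTranspose_one]
    exact (Commute.one_left _).sub_left (spinOp_mul_blockShift_conjTranspose b M 1 μ).symm
  rw [free_conjTranspose_mul_self]
  refine (Commute.one_left _).add_left (Commute.sum_left _ _ _ fun μ _ =>
    Commute.sum_left _ _ _ fun ν _ => ?_)
  split_ifs
  · exact Commute.zero_left _
  · refine Commute.smul_left ?_ _
    rw [conjTranspose_mul]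
    exact ((hT' _).mul_left (hT' _)).mul_left ((hT _).mul_left (hT _))

lemma spinOp_mul_blockS_one (M : Mat 4) :
    spinOp n d M * blockS b 1 = blockS b 1 * spinOp n d M := by
  rw [blockS_eq b (norm_gapB_one_lt b), mul_smul_comm, smul_mul_assoc]
  congr 1
  exact ((spinOp_mul_free b M).cfc_real _).symm

lemma trace_blockG_one : (blockG (n := n) (d := d) b 1).trace = 0 := by
  have key : ∀ (μ : Fin 4) (X : Op n d), (∀ M, spinOp n d M * X = X * spinOp n d M) →
      (gamma5 n d * X).trace = 0 ∧ (gamma5 n d * (spinOp n d (gamma μ) * X)).trace = 0 := by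
    intro μ X hX
    refine ⟨trace_mul_eq_zero_of_anticomm (spinOp_gamma_sq μ) (gamma5_gamma_anticomm μ) (hX _), ?_⟩
    rw [← mul_assoc]
    refine trace_mul_eq_zero_of_anticomm (spinOp_gamma_sq μ) ?_ (hX _)
    rw [gamma5_gamma_anticomm, neg_mul, neg_inj, mul_assoc, gamma5_gamma_anticomm, mul_neg]
  have hS := spinOp_mul_blockS_one (n := n) (d := d) b
  have hTS : ∀ μ M, spinOp n d M * (blockShift b 1 μ * blockS b 1) =
      blockShift b 1 μ * blockS b 1 * spinOp n d M := fun μ M => by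
    rw [← mul_assoc, spinOp_mul_blockShift, mul_assoc, hS, mul_assoc]
  have hTS' : ∀ μ M, spinOp n d M * ((blockShift b 1 μ)ᴴ * blockS b 1) =
      (blockShift b 1 μ)ᴴ * blockS b 1 * spinOp n d M := fun μ M => by
    rw [← mul_assoc, spinOp_mul_blockShift_conjTranspose, mul_assoc, hS, mul_assoc]
  have h3 : (3 : Op n d) = (3 : ℂ) • 1 := by
    rw [← Algebra.algebraMap_eq_smul_one]; exact (map_ofNat (algebraMap ℂ (Op n d)) 3).symm
  rw [blockG, trace_smul, blockA, hopping, mul_sub, sub_mul, trace_sub, h3,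
    mul_smul_comm (3 : ℂ), smul_mul_assoc (3 : ℂ), mul_one, trace_smul (3 : ℂ), (key 0 _ hS).1,
    smul_zero, sub_zero, mul_smul_comm, smul_mul_assoc, trace_smul, mul_sum, sum_mul,
    trace_sum, sum_eq_zero, smul_zero, smul_zero]
  intro μ _
  rw [mul_assoc, add_mul, mul_assoc, mul_assoc, sub_mul, add_mul, one_mul, one_mul, mul_add,
    mul_sub, mul_add, trace_add, trace_sub, trace_add,
    (key μ _ (hTS μ)).1, (key μ _ (hTS μ)).2, (key μ _ (hTS' μ)).1, (key μ _ (hTS' μ)).2]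
  simp

lemma trace_one_op : (1 : Op n d).trace = 2 * ((2 * d * n ^ 4 : ℕ) : ℂ) := by
  rw [trace_one]
  simp only [Fintype.card_prod, Fintype.card_fin, Fintype.card_pi, ZMod.card, prod_const, card_univ]
  push_cast
  ring

lemma trace_blockP_one : (blockP (n := n) (d := d) b 1).trace = ((2 * d * n ^ 4 : ℕ) : ℂ) := by
  rw [blockP, trace_smul, trace_sub, trace_blockG_one, trace_one_op, smul_eq_mul]
  ring

lemma trace_pPlus : (pPlus n d).trace = ((2 * d * n ^ 4 : ℕ) : ℂ) := by
  rw [pPlus, trace_smul, trace_add, trace_gamma5, trace_one_op, smul_eq_mul]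
  ring

lemma half_smul_one_add_idem {A : Type*} [Ring A] [Algebra ℂ A] {g : A} (hg : g * g = 1) :
    ((1 / 2 : ℂ) • (1 + g)) * ((1 / 2 : ℂ) • (1 + g)) = (1 / 2 : ℂ) • (1 + g) := by
  rw [smul_mul_smul_comm, add_mul, mul_add, mul_add, hg, one_mul, one_mul, mul_one]
  module

lemma pPlus_idem : pPlus n d * pPlus n d = pPlus n d := half_smul_one_add_idem gamma5_sq

lemma pPlus_conjTranspose : (pPlus n d)ᴴ = pPlus n d := by
  rw [pPlus, conjTranspose_smul, conjTranspose_add, gamma5_conjTranspose, conjTranspose_one]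
  congr 1
  simp

end Rank

section Isometry

/-- An orthogonal projector of trace `m` has an orthonormal basis of `m` elements; the vectors are
the columns of `V`. -/
lemma exists_isometry_of_projector {ι : Type*} [Fintype ι] [DecidableEq ι] {P : Matrix ι ι ℂ}
    {m : ℕ} (hP : P * P = P) (hPs : Pᴴ = P) (hm : P.trace = m) :
    ∃ V : Matrix ι (Fin m) ℂ, Vᴴ * V = 1 ∧ V * Vᴴ = P := by
  obtain ⟨V, θ, h1, h2, h3, -⟩ := exists_unitary_diagonal_of_skew (K := I • P) (by
    rw [conjTranspose_smul, hPs]; simp)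
  have h4 : P = V * diagonal (fun i => (θ i : ℂ)) * Vᴴ := by
    have e : diagonal (fun i => I * (θ i : ℂ)) = I • diagonal (fun i => (θ i : ℂ)) := by
      rw [← diagonal_smul]; rfl
    rw [e, mul_smul_comm, smul_mul_assoc] at h3
    exact smul_right_injective _ I_ne_zero h3
  have h5 : diagonal (fun i => (θ i : ℂ)) = Vᴴ * P * V := by
    rw [h4]
    calc diagonal (fun i => (θ i : ℂ)) =
        (Vᴴ * V) * diagonal (fun i => (θ i : ℂ)) * (Vᴴ * V) := by rw [h1]; simp
      _ = _ := by simp only [mul_assoc]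
  have h6 : ∀ i, θ i * θ i = θ i := by
    have : diagonal (fun i => (θ i : ℂ)) * diagonal (fun i => (θ i : ℂ)) =
        diagonal (fun i => (θ i : ℂ)) := by
      conv_lhs => rw [h5]
      calc Vᴴ * P * V * (Vᴴ * P * V) = Vᴴ * P * (V * Vᴴ) * P * V := by simp only [mul_assoc]
        _ = Vᴴ * P * V := by rw [h2, mul_one, mul_assoc Vᴴ, hP]
        _ = _ := h5.symm
    rw [diagonal_mul_diagonal] at this
    intro i
    exact_mod_cast congrFun (diagonal_injective this) i
  have h7 : ∀ i, θ i = if θ i = 1 then 1 else 0 := fun i => by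
    split_ifs with h
    · exact h
    · have := h6 i
      rcases mul_eq_zero.1 (show θ i * (θ i - 1) = 0 by linarith) with h' | h'
      · exact h'
      · exact absurd (by linarith) h
  have hcard : Fintype.card {i // θ i = 1} = m := by
    have e : P.trace = ∑ i, (θ i : ℂ) := by
      rw [h4, trace_mul_comm, ← mul_assoc, h1, one_mul, trace_diagonal]
    rw [hm] at e
    have e2 : ((m : ℝ) : ℂ) = ((∑ i, θ i : ℝ) : ℂ) := by push_cast; exact e
    have e3 : (m : ℝ) = ∑ i, θ i := by exact_mod_cast e2
    rw [sum_congr rfl fun i _ => h7 i, sum_ite, sum_const_zero, add_zero,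
      sum_const, nsmul_eq_mul, mul_one] at e3
    rw [Fintype.card_subtype]
    exact_mod_cast e3.symm
  let e : {i // θ i = 1} ≃ Fin m := Fintype.equivFinOfCardEq hcard
  refine ⟨V.submatrix id fun k => (e.symm k).1, ?_, ?_⟩
  · have e1 : (V.submatrix id fun k => (e.symm k).1)ᴴ * (V.submatrix id fun k => (e.symm k).1) =
        (Vᴴ * V).submatrix (fun k => (e.symm k).1) (fun k => (e.symm k).1) := rfl
    rw [e1, h1]
    ext j k
    simp only [submatrix_apply, Matrix.one_apply]
    refine if_congr ?_ rfl rfl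
    rw [Subtype.coe_inj, e.symm.injective.eq_iff]
  · ext s s'
    rw [h4, Matrix.mul_apply, Matrix.mul_apply]
    simp only [mul_diagonal, submatrix_apply, conjTranspose_apply, id]
    rw [e.symm.sum_comp (fun i : {i // θ i = 1} => V s i.1 * star (V s' i.1)),
      ← sum_subtype (Finset.univ.filter fun i => θ i = 1) (by simp)
        (fun i => V s i * star (V s' i)), sum_filter]
    refine sum_congr rfl fun i _ => ?_
    conv_rhs => rw [h7 i]
    split_ifs <;> simp

end Isometry

section Basis

variable {n d m : ℕ} [NeZero n] {a : ℝ}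

/-- The basis of fermion fields made from the columns of an isometry. -/
def columnBasis (a : ℝ) (V : Matrix (Idx n d) (Fin m) ℂ) : Fin m → Idx n d → ℂ :=
  fun j s => ((a : ℂ) ^ 2)⁻¹ * V s j

lemma isWeylBasis_columnBasis (ha : a ≠ 0) {P : Op n d} {V : Matrix (Idx n d) (Fin m) ℂ}
    (h1 : Vᴴ * V = 1) (h2 : V * Vᴴ = P) : IsWeylBasis a P (columnBasis a V) := by
  have ha' : (a : ℂ) ≠ 0 := Complex.ofReal_ne_zero.2 ha
  have hcol : ∀ j, columnBasis a V j = ((a : ℂ) ^ 2)⁻¹ • (V *ᵥ Pi.single j 1) := by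
    intro j; ext s; simp [columnBasis]
  refine ⟨fun j => ?_, fun k j => ?_, fun w hw => ?_⟩
  · rw [hcol, mulVec_smul, mulVec_mulVec, ← h2, Matrix.mul_assoc, h1, Matrix.mul_one]
  · have e := congrFun (congrFun h1 k) j
    rw [Matrix.one_apply, Matrix.mul_apply] at e
    rw [← e, fieldInner, mul_sum]
    refine sum_congr rfl fun s _ => ?_
    simp only [columnBasis, star_mul', star_inv₀, star_pow, star_def, conj_ofReal,
      conjTranspose_apply]
    field_simp
  · rw [← hw, ← h2, ← mulVec_mulVec]
    have : V *ᵥ (Vᴴ *ᵥ w) = ∑ j, ((a : ℂ) ^ 2 * (Vᴴ *ᵥ w) j) • columnBasis a V j := by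
      ext s
      simp only [mulVec, dotProduct, Finset.sum_apply, Pi.smul_apply, columnBasis, smul_eq_mul]
      refine sum_congr rfl fun j _ => ?_
      field_simp
    rw [this]
    exact Submodule.sum_mem _ fun j _ => Submodule.smul_mem _ _ (Submodule.subset_span ⟨j, rfl⟩)

lemma isDualWeylBasis_of_isometry (ha : a ≠ 0) {P : Op n d} {V : Matrix (Idx n d) (Fin m) ℂ}
    (h1 : Vᴴ * V = 1) (h2 : V * Vᴴ = P) :
    IsDualWeylBasis a P (fun k => star (columnBasis a V k)) := by
  have h := isWeylBasis_columnBasis ha h1 h2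
  have hP : Pᴴ = P := by rw [← h2, conjTranspose_mul, conjTranspose_conjTranspose]
  refine ⟨fun k => ?_, fun j k => ?_, fun w hw => ?_⟩
  · rw [← hP, ← star_mulVec, h.proj]
  · rw [star_star, star_star, h.orthonormal]
  · have h3 := h.complete (star w) (by
      rw [← star_star (P *ᵥ star w), star_mulVec, hP, star_star, hw])
    rw [Submodule.mem_span_range_iff_exists_fun] at h3 ⊢
    obtain ⟨c, hc⟩ := h3
    refine ⟨star c, ?_⟩
    rw [← star_star w, ← hc, star_sum]
    exact sum_congr rfl fun i _ => by rw [star_smul]; rfl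

/-- The matrix with orthonormal rows made from a basis of the dual space. -/
def rowMatrix (a : ℝ) (vb : Fin m → Idx n d → ℂ) : Matrix (Fin m) (Idx n d) ℂ :=
  fun k s => (a : ℂ) ^ 2 * vb k s

lemma IsDualWeylBasis.rowMatrix_mul_conjTranspose {P : Op n d}
    {vb : Fin m → Idx n d → ℂ} (h : IsDualWeylBasis a P vb) :
    rowMatrix a vb * (rowMatrix a vb)ᴴ = 1 := by
  ext j k
  have := h.orthonormal j k
  rw [fieldInner, mul_sum] at this
  rw [Matrix.one_apply, ← this, Matrix.mul_apply]
  refine sum_congr rfl fun s _ => ?_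
  simp only [rowMatrix, conjTranspose_apply, star_mul', star_pow, star_def,
    conj_ofReal, Pi.star_apply, conj_conj]
  ring

lemma IsDualWeylBasis.conjTranspose_mul_rowMatrix (ha : a ≠ 0) {P : Op n d} (hP : Pᴴ = P)
    (hPP : P * P = P) {vb : Fin m → Idx n d → ℂ} (h : IsDualWeylBasis a P vb) :
    (rowMatrix a vb)ᴴ * rowMatrix a vb = P := by
  have ha' : (a : ℂ) ≠ 0 := Complex.ofReal_ne_zero.2 ha
  have hQP : rowMatrix a vb * P = rowMatrix a vb := by
    ext k s
    have := congrFun (h.proj k) s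
    simp only [vecMul, dotProduct] at this
    simp only [Matrix.mul_apply, rowMatrix]
    rw [← this, mul_sum]
    exact sum_congr rfl fun i _ => by ring
  have hQQ := h.rowMatrix_mul_conjTranspose
  have key : ∀ w : Idx n d → ℂ, w ᵥ* P = w → w ᵥ* ((rowMatrix a vb)ᴴ * rowMatrix a vb) = w := by
    intro w hw
    obtain ⟨c, hc⟩ := (Submodule.mem_span_range_iff_exists_fun ℂ).1 (h.complete w hw)
    have e : w = (fun k => ((a : ℂ) ^ 2)⁻¹ * c k) ᵥ* rowMatrix a vb := by
      rw [← hc]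
      ext s
      simp only [vecMul, dotProduct, rowMatrix, Finset.sum_apply, Pi.smul_apply, smul_eq_mul]
      exact sum_congr rfl fun i _ => by field_simp
    rw [e, vecMul_vecMul, ← Matrix.mul_assoc, hQQ, Matrix.one_mul]
  have h2 : P * ((rowMatrix a vb)ᴴ * rowMatrix a vb) = P := by
    ext s s'
    have := congrFun (key (P s) (by
      ext s'
      have := congrFun (congrFun hPP s) s'
      rwa [Matrix.mul_apply] at this)) s'
    rwa [Matrix.mul_apply]
  have h3 := congrArg conjTranspose h2
  rw [conjTranspose_mul, conjTranspose_mul, conjTranspose_conjTranspose,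
    hP, Matrix.mul_assoc, hQP] at h3
  exact h3

end Basis

/-! ### Curvature of a family of projectors -/

section Curvature

variable {Z A : Type*} [NormedAddCommGroup Z] [NormedSpace ℝ Z] [NormedRing A] [NormedAlgebra ℝ A]

/-- The curvature two-form `Tr {P [∂_u P, ∂_w P]}` of a family of projectors. -/
def curvature (tr : A →L[ℝ] ℂ) (P : Z → A) (z u w : Z) : ℂ :=
  tr (P z * (𝐝 P z u * 𝐝 P z w - 𝐝 P z w * 𝐝 P z u))

variable {tr : A →L[ℝ] ℂ} {P : Z → A}

lemma hasFDerivAt_fderiv_apply {z : Z} (hP : SmoothAt P z) (u : Z) :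
    HasFDerivAt (fun z => 𝐝 P z u) ((𝐝 (𝐝 P) z).flip u) z := by
  have h := (hP.fderiv_right (m := ∞) (by simp)).hasFD
  have := h.clm_apply (hasFDerivAt_const u z)
  simpa using this

lemma fderiv_curvature {z : Z} (hP : SmoothAt P z) (u w v : Z) :
    𝐝 (fun z => curvature tr P z u w) z v = tr (𝐝 P z v * (𝐝 P z u * 𝐝 P z w - 𝐝 P z w * 𝐝 P z u)) +
      tr (P z * ((𝐝 (𝐝 P) z v u * 𝐝 P z w + 𝐝 P z u * 𝐝 (𝐝 P) z v w) - (𝐝 (𝐝 P) z v w * 𝐝 P z u +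
          𝐝 P z w * 𝐝 (𝐝 P) z v u))) := by
  have h0 := hP.hasFD
  have hu := hasFDerivAt_fderiv_apply hP u
  have hw := hasFDerivAt_fderiv_apply hP w
  have h := (tr.hasFDerivAt.comp z (h0.mul' ((hu.mul' hw).sub (hw.mul' hu)))).fderiv
  have e : (fun z => curvature tr P z u w) = tr ∘ (P * ((fun z => 𝐝 P z u) *
    (fun z => 𝐝 P z w) - (fun z => 𝐝 P z w) * (fun z => 𝐝 P z u))) := rfl
  rw [e, h, ← map_add]
  simp only [ContinuousLinearMap.comp_apply, add_apply, sub_apply, smul_apply, flip_apply,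
    smul_eq_mul, MulOpposite.smul_eq_mul_unop, MulOpposite.unop_op, Pi.mul_apply, Pi.sub_apply]
  congr 1
  abel_nf

/-- The derivative of a projector maps its range to the complement and vice versa. -/
lemma mul_fderiv_add_fderiv_mul {z : Z} (hP : SmoothAt P z)
    (hid : ∀ᶠ y in 𝓝 z, P y * P y = P y) (v : Z) :
    P z * 𝐝 P z v + 𝐝 P z v * P z = 𝐝 P z v := by
  have h0 := hP.hasFD
  have h1 : 𝐝 (P * P) z = 𝐝 P z := Filter.EventuallyEq.fderiv_eq hid
  rw [(h0.mul' h0).fderiv] at h1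
  simpa using congrArg (fun L => L v) h1

lemma trace_three_eq_zero (htr : ∀ x y, tr (x * y) = tr (y * x)) {p x y w : A} (hp : p * p = p)
    (hx : p * x + x * p = x) (hy : p * y + y * p = y) (hw : p * w + w * p = w) :
    tr (x * y * w) = 0 := by
  have hx' : p * x = x - x * p := eq_sub_of_add_eq hx
  have hy' : p * y = y - y * p := eq_sub_of_add_eq hy
  have hw' : p * w = w - w * p := eq_sub_of_add_eq hw
  have h1 : p * (x * y * w) = x * y * w - x * y * w * p := by
    calc p * (x * y * w) = (p * x) * y * w := by noncomm_ring
      _ = x * y * w - x * (p * y) * w := by rw [hx']; noncomm_ring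
      _ = x * y * (p * w) := by rw [hy']; noncomm_ring
      _ = _ := by rw [hw']; noncomm_ring
  have h2 : p * (x * y * w) * p = 0 := by rw [h1, sub_mul, mul_assoc (x * y * w) p p, hp, sub_self]
  have h3 : tr (p * (x * y * w)) = 0 := by rw [← hp, mul_assoc p p, htr, h2, map_zero]
  have h4 := congrArg tr h1
  rw [h3, map_sub, htr _ p, h3, sub_zero] at h4
  exact h4.symm

/-- The curvature is a closed two-form. -/
lemma curvature_closed (htr : ∀ x y, tr (x * y) = tr (y * x)) {z : Z}
    (hP : SmoothAt P z) (hid : ∀ᶠ y in 𝓝 z, P y * P y = P y) (u v w : Z) :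
    𝐝 (fun z => curvature tr P z v w) z u + 𝐝 (fun z => curvature tr P z w u) z v +
      𝐝 (fun z => curvature tr P z u v) z w = 0 := by
  have hsym : IsSymmSndFDerivAt ℝ P z := hP.isSymmSndFDerivAt (by
    simp only [minSmoothness_of_isRCLikeNormedField]
    exact WithTop.coe_le_coe.2 (le_top : (2 : ℕ∞) ≤ ⊤))
  have hX := mul_fderiv_add_fderiv_mul hP hid
  have hpp := hid.self_of_nhds
  have h3 : ∀ a b c, tr (𝐝 P z a * (𝐝 P z b * 𝐝 P z c - 𝐝 P z c * 𝐝 P z b)) = 0 := fun a b c => by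
    rw [mul_sub, map_sub, ← mul_assoc, ← mul_assoc,
      trace_three_eq_zero htr hpp (hX _) (hX _) (hX _),
      trace_three_eq_zero htr hpp (hX _) (hX _) (hX _), sub_zero]
  rw [fderiv_curvature hP, fderiv_curvature hP, fderiv_curvature hP, h3, h3, h3, zero_add, zero_add,
    zero_add, hsym.eq v u, hsym.eq w u, hsym.eq w v, ← map_add, ← map_add]
  rw [← mul_add, ← mul_add]
  have : ∀ a b c x y t : A, (a * t + y * b - (b * y + t * a)) + (c * x + t * a - (a * t + x * c)) +
      (b * y + x * c - (c * x + y * b)) = 0 := fun a b c x y t => by abel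
  rw [this, mul_zero, map_zero]

lemma curvature_swap (z u w : Z) : curvature tr P z w u = -curvature tr P z u w := by
  rw [curvature, curvature, ← map_neg, ← mul_neg, neg_sub]

lemma contDiffAt_curvature {z : Z} (hP : SmoothAt P z) (u w : Z) :
    SmoothAt (fun z => curvature tr P z u w) z := by
  have hu := contDiffAt_fderiv_apply hP u
  have hw := contDiffAt_fderiv_apply hP w
  exact tr.contDiff.contDiffAt.comp z (hP.mul ((hu.mul hw).sub (hw.mul hu)))

end Curvature

section Connection

variable {E A : Type*} [NormedAddCommGroup E] [NormedSpace ℝ E] [NormedRing A] [NormedAlgebra ℝ A]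

/-- The one-form `w ↦ Tr {P [∂_t P, ∂_w P]}` of a family of projectors depending on `t` and on
further parameters. -/
def transportForm (tr : A →L[ℝ] ℂ) (P : ℝ × E → A) (z : ℝ × E) : E →L[ℝ] ℂ :=
  (traceFunctional tr (P z * 𝐝 P z (1, 0) - 𝐝 P z (1, 0) * P z)).comp ((𝐝 P z).comp (inr ℝ ℝ E))

/-- The one-form `w ↦ ∫₀¹ dt Tr {P [∂_t P, ∂_w P]}`. -/
def connection (tr : A →L[ℝ] ℂ) (P : ℝ × E → A) (y : E) : E →L[ℝ] ℂ :=
  ∫ t in (0 : ℝ)..1, transportForm tr P (t, y)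

variable {tr : A →L[ℝ] ℂ} {P : ℝ × E → A} {O : Set (ℝ × E)} {y : E}

lemma transportForm_apply (htr : ∀ x y, tr (x * y) = tr (y * x)) (z : ℝ × E) (w : E) :
    transportForm tr P z w = curvature tr P z (1, 0) (0, w) := by
  rw [transportForm, curvature]
  show tr (𝐝 P z (0, w) * _) = _
  rw [mul_sub, mul_sub, map_sub, map_sub, htr (𝐝 P z (0, w)), ← mul_assoc _ _ (P z),
    htr _ (P z), mul_assoc]

lemma contDiffAt_transportForm {z : ℝ × E} (hP : SmoothAt P z) :
    SmoothAt (transportForm tr P) z := by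
  have h1 := contDiffAt_fderiv_apply hP ((1 : ℝ), (0 : E))
  have h2 := (traceFunctional tr).contDiff.contDiffAt.comp z ((hP.mul h1).sub (h1.mul hP))
  exact h2.clm_comp ((hP.fderiv_right (m := ∞) (by simp)).clm_comp contDiffAt_const)

lemma contDiffAt_connection (hO : IsOpen O) (hP : ∀ p ∈ O, SmoothAt P p)
    (hy : ∀ t ∈ 𝕀, (t, y) ∈ O) : SmoothAt (connection tr P) y :=
  contDiffAt_unitIntegral hO (fun p hp => contDiffAt_transportForm (hP p hp)) hy

lemma connection_apply (htr : ∀ x y, tr (x * y) = tr (y * x))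
    (hP : ∀ p ∈ O, SmoothAt P p) (hy : ∀ t ∈ 𝕀, (t, y) ∈ O) (w : E) :
    connection tr P y w = ∫ t in (0 : ℝ)..1, curvature tr P (t, y) (1, 0) (0, w) := by
  rw [connection, intervalIntegral_apply
    (intervalIntegrable_slice (fun p hp => contDiffAt_transportForm (hP p hp)) hy)]
  simp only [transportForm_apply htr]

/-- The exterior derivative of the connection is the difference of the curvatures at the end
points. -/
lemma fderiv_connection_sub (htr : ∀ x y, tr (x * y) = tr (y * x)) (hO : IsOpen O)
    (hP : ∀ p ∈ O, SmoothAt P p) (hid : ∀ p ∈ O, P p * P p = P p)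
    (hy : ∀ t ∈ 𝕀, (t, y) ∈ O) (v w : E) :
    𝐝 (connection tr P) y v w - 𝐝 (connection tr P) y w v =
      curvature tr P (1, y) (0, v) (0, w) - curvature tr P (0, y) (0, v) (0, w) := by
  have hT : ∀ p ∈ O, SmoothAt (transportForm tr P) p :=
    fun p hp => contDiffAt_transportForm (hP p hp)
  have hD : ∀ p ∈ O, SmoothAt (fun q => (𝐝 (transportForm tr P) q).comp (inr ℝ ℝ E)) p :=
    fun p hp => ((hT p hp).fderiv_right (m := ∞) (by simp)).clm_comp contDiffAt_const
  have hI := intervalIntegrable_slice hD hy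
  have h1 : 𝐝 (connection tr P) y = ∫ t in (0 : ℝ)..1,
      (𝐝 (transportForm tr P) (t, y)).comp (inr ℝ ℝ E) := by
    refine (hasFDerivAt_unitIntegral hO hT hy).fderiv.trans ?_
    refine unitIntegral_congr fun t ht => ?_
    exact fderiv_slice (hT _ (hy t ht))
  have hint : ∀ v : E, IntervalIntegrable (fun t => (𝐝 (transportForm tr P) (t, y)).comp
      (inr ℝ ℝ E) v) MeasureTheory.volume 0 1 := fun v =>
    intervalIntegrable_slice (O := O) (G := fun q => (𝐝 (transportForm tr P) q).comp
      (inr ℝ ℝ E) v) (fun p hp => (hD p hp).clm_apply contDiffAt_const) hy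
  have hint2 : ∀ v w : E, IntervalIntegrable (fun t => (𝐝 (transportForm tr P) (t, y)).comp
      (inr ℝ ℝ E) v w) MeasureTheory.volume 0 1 := fun v w =>
    intervalIntegrable_slice (O := O) (G := fun q => (𝐝 (transportForm tr P) q).comp
      (inr ℝ ℝ E) v w)
      (fun p hp => ((hD p hp).clm_apply contDiffAt_const).clm_apply contDiffAt_const) hy
  have h2 : ∀ v w : E, ∀ p ∈ O, (𝐝 (transportForm tr P) p).comp (inr ℝ ℝ E) v w =
      𝐝 (fun z => curvature tr P z (1, 0) (0, w)) p (0, v) := by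
    intro v w p hp
    have e : (fun z => curvature tr P z (1, 0) (0, w)) = fun z => transportForm tr P z w :=
      funext fun z => (transportForm_apply htr z w).symm
    have := (hT p hp).hasFD.clm_apply (hasFDerivAt_const w p)
    rw [e, this.fderiv]
    simp
  rw [h1, intervalIntegral_apply hI, intervalIntegral_apply hI, intervalIntegral_apply (hint v),
    intervalIntegral_apply (hint w),
    ← integral_sub (hint2 v w) (hint2 w v)]
  have hder : ∀ t ∈ Set.uIcc (0 : ℝ) 1, HasDerivAt (fun t => curvature tr P (t, y) (0, v) (0, w))
      ((𝐝 (transportForm tr P) (t, y)).comp (inr ℝ ℝ E) v w -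
        (𝐝 (transportForm tr P) (t, y)).comp (inr ℝ ℝ E) w v) t := by
    intro t ht
    rw [Set.uIcc_of_le zero_le_one] at ht
    have hp := hy t ht
    have hidp : ∀ᶠ q in 𝓝 (t, y), P q * P q = P q := by
      filter_upwards [hO.mem_nhds hp] with q hq using hid q hq
    have hcl := curvature_closed htr (hP _ hp) hidp (1, 0) (0, v) (0, w)
    have hsw : (fun z => curvature tr P z (0, w) (1, 0)) =
        fun z => -curvature tr P z (1, 0) (0, w) := funext fun z => curvature_swap _ _ _
    rw [hsw, fderiv_fun_neg, neg_apply, ← h2 v w _ hp, ← h2 w v _ hp] at hcl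
    have hc := (contDiffAt_curvature (tr := tr) (hP _ hp) (0, v) (0, w)).hasFD
    have hl : HasDerivAt (fun t : ℝ => (t, y)) ((1 : ℝ), (0 : E)) t :=
      (hasDerivAt_id t).prodMk (hasDerivAt_const t y)
    have := hc.comp_hasDerivAt t hl
    have e : 𝐝 (fun z => curvature tr P z (0, v) (0, w)) (t, y) (1, 0) =
        (𝐝 (transportForm tr P) (t, y)).comp (inr ℝ ℝ E) v w -
        (𝐝 (transportForm tr P) (t, y)).comp (inr ℝ ℝ E) w v := by
      linear_combination hcl
    rw [← e]
    exact this
  rw [integral_eq_sub_of_hasDerivAt hder ((hint2 v w).sub (hint2 w v))]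

end Connection

/-! ### The chiral projectors as smooth functions of the link matrices -/

section BlockSmooth

variable {n d : ℕ} [NeZero n] (b : Fin 4 → Circle)

lemma contDiff_blockA : ContDiff ℝ ∞ (blockA (n := n) (d := d) b) :=
  have h : ContDiff ℝ ∞ (fun φ => hoppingL (n := n) (d := d) b φ) := by fun_prop
  h.sub contDiff_const

lemma contDiff_gapB : ContDiff ℝ ∞ (gapB (n := n) (d := d) b) := by
  have hA := contDiff_blockA (n := n) (d := d) b
  have e : gapB (n := n) (d := d) b = fun φ =>
      1 - (128 : ℝ)⁻¹ • (gamma5 n d * blockA b φ * gamma5 n d * blockA b φ) := by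
    funext φ
    rw [gapB, blockA_conjTranspose]
  rw [e]
  exact contDiff_const.sub ((((contDiff_const.mul hA).mul contDiff_const).mul
    hA).const_smul (128 : ℝ)⁻¹)

lemma contDiffAt_blockS {φ : Blocks n d} (hφ : ‖gapB b φ‖ < 1) :
    SmoothAt (blockS (n := n) (d := d) b) φ :=
  contDiffAt_powerSeries (B := gapB (n := n) (d := d) b) (O := {φ | ‖gapB b φ‖ < 1})
    norm_one_matrix_le abs_invSqrtCoeff_le_one ⟨isOpen_lt (contDiff_gapB b).continuous.norm
      continuous_const, fun _ _ => (contDiff_gapB b).contDiffAt, fun _ h => h⟩ hφ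

lemma contDiffAt_blockG {φ : Blocks n d} (hφ : ‖gapB b φ‖ < 1) :
    SmoothAt (blockG (n := n) (d := d) b) φ :=
  ((contDiffAt_const.mul (contDiff_blockA b).contDiffAt).mul
    (contDiffAt_blockS b hφ)).const_smul (√128)⁻¹

lemma contDiffAt_blockP {φ : Blocks n d} (hφ : ‖gapB b φ‖ < 1) :
    SmoothAt (blockP (n := n) (d := d) b) φ :=
  (contDiffAt_const.sub (contDiffAt_blockG b hφ)).const_smul (1 / 2 : ℂ)

end BlockSmooth

section Ambient

variable {N n d : ℕ} [NeZero N] [NeZero n] (ρ : su N →ₗ[ℝ] Mat d) (b : Fin 4 → Circle)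

/-- The matrix `R([U]^t)`, extended to all matrices `M` in a neighbourhood of the identity. -/
def linkFn (z : ℝ × Mat N) : Mat d := exp (z.1 • ρ (suProj N (logMat z.2)))

lemma contDiffAt_linkFn {z : ℝ × Mat N} (hz : ‖z.2 - 1‖ < 1) : SmoothAt (linkFn ρ) z := by
  have h1 : SmoothAt (fun z : ℝ × Mat N =>
      LinearMap.toContinuousLinearMap (ρ ∘ₗ suProj N) (logMat z.2)) z :=
    (contDiff _).contDiffAt.comp z ((contDiffAt_logMat hz).comp z contDiffAt_snd)
  exact contDiff_exp.contDiffAt.comp z (contDiffAt_fst.smul h1)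

/-- The represented link variables of the family `U_t`. -/
def blockFn (z : ℝ × Blocks n N) : Blocks n d := fun x μ => linkFn ρ (z.1, z.2 x μ)

lemma contDiffAt_blockFn {z : ℝ × Blocks n N} (hz : ∀ x μ, ‖z.2 x μ - 1‖ < 1) :
    SmoothAt (blockFn (n := n) ρ) z :=
  contDiffAt_pi.2 fun x => contDiffAt_pi.2 fun μ =>
    ContDiffAt.comp z (contDiffAt_linkFn ρ (z := (z.1, z.2 x μ)) (hz x μ))
      (contDiffAt_fst.prodMk (by fun_prop))

/-- The projectors `P_t` as functions of `t` and the matrices representing the link variables. -/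
def projFamily (z : ℝ × Blocks n N) : Op n d := blockP b (blockFn ρ z)

/-- A neighbourhood of the relevant link fields on which `projFamily` is smooth. -/
def familyDomain : Set (ℝ × Blocks n N) :=
  {z | (∀ x μ, ‖z.2 x μ - 1‖ < 1) ∧ ‖gapB b (blockFn (n := n) ρ z)‖ < 1}

lemma isOpen_familyDomain : IsOpen (familyDomain (n := n) ρ b) := by
  have h1 : IsOpen {z : ℝ × Blocks n N | ∀ x μ, ‖z.2 x μ - 1‖ < 1} := by
    simp only [Set.ofPred_forall]
    exact isOpen_iInter_of_finite fun x => isOpen_iInter_of_finite fun μ =>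
      isOpen_lt (by fun_prop) continuous_const
  have h2 : ContinuousOn (fun z => ‖gapB b (blockFn (n := n) ρ z)‖)
      {z : ℝ × Blocks n N | ∀ x μ, ‖z.2 x μ - 1‖ < 1} := fun z hz =>
    ((contDiff_gapB b).continuous.continuousAt.comp
      (contDiffAt_blockFn ρ hz).continuousAt).norm.continuousWithinAt
  exact h2.isOpen_inter_preimage h1 (isOpen_Iio (a := (1 : ℝ)))

lemma contDiffAt_projFamily {z : ℝ × Blocks n N} (hz : z ∈ familyDomain (n := n) ρ b) :
    SmoothAt (projFamily (n := n) ρ b) z :=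
  (contDiffAt_blockP b hz.2).comp z (contDiffAt_blockFn ρ hz.1)

lemma projFamily_idem {z : ℝ × Blocks n N} (hz : z ∈ familyDomain (n := n) ρ b) :
    projFamily ρ b z * projFamily ρ b z = projFamily (n := n) ρ b z :=
  blockP_idem b hz.2

lemma blockFn_zero (M : Blocks n N) : blockFn (n := n) ρ (0, M) = 1 := by
  funext x μ
  show exp ((0 : ℝ) • _) = 1
  rw [zero_smul, NormedSpace.exp_zero]

/-- The matrices representing a link field. -/
def coeConfig (U : Config n N) : Blocks n N := fun x μ => (U x μ).1

/-- The tangent vector `δ_η U` in the space of matrix fields. -/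
def tangent (a : ℝ) (η : Pert n N) : Blocks n N →L[ℝ] Blocks n N :=
  LinearMap.toContinuousLinearMap
    { toFun := fun M x μ => a • (η x μ).1 * M x μ
      map_add' := fun M M' => by
        funext x μ
        exact mul_add _ _ _
      map_smul' := fun c M => by
        funext x μ
        exact mul_smul_comm c (a • (η x μ).1) (M x μ) }

lemma tangent_apply (a : ℝ) (η : Pert n N) (M : Blocks n N) (x : Site n) (μ : Fin 4) :
    tangent a η M x μ = a • (η x μ).1 * M x μ := rfl

end Ambient

section Charts

variable {N n d : ℕ} [NeZero n]

lemma contDiff_coeConfig_shift (U : Config n N) :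
    ContDiff ℝ ∞ (fun X : Pert n N => coeConfig (shift X U)) :=
  contDiff_pi.2 fun x => contDiff_pi.2 fun μ => by
    have : ContDiff ℝ ∞ fun X : Pert n N => (su N).subtypeL (X x μ) :=
      (su N).subtypeL.contDiff.comp (by fun_prop)
    exact (contDiff_exp.comp this).mul contDiff_const

lemma shift_zero (U : Config n N) : shift (0 : Pert n N) U = U := by
  funext x μ
  show expSU 0 * U x μ = _
  rw [expSU_zero, one_mul]

lemma hasDerivAt_coeConfig_shift (a : ℝ) (η : Pert n N) (U : Config n N) :
    HasDerivAt (fun s : ℝ => coeConfig (shift ((s * a) • η) U)) (tangent a η (coeConfig U)) 0 := by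
  refine hasDerivAt_pi.2 fun x => hasDerivAt_pi.2 fun μ => ?_
  have h := (hasDerivAt_exp_smul_zero (a • (η x μ).1)).mul_const (U x μ).1
  have e : (fun s : ℝ => coeConfig (shift ((s * a) • η) U) x μ) =
      fun s : ℝ => exp (s • a • (η x μ).1) * (U x μ).1 := by
    funext s
    show exp ((s * a) • (η x μ).1) * _ = _
    rw [mul_smul]
  rw [e]
  exact h

variable {R : Rep N d} {ρ : su N →ₗ[ℝ] Mat d} {δ : ℝ}

lemma SmallRep.eventually_smoothFields (h : SmallRep R ρ δ) {U : Config n N}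
    (hU : U ∈ smoothFields n R δ) : ∀ᶠ X : Pert n N in 𝓝 0, shift X U ∈ smoothFields n R δ := by
  have hρ : Continuous ρ := ρ.continuous_of_finiteDimensional
  have key : ∀ {k : ℕ} (L : su N → Mat k) (w : Mat k)
      (x : Site n) (μ : Fin 4), Continuous L → L 0 = 0 → ‖1 - w‖ < δ →
      ∀ᶠ X : Pert n N in 𝓝 0, ‖1 - exp (L (X x μ)) * w‖ < δ := by
    intro k L w x μ hL hL0 hw
    have hc : Continuous fun X : Pert n N => ‖1 - exp (L (X x μ)) * w‖ := by
      have : Continuous fun X : Pert n N => exp (L (X x μ)) :=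
        (contDiff_exp (n := 0)).continuous.comp (by fun_prop)
      fun_prop
    refine hc.continuousAt.eventually_lt continuousAt_const ?_
    show ‖1 - exp (L 0) * w‖ < δ
    rw [hL0, NormedSpace.exp_zero, one_mul]
    exact hw
  refine Filter.eventually_all.2 fun x => Filter.eventually_all.2 fun μ => ?_
  refine Filter.Eventually.and (key (fun X => X.1) _ x μ continuous_subtype_val rfl (hU x μ).1) ?_
  filter_upwards [key ρ _ x μ hρ (map_zero ρ) (hU x μ).2] with X hX
  show ‖1 - (R (expSU (X x μ) * U x μ)).1‖ < δ
  rw [map_mul]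
  show ‖1 - (R (expSU (X x μ))).1 * (R (U x μ)).1‖ < δ
  rw [h.rep]
  exact hX

variable {V : Type*} [NormedAddCommGroup V] [NormedSpace ℝ V] {F : Config n N → V}
  {f : Blocks n N → V}

lemma SmallRep.eventuallyEq_chart (h : SmallRep R ρ δ)
    (hF : ∀ U ∈ smoothFields n R δ, F U = f (coeConfig U)) {U : Config n N}
    (hU : U ∈ smoothFields n R δ) :
    (fun X : Pert n N => F (shift X U)) =ᶠ[𝓝 0] fun X => f (coeConfig (shift X U)) := by
  filter_upwards [h.eventually_smoothFields hU] with X hX using hF _ hX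

/-- A function of the link field that extends to a smooth function of matrices is smooth. -/
lemma SmallRep.smoothOn_of_eqOn (h : SmallRep R ρ δ)
    (hF : ∀ U ∈ smoothFields n R δ, F U = f (coeConfig U))
    (hf : ∀ U ∈ smoothFields n R δ, SmoothAt f (coeConfig U)) :
    SmoothOn (smoothFields n R δ) F := fun U hU => by
  refine ContDiffAt.congr_of_eventuallyEq ?_ (h.eventuallyEq_chart hF hU)
  refine ContDiffAt.comp 0 ?_ (contDiff_coeConfig_shift U).contDiffAt
  rw [shift_zero]
  exact hf U hU

lemma SmallRep.hasDerivAt_shift (h : SmallRep R ρ δ)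
    (hF : ∀ U ∈ smoothFields n R δ, F U = f (coeConfig U)) {U : Config n N}
    (hU : U ∈ smoothFields n R δ) (hf : DifferentiableAt ℝ f (coeConfig U)) (a : ℝ)
    (η : Pert n N) : HasDerivAt (fun s : ℝ => F (shift ((s * a) • η) U))
      (𝐝 f (coeConfig U) (tangent a η (coeConfig U))) 0 := by
  have h1 := hasDerivAt_coeConfig_shift a η U
  have e0 : coeConfig (shift (((0 : ℝ) * a) • η) U) = coeConfig U := by
    rw [zero_mul, zero_smul, shift_zero]
  have h2 := HasFDerivAt.comp_hasDerivAt (0 : ℝ) (by rw [e0]; exact hf.hasFDerivAt) h1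
  refine h2.congr_of_eventuallyEq ?_
  have hc : Filter.Tendsto (fun s : ℝ => (s * a) • η) (𝓝 0) (𝓝 0) := by
    have : Continuous fun s : ℝ => (s * a) • η := by fun_prop
    simpa using this.tendsto 0
  exact hc.eventually (h.eventuallyEq_chart hF hU)

/-- The variation of a function of the link field in terms of an extension to matrices. -/
lemma SmallRep.variation_eq (h : SmallRep R ρ δ)
    (hF : ∀ U ∈ smoothFields n R δ, F U = f (coeConfig U)) {U : Config n N}
    (hU : U ∈ smoothFields n R δ) (hf : DifferentiableAt ℝ f (coeConfig U)) (a : ℝ)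
    (η : Pert n N) :
    variation a η F U = 𝐝 f (coeConfig U) (tangent a η (coeConfig U)) :=
  (h.hasDerivAt_shift hF hU hf a η).deriv

end Charts

/-! ### The measure term -/

/-- The trace as a continuous real linear functional. -/
def traceL (ι : Type*) [Fintype ι] [DecidableEq ι] : Matrix ι ι ℂ →L[ℝ] ℂ :=
  LinearMap.toContinuousLinearMap (traceLinearMap ι ℝ ℂ)

lemma traceL_apply {ι : Type*} [Fintype ι] [DecidableEq ι] (M : Matrix ι ι ℂ) :
    traceL ι M = M.trace := rfl

lemma traceL_mul_comm {ι : Type*} [Fintype ι] [DecidableEq ι] (x y : Matrix ι ι ℂ) :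
    traceL ι (x * y) = traceL ι (y * x) := trace_mul_comm x y

local notation "𝐓" => traceL (Idx _ _)

/-- The logarithm of a link field. -/
def flowPert {n N : ℕ} [NeZero N] (U : Config n N) : Pert n N := fun x μ => suLog (U x μ)

lemma tangent_comm {N n : ℕ} [NeZero N] [NeZero n] {a : ℝ} (η ζ : Pert n N) (M : Blocks n N) :
    tangent a ζ (tangent a η M) - tangent a η (tangent a ζ M) =
      -(a • tangent a (fun x μ => suBracket (η x μ) (ζ x μ)) M) := by
  funext x μ
  show a • (ζ x μ).1 * (a • (η x μ).1 * M x μ) - a • (η x μ).1 * (a • (ζ x μ).1 * M x μ) =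
    -(a • (a • ((η x μ).1 * (ζ x μ).1 - (ζ x μ).1 * (η x μ).1) * M x μ))
  simp only [smul_mul_assoc, mul_smul_comm, sub_mul, smul_sub, mul_assoc]
  abel

lemma norm_one_sub_mul_le {k : ℕ} {A B : Mat k} (hA : ‖A‖ ≤ 1) :
    ‖1 - A * B‖ ≤ ‖1 - A‖ + ‖1 - B‖ := by
  have e : 1 - A * B = (1 - A) + A * (1 - B) := by noncomm_ring
  rw [e]
  refine (norm_add_le _ _).trans (add_le_add le_rfl ((norm_mul_le _ _).trans ?_))
  exact mul_le_of_le_one_left (norm_nonneg _) hA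

lemma norm_one_sub_inv {k : ℕ} (w : unitaryGroup (Fin k) ℂ) : ‖1 - (w⁻¹).1‖ = ‖1 - w.1‖ := by
  have : 1 - (w⁻¹).1 = (1 - w.1)ᴴ := by rw [conjTranspose_sub, conjTranspose_one]; rfl
  rw [this, l2_opNorm_conjTranspose]

lemma smoothFields_subset_admissible {N n d : ℕ} [NeZero N] [NeZero n] {R : Rep N d} {δ : ℝ} {ε : ℝ}
    (hε : 4 * δ ≤ ε) :
    smoothFields n R δ ⊆ admissible n R ε := by
  intro U hU x μ ν
  have hn : ∀ w : unitaryGroup (Fin d) ℂ, ‖w.1‖ ≤ 1 := fun w => norm_unitary_le w.2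
  rw [plaquette, map_mul, map_mul, map_mul, map_inv, map_inv]
  have h1 := norm_one_sub_mul_le (B := ((R (U x ν))⁻¹).1)
    (hn (R (U x μ) * R (U (step x μ) ν) * (R (U (step x ν) μ))⁻¹))
  have h2 := norm_one_sub_mul_le (B := ((R (U (step x ν) μ))⁻¹).1)
    (hn (R (U x μ) * R (U (step x μ) ν)))
  have h3 := norm_one_sub_mul_le (B := (R (U (step x μ) ν)).1) (hn (R (U x μ)))
  rw [norm_one_sub_inv] at h1 h2
  have k1 := (hU x μ).2
  have k2 := (hU (step x μ) ν).2
  have k3 := (hU (step x ν) μ).2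
  have k4 := (hU x ν).2
  refine h1.trans_lt ?_
  have h2' : ‖1 - (R (U x μ) * R (U (step x μ) ν) * (R (U (step x ν) μ))⁻¹).1‖ ≤ _ := h2
  have h3' : ‖1 - (R (U x μ) * R (U (step x μ) ν)).1‖ ≤ _ := h3
  linarith

namespace SmallRep

variable {N n d : ℕ} [NeZero N] [NeZero n] {R : Rep N d}
  {ρ : su N →ₗ[ℝ] Mat d} {δ : ℝ} {U : Config n N} (b : Fin 4 → Circle) {a : ℝ}
  (h : SmallRep R ρ δ) (hU : U ∈ smoothFields n R δ)

include h hU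

lemma powConfig_eq (t : ℝ) : powConfig t U = fun x μ => expSU (t • flowPert U x μ) :=
  funext fun x => funext fun μ => h.powSU_eq (hU x μ) t

lemma powConfig_zero : powConfig 0 U = 1 := by
  rw [h.powConfig_eq hU]
  funext x μ
  rw [zero_smul, expSU_zero]
  rfl

lemma powConfig_one : powConfig 1 U = U := by
  rw [h.powConfig_eq hU]
  funext x μ
  rw [one_smul]
  exact h.expSU_suLog (hU x μ)

lemma powConfig_mem {t : ℝ} (ht : t ∈ 𝕀) : powConfig t U ∈ smoothFields n R δ := fun x μ => by
  rw [h.powConfig_eq hU]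
  exact h.isSmallLink_expSU (hU x μ) ht

lemma coe_powConfig (t : ℝ) (x : Site n) (μ : Fin 4) :
    (powConfig t U x μ : Mat N) = powMatrix t (U x μ) := by
  rw [h.powConfig_eq hU]
  exact (h.powMatrix_eq (hU x μ) t).symm

lemma powConfig_add (t s : ℝ) : powConfig (t + s) U = shift (s • flowPert U) (powConfig t U) := by
  rw [h.powConfig_eq hU, h.powConfig_eq hU]
  funext x μ
  rw [add_comm, expSU_add_smul]
  rfl

lemma powConfig_powConfig {t : ℝ} (ht : t ∈ 𝕀) (s : ℝ) :
    powConfig s (powConfig t U) = powConfig (s * t) U := by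
  rw [h.powConfig_eq (h.powConfig_mem hU ht), h.powConfig_eq hU, h.powConfig_eq hU (s * t)]
  funext x μ
  show expSU (s • suLog (expSU (t • suLog (U x μ)))) = expSU ((s * t) • suLog (U x μ))
  rw [h.suLog_expSU_smul (hU x μ) ht, smul_smul]

lemma repBlocks_powConfig (t : ℝ) : repBlocks R (powConfig t U) = blockFn ρ (t, coeConfig U) := by
  rw [h.powConfig_eq hU]
  funext x μ
  show (R (expSU _)).1 = exp _
  rw [h.rep, map_smul]
  rfl

lemma norm_repBlocks_sub_one_le : ‖repBlocks R U - 1‖ ≤ 1 / 80 :=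
  (pi_norm_le_iff_of_nonneg (by norm_num)).2 fun x =>
    (pi_norm_le_iff_of_nonneg (by norm_num)).2 fun μ => (h.norm_rep_sub_one_lt (hU x μ)).le

lemma norm_gapB_repBlocks : ‖gapB b (repBlocks R U)‖ < 1 :=
  (norm_gapB_le b (h.norm_repBlocks_sub_one_le hU)).trans_lt (by norm_num)

lemma mem_familyDomain {t : ℝ} (ht : t ∈ 𝕀) : (t, coeConfig U) ∈ familyDomain (n := n) ρ b := by
  refine ⟨fun x μ => (h.norm_sub_one_lt (hU x μ)).trans (by norm_num), ?_⟩
  rw [← h.repBlocks_powConfig hU]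
  exact h.norm_gapB_repBlocks b (h.powConfig_mem hU ht)

lemma projT_eq (ha : a ≠ 0) {t : ℝ} (ht : (t, coeConfig U) ∈ familyDomain (n := n) ρ b) :
    projT R a b t U = projFamily ρ b (t, coeConfig U) := by
  have e := h.repBlocks_powConfig hU t
  rw [projT, hatPMinus_eq b R ha (by rw [e]; exact ht.2), e, projFamily]

omit hU in
lemma hatPMinus_eq_projFamily (ha : a ≠ 0) :
    ∀ U ∈ smoothFields n R δ, hatPMinus R a b U = projFamily ρ b (1, coeConfig U) := by
  intro U hU
  rw [← h.projT_eq b hU ha (h.mem_familyDomain b hU (by simp)), projT, h.powConfig_one hU]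

lemma contDiffAt_projFamily_slice {t : ℝ} (ht : t ∈ 𝕀) :
    SmoothAt (fun M : Blocks n N => projFamily ρ b (t, M)) (coeConfig U) :=
  contDiffAt_slice (contDiffAt_projFamily ρ b (h.mem_familyDomain b hU ht))

lemma contDiffAt_projT (ha : a ≠ 0) {t : ℝ} (ht : t ∈ 𝕀) :
    SmoothAt (fun p : ℝ × Pert n N => projT R a b p.1 (shift p.2 U)) (t, 0) := by
  have hg : ContDiff ℝ ∞ fun p : ℝ × Pert n N => (p.1, coeConfig (shift p.2 U)) :=
    contDiff_fst.prodMk ((contDiff_coeConfig_shift U).comp contDiff_snd)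
  have hm : (t, coeConfig (shift (0 : Pert n N) U)) ∈ familyDomain (n := n) ρ b := by
    rw [shift_zero]; exact h.mem_familyDomain b hU ht
  have hev : (fun p : ℝ × Pert n N => projT R a b p.1 (shift p.2 U)) =ᶠ[𝓝 (t, 0)]
      fun p => projFamily ρ b (p.1, coeConfig (shift p.2 U)) := by
    have h1 : ∀ᶠ p : ℝ × Pert n N in 𝓝 (t, 0),
        (p.1, coeConfig (shift p.2 U)) ∈ familyDomain (n := n) ρ b :=
      (hg.continuous.tendsto (t, 0)).eventually_mem ((isOpen_familyDomain ρ b).mem_nhds hm)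
    have h2 : ∀ᶠ p : ℝ × Pert n N in 𝓝 (t, 0), shift p.2 U ∈ smoothFields n R δ := by
      rw [nhds_prod_eq]
      exact Filter.tendsto_snd.eventually (h.eventually_smoothFields hU)
    filter_upwards [h1, h2] with p hp hp2 using h.projT_eq b hp2 ha hp
  have hcomp : SmoothAt
      (projFamily ρ b ∘ fun p : ℝ × Pert n N => (p.1, coeConfig (shift p.2 U))) (t, 0) :=
    ContDiffAt.comp (t, (0 : Pert n N)) (contDiffAt_projFamily ρ b hm)
      (hg.contDiffAt (x := (t, (0 : Pert n N))))
  exact hcomp.congr_of_eventuallyEq hev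

lemma deriv_projT (ha : a ≠ 0) {t : ℝ} (ht : t ∈ 𝕀) : deriv (fun s => projT R a b s U) t =
      𝐝 (projFamily ρ b) (t, coeConfig U) (1, 0) := by
  have hm := h.mem_familyDomain b hU ht
  have hl : HasDerivAt (fun s : ℝ => (s, coeConfig U)) ((1 : ℝ), (0 : Blocks n N)) t :=
    (hasDerivAt_id t).prodMk (hasDerivAt_const t _)
  have h1 := (contDiffAt_projFamily ρ b hm).hasFD.comp_hasDerivAt t hl
  have hev : (fun s => projT R a b s U) =ᶠ[𝓝 t] fun s => projFamily ρ b (s, coeConfig U) := by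
    filter_upwards [hl.continuousAt.eventually_mem ((isOpen_familyDomain ρ b).mem_nhds hm)]
      with s hs using h.projT_eq b hU ha hs
  exact (h1.congr_of_eventuallyEq hev).deriv

lemma variation_projT (ha : a ≠ 0) {t : ℝ} (ht : t ∈ 𝕀) (η : Pert n N) :
    variation a η (projT R a b t) U =
      𝐝 (projFamily ρ b) (t, coeConfig U) (0, tangent a η (coeConfig U)) := by
  rw [h.variation_eq (f := fun M => projFamily ρ b (t, M))
    (fun V hV => h.projT_eq b hV ha (h.mem_familyDomain b hV ht)) hU
    ((h.contDiffAt_projFamily_slice b hU ht).differentiableAt (by simp)),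
    fderiv_slice (contDiffAt_projFamily ρ b (h.mem_familyDomain b hU ht))]
  rfl

omit hU in
/-- The measure term in terms of the connection of the family of projectors. -/
lemma measureTerm_eq (ha : a ≠ 0) (η : Pert n N) :
    ∀ U ∈ smoothFields n R δ, measureTerm R a b η U = I *
      connection 𝐓 (projFamily ρ b) (coeConfig U) (tangent a η (coeConfig U)) := by
  intro U hU
  rw [connection_apply (O := familyDomain ρ b) traceL_mul_comm
    (fun p hp => contDiffAt_projFamily ρ b hp)
    (fun t ht => h.mem_familyDomain b hU ht), measureTerm]
  congr 1
  refine unitIntegral_congr fun t ht => ?_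
  show (projT R a b t U * _).trace = _
  rw [h.projT_eq b hU ha (h.mem_familyDomain b hU ht), h.deriv_projT b hU ha ht,
    h.variation_projT b hU ha ht, Ring.lie_def]
  rfl

lemma contDiffAt_connection : SmoothAt (connection 𝐓 (projFamily (n := n) ρ b)) (coeConfig U) :=
  LatticeWeyl.contDiffAt_connection (isOpen_familyDomain ρ b)
    (fun _ hp => contDiffAt_projFamily ρ b hp) fun _ ht => h.mem_familyDomain b hU ht

omit hU in
lemma smoothOn_measureTerm (ha : a ≠ 0) (η : Pert n N) :
    SmoothOn (smoothFields n R δ) (measureTerm R a b η) :=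
  h.smoothOn_of_eqOn (f := fun M => I *
      connection 𝐓 (projFamily ρ b) M (tangent a η M)) (h.measureTerm_eq b ha η)
    fun _ hU => contDiffAt_const.mul ((h.contDiffAt_connection b hU).clm_apply
      (tangent a η).contDiff.contDiffAt)

lemma measureTerm_eq_sum_current (ha : a ≠ 0) (η : Pert n N) :
    measureTerm R a b η U = (a : ℂ) ^ 4 * ∑ x, ∑ μ, measureCurrent R a b x μ (η x μ) U := by
  have ha' : (a : ℂ) ≠ 0 := Complex.ofReal_ne_zero.2 ha
  let L : Pert n N →ₗ[ℝ] Blocks n N :=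
    { toFun := fun η => tangent a η (coeConfig U)
      map_add' := fun η ζ => by
        funext x μ
        show a • (η x μ + ζ x μ).1 * _ = a • (η x μ).1 * _ + a • (ζ x μ).1 * _
        rw [Submodule.coe_add, smul_add, add_mul]
      map_smul' := fun c η => by
        funext x μ
        show a • (c • η x μ).1 * (U x μ).1 = c • (a • (η x μ).1 * (U x μ).1)
        rw [Submodule.coe_smul, smul_comm, smul_mul_assoc] }
  have e : η = ∑ x, ∑ μ, Pi.single x (Pi.single μ (η x μ)) := by
    conv_lhs => rw [← univ_sum_single η]
    refine sum_congr rfl fun x _ => ?_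
    conv_lhs => rw [← univ_sum_single (η x)]
    exact map_sum (AddMonoidHom.single (fun _ => Fin 4 → su N) x) _ _
  have e2 : tangent a η (coeConfig U) =
      ∑ x, ∑ μ, tangent a (Pi.single x (Pi.single μ (η x μ))) (coeConfig U) := by
    have := congrArg L e
    simp only [map_sum] at this
    exact this
  rw [h.measureTerm_eq b ha η U hU, e2, map_sum, mul_sum, mul_sum]
  refine sum_congr rfl fun x _ => ?_
  rw [map_sum, mul_sum, mul_sum]
  refine sum_congr rfl fun μ _ => ?_
  rw [measureCurrent, h.measureTerm_eq b ha _ U hU, mul_inv_cancel_left₀ (pow_ne_zero _ ha')]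

lemma fderiv_projFamily_zero (w : Blocks n N) : 𝐝 (projFamily ρ b) (0, coeConfig U) (0, w) = 0 := by
  have h1 := fderiv_slice (contDiffAt_projFamily ρ b (h.mem_familyDomain b hU (t := 0) (by simp)))
  have h2 : (fun M : Blocks n N => projFamily ρ b (0, M)) = fun _ => blockP b 1 := by
    funext M; rw [projFamily, blockFn_zero]
  rw [h2, fderiv_const_apply] at h1
  exact (congrArg (fun L => L w) h1).symm

lemma local_integrability (ha : a ≠ 0) (η ζ : Pert n N) :
    variation a η (measureTerm R a b ζ) U - variation a ζ (measureTerm R a b η) U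
        + (a : ℂ) * measureTerm R a b (fun x μ => suBracket (η x μ) (ζ x μ)) U
      = I * (hatPMinus R a b U *
          ⁅variation a η (hatPMinus R a b) U, variation a ζ (hatPMinus R a b) U⁆).trace := by
  set A := connection 𝐓 (projFamily (n := n) ρ b)
  set M := coeConfig U
  have hA := (h.contDiffAt_connection b hU).hasFD
  have hmt : ∀ η ζ : Pert n N, variation a η (measureTerm R a b ζ) U = I *
      (𝐝 A M (tangent a η M) (tangent a ζ M) + A M (tangent a ζ (tangent a η M))) := by
    intro η ζ
    have h1 := (hA.clm_apply (tangent a ζ).hasFDerivAt).const_mul I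
    rw [h.variation_eq (h.measureTerm_eq b ha ζ) hU h1.differentiableAt, h1.fderiv]
    show I * (A M (tangent a ζ (tangent a η M)) + _) = _
    rw [add_comm]
    rfl
  have hP : ∀ η : Pert n N, variation a η (hatPMinus R a b) U =
      𝐝 (projFamily ρ b) (1, M) (0, tangent a η M) := by
    intro η
    rw [h.variation_eq (h.hatPMinus_eq_projFamily b ha) hU
      ((h.contDiffAt_projFamily_slice b hU (by simp)).differentiableAt (by simp)),
      fderiv_slice (contDiffAt_projFamily ρ b (h.mem_familyDomain b hU (by simp)))]
    rfl
  have hd := fderiv_connection_sub traceL_mul_comm (isOpen_familyDomain (n := n) ρ b)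
    (fun p hp => contDiffAt_projFamily ρ b hp) (fun p hp => projFamily_idem ρ b hp)
    (fun t ht => h.mem_familyDomain b hU ht) (tangent a η M) (tangent a ζ M)
  have h0 : curvature 𝐓 (projFamily ρ b) (0, M) (0, tangent a η M) (0, tangent a ζ M) = 0 := by
    rw [curvature, h.fderiv_projFamily_zero b hU, zero_mul, mul_zero, sub_zero, mul_zero, map_zero]
  have h1 : curvature 𝐓 (projFamily ρ b) (1, M) (0, tangent a η M)
      (0, tangent a ζ M) = (hatPMinus R a b U *
          ⁅variation a η (hatPMinus R a b) U, variation a ζ (hatPMinus R a b) U⁆).trace := by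
    rw [hP, hP, h.hatPMinus_eq_projFamily b ha U hU, Ring.lie_def]
    rfl
  rw [h0, h1, sub_zero] at hd
  have ht : A M (tangent a ζ (tangent a η M)) - A M (tangent a η (tangent a ζ M)) =
      -((a : ℂ) * A M (tangent a (fun x μ => suBracket (η x μ) (ζ x μ)) M)) := by
    rw [← map_sub, tangent_comm, map_neg, map_smul, real_smul]
  rw [hmt, hmt, h.measureTerm_eq b ha _ U hU]
  linear_combination I * hd + I * ht

lemma smul_eq_flowPert {t : ℝ} {η : Pert n N} (hη : ∀ x μ,
    HasDerivAt (fun s : ℝ => (powConfig s U x μ : Mat N))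
          (a • ((η x μ : Mat N) * powConfig t U x μ)) t) :
    a • η = flowPert U := by
  funext x μ
  have h1 := hη x μ
  simp only [h.powConfig_eq hU] at h1
  have h2 := h1.unique (hasDerivAt_exp_smul_const' (𝕂 := ℝ) (flowPert U x μ).1 t)
  have h3 := congrArg (· * (expSU (t • flowPert U x μ)).1ᴴ) h2
  have h4 := su_mul_star (expSU (t • flowPert U x μ))
  have e : exp (t • (flowPert U x μ).1) = (expSU (t • flowPert U x μ)).1 := rfl
  simp only [e, smul_mul_assoc, mul_assoc, h4, mul_one] at h3
  exact Subtype.ext h3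

/-- Along the family `U_t` the projectors depend on a single parameter. -/
lemma measureTerm_powConfig (ha : a ≠ 0) {t : ℝ} (ht : t ∈ 𝕀) {η : Pert n N}
    (hη : a • η = flowPert U) : measureTerm R a b η (powConfig t U) = 0 := by
  have hUt := h.powConfig_mem hU ht
  let Q : ℝ → Op n d := fun τ => blockP b (blockFn ρ (τ, coeConfig U))
  have hQ : ∀ s ∈ 𝕀, HasDerivAt Q (deriv Q (s * t)) (s * t) := by
    intro s hs
    have hm := h.mem_familyDomain b hU (t := s * t)
      ⟨mul_nonneg hs.1 ht.1, mul_le_one₀ hs.2 ht.1 ht.2⟩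
    have h1 : DifferentiableAt ℝ Q (s * t) :=
      DifferentiableAt.comp (s * t) (f := fun τ : ℝ => (τ, coeConfig U))
        ((contDiffAt_projFamily ρ b hm).differentiableAt (by simp))
        (differentiableAt_id.prodMk (differentiableAt_const _))
    exact h1.hasDerivAt
  have hpow : ∀ τ ∈ 𝕀, ∀ r, blockFn (n := n) (d := d) ρ (r, coeConfig (powConfig τ U)) =
      blockFn ρ (r * τ, coeConfig U) := fun τ hτ r => by
    rw [← h.repBlocks_powConfig (h.powConfig_mem hU hτ), h.powConfig_powConfig hU hτ,
      h.repBlocks_powConfig hU]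
  have hfam : ∀ s ∈ 𝕀, curvature 𝐓 (projFamily ρ b)
      (s, coeConfig (powConfig t U)) (1, 0) (0, tangent a η (coeConfig (powConfig t U))) = 0 := by
    intro s hs
    have hm := h.mem_familyDomain b hUt hs
    have hP := (contDiffAt_projFamily ρ b hm).hasFD
    have d1 : 𝐝 (projFamily ρ b) (s, coeConfig (powConfig t U)) (1, 0) = t • deriv Q (s * t) := by
      have hl : HasDerivAt (fun r : ℝ => (r, coeConfig (powConfig t U)))
          ((1 : ℝ), (0 : Blocks n N)) s := (hasDerivAt_id s).prodMk (hasDerivAt_const s _)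
      have h1 := hP.comp_hasDerivAt s hl
      have h2 := (hQ s hs).scomp s ((hasDerivAt_id s).mul_const t)
      rw [one_mul] at h2
      refine h1.unique ?_
      have e : projFamily ρ b ∘ (fun r : ℝ => (r, coeConfig (powConfig t U))) =
          Q ∘ (fun r => id r * t) := by
        funext r
        simp only [Function.comp_apply, projFamily, hpow t ht]
        rfl
      rw [e]
      exact h2
    have d2 : 𝐝 (projFamily ρ b) (s, coeConfig (powConfig t U))
        (0, tangent a η (coeConfig (powConfig t U))) = s • deriv Q (s * t) := by
      have hc := hasDerivAt_coeConfig_shift a η (powConfig t U)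
      have hl : HasDerivAt (fun r : ℝ => (s, coeConfig (shift ((r * a) • η) (powConfig t U))))
          ((0 : ℝ), tangent a η (coeConfig (powConfig t U))) 0 :=
        (hasDerivAt_const 0 s).prodMk hc
      have h1 := HasFDerivAt.comp_hasDerivAt (0 : ℝ)
        (by rw [zero_mul, zero_smul, shift_zero]; exact hP) hl
      have h2 : HasDerivAt (fun r : ℝ => s * (t + r)) s 0 := by
        simpa using ((hasDerivAt_id (0 : ℝ)).const_add t).const_mul s
      have h3 := HasDerivAt.scomp (0 : ℝ) (by rw [add_zero]; exact hQ s hs) h2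
      have e : ∀ r ∈ Set.Icc (-t) (1 - t), (projFamily ρ b ∘ fun r : ℝ =>
          (s, coeConfig (shift ((r * a) • η) (powConfig t U)))) r =
            (Q ∘ fun r => s * (t + r)) r := by
        intro r hr
        simp only [Function.comp_apply, projFamily, Q]
        rw [mul_smul, hη, ← h.powConfig_add hU,
          hpow _ ⟨by linarith [hr.1], by linarith [hr.2]⟩]
      have h0 : (0 : ℝ) ∈ Set.Icc (-t) (1 - t) := ⟨by linarith [ht.1], by linarith [ht.2]⟩
      exact (uniqueDiffOn_Icc (by linarith) 0 h0).eq_deriv _ h1.hasDerivWithinAt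
        (h3.hasDerivWithinAt.congr e (e 0 h0))
    rw [curvature, d1, d2, smul_mul_smul_comm, smul_mul_smul_comm, mul_comm s t, sub_self,
      mul_zero, map_zero]
  rw [h.measureTerm_eq b ha η _ hUt, connection_apply (O := familyDomain ρ b) traceL_mul_comm
    (fun p hp => contDiffAt_projFamily ρ b hp) (fun t ht => h.mem_familyDomain b hUt ht),
    unitIntegral_congr hfam, integral_zero, mul_zero]

/-! ### Smooth fields and the vacuum sector -/

omit hU in
lemma smoothFields_subset_vacuumSector {ε : ℝ} (hε : 4 * δ ≤ ε) :
    smoothFields n R δ ⊆ vacuumSector n R ε := by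
  intro U hU
  have hc : Continuous fun t : ℝ => powConfig t U := by
    have e : (fun t : ℝ => powConfig t U) = fun t x μ => expSU (t • flowPert U x μ) :=
      funext fun t => h.powConfig_eq hU t
    rw [e]
    exact continuous_pi fun x => continuous_pi fun μ => continuous_expSU.comp (by fun_prop)
  have hpre : IsPreconnected ((fun t : ℝ => powConfig t U) '' Set.Icc 0 1) :=
    isPreconnected_Icc.image _ hc.continuousOn
  have h0 : (1 : Config n N) ∈ (fun t : ℝ => powConfig t U) '' Set.Icc 0 1 :=
    ⟨0, by simp, h.powConfig_zero hU⟩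
  refine hpre.subset_connectedComponentIn h0 ?_ ⟨1, by simp, h.powConfig_one hU⟩
  rintro _ ⟨t, ht, rfl⟩
  exact smoothFields_subset_admissible hε (h.powConfig_mem hU ht)

end SmallRep

/-! ### Truncation of the projectors -/

section CurvatureJets

variable {E A : Type*} [NormedAddCommGroup E] [NormedSpace ℝ E] [NormedRing A] [NormedAlgebra ℝ A]
  {tr : A →L[ℝ] ℂ}

lemma curvature_eq_traceFunctional (htr : ∀ x y, tr (x * y) = tr (y * x)) (P : E → A) (z u w : E) :
    curvature tr P z u w = traceFunctional tr (𝐝 P z w) (P z * 𝐝 P z u - 𝐝 P z u * P z) := by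
  rw [traceFunctional_apply, curvature, mul_sub, sub_mul, map_sub, map_sub, ← mul_assoc,
    ← mul_assoc, htr (P z * 𝐝 P z w), mul_assoc (𝐝 P z u) (P z)]

lemma curvature_comp {Z : Type*} [NormedAddCommGroup Z] [NormedSpace ℝ Z] {P : Z → A} {c : E → Z}
    {z : E} (hP : DifferentiableAt ℝ P (c z)) (hc : DifferentiableAt ℝ c z) (u w : E) :
    curvature tr (fun y => P (c y)) z u w = curvature tr P (c z) (𝐝 c z u) (𝐝 c z w) := by
  have h : 𝐝 (fun y => P (c y)) z = (𝐝 P (c z)).comp (𝐝 c z) := fderiv_comp z hP hc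
  rw [curvature, curvature, h]
  rfl

lemma contDiffAt_traceFunctional_fderiv {f : E → A} {z : E} (hf : SmoothAt f z) (v : E) :
    SmoothAt Θ[tr, f, v] z :=
  (traceFunctional tr).contDiff.contDiffAt.comp z (contDiffAt_fderiv_apply hf v)

lemma jetNorm_traceFunctional_fderiv_const_mul_le (htr : ∀ x y, tr (x * y) = tr (y * x))
    {f : E → A} {O : Set E} (hO : IsOpen O) (hf : ∀ z ∈ O, SmoothAt f z) {z : E} (hz : z ∈ O)
    (v : E) {k : ℕ} {σ : ℝ} (hσ : 0 ≤ σ) {c : A} (hc : ‖c‖ ≤ 1) :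
    jetNorm k σ Θ[tr, fun y => c * f y, v] z ≤ jetNorm k σ Θ[tr, f, v] z := by
  refine (jetNorm_traceFunctional_fderiv_mul_le htr hO (fun _ _ => contDiffAt_const) hf hz v
    hσ).trans ?_
  have h0 : Θ[tr, fun _ : E => c, v] = fun _ => 0 := by funext y; simp
  have h1 := jetNorm_const (k := k) (σ := σ) (0 : A →L[ℝ] ℂ) z
  rw [norm_zero] at h1
  rw [h0, jetNorm_const, h1, zero_mul, add_zero]
  exact mul_le_of_le_one_left (jetNorm_nonneg hσ) hc

lemma jetNorm_traceFunctional_fderiv_const_smul_le {f : E → A} {O : Set E} (hO : IsOpen O)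
    (hf : ∀ z ∈ O, SmoothAt f z) {z : E} (hz : z ∈ O)
    (v : E) {k : ℕ} {σ : ℝ} (hσ : 0 ≤ σ) {r : ℝ} (hr : |r| ≤ 1) :
    jetNorm k σ Θ[tr, fun y => r • f y, v] z ≤ jetNorm k σ Θ[tr, f, v] z := by
  have e : Θ[tr, fun y => r • f y, v] =ᶠ[𝓝 z] fun y => r • traceFunctional tr (𝐝 f y v) := by
    filter_upwards [hO.mem_nhds hz] with y hy
    rw [fderiv_fun_const_smul ((hf y hy).differentiableAt (by simp)), smul_apply, map_smul]
  rw [jetNorm_congr e]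
  exact (jetNorm_smul_le (𝕜 := ℝ) hσ _ (contDiffAt_traceFunctional_fderiv (hf z hz) v)).trans
    (mul_le_of_le_one_left (jetNorm_nonneg hσ) hr)

lemma jetNorm_traceFunctional_fderiv_const_sub (c : A) (f : E → A) (z v : E) (k : ℕ) (σ : ℝ) :
    jetNorm k σ Θ[tr, fun y => c - f y, v] z = jetNorm k σ Θ[tr, f, v] z := by
  have e : Θ[tr, fun y => c - f y, v] = fun y => -traceFunctional tr (𝐝 f y v) := by
    funext y
    rw [fderiv_const_sub, neg_apply, map_neg]
  rw [e, jetNorm_neg]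

lemma jetNorm_commutator_le {f g : E → A} {z : E} (hf : SmoothAt f z)
    (hg : SmoothAt g z) {k : ℕ} {σ : ℝ} (hσ : 0 ≤ σ) {s t : ℝ} (hs : jetNorm k σ f z ≤ s)
    (ht : jetNorm k σ g z ≤ t) :
    jetNorm k σ (fun y => f y * g y - g y * f y) z ≤ 2 * s * t := by
  have h1 := jetNorm_mul_le hf hg (k := k) hσ
  have h2 := jetNorm_mul_le hg hf (k := k) hσ
  have h3 := jetNorm_sub_le (k := k) hσ (hf.mul hg) (hg.mul hf)
  have h4 := mul_le_mul hs ht (jetNorm_nonneg hσ) ((jetNorm_nonneg hσ).trans hs)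
  refine h3.trans ?_
  linarith

/-- The curvatures of two families of projectors are close if the families are. -/
lemma jetNorm_curvature_sub_le (htr : ∀ x y, tr (x * y) = tr (y * x)) {P Q : E → A} {O : Set E}
    (hO : IsOpen O) (hP : ∀ z ∈ O, SmoothAt P z) (hQ : ∀ z ∈ O, SmoothAt Q z) {z : E}
    (hz : z ∈ O) {u v : E} (hu : ‖u‖ ≤ 1) {k : ℕ} {σ : ℝ} (hσ : 0 < σ) {β β' e t t' : ℝ}
    (h1 : jetNorm (k + 1) σ P z ≤ β) (h2 : jetNorm (k + 1) σ Q z ≤ β')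
    (h3 : jetNorm (k + 1) σ (fun y => P y - Q y) z ≤ e)
    (h4 : jetNorm k σ Θ[tr, Q, v] z ≤ t)
    (h5 : jetNorm k σ Θ[tr, fun y => P y - Q y, v] z ≤ t') :
    jetNorm k σ (fun y => curvature tr P y u v - curvature tr Q y u v) z ≤
      t' * (2 * β * ((k + 1) / σ * β)) +
        t * (2 * e * ((k + 1) / σ * β) + 2 * β' * ((k + 1) / σ * e)) := by
  have hE : ∀ y ∈ O, SmoothAt (fun y => P y - Q y) y := fun y hy => (hP y hy).sub (hQ y hy)
  have hd : ∀ y ∈ O, ∀ w, 𝐝 (fun y => P y - Q y) y w = 𝐝 P y w - 𝐝 Q y w := by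
    intro y hy w
    rw [fderiv_fun_sub ((hP y hy).differentiableAt (by simp))
      ((hQ y hy).differentiableAt (by simp))]
    rfl
  have heq : (fun y => curvature tr P y u v - curvature tr Q y u v) =ᶠ[𝓝 z] fun y =>
      traceFunctional tr (𝐝 (fun y => P y - Q y) y v) (P y * 𝐝 P y u - 𝐝 P y u * P y) +
      traceFunctional tr (𝐝 Q y v) (((P y - Q y) * 𝐝 P y u - 𝐝 P y u * (P y - Q y)) +
          (Q y * 𝐝 (fun y => P y - Q y) y u - 𝐝 (fun y => P y - Q y) y u * Q y)) := by
    filter_upwards [hO.mem_nhds hz] with y hy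
    have hs : ∀ a b x, traceFunctional tr (a - b) x =
        traceFunctional tr a x - traceFunctional tr b x := fun a b x => by rw [map_sub]; rfl
    rw [curvature_eq_traceFunctional htr, curvature_eq_traceFunctional htr, hd y hy, hd y hy, hs]
    have : (P y - Q y) * 𝐝 P y u - 𝐝 P y u * (P y - Q y) +
        (Q y * (𝐝 P y u - 𝐝 Q y u) - (𝐝 P y u - 𝐝 Q y u) * Q y) =
        (P y * 𝐝 P y u - 𝐝 P y u * P y) -
        (Q y * 𝐝 Q y u - 𝐝 Q y u * Q y) := by noncomm_ring
    rw [this]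
    simp only [map_sub]
    ring
  rw [jetNorm_congr heq]
  have hdu : ∀ {f : E → A}, SmoothAt f z → ∀ {s : ℝ}, jetNorm (k + 1) σ f z ≤ s →
      jetNorm k σ (fun y => 𝐝 f y u) z ≤ (k + 1) / σ * s := by
    intro f hf s hs
    refine (jetNorm_fderiv_apply_le hf u hσ).trans ?_
    have h0 : 0 ≤ jetNorm (k + 1) σ f z := jetNorm_nonneg hσ.le
    calc (k + 1) / σ * ‖u‖ * jetNorm (k + 1) σ f z ≤ (k + 1) / σ * 1 * s := by gcongr
      _ = _ := by ring
  have hmono : ∀ {f : E → A} {s : ℝ}, jetNorm (k + 1) σ f z ≤ s → jetNorm k σ f z ≤ s :=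
    fun h => (jetNorm_mono (Nat.le_succ k) hσ.le _ _).trans h
  have cP := hP z hz
  have cQ := hQ z hz
  have cE := hE z hz
  have cPu := contDiffAt_fderiv_apply cP u
  have cEu := contDiffAt_fderiv_apply cE u
  have cΘ : ∀ {f : E → A}, SmoothAt f z → SmoothAt Θ[tr, f, v] z := fun hf =>
    (traceFunctional tr).contDiff.contDiffAt.comp z (contDiffAt_fderiv_apply hf v)
  have b1 := jetNorm_commutator_le cP cPu hσ.le (hmono h1) (hdu cP h1)
  have b2 := jetNorm_commutator_le cE cPu hσ.le (hmono h3) (hdu cP h1)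
  have b3 := jetNorm_commutator_le cQ cEu hσ.le (hmono h2) (hdu cE h3)
  have c1 : SmoothAt (fun y => P y * 𝐝 P y u - 𝐝 P y u * P y) z := (cP.mul cPu).sub (cPu.mul cP)
  have c2 : SmoothAt (fun y =>
      (P y - Q y) * 𝐝 P y u - 𝐝 P y u * (P y - Q y)) z :=
    (cE.mul cPu).sub (cPu.mul cE)
  have c3 : SmoothAt (fun y => Q y * 𝐝 (fun y => P y - Q y) y u -
      𝐝 (fun y => P y - Q y) y u * Q y) z :=
    (cQ.mul cEu).sub (cEu.mul cQ)
  have hid : ‖ContinuousLinearMap.id ℝ (A →L[ℝ] ℂ)‖ ≤ 1 := norm_id_le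
  refine (jetNorm_add_le hσ.le ((cΘ cE).clm_apply c1) ((cΘ cQ).clm_apply (c2.add c3))).trans ?_
  have d1 := jetNorm_bilin_le (k := k) (ContinuousLinearMap.id ℝ (A →L[ℝ] ℂ)) hid (cΘ cE) c1 hσ.le
  have d2 := jetNorm_bilin_le (k := k) (ContinuousLinearMap.id ℝ (A →L[ℝ] ℂ)) hid (cΘ cQ)
    (c2.add c3) hσ.le
  have d3 := (jetNorm_add_le (k := k) hσ.le c2 c3).trans (add_le_add b2 b3)
  have t0 := (jetNorm_nonneg hσ.le).trans h4
  have t0' := (jetNorm_nonneg hσ.le).trans h5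
  exact add_le_add (d1.trans (mul_le_mul h5 b1 (jetNorm_nonneg hσ.le) t0'))
    (d2.trans (mul_le_mul h4 d3 (jetNorm_nonneg hσ.le) t0))

end CurvatureJets

section Truncation

variable {n d : ℕ} [NeZero n] (b : Fin 4 → Circle)

/-- The remainder of the power series of `blockS` after `K` terms. -/
def tailS (K : ℕ) (φ : Blocks n d) : Op n d :=
  (∑' m, invSqrtCoeff m • gapB b φ ^ m) - ∑ m ∈ range K, invSqrtCoeff m • gapB b φ ^ m

/-- The projector `P̂₋` with the power series of the inverse square root truncated after `K`
terms. -/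
def truncP (K : ℕ) (φ : Blocks n d) : Op n d := (1 / 2 : ℂ) • (1 - (√128)⁻¹ •
  (gamma5 n d * blockA b φ * ∑ m ∈ range K, invSqrtCoeff m • gapB b φ ^ m))

lemma blockP_sub_truncP (K : ℕ) (φ : Blocks n d) : blockP b φ - truncP b K φ =
    (-(1 / 2) * (√128)⁻¹ : ℝ) • (gamma5 n d * (blockA b φ * tailS b K φ)) := by
  rw [blockP, truncP, blockG, blockS, tailS, mul_sub, mul_sub, ← mul_assoc, ← mul_assoc]
  module

lemma contDiff_truncP (K : ℕ) : ContDiff ℝ ∞ (truncP (n := n) (d := d) b K) := by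
  have hA := contDiff_blockA (n := n) (d := d) b
  have hB := contDiff_gapB (n := n) (d := d) b
  have hS : ContDiff ℝ ∞ fun φ : Blocks n d =>
      ∑ m ∈ range K, invSqrtCoeff m • gapB b φ ^ m :=
    ContDiff.sum fun m _ => (hB.pow m).const_smul _
  exact (contDiff_const.sub (((contDiff_const.mul hA).mul hS).const_smul _)).const_smul (1 / 2 : ℂ)

variable {E : Type*} [NormedAddCommGroup E] [NormedSpace ℝ E] {φ : E → Blocks n d} {O : Set E}

/-- The quantities that control the jets of the projectors at a point `z`: the jets of `A` and of
`1 - A† A / 128`, and the trace norm of the derivative of `A` in a direction `v`. -/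
structure JetBound (φ : E → Blocks n d) (O : Set E) (z v : E) (k : ℕ) (σ α q τ : ℝ) : Prop where
  isOpen : IsOpen O
  smooth : ∀ y ∈ O, SmoothAt φ y
  gap : ∀ y ∈ O, ‖gapB b (φ y)‖ < 1
  mem : z ∈ O
  pos : 0 < σ
  boundA : jetNorm (k + 1) σ (fun y => blockA b (φ y)) z ≤ α
  boundB : jetNorm (k + 1) σ (fun y => gapB b (φ y)) z ≤ q
  boundTr : jetNorm k σ Θ[𝐓, fun y => blockA b (φ y), v] z ≤ τ

variable {b} {z v : E} {k : ℕ} {σ α q τ : ℝ}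

lemma abs_prefactor_le : |(-(1 / 2) * (√128)⁻¹ : ℝ)| ≤ 1 := by
  have h1 : (1 : ℝ) ≤ √128 := Real.one_le_sqrt.2 (by norm_num)
  have h2 : (√128)⁻¹ ≤ 1 := inv_le_one_of_one_le₀ h1
  have h3 : 0 ≤ (√128)⁻¹ := by positivity
  rw [abs_le]
  constructor <;> linarith

lemma jetNorm_gamma5_mul_le {f : E → Op n d} (hf : SmoothAt f z) (hσ : 0 ≤ σ) :
    jetNorm k σ (fun y => gamma5 n d * f y) z ≤ jetNorm k σ f z := by
  refine (jetNorm_mul_le contDiffAt_const hf hσ).trans ?_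
  rw [jetNorm_const]
  exact mul_le_of_le_one_left (jetNorm_nonneg hσ) norm_gamma5_le

lemma gapB_eq (ψ : Blocks n d) : gapB b ψ =
    1 - (128 : ℝ)⁻¹ • ((gamma5 n d * blockA b ψ) * (gamma5 n d * blockA b ψ)) := by
  rw [gapB, gamma5_mul_blockA_sq]

namespace JetBound

variable (h : JetBound b φ O z v k σ α q τ)
include h

lemma smoothA : ∀ y ∈ O, SmoothAt (fun y => blockA b (φ y)) y := fun y hy =>
  (contDiff_blockA b).contDiffAt.comp y (h.smooth y hy)

lemma smoothB : ∀ y ∈ O, SmoothAt (fun y => gapB b (φ y)) y := fun y hy =>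
  (contDiff_gapB b).contDiffAt.comp y (h.smooth y hy)

lemma alpha_nonneg : 0 ≤ α := (jetNorm_nonneg h.pos.le).trans h.boundA

lemma tau_nonneg : 0 ≤ τ := (jetNorm_nonneg h.pos.le).trans h.boundTr

lemma contracting : IsContracting (fun y => gapB b (φ y)) O := ⟨h.isOpen, h.smoothB, h.gap⟩

lemma smoothP : ∀ y ∈ O, SmoothAt (fun y => blockP b (φ y)) y := fun y hy =>
  (contDiffAt_blockP b (h.gap y hy)).comp y (h.smooth y hy)

lemma smoothTrunc (K : ℕ) : ∀ y ∈ O, SmoothAt (fun y => truncP b K (φ y)) y := fun y hy =>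
  (contDiff_truncP b K).contDiffAt.comp y (h.smooth y hy)

lemma smoothTail (K : ℕ) : ∀ y ∈ O, SmoothAt (fun y => tailS b K (φ y)) y := fun y hy => by
  have h1 := (contDiffAt_blockS b (h.gap y hy)).comp y (h.smooth y hy)
  have h2 : SmoothAt (fun y =>
      ∑ m ∈ range K, invSqrtCoeff m • gapB b (φ y) ^ m) y :=
    ContDiffAt.sum fun m _ => ((h.smoothB y hy).pow m).const_smul _
  exact h1.sub h2

lemma jetNorm_tailS_le (hq : q < 1) (K : ℕ) :
    jetNorm (k + 1) σ (fun y => tailS b K (φ y)) z ≤ q ^ K / (1 - q) :=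
  jetNorm_powerSeries_remainder_le norm_one_matrix_le abs_invSqrtCoeff_le_one h.contracting
    h.mem h.pos.le h.boundB hq K

lemma jetNorm_error_le (hq : q < 1) (K : ℕ) :
    jetNorm (k + 1) σ (fun y => blockP b (φ y) - truncP b K (φ y)) z ≤ α * (q ^ K / (1 - q)) := by
  have hα := h.alpha_nonneg
  simp only [blockP_sub_truncP]
  have cA := h.smoothA z h.mem
  have cT := h.smoothTail K z h.mem
  refine (jetNorm_smul_le (𝕜 := ℝ) h.pos.le _ (contDiffAt_const.mul (cA.mul cT))).trans ?_
  refine (mul_le_of_le_one_left (jetNorm_nonneg h.pos.le) abs_prefactor_le).trans ?_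
  refine (jetNorm_gamma5_mul_le (cA.mul cT) h.pos.le).trans ?_
  refine (jetNorm_mul_le cA cT h.pos.le).trans ?_
  exact mul_le_mul h.boundA (h.jetNorm_tailS_le hq K) (jetNorm_nonneg h.pos.le) hα

lemma jetNorm_traceB_le : jetNorm k σ Θ[𝐓, fun y => gapB b (φ y), v] z ≤ 2 * α * τ := by
  have hα := h.alpha_nonneg
  have hτ := h.tau_nonneg
  have hA : jetNorm k σ (fun y => blockA b (φ y)) z ≤ α :=
    (jetNorm_mono (Nat.le_succ k) h.pos.le _ _).trans h.boundA
  have c5A : ∀ y ∈ O, SmoothAt (fun y => gamma5 n d * blockA b (φ y)) y :=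
    fun y hy => contDiffAt_const.mul (h.smoothA y hy)
  have b1 : jetNorm k σ (fun y => gamma5 n d * blockA b (φ y)) z ≤ α :=
    (jetNorm_gamma5_mul_le (h.smoothA z h.mem) h.pos.le).trans hA
  have b2 : jetNorm k σ Θ[𝐓, fun y => gamma5 n d * blockA b (φ y), v] z ≤ τ :=
    (jetNorm_traceFunctional_fderiv_const_mul_le traceL_mul_comm h.isOpen h.smoothA h.mem v
      h.pos.le norm_gamma5_le).trans h.boundTr
  simp only [gapB_eq]
  rw [jetNorm_traceFunctional_fderiv_const_sub]
  refine (jetNorm_traceFunctional_fderiv_const_smul_le h.isOpen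
    (fun y hy => (c5A y hy).mul (c5A y hy)) h.mem v h.pos.le
    (by rw [abs_of_pos (by norm_num)]; norm_num)).trans ?_
  refine (jetNorm_traceFunctional_fderiv_mul_le traceL_mul_comm h.isOpen c5A c5A h.mem v
    h.pos.le).trans ?_
  have m1 := mul_le_mul b1 b2 (jetNorm_nonneg h.pos.le) hα
  have m2 := mul_le_mul b2 b1 (jetNorm_nonneg h.pos.le) hτ
  linarith

lemma jetNorm_trace_error_le {p M : ℝ} (hqp : q ≤ p)
    (hp : p < 1) (hM : ∀ m : ℕ, m * q ^ (m - 1) ≤ M * p ^ m) (K : ℕ) :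
    jetNorm k σ Θ[𝐓, fun y => blockP b (φ y) - truncP b K (φ y), v] z ≤
      (2 * α ^ 2 * M + 1) / (1 - p) * τ * p ^ K := by
  have hα := h.alpha_nonneg
  have hτ := h.tau_nonneg
  have hq0 : 0 ≤ q := (jetNorm_nonneg h.pos.le).trans h.boundB
  have hp0 : 0 ≤ p := hq0.trans hqp
  have hq1 : q < 1 := hqp.trans_lt hp
  have hA : jetNorm k σ (fun y => blockA b (φ y)) z ≤ α :=
    (jetNorm_mono (Nat.le_succ k) h.pos.le _ _).trans h.boundA
  have hB : jetNorm k σ (fun y => gapB b (φ y)) z ≤ q :=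
    (jetNorm_mono (Nat.le_succ k) h.pos.le _ _).trans h.boundB
  have hT : jetNorm k σ (fun y => tailS b K (φ y)) z ≤ p ^ K / (1 - p) := by
    refine ((jetNorm_mono (Nat.le_succ k) h.pos.le _ _).trans (h.jetNorm_tailS_le hq1 K)).trans ?_
    have : 0 < 1 - p := by linarith
    gcongr
  have hTt := jetNorm_traceFunctional_fderiv_remainder_le traceL_mul_comm norm_one_matrix_le
    abs_invSqrtCoeff_le_one h.contracting h.mem v h.pos.le hB hp0 hp hM
    h.jetNorm_traceB_le K
  have cAT : ∀ y ∈ O, SmoothAt (fun y => blockA b (φ y) * tailS b K (φ y)) y :=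
    fun y hy => (h.smoothA y hy).mul (h.smoothTail K y hy)
  have c5 : ∀ y ∈ O, SmoothAt (fun y => gamma5 n d * (blockA b (φ y) * tailS b K (φ y))) y :=
    fun y hy => contDiffAt_const.mul (cAT y hy)
  simp only [blockP_sub_truncP]
  refine (jetNorm_traceFunctional_fderiv_const_smul_le h.isOpen c5 h.mem v h.pos.le
    abs_prefactor_le).trans ?_
  refine (jetNorm_traceFunctional_fderiv_const_mul_le traceL_mul_comm h.isOpen cAT h.mem v
    h.pos.le norm_gamma5_le).trans ?_
  refine (jetNorm_traceFunctional_fderiv_mul_le traceL_mul_comm h.isOpen h.smoothA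
    (h.smoothTail K) h.mem v h.pos.le).trans ?_
  refine (add_le_add (mul_le_mul hA hTt (jetNorm_nonneg h.pos.le) hα)
    (mul_le_mul h.boundTr hT (jetNorm_nonneg h.pos.le) hτ)).trans (le_of_eq ?_)
  ring

/-- The error made in the curvature by truncating the power series decays geometrically. -/
lemma jetNorm_curvature_error_le {p M : ℝ} (hqp : q ≤ p)
    (hp : p < 1) (hM0 : 0 ≤ M) (hM : ∀ m : ℕ, m * q ^ (m - 1) ≤ M * p ^ m) {u : E} (hu : ‖u‖ ≤ 1)
    (K : ℕ) :
    jetNorm k σ (fun y => curvature 𝐓 (fun y => blockP b (φ y)) y u v -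
      curvature 𝐓 (fun y => truncP b K (φ y)) y u v) z ≤
      14 * ((2 * α ^ 2 * M + 1) / (1 - p)) * ((k + 1) / σ) * (1 + α / (1 - p)) ^ 2 * τ * p ^ K := by
  have hα := h.alpha_nonneg
  have hτ := h.tau_nonneg
  have hq0 : 0 ≤ q := (jetNorm_nonneg h.pos.le).trans h.boundB
  have hp0 : 0 ≤ p := hq0.trans hqp
  have hp1 : 0 < 1 - p := by linarith
  have hq1 : q < 1 := hqp.trans_lt hp
  set β := 1 + α / (1 - p) with hβ
  set C := (2 * α ^ 2 * M + 1) / (1 - p) with hC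
  have hβ0 : 0 ≤ β := by positivity
  have hC0 : 0 ≤ C := by positivity
  have herr : ∀ K, jetNorm (k + 1) σ (fun y => blockP b (φ y) - truncP b K (φ y)) z ≤
      β * p ^ K := by
    intro K
    refine (h.jetNorm_error_le hq1 K).trans ?_
    calc α * (q ^ K / (1 - q)) ≤ α * (p ^ K / (1 - p)) := by gcongr
      _ = α / (1 - p) * p ^ K := by ring
      _ ≤ β * p ^ K := by gcongr; linarith
  have h0 : ∀ ψ : Blocks n d, truncP b 0 ψ = (1 / 2 : ℂ) • 1 := fun ψ => by simp [truncP]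
  have hP : jetNorm (k + 1) σ (fun y => blockP b (φ y)) z ≤ β := by
    have e : (fun y => blockP b (φ y)) = fun y => (blockP b (φ y) - truncP b 0 (φ y)) +
        (1 / 2 : ℂ) • (1 : Op n d) := by
      funext y; rw [h0, sub_add_cancel]
    rw [e]
    refine (jetNorm_add_le h.pos.le ((h.smoothP z h.mem).sub (h.smoothTrunc 0 z h.mem))
      contDiffAt_const).trans ?_
    rw [jetNorm_const]
    have e2 : ‖(1 / 2 : ℂ) • (1 : Op n d)‖ ≤ 1 := by
      rw [norm_smul]
      have := norm_one_matrix_le (ι := Idx n d)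
      have e3 : ‖(1 / 2 : ℂ)‖ = 1 / 2 := by simp
      rw [e3]; linarith
    have e3 := h.jetNorm_error_le hq1 0
    have e4 : α * (q ^ 0 / (1 - q)) ≤ α / (1 - p) := by rw [pow_zero, mul_one_div]; gcongr
    linarith
  have hQ : ∀ K, jetNorm (k + 1) σ (fun y => truncP b K (φ y)) z ≤ 2 * β := by
    intro K
    have e : (fun y => truncP b K (φ y)) = fun y => blockP b (φ y) -
        (blockP b (φ y) - truncP b K (φ y)) := by funext y; abel
    rw [e]
    refine (jetNorm_sub_le h.pos.le (h.smoothP z h.mem)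
      ((h.smoothP z h.mem).sub (h.smoothTrunc K z h.mem))).trans ?_
    have : β * p ^ K ≤ β := mul_le_of_le_one_right hβ0 (pow_le_one₀ hp0 hp.le)
    linarith [herr K]
  have hΘ : ∀ K, jetNorm k σ Θ[𝐓, fun y => truncP b K (φ y), v] z ≤ 2 * C * τ := by
    intro K
    have e : Θ[𝐓, fun y => truncP b K (φ y), v] =ᶠ[𝓝 z] fun y =>
        traceFunctional 𝐓 (𝐝 (fun y => blockP b (φ y) - truncP b 0 (φ y)) y v) -
        traceFunctional 𝐓 (𝐝 (fun y => blockP b (φ y) - truncP b K (φ y)) y v) := by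
      filter_upwards [h.isOpen.mem_nhds h.mem] with y hy
      have dP := (h.smoothP y hy).differentiableAt (n := ∞) (by simp)
      have dQ := (h.smoothTrunc K y hy).differentiableAt (n := ∞) (by simp)
      have e0 : (fun y => blockP b (φ y) - truncP b 0 (φ y)) =
          fun y => blockP b (φ y) - (1 / 2 : ℂ) • (1 : Op n d) := by funext y; rw [h0]
      rw [e0, fderiv_sub_const, fderiv_fun_sub dP dQ, ← map_sub, sub_apply, sub_sub_cancel]
    rw [jetNorm_congr e]
    have c : ∀ K, SmoothAt Θ[𝐓, fun y => blockP b (φ y) - truncP b K (φ y), v] z := fun K =>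
      contDiffAt_traceFunctional_fderiv ((h.smoothP z h.mem).sub (h.smoothTrunc K z h.mem)) v
    refine (jetNorm_sub_le h.pos.le (c 0) (c K)).trans ?_
    have t1 := h.jetNorm_trace_error_le hqp hp hM 0
    have t2 := h.jetNorm_trace_error_le hqp hp hM K
    have : C * τ * p ^ K ≤ C * τ := mul_le_of_le_one_right (by positivity) (pow_le_one₀ hp0 hp.le)
    rw [pow_zero, mul_one] at t1
    linarith
  refine (jetNorm_curvature_sub_le traceL_mul_comm h.isOpen h.smoothP (h.smoothTrunc K) h.mem hu
    h.pos hP (hQ K) (herr K) (hΘ K) (h.jetNorm_trace_error_le hqp hp hM K)).trans (le_of_eq ?_)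
  ring

end JetBound

end Truncation

/-! ### Uniform bounds on the jets in exponential charts -/

section HoppingTrace

lemma norm_trace_mul_le_sum {ι : Type*} [Fintype ι] [DecidableEq ι] (y M : Matrix ι ι ℂ) :
    ‖(y * M).trace‖ ≤ ‖y‖ * ∑ p, ∑ q, ‖M p q‖ := by
  rw [trace_mul_comm, trace]
  refine (norm_sum_le _ _).trans ?_
  rw [mul_sum]
  refine sum_le_sum fun p _ => ?_
  rw [diag_apply, Matrix.mul_apply, mul_sum]
  refine (norm_sum_le _ _).trans (sum_le_sum fun q _ => ?_)
  rw [norm_mul, mul_comm]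
  gcongr
  exact norm_entry_le y q p

variable {n d : ℕ} [NeZero n] (b : Fin 4 → Circle)

lemma sum_norm_blockShift_single_le (x : Site n) (μ ν : Fin 4) (Z : Mat d) :
    ∑ p, ∑ q, ‖blockShift b (Pi.single x (Pi.single μ Z)) ν p q‖ ≤ 16 * d ^ 2 * ‖Z‖ := by
  have h1 : ∀ p q : Idx n d, ‖blockShift b (Pi.single x (Pi.single μ Z)) ν p q‖ ≤
      if p.1 = x then (if q.1 = step x ν then ‖Z‖ else 0) else 0 := by
    intro p q
    rw [blockShift]
    split_ifs with h h2 h3 h3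
    · rw [norm_mul, norm_bdyPhase, one_mul, h2, Pi.single_eq_same]
      rcases eq_or_ne ν μ with rfl | hν
      · rw [Pi.single_eq_same]; exact norm_entry_le Z _ _
      · rw [Pi.single_eq_of_ne hν]; simp
    · exact absurd (h2 ▸ h.1) h3
    · rw [Pi.single_eq_of_ne h2]; simp
    all_goals simp
  refine (sum_le_sum fun p _ => sum_le_sum fun q _ => h1 p q).trans (le_of_eq ?_)
  have h2 : ∀ (y : Site n) (c : ℝ), ∑ q : Idx n d, (if q.1 = y then c else 0) = 4 * d * c := by
    intro y c
    rw [Fintype.sum_prod_type]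
    have e : ∀ z : Site n, (∑ _s : Fin 4 × Fin d, if z = y then c else 0) =
        if z = y then 4 * d * c else 0 := by
      intro z
      rw [sum_const, card_univ, Fintype.card_prod, Fintype.card_fin,
        Fintype.card_fin, nsmul_eq_mul, mul_ite, mul_zero]
      push_cast
      rfl
    rw [sum_congr rfl fun z _ => e z, sum_ite_eq' univ y, if_pos (mem_univ _)]
  have h3 : ∀ p : Idx n d, (∑ q : Idx n d, if p.1 = x then
      (if q.1 = step x ν then ‖Z‖ else 0) else 0) = if p.1 = x then 4 * d * ‖Z‖ else 0 := by
    intro p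
    split_ifs
    · exact h2 _ _
    · exact sum_const_zero
  rw [sum_congr rfl fun p _ => h3 p, h2]
  ring

/-- The contribution of a single link to the hopping term has a trace norm that does not depend on
the lattice. -/
lemma norm_traceFunctional_hopping_single_le (x : Site n) (μ : Fin 4) (Z : Mat d) :
    ‖traceFunctional 𝐓 (hoppingL b (Pi.single x (Pi.single μ Z)))‖ ≤ 128 * d ^ 2 * ‖Z‖ := by
  refine opNorm_le_bound _ (by positivity) fun y => ?_
  rw [traceFunctional_apply, traceL_apply, hoppingL_apply, hopping, mul_smul_comm, trace_smul,
    mul_sum, trace_sum, norm_smul]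
  have hg : ∀ ν, ‖y * (1 - spinOp n d (gamma ν))‖ ≤ 2 * ‖y‖ ∧
      ‖y * (1 + spinOp n d (gamma ν))‖ ≤ 2 * ‖y‖ := by
    intro ν
    have hs := norm_spinOp_gamma_le (n := n) (d := d) ν
    have ho := norm_one_matrix_le (ι := Idx n d)
    have h1 := (norm_sub_le (1 : Op n d) (spinOp n d (gamma ν))).trans (add_le_add ho hs)
    have h2 := (norm_add_le (1 : Op n d) (spinOp n d (gamma ν))).trans (add_le_add ho hs)
    have hy := norm_nonneg y
    exact ⟨(norm_mul_le _ _).trans (by nlinarith), (norm_mul_le _ _).trans (by nlinarith)⟩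
  have hterm : ∀ ν ∈ univ, ‖(y * ((1 - spinOp n d (gamma ν)) *
      blockShift b (Pi.single x (Pi.single μ Z)) ν + (1 + spinOp n d (gamma ν)) *
      (blockShift b (Pi.single x (Pi.single μ Z)) ν)ᴴ)).trace‖ ≤ 64 * d ^ 2 * ‖Z‖ * ‖y‖ := by
    intro ν _
    have hs := sum_norm_blockShift_single_le b x μ ν Z
    have hs' : ∑ p, ∑ q, ‖(blockShift b (Pi.single x (Pi.single μ Z)) ν)ᴴ p q‖ ≤
        16 * d ^ 2 * ‖Z‖ := by
      rw [sum_comm]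
      simpa only [conjTranspose_apply, norm_star] using hs
    rw [mul_add, trace_add, ← mul_assoc, ← mul_assoc]
    refine (norm_add_le _ _).trans ?_
    have e1 := (norm_trace_mul_le_sum (y * (1 - spinOp n d (gamma ν)))
      (blockShift b (Pi.single x (Pi.single μ Z)) ν)).trans
      (mul_le_mul (hg ν).1 hs (by positivity) (by positivity))
    have e2 := (norm_trace_mul_le_sum (y * (1 + spinOp n d (gamma ν)))
      (blockShift b (Pi.single x (Pi.single μ Z)) ν)ᴴ).trans
      (mul_le_mul (hg ν).2 hs' (by positivity) (by positivity))
    linarith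
  have := (norm_sum_le _ _).trans (sum_le_sum hterm)
  rw [sum_const, card_univ, Fintype.card_fin, nsmul_eq_mul] at this
  have e : ‖(1 / 2 : ℂ)‖ = 1 / 2 := by simp
  rw [e]
  push_cast at this
  linarith

/-- The trace norm functional of the hopping term on a single link. -/
def linkTrace (x : Site n) (μ : Fin 4) : Mat d →L[ℝ] Op n d →L[ℝ] ℂ :=
  (traceFunctional 𝐓).comp ((hoppingL b).comp
    ((ContinuousLinearMap.single ℝ (fun _ : Site n => Fin 4 → Mat d) x).comp
      (ContinuousLinearMap.single ℝ (fun _ : Fin 4 => Mat d) μ)))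

lemma norm_linkTrace_le (x : Site n) (μ : Fin 4) : ‖linkTrace (d := d) b x μ‖ ≤ 128 * d ^ 2 :=
  opNorm_le_bound _ (by positivity) fun Z => norm_traceFunctional_hopping_single_le b x μ Z

end HoppingTrace

section LinkChart

lemma continuousAt_norm_iteratedFDeriv {E F : Type*} [NormedAddCommGroup E] [NormedSpace ℝ E]
    [NormedAddCommGroup F] [NormedSpace ℝ F] {f : E → F} {z : E} (hf : SmoothAt f z)
    (j : ℕ) : ContinuousAt (fun y => ‖𝐃 j f y‖) z :=
  (hf.iteratedFDeriv_right (i := j) (m := 0) (mod_cast le_top)).continuousAt.norm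

variable {N d : ℕ} [NeZero N] (ρ : su N →ₗ[ℝ] Mat d)

/-- The represented link variable as a function of `t` and of two successive shifts. -/
def linkChart (u : Mat N) (z : ℝ × su N × su N) : Mat d :=
  linkFn ρ (z.1, exp z.2.2.1 * (exp z.2.1.1 * u))

lemma contDiff_shiftedLink : ContDiff ℝ ∞ fun z : (ℝ × su N × su N) × Mat N =>
    (z.1.1, exp z.1.2.2.1 * (exp z.1.2.1.1 * z.2)) := by
  have h1 : ContDiff ℝ ∞ fun z : (ℝ × su N × su N) × Mat N =>
      (su N).subtypeL z.1.2.1 := (su N).subtypeL.contDiff.comp (by fun_prop)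
  have h2 : ContDiff ℝ ∞ fun z : (ℝ × su N × su N) × Mat N =>
      (su N).subtypeL z.1.2.2 := (su N).subtypeL.contDiff.comp (by fun_prop)
  have h3 : ContDiff ℝ ∞ fun z : (ℝ × su N × su N) × Mat N => z.1.1 := by fun_prop
  exact h3.prodMk ((contDiff_exp.comp h2).mul ((contDiff_exp.comp h1).mul contDiff_snd))

lemma contDiffAt_linkChart_uncurried {t : ℝ} {u : Mat N} (hu : ‖u - 1‖ < 1) :
    SmoothAt (fun z : (ℝ × su N × su N) × Mat N => linkChart ρ z.2 z.1) ((t, 0, 0), u) := by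
  refine ContDiffAt.comp ((t, (0 : su N), (0 : su N)), u) (g := linkFn ρ) ?_
    (contDiff_shiftedLink (N := N)).contDiffAt
  refine contDiffAt_linkFn ρ ?_
  show ‖exp (0 : su N).1 * (exp (0 : su N).1 * u) - 1‖ < 1
  rw [ZeroMemClass.coe_zero, NormedSpace.exp_zero, one_mul, one_mul]
  exact hu

/-- By compactness, the derivatives of the represented link variables are bounded. -/
lemma exists_bound_linkChart (j : ℕ) : ∃ C : ℝ, 0 ≤ C ∧ ∀ t ∈ 𝕀, ∀ u : Mat N, ‖u - 1‖ ≤ 1 / 80 →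
      ‖𝐃 j (linkChart ρ u) (t, 0, 0)‖ ≤ C := by
  set Ψ := fun z : (ℝ × su N × su N) × Mat N => linkChart ρ z.2 z.1 with hΨ
  let K : Set (ℝ × Mat N) := 𝕀 ×ˢ Metric.closedBall 1 (1 / 80)
  have hK : IsCompact K := isCompact_Icc.prod (isCompact_closedBall _ _)
  have hcd : ∀ p ∈ K, SmoothAt Ψ ((p.1, 0, 0), p.2) := fun p hp =>
    contDiffAt_linkChart_uncurried ρ (by
      have := hp.2
      rw [Metric.mem_closedBall, dist_eq_norm] at this
      linarith)
  have hcont : ContinuousOn (fun p : ℝ × Mat N =>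
      ‖𝐃 j Ψ ((p.1, 0, 0), p.2)‖) K := fun p hp =>
    (ContinuousAt.comp (g := fun z => ‖𝐃 j Ψ z‖) (f :=
      fun p : ℝ × Mat N =>
      (((p.1, 0, 0), p.2) : (ℝ × su N × su N) × Mat N))
      (continuousAt_norm_iteratedFDeriv (hcd p hp) j) (by fun_prop)).continuousWithinAt
  obtain ⟨C, hC⟩ := hK.exists_bound_of_continuousOn hcont
  refine ⟨max C 0, le_max_right _ _, fun t ht u hu => ?_⟩
  have hp : (t, u) ∈ K := ⟨ht, by rw [Metric.mem_closedBall, dist_eq_norm]; exact hu⟩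
  have h1 := norm_iteratedFDeriv_comp_affine_le (inl ℝ (ℝ × su N × su N) (Mat N))
    (norm_inl_le_one ℝ _ _) (0, u) (f := Ψ) (y := (t, 0, 0))
    (by simpa using hcd _ hp) j
  have e : (fun y => Ψ ((0, u) + inl ℝ (ℝ × su N × su N) _ y)) = linkChart ρ u := by
    funext y; simp [hΨ]
  rw [e] at h1
  refine h1.trans (le_trans ?_ (le_max_left _ _))
  have := (le_abs_self _).trans (hC _ hp)
  simpa using this

end LinkChart

section Chart

variable {N n d : ℕ} [NeZero N] [NeZero n] (ρ : su N →ₗ[ℝ] Mat d) (b : Fin 4 → Circle)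

/-- The parameter space of `t` and two successive shifts of the link field. -/
abbrev ChartSpace (n N : ℕ) : Type := ℝ × Pert n N × Pert n N

/-- The link field shifted twice. -/
def chartMap (W : Config n N) (z : ChartSpace n N) : ℝ × Blocks n N :=
  (z.1, coeConfig (shift z.2.2 (shift z.2.1 W)))

/-- The restriction of the parameters to a single link. -/
def linkProj (x : Site n) (μ : Fin 4) : ChartSpace n N →L[ℝ] ℝ × su N × su N :=
  (fst ℝ _ _).prod (((proj μ).comp ((proj (R := ℝ) (φ := fun _ : Site n => Fin 4 → su N) x).comp
        ((fst ℝ _ _).comp (snd ℝ _ _)))).prod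
      ((proj μ).comp ((proj (R := ℝ) (φ := fun _ : Site n => Fin 4 → su N) x).comp
        ((snd ℝ _ _).comp (snd ℝ _ _)))))

lemma linkProj_apply (x : Site n) (μ : Fin 4) (z : ChartSpace n N) :
    linkProj x μ z = (z.1, z.2.1 x μ, z.2.2 x μ) := rfl

lemma norm_linkProj_le (x : Site n) (μ : Fin 4) : ‖linkProj (N := N) x μ‖ ≤ 1 := by
  refine opNorm_le_bound _ zero_le_one fun z => ?_
  rw [one_mul, linkProj_apply]
  have h : ∀ X : Pert n N, ‖X x μ‖ ≤ ‖X‖ := fun X =>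
    (norm_le_pi_norm (X x) μ).trans (norm_le_pi_norm X x)
  refine norm_prod_le_iff.2 ⟨norm_fst_le z, norm_prod_le_iff.2 ⟨?_, ?_⟩⟩
  · exact (h _).trans ((norm_fst_le z.2).trans (norm_snd_le z))
  · exact (h _).trans ((norm_snd_le z.2).trans (norm_snd_le z))

lemma contDiff_chartMap (W : Config n N) : ContDiff ℝ ∞ (chartMap (n := n) W) := by
  refine contDiff_fst.prodMk (contDiff_pi.2 fun x => contDiff_pi.2 fun μ => ?_)
  have h := (contDiff_shiftedLink (N := N)).comp
    ((linkProj (N := N) x μ).contDiff.prodMk (contDiff_const (c := (W x μ).1)) (n := ∞))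
  exact contDiff_snd.comp h

/-- The part of the parameter space in which the projectors are smooth. -/
def chartDomain (W : Config n N) : Set (ChartSpace n N) := chartMap W ⁻¹' familyDomain (n := n) ρ b

lemma isOpen_chartDomain (W : Config n N) : IsOpen (chartDomain ρ b W) :=
  (isOpen_familyDomain ρ b).preimage (contDiff_chartMap W).continuous

lemma contDiffAt_chartBlocks (W : Config n N) : ∀ z ∈ chartDomain ρ b W,
    SmoothAt (fun z => blockFn (n := n) ρ (chartMap W z)) z := fun z hz =>
  (contDiffAt_blockFn ρ hz.1).comp z (contDiff_chartMap W).contDiffAt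

lemma chartMap_shift (W : Config n N) (t : ℝ) (X : Pert n N) :
    chartMap W (t, X, 0) = (t, coeConfig (shift X W)) := by
  rw [chartMap, shift_zero]

lemma fderiv_chartMap (W : Config n N) (t : ℝ) (X η : Pert n N) :
    𝐝 (chartMap W) (t, X, 0) (1, 0, 0) = (1, 0) ∧
    𝐝 (chartMap W) (t, X, 0) (0, 0, η) = (0, tangent 1 η (coeConfig (shift X W))) := by
  have hd := ((contDiff_chartMap W).contDiffAt (x := (t, X, 0))).differentiableAt (by simp)
    |>.hasFDerivAt
  constructor
  · have hl : HasDerivAt (fun s : ℝ => ((s, X, 0) : ChartSpace n N)) (1, 0, 0) t :=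
      (hasDerivAt_id t).prodMk (hasDerivAt_const t _)
    refine (hd.comp_hasDerivAt t hl).unique ?_
    have e : chartMap W ∘ (fun s : ℝ => ((s, X, 0) : ChartSpace n N)) =
        fun s => (s, coeConfig (shift X W)) := funext fun s => chartMap_shift W s X
    rw [e]
    exact (hasDerivAt_id t).prodMk (hasDerivAt_const t _)
  · have hl : HasDerivAt (fun s : ℝ => ((t, X, s • η) : ChartSpace n N)) (0, 0, η) 0 := by
      have h1 : HasDerivAt (fun s : ℝ => s • η) η 0 := by
        simpa using (hasDerivAt_id (0 : ℝ)).smul_const η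
      exact (hasDerivAt_const 0 t).prodMk ((hasDerivAt_const 0 X).prodMk h1)
    have hd' : HasFDerivAt (chartMap W) (𝐝 (chartMap W) (t, X, 0))
        ((t, X, (0 : ℝ) • η) : ChartSpace n N) := by rw [zero_smul]; exact hd
    refine (hd'.comp_hasDerivAt (0 : ℝ) hl).unique ?_
    have h2 := hasDerivAt_coeConfig_shift 1 η (shift X W)
    simp only [mul_one] at h2
    exact (hasDerivAt_const 0 t).prodMk h2

end Chart

/-! ### Exponential decay of the truncation error of the measure current -/

section JetSum

variable {E F : Type*} [NormedAddCommGroup E] [NormedSpace ℝ E] [NormedAddCommGroup F]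
  [NormedSpace ℝ F]

/-- The value of the jet norm that corresponds to derivatives of norm `c j`. -/
def jetSum (c : ℕ → ℝ) (k : ℕ) (σ : ℝ) : ℝ := ∑ j ∈ range (k + 1), σ ^ j / j.factorial * c j

lemma jetNorm_le_jetSum {c : ℕ → ℝ} {k : ℕ} {σ : ℝ} (hσ : 0 ≤ σ) {f : E → F} {z : E}
    (h : ∀ j, ‖𝐃 j f z‖ ≤ c j) : jetNorm k σ f z ≤ jetSum c k σ :=
  sum_le_sum fun j _ => by
    have := h j
    gcongr

lemma jetSum_nonneg {c : ℕ → ℝ} (hc : ∀ j, 0 ≤ c j) (k : ℕ) {σ : ℝ} (hσ : 0 ≤ σ) :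
    0 ≤ jetSum c k σ :=
  sum_nonneg fun j _ => by
    have := hc j
    positivity

end JetSum

section ChartBounds

variable {N n d : ℕ} [NeZero N] [NeZero n] {ρ : su N →ₗ[ℝ] Mat d}
  {b : Fin 4 → Circle} {W : Config n N} {t : ℝ} {c : ℕ → ℝ}

/-- The represented link variables in the chart centred at `W`. -/
def chartBlocks (ρ : su N →ₗ[ℝ] Mat d) (W : Config n N) (z : ChartSpace n N) :
    Blocks n d := blockFn ρ (chartMap W z)

lemma contDiffAt_chartBlocks_apply {z : ChartSpace n N} (hz : z ∈ chartDomain ρ b W) (x : Site n)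
    (μ : Fin 4) : SmoothAt (fun z => chartBlocks ρ W z x μ) z :=
  contDiffAt_pi.1 (contDiffAt_pi.1 (contDiffAt_chartBlocks ρ b W z hz) x) μ

lemma norm_iteratedFDeriv_chartBlocks_apply_le
    (hc : ∀ j, ‖𝐃 j (linkChart ρ (W x μ).1) (t, 0, 0)‖ ≤ c j)
    (hu : ‖(W x μ).1 - 1‖ < 1) (j : ℕ) :
    ‖𝐃 j (fun z => chartBlocks ρ W z x μ) (t, 0, 0)‖ ≤ c j := by
  have e : linkProj (N := N) x μ ((t, 0, 0) : ChartSpace n N) = (t, 0, 0) := rfl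
  have h0 : SmoothAt (linkChart ρ (W x μ).1) (t, 0, 0) :=
    (contDiffAt_linkChart_uncurried ρ hu).comp (t, (0 : su N), (0 : su N))
      (f := fun z => (z, (W x μ).1)) (by fun_prop)
  have h1 := norm_iteratedFDeriv_comp_affine_le (linkProj (N := N) x μ) (norm_linkProj_le x μ) 0
    (f := linkChart ρ (W x μ).1) (y := ((t, 0, 0) : ChartSpace n N))
    (by rw [zero_add, e]; exact h0) j
  simp only [zero_add] at h1
  exact h1.trans (hc j)

lemma norm_iteratedFDeriv_chartBlocks_le (hc0 : ∀ j, 0 ≤ c j)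
    (hc : ∀ x μ j, ‖𝐃 j (linkChart ρ (W x μ).1) (t, 0, 0)‖ ≤ c j)
    (hu : ∀ x μ, ‖(W x μ).1 - 1‖ < 1) (ht : (t, 0, 0) ∈ chartDomain ρ b W) (j : ℕ) :
    ‖𝐃 j (chartBlocks ρ W) (t, 0, 0)‖ ≤ c j :=
  norm_iteratedFDeriv_pi_le
    (fun x => contDiffAt_pi.1 (contDiffAt_chartBlocks ρ b W _ ht) x) (hc0 j) fun x =>
    norm_iteratedFDeriv_pi_le (fun μ => contDiffAt_chartBlocks_apply ht x μ) (hc0 j) fun μ =>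
      norm_iteratedFDeriv_chartBlocks_apply_le (hc x μ) (hu x μ) j

/-- The variation of a single link. -/
abbrev singlePert (x : Site n) (μ : Fin 4) (X : su N) : Pert n N := Pi.single x (Pi.single μ X)

lemma norm_singlePert_le (x : Site n) (μ : Fin 4) (X : su N) : ‖singlePert x μ X‖ ≤ ‖X‖ := by
  refine (pi_norm_le_iff_of_nonneg (norm_nonneg _)).2 fun y => ?_
  rcases eq_or_ne y x with rfl | hy
  · rw [singlePert, Pi.single_eq_same]
    refine (pi_norm_le_iff_of_nonneg (norm_nonneg _)).2 fun ν => ?_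
    rcases eq_or_ne ν μ with rfl | hν
    · rw [Pi.single_eq_same]
    · rw [Pi.single_eq_of_ne hν, norm_zero]; exact norm_nonneg _
  · rw [singlePert, Pi.single_eq_of_ne hy, norm_zero]; exact norm_nonneg _

/-- A variation of a single link changes the represented link variables on that link only. -/
lemma fderiv_chartBlocks_single {z : ChartSpace n N} (hz : z ∈ chartDomain ρ b W) (x : Site n)
    (μ : Fin 4) (X : su N) :
    𝐝 (chartBlocks ρ W) z (0, 0, singlePert x μ X) = Pi.single x (Pi.single μ
      (𝐝 (fun z => chartBlocks ρ W z x μ) z (0, 0, singlePert x μ X))) := by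
  have hd : HasFDerivAt (chartBlocks ρ W) _ z := (contDiffAt_chartBlocks ρ b W z hz).hasFD
  have hc : ∀ y ν, 𝐝 (fun z => chartBlocks ρ W z y ν) z (0, 0, singlePert x μ X) =
      𝐝 (chartBlocks ρ W) z (0, 0, singlePert x μ X) y ν := by
    intro y ν
    have h := hasFDerivAt_pi'.1 (hasFDerivAt_pi'.1 hd y) ν
    rw [h.fderiv]
    rfl
  have h0 : ∀ y ν, singlePert x μ X y ν = 0 →
      𝐝 (chartBlocks ρ W) z (0, 0, singlePert x μ X) y ν = 0 := by
    intro y ν hX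
    have e1 : (fun z => chartBlocks ρ W z y ν) =
        fun z => linkChart ρ (W y ν).1 (linkProj y ν z) := rfl
    have hl : DifferentiableAt ℝ (linkChart ρ (W y ν).1) (linkProj y ν z) := by
      have h3 : SmoothAt (linkFn ρ) ((chartMap W z).1, (chartMap W z).2 y ν) :=
        contDiffAt_linkFn ρ (hz.1 y ν)
      have h4 : ContDiff ℝ ∞ fun z : ℝ × su N × su N =>
          (z.1, exp z.2.2.1 * (exp z.2.1.1 * (W y ν).1)) :=
        (contDiff_shiftedLink (N := N)).comp (contDiff_id.prodMk contDiff_const)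
      exact (ContDiffAt.comp (linkProj y ν z) (g := linkFn ρ) h3 h4.contDiffAt).differentiableAt
        (by simp)
    have hf : 𝐝 (fun z => linkChart ρ (W y ν).1 (linkProj y ν z)) z =
        (𝐝 (linkChart ρ (W y ν).1) (linkProj y ν z)).comp (linkProj y ν) :=
      (hl.hasFDerivAt.comp z (linkProj y ν).hasFDerivAt).fderiv
    rw [← hc, e1, hf]
    have e2 : linkProj y ν ((0, 0, singlePert x μ X) : ChartSpace n N) = 0 := by
      rw [linkProj_apply]
      exact Prod.ext rfl (Prod.ext rfl hX)
    rw [ContinuousLinearMap.comp_apply, e2, map_zero]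
  funext y ν
  rcases eq_or_ne y x with rfl | hy
  · rw [Pi.single_eq_same]
    rcases eq_or_ne ν μ with rfl | hν
    · rw [Pi.single_eq_same, hc]
    · rw [Pi.single_eq_of_ne hν, h0 y ν (by rw [singlePert, Pi.single_eq_same,
        Pi.single_eq_of_ne hν])]
  · rw [Pi.single_eq_of_ne hy, h0 y ν (by rw [singlePert, Pi.single_eq_of_ne hy]; rfl)]
    rfl

lemma jetNorm_blockA_le {E : Type*} [NormedAddCommGroup E] [NormedSpace ℝ E]
    {φ : E → Blocks n d} {z : E} (hφ : SmoothAt φ z) {k : ℕ} {σ : ℝ} (hσ : 0 ≤ σ) :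
    jetNorm k σ (fun y => blockA b (φ y)) z ≤ 8 * jetNorm k σ φ z + 3 := by
  have h1 : SmoothAt (fun y => hoppingL b (φ y)) z :=
    ContDiffAt.comp z (g := hoppingL b) (hoppingL (n := n) (d := d) b).contDiff.contDiffAt hφ
  refine (jetNorm_sub_le (f := fun y => hoppingL b (φ y)) (g := fun _ => 3) hσ h1
    contDiffAt_const).trans ?_
  rw [jetNorm_const]
  refine add_le_add ((jetNorm_clm_comp_le hσ _ hφ).trans ?_) norm_three_op_le
  exact mul_le_mul_of_nonneg_right (norm_hoppingL_le b) (jetNorm_nonneg hσ)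

lemma jetNorm_gapB_le {E : Type*} [NormedAddCommGroup E] [NormedSpace ℝ E]
    {φ : E → Blocks n d} {z : E} (hφ : SmoothAt φ z) {k : ℕ} {σ : ℝ} (hσ : 0 ≤ σ) :
    jetNorm k σ (fun y => gapB b (φ y)) z ≤ 1 + (8 * jetNorm k σ φ z + 3) ^ 2 := by
  have cA : SmoothAt (fun y => blockA b (φ y)) z := (contDiff_blockA b).contDiffAt.comp z hφ
  have c5 : SmoothAt (fun y => gamma5 n d * blockA b (φ y)) z := contDiffAt_const.mul cA
  have b1 : jetNorm k σ (fun y => gamma5 n d * blockA b (φ y)) z ≤ 8 * jetNorm k σ φ z + 3 :=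
    (jetNorm_gamma5_mul_le cA hσ).trans (jetNorm_blockA_le hφ hσ)
  simp only [gapB_eq]
  refine (jetNorm_sub_le hσ contDiffAt_const ((c5.mul c5).const_smul _)).trans ?_
  rw [jetNorm_const]
  refine add_le_add norm_one_matrix_le ((jetNorm_smul_le (𝕜 := ℝ) hσ _ (c5.mul c5)).trans ?_)
  refine (mul_le_of_le_one_left (jetNorm_nonneg hσ) (by norm_num)).trans ?_
  refine (jetNorm_mul_le c5 c5 hσ).trans ?_
  rw [sq]
  exact mul_le_mul b1 b1 (jetNorm_nonneg hσ) ((jetNorm_nonneg hσ).trans b1)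

lemma jetNorm_traceA_single_le (hc : ∀ x μ j, ‖𝐃 j (linkChart ρ (W x μ).1) (t, 0, 0)‖ ≤ c j)
    (hu : ∀ x μ, ‖(W x μ).1 - 1‖ < 1) (ht : (t, 0, 0) ∈ chartDomain ρ b W) (x : Site n)
    (μ : Fin 4) (X : su N) (k : ℕ) {σ : ℝ} (hσ : 0 < σ) :
    jetNorm k σ Θ[𝐓, fun y => blockA b (chartBlocks ρ W y), (0, 0, singlePert x μ X)] (t, 0, 0) ≤
      128 * d ^ 2 * ((k + 1) / σ * jetSum c (k + 1) σ) * ‖X‖ := by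
  have hev : Θ[𝐓, fun y => blockA b (chartBlocks ρ W y), (0, 0, singlePert x μ X)]
      =ᶠ[𝓝 (t, 0, 0)] fun y => linkTrace b x μ
        (𝐝 (fun z => chartBlocks ρ W z x μ) y (0, 0, singlePert x μ X)) := by
    filter_upwards [(isOpen_chartDomain ρ b W).mem_nhds ht] with y hy
    have hd : HasFDerivAt (chartBlocks ρ W) _ y := (contDiffAt_chartBlocks ρ b W y hy).hasFD
    have hA : HasFDerivAt (fun y => blockA b (chartBlocks ρ W y))
        ((hoppingL b).comp (𝐝 (chartBlocks ρ W) y)) y :=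
      ((hoppingL b).hasFDerivAt.comp y hd).sub_const 3
    rw [hA.fderiv, ContinuousLinearMap.comp_apply, fderiv_chartBlocks_single hy]
    rfl
  have hcx := contDiffAt_chartBlocks_apply ht x μ
  rw [jetNorm_congr hev]
  refine (jetNorm_clm_comp_le hσ.le _ (contDiffAt_fderiv_apply hcx _)).trans ?_
  have h1 := jetNorm_fderiv_apply_le hcx ((0, 0, singlePert x μ X) : ChartSpace n N) (k := k) hσ
  have hv : ‖((0, 0, singlePert x μ X) : ChartSpace n N)‖ ≤ ‖X‖ :=
    norm_prod_le_iff.2 ⟨by simp, norm_prod_le_iff.2 ⟨by simp, norm_singlePert_le x μ X⟩⟩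
  have h2 : jetNorm (k + 1) σ (fun z => chartBlocks ρ W z x μ) (t, 0, 0) ≤ jetSum c (k + 1) σ :=
    jetNorm_le_jetSum hσ.le fun j => norm_iteratedFDeriv_chartBlocks_apply_le (hc x μ) (hu x μ) j
  have h3 := norm_linkTrace_le (d := d) b x μ
  have h4 := jetNorm_nonneg (k := k + 1) hσ.le (f := fun z => chartBlocks ρ W z x μ)
    (z := (t, 0, 0))
  calc _ ≤ 128 * (d : ℝ) ^ 2 * ((k + 1) / σ * ‖X‖ * jetSum c (k + 1) σ) := by
        refine mul_le_mul h3 (h1.trans ?_) (jetNorm_nonneg hσ.le) (by positivity)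
        gcongr
    _ = _ := by ring

end ChartBounds

section Truncation

/-- A geometric bound of the derivatives of the powers, with a slightly larger ratio. -/
lemma exists_mul_pow_le {q p : ℝ} (hq : 0 < q) (hqp : q < p) :
    ∃ M : ℝ, 0 ≤ M ∧ ∀ m : ℕ, m * q ^ (m - 1) ≤ M * p ^ m := by
  have hp : 0 < p := hq.trans hqp
  have ht := tendsto_self_mul_const_pow_of_lt_one (r := q / p) (by positivity)
    ((div_lt_one hp).2 hqp)
  obtain ⟨M, hM⟩ := ht.bddAbove_range
  have hM' : ∀ m : ℕ, m * (q / p) ^ m ≤ M := fun m => hM ⟨m, rfl⟩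
  have hM0 : 0 ≤ M := by simpa using hM' 0
  refine ⟨q⁻¹ * M, by positivity, fun m => ?_⟩
  rcases m with _ | m
  · simp; positivity
  · have h1 := hM' (m + 1)
    rw [Nat.add_sub_cancel]
    calc ((m + 1 : ℕ) : ℝ) * q ^ m
        = q⁻¹ * ((m + 1 : ℕ) * (q / p) ^ (m + 1)) * p ^ (m + 1) := by rw [div_pow]; field_simp; ring
      _ ≤ q⁻¹ * M * p ^ (m + 1) := by gcongr

variable {N d : ℕ} [NeZero N] {R : Rep N d} {ρ : su N →ₗ[ℝ] Mat d} {δ : ℝ}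

/-- Bounds of the jets that do not depend on the lattice and on the link field. -/
lemma SmallRep.exists_jetBound (h : SmallRep R ρ δ) (k : ℕ) : ∃ σ α T : ℝ, 0 < σ ∧ 0 ≤ α ∧
    0 ≤ T ∧ ∀ (n : ℕ) [NeZero n] (b : Fin 4 → Circle), ∀ W ∈ smoothFields n R δ,
      ∀ t ∈ 𝕀, ∀ x μ X, JetBound b (chartBlocks ρ W) (chartDomain ρ b W) (t, 0, 0)
        (0, 0, singlePert x μ X) k σ α (249 / 250) (T * ‖X‖) := by
  choose c hc0 hc using exists_bound_linkChart (N := N) ρ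
  obtain ⟨σ, hσ, hlt⟩ := exists_jetNorm_lt (k + 1)
    (fun j => j.factorial * (1 + (8 * jetSum c j 1 + 3) ^ 2)) (q := 199 / 200) (q' := 249 / 250)
    (by norm_num)
  have hs := jetSum_nonneg hc0 (k + 1) hσ.le
  refine ⟨σ, 8 * jetSum c (k + 1) σ + 3, 128 * d ^ 2 * ((k + 1) / σ * jetSum c (k + 1) σ), hσ,
    by positivity, by positivity, fun n _ b W hW t ht x μ X => ?_⟩
  have hu : ∀ x μ, ‖(W x μ).1 - 1‖ < 1 / 80 := fun x μ => h.norm_sub_one_lt (hW x μ)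
  have hu' : ∀ x μ, ‖(W x μ).1 - 1‖ < 1 := fun x μ => (hu x μ).trans (by norm_num)
  have hmap : chartMap W ((t, 0, 0) : ChartSpace n N) = (t, coeConfig W) := by
    rw [chartMap_shift, shift_zero]
  have hmem : ((t, 0, 0) : ChartSpace n N) ∈ chartDomain ρ b W := by
    show chartMap W _ ∈ familyDomain (n := n) ρ b
    rw [hmap]
    exact h.mem_familyDomain b hW ht
  have hcW : ∀ x μ j, ‖𝐃 j (linkChart ρ (W x μ).1) (t, 0, 0)‖ ≤ c j :=
    fun x μ j => hc j t ht _ (hu x μ).le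
  have hφ : SmoothAt (chartBlocks ρ W) (t, 0, 0) := contDiffAt_chartBlocks ρ b W _ hmem
  have hder := norm_iteratedFDeriv_chartBlocks_le hc0 hcW hu' hmem
  refine ⟨isOpen_chartDomain ρ b W, contDiffAt_chartBlocks ρ b W, fun y hy => hy.2, hmem, hσ, ?_,
    ?_, jetNorm_traceA_single_le hcW hu' hmem x μ X k hσ⟩
  · refine (jetNorm_blockA_le hφ hσ.le).trans ?_
    have := jetNorm_le_jetSum (k := k + 1) hσ.le hder
    linarith
  · refine (hlt _ _ _ _ ?_ fun j _ _ => ?_).le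
    · show ‖gapB b (blockFn ρ (chartMap W _))‖ ≤ _
      rw [hmap, ← h.repBlocks_powConfig hW]
      exact norm_gapB_le b (h.norm_repBlocks_sub_one_le (h.powConfig_mem hW ht))
    · have h1 := norm_iteratedFDeriv_le_jetNorm (le_refl j) one_pos
        (fun y => gapB b (chartBlocks ρ W y)) ((t, 0, 0) : ChartSpace n N)
      rw [one_pow, div_one] at h1
      refine h1.trans (mul_le_mul_of_nonneg_left ?_ (by positivity))
      refine (jetNorm_gapB_le hφ zero_le_one).trans ?_
      have h2 := jetNorm_le_jetSum (k := j) zero_le_one hder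
      have h3 := jetNorm_nonneg (k := j) zero_le_one (f := chartBlocks ρ W) (z := (t, 0, 0))
      gcongr

variable {n : ℕ} [NeZero n]

/-- The component of `∫₀¹ dt Tr {P_t [∂_t P_t, δ P_t]}` that corresponds to the variation of a
single link, for a family of operators `Q` in place of the projectors. -/
def linkForm (ρ : su N →ₗ[ℝ] Mat d) (Q : Blocks n d → Op n d) (x : Site n)
    (μ : Fin 4) (X : su N) (U : Config n N) : ℂ :=
  ∫ t in (0 : ℝ)..1, curvature 𝐓 (fun z => Q (blockFn ρ z)) (t, coeConfig U) (1, 0)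
    (0, tangent 1 (singlePert x μ X) (coeConfig U))

lemma linkForm_shift {b : Fin 4 → Circle} {Q : Blocks n d → Op n d}
    (hQ : ∀ z ∈ familyDomain (N := N) (n := n) ρ b, SmoothAt (fun z => Q (blockFn ρ z)) z)
    (x : Site n) (μ : Fin 4) (X : su N) {W : Config n N} {Y : Pert n N}
    (hY : ∀ t ∈ 𝕀, (t, Y, 0) ∈ chartDomain ρ b W) :
    linkForm ρ Q x μ X (shift Y W) = ∫ t in (0 : ℝ)..1,
      curvature 𝐓 (fun z => Q (chartBlocks ρ W z)) (t, Y, 0) (1, 0, 0)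
        (0, 0, singlePert x μ X) := by
  refine unitIntegral_congr fun t ht => ?_
  have h1 := curvature_comp (tr := 𝐓) (P := fun z => Q (blockFn ρ z))
    (c := chartMap W) (z := (t, Y, 0)) ((hQ _ (hY t ht)).differentiableAt (by simp))
    ((contDiff_chartMap W).contDiffAt.differentiableAt (by simp)) (1, 0, 0)
    (0, 0, singlePert x μ X)
  rw [(fderiv_chartMap W t Y 0).1, (fderiv_chartMap W t Y _).2, chartMap_shift] at h1
  exact h1.symm

lemma contDiffAt_truncP_blockFn {b : Fin 4 → Circle} (K : ℕ) {z : ℝ × Blocks n N}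
    (hz : z ∈ familyDomain (n := n) ρ b) :
    SmoothAt (fun z => truncP b K (blockFn (n := n) ρ z)) z :=
  (contDiff_truncP b K).contDiffAt.comp z (contDiffAt_blockFn ρ hz.1)

/-- The truncation error of the measure current decays exponentially with the order of the
truncation, uniformly in the lattice and the link field. -/
lemma SmallRep.exists_truncation_bound (h : SmallRep R ρ δ) :
    ∃ p : ℝ, 0 < p ∧ p < 1 ∧ ∃ C : ℕ → ℝ, (∀ k, 0 ≤ C k) ∧ ∀ (n : ℕ) [NeZero n]
      (b : Fin 4 → Circle) (x : Site n) (μ : Fin 4) (X : su N) (K k : ℕ),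
      ∀ W ∈ smoothFields n R δ, ‖𝐃 k (fun Y : Pert n N =>
        linkForm ρ (blockP b) x μ X (shift Y W) - linkForm ρ (truncP b K) x μ X (shift Y W)) 0‖ ≤
        C k * ‖X‖ * p ^ K := by
  obtain ⟨M, hM0, hM⟩ := exists_mul_pow_le (q := 249 / 250) (p := 499 / 500) (by norm_num)
    (by norm_num)
  choose σ α T hσ hα hT hJ using h.exists_jetBound
  refine ⟨499 / 500, by norm_num, by norm_num, fun k => k.factorial / σ k ^ k *
    (14 * ((2 * α k ^ 2 * M + 1) / (1 - 499 / 500)) * ((k + 1) / σ k) *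
      (1 + α k / (1 - 499 / 500)) ^ 2 * T k), fun k => ?_, fun n _ b x μ X K k W hW => ?_⟩
  · have := hα k
    have := hT k
    have := hσ k
    norm_num
    positivity
  have hj0 := hJ k n b W hW 0 (by simp) x μ X
  set ΔP : ChartSpace n N → ℂ := fun z => curvature 𝐓 (fun z => blockP b (chartBlocks ρ W z)) z
    (1, 0, 0) (0, 0, singlePert x μ X)
  set ΔT : ChartSpace n N → ℂ := fun z => curvature 𝐓 (fun z => truncP b K (chartBlocks ρ W z)) z
    (1, 0, 0) (0, 0, singlePert x μ X)
  set Δ : ChartSpace n N → ℂ := fun z => ΔP z - ΔT z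
  have hΔPs : ∀ z ∈ chartDomain ρ b W, SmoothAt ΔP z := fun z hz =>
    contDiffAt_curvature (hj0.smoothP z hz) _ _
  have hΔTs : ∀ z ∈ chartDomain ρ b W, SmoothAt ΔT z := fun z hz =>
    contDiffAt_curvature (hj0.smoothTrunc K z hz) _ _
  have hΔs : ∀ z ∈ chartDomain ρ b W, SmoothAt Δ z := fun z hz => (hΔPs z hz).sub (hΔTs z hz)
  let L : ℝ × Pert n N →L[ℝ] ChartSpace n N := (fst ℝ _ _).prod ((snd ℝ _ _).prod 0)
  let O : Set (ℝ × Pert n N) := L ⁻¹' chartDomain ρ b W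
  have hO : IsOpen O := (isOpen_chartDomain ρ b W).preimage L.continuous
  have h0 : ∀ t ∈ 𝕀, (t, (0 : Pert n N)) ∈ O := fun t ht =>
    (hJ k n b W hW t ht x μ X).mem
  have hsm : ∀ f : ChartSpace n N → ℂ, (∀ z ∈ chartDomain ρ b W, SmoothAt f z) →
      ∀ w ∈ O, SmoothAt (fun w => f (L w)) w := fun f hf w hw =>
    ContDiffAt.comp w (g := f) (hf (L w) hw) L.contDiff.contDiffAt
  have hev : (fun Y : Pert n N =>
      linkForm ρ (blockP b) x μ X (shift Y W) - linkForm ρ (truncP b K) x μ X (shift Y W))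
      =ᶠ[𝓝 0] fun Y => ∫ t in (0 : ℝ)..1, Δ (L (t, Y)) := by
    filter_upwards [(isOpen_forall_unitInterval hO).mem_nhds h0] with Y hY
    rw [linkForm_shift (fun z hz => contDiffAt_projFamily ρ b hz) x μ X hY,
      linkForm_shift (fun z hz => contDiffAt_truncP_blockFn K hz) x μ X hY]
    exact (integral_sub (f := fun t => ΔP (L (t, Y))) (g := fun t => ΔT (L (t, Y)))
      (intervalIntegrable_slice (G := fun w => ΔP (L w)) (O := O) (hsm ΔP hΔPs) hY)
      (intervalIntegrable_slice (G := fun w => ΔT (L w)) (O := O) (hsm ΔT hΔTs) hY)).symm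
  rw [iteratedFDeriv_congr_of_eventuallyEq hev]
  refine norm_iteratedFDeriv_unitIntegral_le (G := fun w => Δ (L w)) hO (hsm _ hΔs) h0 k
    fun t ht => ?_
  have hj := hJ k n b W hW t ht x μ X
  let L' : Pert n N →L[ℝ] ChartSpace n N := (0 : Pert n N →L[ℝ] ℝ).prod
    ((ContinuousLinearMap.id ℝ _).prod 0)
  have hL' : ‖L'‖ ≤ 1 := opNorm_le_bound _ zero_le_one fun Y => by
    rw [one_mul]
    exact norm_prod_le_iff.2 ⟨by simp [L'], norm_prod_le_iff.2 ⟨le_rfl, by simp [L']⟩⟩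
  have e0 : ((t, 0, 0) : ChartSpace n N) + L' 0 = (t, 0, 0) := by simp
  have e1 : (fun Y => Δ (L (t, Y))) = fun Y => Δ ((t, 0, 0) + L' Y) := by
    funext Y
    congr 1
    exact Prod.ext (add_zero t).symm (Prod.ext (zero_add Y).symm (add_zero _).symm)
  have h1 := norm_iteratedFDeriv_comp_affine_le L' hL' (t, 0, 0) (f := Δ) (y := 0)
    (by rw [e0]; exact hΔs _ hj.mem) k
  rw [e0, ← e1] at h1
  refine h1.trans ((norm_iteratedFDeriv_le_jetNorm le_rfl (hσ k) _ _).trans ?_)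
  have hu : ‖((1, 0, 0) : ChartSpace n N)‖ ≤ 1 :=
    norm_prod_le_iff.2 ⟨by simp, norm_prod_le_iff.2 ⟨by simp, by simp⟩⟩
  have h2 : jetNorm k (σ k) Δ (t, 0, 0) ≤ _ :=
    hj.jetNorm_curvature_error_le (by norm_num) (by norm_num) hM0 hM hu K
  have h3 : 0 ≤ (k.factorial : ℝ) / σ k ^ k := by have := hσ k; positivity
  refine (mul_le_mul_of_nonneg_left h2 h3).trans (le_of_eq ?_)
  ring

end Truncation

/-! ### Locality of the truncated projectors -/

section SiteDist

variable {n : ℕ} [NeZero n]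

lemma siteDist_self (x : Site n) : siteDist x x = 0 := by simp [siteDist]

lemma siteDist_comm (x y : Site n) : siteDist x y = siteDist y x :=
  sum_congr rfl fun μ _ => by rw [← neg_sub (y μ) (x μ), ZMod.natAbs_valMinAbs_neg]

lemma siteDist_triangle (x y z : Site n) : siteDist x z ≤ siteDist x y + siteDist y z := by
  rw [siteDist, siteDist, siteDist, ← sum_add_distrib]
  refine sum_le_sum fun μ _ => ?_
  have := ZMod.natAbs_valMinAbs_add_le (x μ - y μ) (y μ - z μ)
  rw [sub_add_sub_cancel] at this
  exact this.trans (Int.natAbs_add_le _ _)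

lemma siteDist_step_le (x : Site n) (μ : Fin 4) : siteDist x (step x μ) ≤ 1 := by
  rw [siteDist_comm, siteDist, sum_eq_single μ]
  · rw [step, Pi.add_apply, add_sub_cancel_left, Pi.single_eq_same, ZMod.valMinAbs_natAbs_eq_min]
    refine (min_le_left _ _).trans ?_
    rw [ZMod.val_one_eq_one_mod]
    exact Nat.mod_le 1 n
  · intro ν _ hν
    rw [step, Pi.add_apply, add_sub_cancel_left, Pi.single_eq_of_ne hν]
    simp
  · simp

end SiteDist

section LocalOp

variable {n d : ℕ} [NeZero n] {b : Fin 4 → Circle}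

/-- The matrix elements `(p, q)` of `Q φ` vanish unless the distance of `p` and `q` is at most `s`,
and they depend only on the link variables within distance `s` of `p`. -/
structure IsLocalOp (s : ℕ) (Q : Blocks n d → Op n d) : Prop where
  band : ∀ φ p q, s < siteDist p.1 q.1 → Q φ p q = 0
  congr : ∀ φ φ' p, (∀ y ν, siteDist p.1 y ≤ s → φ y ν = φ' y ν) → ∀ q, Q φ p q = Q φ' p q

/-- A row of a product is determined by a row of the first factor and by the nearby rows of the
second. -/
lemma mul_apply_congr {s : ℕ} {M M' L L' : Op n d} {p : Idx n d}
    (hb : ∀ q, s < siteDist p.1 q.1 → M p q = 0) (hM : ∀ q, M p q = M' p q)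
    (hL : ∀ q, siteDist p.1 q.1 ≤ s → ∀ r, L q r = L' q r) (r : Idx n d) :
    (M * L) p r = (M' * L') p r := by
  rw [Matrix.mul_apply, Matrix.mul_apply]
  refine sum_congr rfl fun q _ => ?_
  rcases le_or_gt (siteDist p.1 q.1) s with h | h
  · rw [hM, hL q h]
  · rw [← hM, hb q h, zero_mul, zero_mul]

namespace IsLocalOp

variable {s s' : ℕ} {Q Q' : Blocks n d → Op n d}

lemma mono (h : IsLocalOp s Q) (hs : s ≤ s') : IsLocalOp s' Q :=
  ⟨fun φ p q hpq => h.band φ p q (hs.trans_lt hpq),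
    fun φ φ' p hφ => h.congr φ φ' p fun y ν hy => hφ y ν (hy.trans hs)⟩

lemma const {M : Op n d} (hM : ∀ p q, s < siteDist p.1 q.1 → M p q = 0) : IsLocalOp s fun _ => M :=
  ⟨fun _ p q h => hM p q h, fun _ _ _ _ _ => rfl⟩

lemma add (h : IsLocalOp s Q) (h' : IsLocalOp s Q') : IsLocalOp s fun φ => Q φ + Q' φ :=
  ⟨fun φ p q hpq => by rw [Matrix.add_apply, h.band φ p q hpq, h'.band φ p q hpq, add_zero],
    fun φ φ' p hφ q => by
      rw [Matrix.add_apply, Matrix.add_apply, h.congr φ φ' p hφ, h'.congr φ φ' p hφ]⟩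

lemma csmul (h : IsLocalOp s Q) (c : ℂ) : IsLocalOp s fun φ => c • Q φ :=
  ⟨fun φ p q hpq => by rw [Matrix.smul_apply, h.band φ p q hpq, smul_zero],
    fun φ φ' p hφ q => by rw [Matrix.smul_apply, Matrix.smul_apply, h.congr φ φ' p hφ]⟩

lemma rsmul (h : IsLocalOp s Q) (c : ℝ) : IsLocalOp s fun φ => c • Q φ :=
  ⟨fun φ p q hpq => by rw [Matrix.smul_apply, h.band φ p q hpq, smul_zero],
    fun φ φ' p hφ q => by rw [Matrix.smul_apply, Matrix.smul_apply, h.congr φ φ' p hφ]⟩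

lemma sub (h : IsLocalOp s Q) (h' : IsLocalOp s Q') : IsLocalOp s fun φ => Q φ - Q' φ := by
  have := h.add (h'.rsmul (-1))
  simpa only [neg_smul, one_smul, ← sub_eq_add_neg] using this

lemma mul (h : IsLocalOp s Q) (h' : IsLocalOp s' Q') : IsLocalOp (s + s') fun φ => Q φ * Q' φ := by
  refine ⟨fun φ p q hpq => ?_, fun φ φ' p hφ q => ?_⟩
  · rw [Matrix.mul_apply]
    refine sum_eq_zero fun r _ => ?_
    rcases le_or_gt (siteDist p.1 r.1) s with hr | hr
    · have := siteDist_triangle p.1 r.1 q.1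
      rw [h'.band φ r q (by omega), mul_zero]
    · rw [h.band φ p r hr, zero_mul]
  · refine mul_apply_congr (h.band φ p) (h.congr φ φ' p fun y ν hy => hφ y ν (by omega))
      (fun r hr => h'.congr φ φ' r fun y ν hy => hφ y ν ?_) q
    have := siteDist_triangle p.1 r.1 y
    omega

lemma sum {ι : Type*} (t : Finset ι) {Q : ι → Blocks n d → Op n d}
    (h : ∀ i ∈ t, IsLocalOp s (Q i)) : IsLocalOp s fun φ => ∑ i ∈ t, Q i φ :=
  ⟨fun φ p q hpq => by rw [Matrix.sum_apply]; exact sum_eq_zero fun i hi => (h i hi).band φ p q hpq,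
    fun φ φ' p hφ q => by
      rw [Matrix.sum_apply, Matrix.sum_apply]
      exact sum_congr rfl fun i hi => (h i hi).congr φ φ' p hφ q⟩

lemma one : IsLocalOp (n := n) (d := d) s fun _ => 1 :=
  const fun p q h => one_apply_ne (by
    rintro rfl
    rw [siteDist_self] at h
    exact absurd h (Nat.not_lt_zero _))

lemma pow (h : IsLocalOp s Q) (m : ℕ) : IsLocalOp (m * s) fun φ => Q φ ^ m := by
  induction m with
  | zero => simpa using one (n := n) (d := d) (s := 0)
  | succ m ih =>
    have := ih.mul h
    simpa only [pow_succ, add_mul, one_mul] using this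

lemma spinOp (M : Mat 4) : IsLocalOp (n := n) (d := d) s fun _ => LatticeWeyl.spinOp n d M :=
  const fun p q h => by
    have hpq : p.1 ≠ q.1 := fun e => by
      rw [e, siteDist_self] at h
      exact absurd h (Nat.not_lt_zero _)
    rw [LatticeWeyl.spinOp, kroneckerMap_apply, one_apply_ne hpq, zero_mul]

end IsLocalOp

variable (b)

lemma isLocalOp_blockShift (μ : Fin 4) : IsLocalOp 1 fun φ : Blocks n d => blockShift b φ μ := by
  refine ⟨fun φ p q hpq => ?_, fun φ φ' p hφ q => ?_⟩
  · rw [blockShift, if_neg]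
    rintro ⟨h, -⟩
    rw [h] at hpq
    exact absurd (siteDist_step_le p.1 μ) (by omega)
  · rw [blockShift, blockShift, hφ p.1 μ (by rw [siteDist_self]; omega)]

lemma isLocalOp_blockShift_conjTranspose (μ : Fin 4) :
    IsLocalOp 1 fun φ : Blocks n d => (blockShift b φ μ)ᴴ := by
  have hd : ∀ p q : Idx n d, 1 < siteDist p.1 q.1 → ¬(p.1 = step q.1 μ ∧ q.2.1 = p.2.1) := by
    rintro p q hpq ⟨h, -⟩
    rw [h, siteDist_comm] at hpq
    exact absurd (siteDist_step_le q.1 μ) (by omega)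
  refine ⟨fun φ p q hpq => ?_, fun φ φ' p hφ q => ?_⟩
  · rw [conjTranspose_apply, blockShift, if_neg (hd p q hpq), star_zero]
  · rw [conjTranspose_apply, conjTranspose_apply, blockShift, blockShift]
    rcases le_or_gt (siteDist p.1 q.1) 1 with h | h
    · rw [hφ q.1 μ h]
    · rw [if_neg (hd p q h), if_neg (hd p q h)]

lemma isLocalOp_gamma5 (s : ℕ) : IsLocalOp (n := n) (d := d) s fun _ => gamma5 n d :=
  IsLocalOp.spinOp _

lemma isLocalOp_blockA : IsLocalOp 1 (blockA (n := n) (d := d) b) := by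
  have h3 : IsLocalOp (n := n) (d := d) 1 fun _ => (3 : Op n d) := by
    have := (IsLocalOp.one (n := n) (d := d) (s := 1)).rsmul 3
    have e : (3 : Op n d) = (3 : ℝ) • 1 := by
      rw [← Algebra.algebraMap_eq_smul_one]; exact (map_ofNat (algebraMap ℝ (Op n d)) 3).symm
    rw [e]; exact this
  have h1 : ∀ μ, IsLocalOp (n := n) (d := d) 1 fun φ =>
      (1 - spinOp n d (gamma μ)) * blockShift b φ μ := fun μ => by
    simpa only [zero_add] using
      ((IsLocalOp.one (s := 0)).sub (IsLocalOp.spinOp _)).mul (isLocalOp_blockShift b μ)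
  have h2 : ∀ μ, IsLocalOp (n := n) (d := d) 1 fun φ =>
      (1 + spinOp n d (gamma μ)) * (blockShift b φ μ)ᴴ := fun μ => by
    simpa only [zero_add] using ((IsLocalOp.one (s := 0)).add (IsLocalOp.spinOp _)).mul
        (isLocalOp_blockShift_conjTranspose b μ)
  exact ((IsLocalOp.sum univ fun μ _ => (h1 μ).add (h2 μ)).csmul _).sub h3

lemma isLocalOp_gamma5_mul_blockA : IsLocalOp 1 fun φ : Blocks n d => gamma5 n d * blockA b φ := by
  simpa only [zero_add] using (isLocalOp_gamma5 0).mul (isLocalOp_blockA b)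

lemma isLocalOp_gapB : IsLocalOp 2 (gapB (n := n) (d := d) b) := by
  have h := (IsLocalOp.one (n := n) (d := d)).sub
    (((isLocalOp_gamma5_mul_blockA b).mul (isLocalOp_gamma5_mul_blockA b)).rsmul (128 : ℝ)⁻¹)
  simp only [gamma5_mul_blockA_sq] at h
  exact h

lemma isLocalOp_truncP (K : ℕ) : IsLocalOp (2 * K + 1) (truncP (n := n) (d := d) b (K + 1)) := by
  have h1 : IsLocalOp (2 * K) fun φ : Blocks n d =>
      ∑ m ∈ range (K + 1), invSqrtCoeff m • gapB b φ ^ m :=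
    IsLocalOp.sum _ fun m hm => (((isLocalOp_gapB b).pow m).rsmul _).mono (by
      have := Finset.mem_range.1 hm
      omega)
  have h2 := (((isLocalOp_gamma5_mul_blockA b).mul h1).mono
    (s' := 2 * K + 1) (by omega)).rsmul (√128)⁻¹
  exact (IsLocalOp.one.sub h2).csmul _

end LocalOp

section LocalCurvature

variable {N n d : ℕ} [NeZero N] [NeZero n] {b : Fin 4 → Circle}
  {ρ : su N →ₗ[ℝ] Mat d} {Q : Blocks n d → Op n d} {s : ℕ}

lemma fderiv_entry {E : Type*} [NormedAddCommGroup E] [NormedSpace ℝ E] {f : E → Op n d} {z : E}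
    (hf : DifferentiableAt ℝ f z) (v : E) (p q : Idx n d) :
    𝐝 f z v p q = deriv (fun u : ℝ => f (z + u • v) p q) 0 := by
  have hl : HasDerivAt (fun u : ℝ => z + u • v) v 0 := by
    simpa using ((hasDerivAt_id (0 : ℝ)).smul_const v).const_add z
  have hf' : HasFDerivAt f (𝐝 f z) (z + (0 : ℝ) • v) := by
    rw [zero_smul, add_zero]; exact hf.hasFDerivAt
  have h := hf'.comp_hasDerivAt (0 : ℝ) hl
  have h2 : HasDerivAt (fun u : ℝ => f (z + u • v) p q) (𝐝 f z v p q) 0 :=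
    hasDerivAt_pi.1 (hasDerivAt_pi.1 h p) q
  exact h2.deriv.symm

/-- The link form of a local operator depends on the link variables in a neighbourhood of the
link only. -/
lemma linkForm_congr (hQ : IsLocalOp s Q) {U U' : Config n N} {x : Site n}
    (hd : ∀ t ∈ 𝕀, DifferentiableAt ℝ (fun z => Q (blockFn ρ z)) (t, coeConfig U))
    (hd' : ∀ t ∈ 𝕀, DifferentiableAt ℝ (fun z => Q (blockFn ρ z)) (t, coeConfig U'))
    (hU : ∀ y ν, siteDist x y ≤ 4 * s → U y ν = U' y ν) (μ : Fin 4) (X : su N) :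
    linkForm ρ Q x μ X U = linkForm ρ Q x μ X U' := by
  refine unitIntegral_congr fun t ht => ?_
  have hd := hd t ht
  have hd' := hd' t ht
  set P := fun z : ℝ × Blocks n N => Q (blockFn ρ z) with hP
  set w := fun V : Config n N => ((0, tangent 1 (singlePert x μ X) (coeConfig V)) : ℝ × Blocks n N)
    with hw
  have hlink : ∀ (r : ℝ) (M M' : Blocks n N) y ν, M y ν = M' y ν →
      blockFn (n := n) ρ (r, M) y ν = blockFn (n := n) ρ (r, M') y ν := by
    intro r M M' y ν h
    show linkFn ρ (r, M y ν) = linkFn ρ (r, M' y ν)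
    rw [h]
  -- agreement of the rows of the operator and of its two derivatives
  have hrow : ∀ p : Idx n d, siteDist x p.1 ≤ 3 * s → ∀ y ν, siteDist p.1 y ≤ s →
      U y ν = U' y ν := fun p hp y ν hy => hU y ν (by
    have := siteDist_triangle x p.1 y; omega)
  have hPr : ∀ p : Idx n d, siteDist x p.1 ≤ 3 * s → ∀ q,
      P (t, coeConfig U) p q = P (t, coeConfig U') p q := fun p hp q =>
    hQ.congr _ _ p (fun y ν hy => hlink t _ _ y ν (congrArg Subtype.val (hrow p hp y ν hy))) q
  have hTr : ∀ p : Idx n d, siteDist x p.1 ≤ 3 * s → ∀ q,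
      𝐝 P (t, coeConfig U) (1, 0) p q = 𝐝 P (t, coeConfig U') (1, 0) p q := by
    intro p hp q
    rw [fderiv_entry hd, fderiv_entry hd']
    congr 1
    funext u
    refine hQ.congr _ _ p (fun y ν hy => ?_) q
    refine hlink (t + u • 1) _ _ y ν ?_
    show coeConfig U y ν + u • (0 : Mat N) = coeConfig U' y ν + u • (0 : Mat N)
    rw [smul_zero, add_zero, add_zero]
    exact congrArg Subtype.val (hrow p hp y ν hy)
  have hDr : ∀ p : Idx n d, siteDist x p.1 ≤ s → ∀ q,
      𝐝 P (t, coeConfig U) (w U) p q = 𝐝 P (t, coeConfig U') (w U') p q := by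
    intro p hp q
    rw [fderiv_entry hd, fderiv_entry hd']
    congr 1
    funext u
    refine hQ.congr _ _ p (fun y ν hy => ?_) q
    have e : coeConfig U y ν = coeConfig U' y ν := congrArg Subtype.val (hrow p (by omega) y ν hy)
    refine hlink _ _ _ y ν ?_
    show coeConfig U y ν + u • tangent 1 (singlePert x μ X) (coeConfig U) y ν =
      coeConfig U' y ν + u • tangent 1 (singlePert x μ X) (coeConfig U') y ν
    rw [tangent_apply, tangent_apply, e]
  have hD0 : ∀ V : Config n N, DifferentiableAt ℝ P (t, coeConfig V) → ∀ p : Idx n d,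
      s < siteDist x p.1 → ∀ q, 𝐝 P (t, coeConfig V) (w V) p q = 0 := by
    intro V hV p hp q
    rw [fderiv_entry hV]
    have e : (fun u : ℝ => P ((t, coeConfig V) + u • w V) p q) =
        fun _ => P (t, coeConfig V) p q := by
      funext u
      refine hQ.congr _ _ p (fun y ν hy => ?_) q
      have hyx : y ≠ x := by
        rintro rfl
        rw [siteDist_comm] at hp
        omega
      refine (hlink (t + u • 0) _ (coeConfig V) y ν ?_).trans (by rw [smul_zero, add_zero])
      show coeConfig V y ν + u • tangent 1 (singlePert x μ X) (coeConfig V) y ν = coeConfig V y ν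
      rw [tangent_apply, singlePert, Pi.single_eq_of_ne hyx]
      simp
    rw [e, deriv_const]
  -- all operators have band width `s`
  have hband : ∀ V : Config n N, DifferentiableAt ℝ P (t, coeConfig V) → ∀ v p q,
      s < siteDist p.1 q.1 → 𝐝 P (t, coeConfig V) v p q = 0 := by
    intro V hV v p q hpq
    rw [fderiv_entry hV]
    have e : (fun u : ℝ => P ((t, coeConfig V) + u • v) p q) = fun _ => 0 :=
      funext fun u => hQ.band _ p q hpq
    rw [e, deriv_const]
  have hC : ∀ p : Idx n d, siteDist x p.1 ≤ 2 * s → ∀ r,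
      (P (t, coeConfig U) * 𝐝 P (t, coeConfig U) (1, 0) -
        𝐝 P (t, coeConfig U) (1, 0) * P (t, coeConfig U)) p r =
      (P (t, coeConfig U') * 𝐝 P (t, coeConfig U') (1, 0) -
        𝐝 P (t, coeConfig U') (1, 0) * P (t, coeConfig U')) p r := by
    intro p hp r
    have hq : ∀ q : Idx n d, siteDist p.1 q.1 ≤ s → siteDist x q.1 ≤ 3 * s := fun q hq => by
      have := siteDist_triangle x p.1 q.1; omega
    rw [Matrix.sub_apply, Matrix.sub_apply,
      mul_apply_congr (hQ.band _ p) (hPr p (by omega)) (fun q h => hTr q (hq q h)) r,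
      mul_apply_congr (hband U hd _ p) (hTr p (by omega)) (fun q h => hPr q (hq q h)) r]
  show curvature 𝐓 P (t, coeConfig U) (1, 0) (w U) = curvature 𝐓 P (t, coeConfig U') (1, 0) (w U')
  rw [curvature_eq_traceFunctional traceL_mul_comm, curvature_eq_traceFunctional traceL_mul_comm,
    traceFunctional_apply, traceFunctional_apply, traceL_mul_comm,
    traceL_mul_comm _ (𝐝 P (t, coeConfig U') (w U')), traceL_apply, traceL_apply,
    trace, trace]
  refine sum_congr rfl fun p _ => ?_
  rw [diag_apply, diag_apply]
  rcases le_or_gt (siteDist x p.1) s with hp | hp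
  · exact mul_apply_congr (hband U hd _ p) (hDr p hp) (fun q h => hC q (by
      have := siteDist_triangle x p.1 q.1; omega)) p
  · rw [Matrix.mul_apply, Matrix.mul_apply, sum_eq_zero, sum_eq_zero]
    · intro q _
      rw [hD0 U' hd' p hp, zero_mul]
    · intro q _
      rw [hD0 U hd p hp, zero_mul]

end LocalCurvature

section Locality

variable {N n d : ℕ} [NeZero N] [NeZero n] {R : Rep N d}
  {ρ : su N →ₗ[ℝ] Mat d} {δ : ℝ}

lemma linkForm_truncP_zero (b : Fin 4 → Circle) (x : Site n) (μ : Fin 4) (X : su N)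
    (U : Config n N) : linkForm ρ (truncP b 0) x μ X U = 0 := by
  have e : (fun z : ℝ × Blocks n N => truncP b 0 (blockFn (d := d) ρ z)) =
      fun _ => (1 / 2 : ℂ) • 1 := by
    funext z; simp [truncP]
  have h0 : ∀ t ∈ 𝕀, curvature 𝐓
      (fun z => truncP b 0 (blockFn ρ z)) (t, coeConfig U) (1, 0)
      (0, tangent 1 (singlePert x μ X) (coeConfig U)) = 0 := by
    intro t _
    rw [e, curvature, fderiv_fun_const]
    simp
  rw [linkForm, unitIntegral_congr h0, integral_zero]

lemma SmallRep.linkForm_truncP_congr (h : SmallRep R ρ δ) (b : Fin 4 → Circle) {U U' : Config n N}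
    (hU : U ∈ smoothFields n R δ) (hU' : U' ∈ smoothFields n R δ) {x : Site n} {K : ℕ}
    (he : ∀ y ν, siteDist x y < 8 * K → U y ν = U' y ν) (μ : Fin 4) (X : su N) :
    linkForm ρ (truncP b K) x μ X U = linkForm ρ (truncP b K) x μ X U' := by
  rcases K with _ | K
  · rw [linkForm_truncP_zero, linkForm_truncP_zero]
  · have hd : ∀ V ∈ smoothFields n R δ, ∀ t ∈ 𝕀, DifferentiableAt ℝ
        (fun z => truncP b (K + 1) (blockFn (n := n) ρ z)) (t, coeConfig V) := fun V hV t ht =>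
      (contDiffAt_truncP_blockFn (K + 1) (h.mem_familyDomain b hV ht)).differentiableAt (by simp)
    exact linkForm_congr (isLocalOp_truncP b K) (hd U hU) (hd U' hU')
      (fun y ν hy => he y ν (by omega)) μ X

lemma SmallRep.contDiffAt_linkForm_shift (h : SmallRep R ρ δ) {b : Fin 4 → Circle}
    {Q : Blocks n d → Op n d}
    (hQ : ∀ z ∈ familyDomain (N := N) (n := n) ρ b, SmoothAt (fun z => Q (blockFn ρ z)) z)
    (x : Site n) (μ : Fin 4) (X : su N) {W : Config n N} (hW : W ∈ smoothFields n R δ) :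
    SmoothAt (fun Y : Pert n N => linkForm ρ Q x μ X (shift Y W)) 0 := by
  let L : ℝ × Pert n N →L[ℝ] ChartSpace n N := (fst ℝ _ _).prod ((snd ℝ _ _).prod 0)
  let O : Set (ℝ × Pert n N) := L ⁻¹' chartDomain ρ b W
  have hO : IsOpen O := (isOpen_chartDomain ρ b W).preimage L.continuous
  have h0 : ∀ t ∈ 𝕀, (t, (0 : Pert n N)) ∈ O := fun t ht => by
    show chartMap W (t, 0, 0) ∈ familyDomain (n := n) ρ b
    rw [chartMap_shift, shift_zero]
    exact h.mem_familyDomain b hW ht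
  set f : ChartSpace n N → ℂ := fun z => curvature 𝐓
    (fun z => Q (chartBlocks ρ W z)) z (1, 0, 0) (0, 0, singlePert x μ X) with hf
  have hfs : ∀ z ∈ chartDomain ρ b W, SmoothAt f z := fun z hz =>
    contDiffAt_curvature (ContDiffAt.comp z (g := fun z => Q (blockFn ρ z)) (f := chartMap W)
      (hQ _ hz) (contDiff_chartMap W).contDiffAt) _ _
  refine (contDiffAt_unitIntegral (G := fun w => f (L w)) hO (fun w hw =>
    ContDiffAt.comp w (g := f) (hfs (L w) hw) L.contDiff.contDiffAt) h0).congr_of_eventuallyEq ?_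
  filter_upwards [(isOpen_forall_unitInterval hO).mem_nhds h0] with Y hY
  exact linkForm_shift hQ x μ X hY

/-- At vanishing gauge field the family of projectors is constant in `t`. -/
lemma SmallRep.linkForm_one (h : SmallRep R ρ δ) (hδ : 0 < δ) (b : Fin 4 → Circle) (x : Site n)
    (μ : Fin 4) (X : su N) : linkForm ρ (blockP b) x μ X (1 : Config n N) = 0 := by
  have h1 : (1 : Config n N) ∈ smoothFields n R δ := fun y ν => by constructor <;> simpa using hδ
  have hflow : flowPert (1 : Config n N) = 0 := funext fun y => funext fun ν => suLog_one N
  have hc : ∀ t : ℝ, blockFn (n := n) ρ (t, coeConfig (1 : Config n N)) = 1 := by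
    intro t
    rw [← h.repBlocks_powConfig h1, h.powConfig_eq h1, hflow]
    funext y ν
    show (R (expSU (t • (0 : su N)))).1 = 1
    rw [smul_zero, expSU_zero, map_one]
    rfl
  have h0 : ∀ t ∈ 𝕀, curvature 𝐓
      (fun z => blockP b (blockFn ρ z)) (t, coeConfig (1 : Config n N)) (1, 0)
      (0, tangent 1 (singlePert x μ X) (coeConfig (1 : Config n N))) = 0 := by
    intro t ht
    have hd := (contDiffAt_projFamily ρ b (h.mem_familyDomain b h1 ht)).hasFD
    have hl : HasDerivAt (fun s : ℝ => (s, coeConfig (1 : Config n N))) (1, 0) t :=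
      (hasDerivAt_id t).prodMk (hasDerivAt_const t _)
    have hz : 𝐝 (fun z => blockP b (blockFn ρ z)) (t, coeConfig (1 : Config n N)) (1, 0) = 0 := by
      refine (hd.comp_hasDerivAt t hl).unique ?_
      have e : projFamily ρ b ∘ (fun s : ℝ => (s, coeConfig (1 : Config n N))) =
          fun _ => blockP b 1 := funext fun s => by
        show blockP b (blockFn ρ (s, _)) = _
        rw [hc]
      rw [e]
      exact hasDerivAt_const t _
    rw [curvature, hz]
    simp
  rw [linkForm, unitIntegral_congr h0, integral_zero]

open Classical in
/-- The link field that agrees with `U` at the sites at distance less than `r` from `x`, and that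
is trivial elsewhere. -/
def cutConfig (x : Site n) (r : ℕ) (U : Config n N) : Config n N :=
  fun y ν => if siteDist x y < r then U y ν else 1

open Classical in
/-- The restriction of variation vectors to the sites at distance less than `r` from `x`. -/
def cutPert (N : ℕ) (x : Site n) (r : ℕ) : Pert n N →L[ℝ] Pert n N :=
  ContinuousLinearMap.pi fun y => if siteDist x y < r then proj y else 0

lemma norm_cutPert_le (x : Site n) (r : ℕ) : ‖cutPert N x r‖ ≤ 1 := by
  refine opNorm_le_bound _ zero_le_one fun X => ?_
  rw [one_mul]
  refine (pi_norm_le_iff_of_nonneg (norm_nonneg _)).2 fun y => ?_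
  rw [cutPert, coe_pi']
  dsimp only
  split_ifs
  · exact norm_le_pi_norm X y
  · rw [zero_apply, norm_zero]
    exact norm_nonneg _

lemma cutConfig_shift (x : Site n) (r : ℕ) (X : Pert n N) (U : Config n N) :
    cutConfig x r (shift X U) = shift (cutPert N x r X) (cutConfig x r U) := by
  funext y ν
  rw [shift, cutConfig, cutConfig, cutPert, coe_pi']
  dsimp only
  split_ifs
  · rfl
  · rw [zero_apply, Pi.zero_apply, expSU_zero, one_mul]

lemma cutConfig_mem (hδ : 0 < δ) {U : Config n N} (hU : U ∈ smoothFields n R δ) (x : Site n)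
    (r : ℕ) : cutConfig x r U ∈ smoothFields n R δ := fun y ν => by
  rw [cutConfig]
  split_ifs
  · exact hU y ν
  · constructor <;> simpa using hδ

lemma cutConfig_zero (x : Site n) (U : Config n N) : cutConfig x 0 U = 1 := by
  funext y ν
  rw [cutConfig, if_neg (Nat.not_lt_zero _)]
  rfl

lemma exists_cutConfig_eq (x : Site n) :
    ∃ r₀, ∀ r, r₀ ≤ r → ∀ U : Config n N, cutConfig x r U = U := by
  obtain ⟨M, hM⟩ := (Set.finite_range fun y : Site n => siteDist x y).bddAbove
  refine ⟨M + 1, fun r hr U => funext fun y => funext fun ν => ?_⟩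
  rw [cutConfig, if_pos]
  exact lt_of_lt_of_le (Nat.lt_succ_of_le (hM ⟨y, rfl⟩)) hr

lemma SmallRep.measureCurrent_eq (h : SmallRep R ρ δ) (b : Fin 4 → Circle) {a : ℝ} (ha : a ≠ 0)
    (x : Site n) (μ : Fin 4) (X : su N) {U : Config n N} (hU : U ∈ smoothFields n R δ) :
    measureCurrent R a b x μ X U = ((a : ℂ) ^ 3)⁻¹ * I * linkForm ρ (blockP b) x μ X U := by
  have e : tangent a (singlePert x μ X) (coeConfig U) =
      a • tangent 1 (singlePert x μ X) (coeConfig U) := by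
    funext y ν
    rw [Pi.smul_apply, Pi.smul_apply, tangent_apply, tangent_apply, one_smul, smul_mul_assoc]
  have hc := connection_apply (O := familyDomain (n := n) ρ b) (y := coeConfig U)
    (tr := 𝐓) traceL_mul_comm (fun p hp => contDiffAt_projFamily ρ b hp)
    (fun t ht => h.mem_familyDomain b hU ht) (tangent 1 (singlePert x μ X) (coeConfig U))
  have hm := h.measureTerm_eq b ha (singlePert x μ X) U hU
  rw [e, map_smul, hc] at hm
  rw [measureCurrent, hm]
  have ha' : (a : ℂ) ≠ 0 := Complex.ofReal_ne_zero.2 ha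
  show ((a : ℂ) ^ 4)⁻¹ * (I * (a • linkForm ρ (blockP b) x μ X U)) = _
  rw [real_smul]
  field_simp

end Locality

/-! ### Locality of the measure current -/

lemma norm_iteratedFDeriv_smul_sub_le {E : Type*} [NormedAddCommGroup E] [NormedSpace ℝ E] (c : ℂ)
    {f g : E → ℂ} {z : E} (hf : SmoothAt f z) (hg : SmoothAt g z) (k : ℕ) :
    ‖𝐃 k (fun y => c * (f y - g y)) z‖ ≤ ‖c‖ * (‖𝐃 k f z‖ + ‖𝐃 k g z‖) := by
  have h1 := (mul ℝ ℂ c).norm_iteratedFDeriv_comp_left (hf.sub hg) (n := k) (mod_cast le_top)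
  have h2 : 𝐃 k (fun y => f y - g y) z = _ :=
    iteratedFDeriv_sub_apply (hf.of_le (mod_cast le_top)) (hg.of_le (mod_cast le_top))
  rw [h2] at h1
  refine h1.trans ?_
  gcongr
  · exact opNorm_mul_apply_le ℝ ℂ c
  · exact norm_sub_le _ _

section Locality

variable {N d : ℕ} [NeZero N] {R : Rep N d} {ρ : su N →ₗ[ℝ] Mat d} {δ : ℝ}

/-- The error bound of the truncation of order `K = r / 8` as a function of the distance `r`. -/
lemma pow_div_le_exp {p : ℝ} (hp0 : 0 < p) (hp1 : p < 1) (r : ℕ) :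
    p ^ (r / 8) ≤ p⁻¹ * Real.exp (-(-Real.log p / 8) * r) := by
  have hl : Real.log p < 0 := Real.log_neg hp0 hp1
  have h1 : ((r : ℝ) / 8 - 1) ≤ ((r / 8 : ℕ) : ℝ) := by
    have : r < 8 * (r / 8) + 8 := by omega
    have : (r : ℝ) < 8 * ((r / 8 : ℕ) : ℝ) + 8 := by exact_mod_cast this
    linarith
  have h2 : p ^ (r / 8) = Real.exp (((r / 8 : ℕ) : ℝ) * Real.log p) := by
    rw [Real.exp_nat_mul, Real.exp_log hp0]
  have h3 : p⁻¹ = Real.exp (-Real.log p) := by rw [Real.exp_neg, Real.exp_log hp0]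
  rw [h2, h3, ← Real.exp_add]
  refine Real.exp_le_exp.2 ?_
  nlinarith

variable {n : ℕ} [NeZero n]

/-- The part of the measure current that is added when the link variables at distance `r` from the
site `x` are switched on. -/
def currentPart (ρ : su N →ₗ[ℝ] Mat d) (b : Fin 4 → Circle) (a : ℝ)
    (x : Site n) (μ : Fin 4) (X : su N) (r : ℕ) (U : Config n N) : ℂ :=
  ((a : ℂ) ^ 3)⁻¹ * I * (linkForm ρ (blockP b) x μ X (cutConfig x (r + 1) U) -
    linkForm ρ (blockP b) x μ X (cutConfig x r U))

lemma contDiffAt_cut (F : Config n N → ℂ) (x : Site n) (r : ℕ) {U : Config n N}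
    (hF : SmoothAt (fun Y => F (shift Y (cutConfig x r U))) 0) :
    SmoothAt (fun Y => F (cutConfig x r (shift Y U))) 0 := by
  simp only [cutConfig_shift]
  exact ContDiffAt.comp 0 (g := fun Y => F (shift Y (cutConfig x r U))) (f := cutPert N x r)
    (by rw [map_zero]; exact hF) (cutPert N x r).contDiff.contDiffAt

lemma norm_iteratedFDeriv_cut_le (F : Config n N → ℂ) (x : Site n) (r k : ℕ) {U : Config n N}
    (hF : SmoothAt (fun Y => F (shift Y (cutConfig x r U))) 0) :
    ‖𝐃 k (fun Y => F (cutConfig x r (shift Y U))) 0‖ ≤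
      ‖𝐃 k (fun Y => F (shift Y (cutConfig x r U))) 0‖ := by
  simp only [cutConfig_shift]
  have := norm_iteratedFDeriv_comp_affine_le (cutPert N x r) (norm_cutPert_le x r) 0
    (f := fun Y => F (shift Y (cutConfig x r U))) (y := 0)
    (by rw [map_zero, zero_add]; exact hF) k
  simpa only [zero_add, map_zero] using this

lemma SmallRep.smoothOn_currentPart (h : SmallRep R ρ δ) (hδ : 0 < δ) (b : Fin 4 → Circle)
    (a : ℝ) (x : Site n) (μ : Fin 4) (X : su N) (r : ℕ) :
    SmoothOn (smoothFields n R δ) (currentPart ρ b a x μ X r) := fun U hU => by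
  have hs : ∀ r, SmoothAt (fun Y : Pert n N =>
      linkForm ρ (blockP b) x μ X (cutConfig x r (shift Y U))) 0 := fun r =>
    contDiffAt_cut _ x r (h.contDiffAt_linkForm_shift (fun z hz => contDiffAt_projFamily ρ b hz)
      x μ X (cutConfig_mem hδ hU x r))
  exact contDiffAt_const.mul ((hs (r + 1)).sub (hs r))

lemma currentPart_congr (b : Fin 4 → Circle) (a : ℝ) {x : Site n} (μ : Fin 4) (X : su N) {r : ℕ}
    {U U' : Config n N} (hU : ∀ y ν, siteDist x y ≤ r → U y ν = U' y ν) :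
    currentPart ρ b a x μ X r U = currentPart ρ b a x μ X r U' := by
  have h : ∀ s, s ≤ r + 1 → cutConfig x s U = cutConfig x s U' := fun s hs => by
    funext y ν
    rw [cutConfig, cutConfig]
    split_ifs with hy
    · exact hU y ν (by omega)
    · rfl
  rw [currentPart, currentPart, h _ le_rfl, h _ (Nat.le_succ r)]

lemma SmallRep.norm_iteratedFDeriv_currentPart_le (h : SmallRep R ρ δ) (hδ : 0 < δ)
    (b : Fin 4 → Circle) {a : ℝ} (ha : 0 < a) (x : Site n) (μ : Fin 4) (X : su N) (r k : ℕ)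
    {B : ℝ} (hB : ∀ W ∈ smoothFields n R δ, ‖𝐃 k (fun Y : Pert n N =>
        linkForm ρ (blockP b) x μ X (shift Y W) -
          linkForm ρ (truncP b (r / 8)) x μ X (shift Y W)) 0‖ ≤ B)
    {U : Config n N} (hU : U ∈ smoothFields n R δ) :
    ‖𝐃 k (fun Y : Pert n N => currentPart ρ b a x μ X r (shift Y U)) 0‖ ≤ (a ^ 3)⁻¹ * (B + B) := by
  set F : Config n N → ℂ := fun V => linkForm ρ (blockP b) x μ X V -
    linkForm ρ (truncP b (r / 8)) x μ X V with hF
  have hFs : ∀ s, SmoothAt (fun Y => F (shift Y (cutConfig x s U))) 0 := fun s =>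
    (h.contDiffAt_linkForm_shift (fun z hz => contDiffAt_projFamily ρ b hz) x μ X
      (cutConfig_mem hδ hU x s)).sub
    (h.contDiffAt_linkForm_shift (fun z hz => contDiffAt_truncP_blockFn (r / 8) hz) x μ X
      (cutConfig_mem hδ hU x s))
  -- the truncated form does not see the link variables at distance `r`
  have hev : (fun Y : Pert n N => currentPart ρ b a x μ X r (shift Y U)) =ᶠ[𝓝 0] fun Y =>
      (((a : ℂ) ^ 3)⁻¹ * I) * (F (cutConfig x (r + 1) (shift Y U)) -
        F (cutConfig x r (shift Y U))) := by
    filter_upwards [h.eventually_smoothFields hU] with Y hY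
    have ht : linkForm ρ (truncP b (r / 8)) x μ X (cutConfig x (r + 1) (shift Y U)) =
        linkForm ρ (truncP b (r / 8)) x μ X (cutConfig x r (shift Y U)) :=
      h.linkForm_truncP_congr b (cutConfig_mem hδ hY x _) (cutConfig_mem hδ hY x _)
        (fun y ν hy => by
          have : siteDist x y < r := by omega
          rw [cutConfig, cutConfig, if_pos this, if_pos (by omega)]) μ X
    rw [currentPart, hF]
    dsimp only
    rw [ht]
    ring
  have c1 := contDiffAt_cut F x (r + 1) (hFs (r + 1))
  have c2 := contDiffAt_cut F x r (hFs r)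
  have hn : ‖((a : ℂ) ^ 3)⁻¹ * I‖ = (a ^ 3)⁻¹ := by
    rw [norm_mul, norm_I, mul_one, norm_inv, norm_pow, norm_real, Real.norm_of_nonneg ha.le]
  rw [iteratedFDeriv_congr_of_eventuallyEq hev]
  refine (norm_iteratedFDeriv_smul_sub_le _ c1 c2 k).trans ?_
  rw [hn]
  gcongr
  · exact (norm_iteratedFDeriv_cut_le F x (r + 1) k (hFs (r + 1))).trans
      (hB _ (cutConfig_mem hδ hU x _))
  · exact (norm_iteratedFDeriv_cut_le F x r k (hFs r)).trans (hB _ (cutConfig_mem hδ hU x _))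

lemma SmallRep.hasSum_currentPart (h : SmallRep R ρ δ) (hδ : 0 < δ) (b : Fin 4 → Circle) {a : ℝ}
    (ha : a ≠ 0) (x : Site n) (μ : Fin 4) (X : su N) {U : Config n N}
    (hU : U ∈ smoothFields n R δ) :
    HasSum (fun r => currentPart ρ b a x μ X r U) (measureCurrent R a b x μ X U) := by
  obtain ⟨r₀, hr₀⟩ := exists_cutConfig_eq (N := N) x
  have hz : ∀ r ∉ range r₀, currentPart ρ b a x μ X r U = 0 := fun r hr => by
    have hr' : r₀ ≤ r := not_lt.1 fun hlt => hr (Finset.mem_range.2 hlt)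
    rw [currentPart, hr₀ r hr', hr₀ (r + 1) (by omega), sub_self, mul_zero]
  have hs : HasSum (fun r => currentPart ρ b a x μ X r U) _ := hasSum_sum_of_ne_finset_zero hz
  have e : ∑ r ∈ range r₀, currentPart ρ b a x μ X r U = measureCurrent R a b x μ X U := by
    simp only [currentPart]
    rw [← mul_sum, sum_range_sub (fun r =>
      linkForm ρ (blockP b) x μ X (cutConfig x r U)), hr₀ r₀ le_rfl, cutConfig_zero,
      h.linkForm_one hδ, sub_zero, h.measureCurrent_eq b ha x μ X hU]
  rwa [e] at hs

/-- The measure current is local, with bounds that are uniform in the lattice. -/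
lemma SmallRep.exists_isLocalAt_measureCurrent (h : SmallRep R ρ δ) (hδ : 0 < δ) :
    ∃ θ : ℝ, 0 < θ ∧ ∃ C : ℕ → ℝ,
      ∀ (n : ℕ) [NeZero n] (a : ℝ), 0 < a → ∀ (b : Fin 4 → Circle) (x : Site n) (μ : Fin 4)
        (X : su N), IsLocalAt (smoothFields n R δ) x θ (fun k => C k * ‖X‖ / a ^ 3)
          (measureCurrent R a b x μ X) := by
  obtain ⟨p, hp0, hp1, C, hC0, hC⟩ := h.exists_truncation_bound
  refine ⟨-Real.log p / 8, by have := Real.log_neg hp0 hp1; linarith, fun k => 2 * C k * p⁻¹,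
    fun n _ a ha b x μ X => ⟨currentPart ρ b a x μ X, h.smoothOn_currentPart hδ b a x μ X,
      fun r U _ U' _ hUU' => currentPart_congr b a μ X hUU', fun r k U hU => ?_,
      fun U hU => h.hasSum_currentPart hδ b ha.ne' x μ X hU⟩⟩
  refine (h.norm_iteratedFDeriv_currentPart_le hδ b ha x μ X r k
    (fun W hW => hC n b x μ X (r / 8) k W hW) hU).trans ?_
  have h1 := pow_div_le_exp hp0 hp1 r
  have h2 := hC0 k
  calc (a ^ 3)⁻¹ * (C k * ‖X‖ * p ^ (r / 8) + C k * ‖X‖ * p ^ (r / 8))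
      = (a ^ 3)⁻¹ * (2 * C k * ‖X‖) * p ^ (r / 8) := by ring
    _ ≤ (a ^ 3)⁻¹ * (2 * C k * ‖X‖) * (p⁻¹ * Real.exp (-(-Real.log p / 8) * r)) := by gcongr
    _ = _ := by ring

end Locality

/-! ### Geometric phases of orthonormal frames -/

section Frame

variable {E A : Type*} [NormedAddCommGroup E] [NormedSpace ℝ E] [NormedRing A] [NormedAlgebra ℝ A]

section OneForm

variable {α : ℝ × E → (ℝ × E →L[ℝ] ℂ)} {O : Set (ℝ × E)} {y : E}

/-- The derivative of the integral of a one-form along the lines `t ↦ (t, y)` consists of boundary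
terms and of the integral of its exterior derivative. -/
lemma hasFDerivAt_lineIntegral (hO : IsOpen O) (hα : ∀ p ∈ O, SmoothAt α p)
    (hy : ∀ t ∈ 𝕀, (t, y) ∈ O) : ∃ φ' : E →L[ℝ] ℂ,
    HasFDerivAt (fun y => ∫ t in (0 : ℝ)..1, α (t, y) (1, 0)) φ' y ∧
    ∀ w, φ' w = α (1, y) (0, w) - α (0, y) (0, w) - ∫ t in (0 : ℝ)..1,
      (𝐝 α (t, y) (1, 0) (0, w) - 𝐝 α (t, y) (0, w) (1, 0)) := by
  have happ : ∀ v, ∀ p ∈ O, HasFDerivAt (fun q => α q v) ((𝐝 α p).flip v) p := by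
    intro v p hp
    simpa using (hα p hp).hasFD.clm_apply (hasFDerivAt_const v p)
  have hs : ∀ v, ∀ p ∈ O, SmoothAt (fun q => α q v) p := fun v p hp =>
    (hα p hp).clm_apply contDiffAt_const
  have hs2 : ∀ u v, ∀ p ∈ O, SmoothAt (fun q => 𝐝 α q u v) p := fun u v p hp =>
    (((hα p hp).fderiv_right (m := ∞) (by simp)).clm_apply contDiffAt_const).clm_apply
      contDiffAt_const
  have hs3 : ∀ p ∈ O, SmoothAt (fun q => (𝐝 (fun q => α q (1, 0)) q).comp
      (inr ℝ ℝ E)) p := fun p hp =>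
    ((hs (1, 0) p hp).fderiv_right (m := ∞) (by simp)).clm_comp contDiffAt_const
  refine ⟨_, hasFDerivAt_unitIntegral hO (hs (1, 0)) hy, fun w => ?_⟩
  have h1 : ∫ t in (0 : ℝ)..1, 𝐝 (fun y => α (t, y) (1, 0)) y = ∫ t in (0 : ℝ)..1,
      (𝐝 (fun q => α q (1, 0)) (t, y)).comp (inr ℝ ℝ E) := by
    refine unitIntegral_congr fun t ht => ?_
    exact fderiv_slice (G := fun q => α q (1, 0)) (hs (1, 0) _ (hy t ht))
  have hder : ∀ t ∈ Set.uIcc (0 : ℝ) 1, HasDerivAt (fun t => α (t, y) (0, w))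
      (𝐝 α (t, y) (1, 0) (0, w)) t := by
    intro t ht
    rw [Set.uIcc_of_le zero_le_one] at ht
    exact (happ (0, w) _ (hy t ht)).comp_hasDerivAt t
      ((hasDerivAt_id t).prodMk (hasDerivAt_const t y))
  have i1 := intervalIntegrable_slice (hs2 (1, 0) (0, w)) hy
  have i2 := intervalIntegrable_slice (hs2 (0, w) (1, 0)) hy
  have i3 := intervalIntegrable_slice hs3 hy
  rw [h1, intervalIntegral_apply i3, ← integral_eq_sub_of_hasDerivAt hder i1,
    ← integral_sub i1 (i1.sub i2)]
  refine unitIntegral_congr fun t ht => ?_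
  have e : 𝐝 (fun q => α q (1, 0)) (t, y) (0, w) = 𝐝 α (t, y) (0, w) (1, 0) := by
    rw [(happ (1, 0) _ (hy t ht)).fderiv, flip_apply]
  simp only [ContinuousLinearMap.comp_apply, inr_apply]
  rw [e, sub_sub_cancel]

end OneForm

variable {Z : Type*} [NormedAddCommGroup Z] [NormedSpace ℝ Z] {tr : A →L[ℝ] ℂ} {p : A}
  {K L P : Z → A} {O : Set Z} {z : Z}

/-- A frame of the projectors `P = K L`: a partial isometry `K` from the range of the constant
projector `p`, with adjoint `L`. -/
structure IsFrame (p : A) (K L P : Z → A) (O : Set Z) : Prop where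
  isOpen : IsOpen O
  smoothK : ∀ z ∈ O, SmoothAt K z
  smoothL : ∀ z ∈ O, SmoothAt L z
  mul_eq : ∀ z ∈ O, L z * K z = p
  left : ∀ z ∈ O, K z * p = K z
  right : ∀ z ∈ O, p * L z = L z
  proj : ∀ z ∈ O, P z = K z * L z

/-- The connection form `Tr (L dK)` of a frame. -/
def frameForm (tr : A →L[ℝ] ℂ) (K L : Z → A) (z : Z) : Z →L[ℝ] ℂ :=
  (traceFunctional tr (L z)).comp (𝐝 K z)

lemma frame_algebra {k l ku lu kw lw : A} (h1 : l * k = p) (h3 : p * l = l)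
    (hkw : kw * p = kw) (hlu : p * lu = lu) (hu : lu * k = -(l * ku)) (hw : lw * k = -(l * kw)) :
    l * ((ku * l + k * lu) * (kw * l + k * lw)) * k = lu * kw + l * ku * (l * kw) := by
  have e : l * ((ku * l + k * lu) * (kw * l + k * lw)) * k =
      (l * ku * l + (l * k) * lu) * (kw * (l * k) + k * (lw * k)) := by noncomm_ring
  have e2 : (l * ku * l + lu) * (kw + k * -(l * kw)) =
      l * ku * l * kw - l * ku * ((l * k) * l) * kw + lu * kw - (lu * k) * (l * kw) := by
    noncomm_ring
  rw [e, h1, hw, hkw, hlu, e2, h1, h3, hu]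
  noncomm_ring

namespace IsFrame

variable (h : IsFrame p K L P O) (hz : z ∈ O)

include h hz

lemma smooth_frameForm : SmoothAt (frameForm tr K L) z :=
  ((traceFunctional tr).contDiff.contDiffAt.comp z (h.smoothL z hz)).clm_comp
    ((h.smoothK z hz).fderiv_right (m := ∞) (by simp))

lemma eventually_mem : ∀ᶠ y in 𝓝 z, y ∈ O :=
  h.isOpen.mem_nhds hz

lemma fderiv_mul_add (v : Z) :
    L z * 𝐝 K z v + 𝐝 L z v * K z = 0 := by
  have e : 𝐝 (L * K) z = 0 := by
    rw [Filter.EventuallyEq.fderiv_eq ((h.eventually_mem hz).mono fun y hy => h.mul_eq y hy :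
      L * K =ᶠ[𝓝 z] fun _ => p), fderiv_fun_const]
    rfl
  rw [((h.smoothL z hz).hasFD.mul' (h.smoothK z hz).hasFD).fderiv] at e
  simpa using congrArg (fun M => M v) e

/-- The connection form of a frame of partial isometries is purely imaginary. -/
lemma star_frameForm [StarRing A] [StarModule ℝ A] [ContinuousStar A]
    (hKL : ∀ z ∈ O, star (K z) = L z) (htr : ∀ x y, tr (x * y) = tr (y * x))
    (hst : ∀ x, tr (star x) = star (tr x)) (v : Z) :
    star (frameForm tr K L z v) = -frameForm tr K L z v := by
  have e : 𝐝 L z v = star (𝐝 K z v) := by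
    have := (h.smoothK z hz).hasFD.star
    rw [(this.congr_of_eventuallyEq
      ((h.eventually_mem hz).mono fun y hy => (hKL y hy).symm)).fderiv]
    rfl
  have e2 := eq_neg_of_add_eq_zero_right (h.fderiv_mul_add hz v)
  show star (tr (𝐝 K z v * L z)) = -tr (𝐝 K z v * L z)
  rw [← hst, star_mul, ← e, ← hKL z hz, star_star, htr, e2, map_neg, htr, hKL z hz]

/-- The exterior derivative of the connection form is the curvature of the projectors. -/
lemma fderiv_frameForm_sub (htr : ∀ x y, tr (x * y) = tr (y * x)) (u w : Z) :
    𝐝 (frameForm tr K L) z u w - 𝐝 (frameForm tr K L) z w u = curvature tr P z u w := by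
  have hK := h.smoothK z hz
  have hL := h.smoothL z hz
  have dK := hK.hasFD
  have dL := hL.hasFD
  have hsym : IsSymmSndFDerivAt ℝ K z := hK.isSymmSndFDerivAt (by
    simp only [minSmoothness_of_isRCLikeNormedField]
    exact WithTop.coe_le_coe.2 (le_top : (2 : ℕ∞) ≤ ⊤))
  have hform : ∀ u w, 𝐝 (frameForm tr K L) z u w =
      tr (𝐝 (𝐝 K) z u w * L z + 𝐝 K z w * 𝐝 L z u) := by
    intro u w
    have h1 := (h.smooth_frameForm (tr := tr) hz).hasFD.clm_apply (hasFDerivAt_const w z)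
    have h2 := tr.hasFDerivAt.comp z ((hasFDerivAt_fderiv_apply hK w).mul' dL)
    have := congrArg (fun M => M u) (h1.unique h2)
    simpa [add_comm] using this
  have hO := h.eventually_mem hz
  have d1 := h.fderiv_mul_add hz
  have d2 : ∀ v, 𝐝 K z v * p = 𝐝 K z v := by
    intro v
    have e : 𝐝 (fun y => K y * p) z = 𝐝 K z :=
      Filter.EventuallyEq.fderiv_eq (hO.mono fun y hy => h.left y hy)
    rw [(dK.mul_const' p).fderiv] at e
    simpa using congrArg (fun M => M v) e
  have d3 : ∀ v, p * 𝐝 L z v = 𝐝 L z v := by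
    intro v
    have e : 𝐝 (fun y => p * L y) z = 𝐝 L z :=
      Filter.EventuallyEq.fderiv_eq (hO.mono fun y hy => h.right y hy)
    rw [(dL.const_mul p).fderiv] at e
    simpa using congrArg (fun M => M v) e
  have d4 : ∀ v, 𝐝 P z v = 𝐝 K z v * L z + K z * 𝐝 L z v := by
    intro v
    have e : 𝐝 P z = 𝐝 (K * L) z := Filter.EventuallyEq.fderiv_eq (hO.mono fun y hy => h.proj y hy)
    rw [e, (dK.mul' dL).fderiv]
    simp [add_comm]
  have key : ∀ u w, tr (P z * (𝐝 P z u * 𝐝 P z w)) =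
      tr (𝐝 K z w * 𝐝 L z u) + tr (L z * 𝐝 K z u * (L z * 𝐝 K z w)) := by
    intro u w
    rw [h.proj z hz, mul_assoc, htr, d4, d4, frame_algebra (h.mul_eq z hz) (h.right z hz) (d2 w)
      (d3 u) (eq_neg_of_add_eq_zero_right (d1 u)) (eq_neg_of_add_eq_zero_right (d1 w)), map_add,
      htr (𝐝 L z u)]
  rw [curvature, mul_sub, map_sub, key, key, hform, hform, map_add, map_add, hsym.eq w u,
    htr (L z * 𝐝 K z w)]
  ring

end IsFrame

/-- The phase of a frame along the lines `t ↦ (t, y)`. -/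
lemma IsFrame.hasFDerivAt_phase {K L P : ℝ × E → A} {O : Set (ℝ × E)} (h : IsFrame p K L P O)
    (htr : ∀ x y, tr (x * y) = tr (y * x)) {y : E} (hy : ∀ t ∈ 𝕀, (t, y) ∈ O)
    (hP : ∀ q ∈ O, SmoothAt P q) : ∃ φ' : E →L[ℝ] ℂ,
    HasFDerivAt (fun y => ∫ t in (0 : ℝ)..1, frameForm tr K L (t, y) (1, 0)) φ' y ∧
    ∀ w, φ' w = frameForm tr K L (1, y) (0, w) - frameForm tr K L (0, y) (0, w) -
      connection tr P y w := by
  obtain ⟨φ', h1, h2⟩ := hasFDerivAt_lineIntegral h.isOpen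
    (fun q hq => h.smooth_frameForm (tr := tr) hq) hy
  refine ⟨φ', h1, fun w => ?_⟩
  rw [h2, connection_apply htr hP hy]
  congr 1
  exact unitIntegral_congr fun t ht => h.fderiv_frameForm_sub (hy t ht) htr _ _

end Frame

/-! ### Smooth orthonormal bases of the spaces of Weyl fields -/

section ProjectorPair

variable {ι : Type*} [Fintype ι] [DecidableEq ι] {p P : Matrix ι ι ℂ}

open scoped MatrixOrder ComplexOrder in
/-- If no non-zero vector in the range of `p` is annihilated by `P`, the compression of `1 - P` to
the range of `p` is a strict contraction. -/
lemma norm_compression_lt_one (hp : p * p = p) (hps : pᴴ = p) (hP : P * P = P) (hPs : Pᴴ = P)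
    (h : ∀ ψ : ι → ℂ, p *ᵥ ψ = ψ → P *ᵥ ψ = 0 → ψ = 0) : ‖p * (1 - P) * p‖ < 1 := by
  cases subsingleton_or_nontrivial (Matrix ι ι ℂ)
  · rw [Subsingleton.elim (p * (1 - P) * p) 0, norm_zero]; exact one_pos
  have hp1 : ‖p‖ ≤ 1 := IsStarProjection.norm_le p ⟨hp, hps⟩
  have hQ : (1 - P) * (1 - P) = 1 - P := by simp [mul_sub, sub_mul, hP]
  have hQs : (1 - P)ᴴ = 1 - P := by rw [conjTranspose_sub, hPs, conjTranspose_one]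
  have hQ1 : ‖1 - P‖ ≤ 1 := IsStarProjection.norm_le (1 - P) ⟨hQ, hQs⟩
  have hle : ‖p * (1 - P) * p‖ ≤ 1 := (norm_mul_le _ _).trans <| mul_le_one₀
    ((norm_mul_le _ _).trans (mul_le_one₀ hp1 (norm_nonneg _) hQ1)) (norm_nonneg _) hp1
  refine lt_of_le_of_ne hle fun hn => ?_
  have hnn : 0 ≤ p * (1 - P) * p := by
    have := star_mul_self_nonneg ((1 - P) * p)
    rwa [star_mul, star_eq_conjTranspose, star_eq_conjTranspose, hps, hQs, mul_assoc,
      ← mul_assoc (1 - P), hQ, ← mul_assoc] at this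
  have hsp := CStarAlgebra.norm_mem_spectrum_of_nonneg hnn
  rw [hn, spectrum.mem_iff, map_one, isUnit_iff_isUnit_det, isUnit_iff_ne_zero, not_not] at hsp
  obtain ⟨ψ, hψ, h0⟩ := Matrix.exists_mulVec_eq_zero_iff.2 hsp
  rw [sub_mulVec, one_mulVec, sub_eq_zero] at h0
  have h1 : p *ᵥ ψ = ψ := by rw [h0, mulVec_mulVec, ← mul_assoc, ← mul_assoc, hp]
  refine hψ (h ψ h1 ?_)
  have h2 : p *ᵥ (P *ᵥ ψ) = 0 := by
    rw [← mulVec_mulVec, h1, ← mulVec_mulVec, sub_mulVec, one_mulVec, mulVec_sub, h1] at h0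
    exact sub_eq_self.1 h0.symm
  rw [← dotProduct_star_self_eq_zero]
  calc star (P *ᵥ ψ) ⬝ᵥ P *ᵥ ψ = star ψ ⬝ᵥ (Pᴴ *ᵥ (P *ᵥ ψ)) := by
        rw [star_mulVec, ← dotProduct_mulVec]
    _ = star (p *ᵥ ψ) ⬝ᵥ (P *ᵥ ψ) := by rw [hPs, mulVec_mulVec, hP, h1]
    _ = 0 := by rw [star_mulVec, hps, ← dotProduct_mulVec, h2, dotProduct_zero]

/-- Two orthogonal projectors whose ranges are in general position, i.e. are mapped onto one another
by the projectors. -/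
structure ProjPair (p P : Matrix ι ι ℂ) : Prop where
  idem₁ : p * p = p
  star₁ : pᴴ = p
  idem₂ : P * P = P
  star₂ : Pᴴ = P
  lt₁ : ‖p * (1 - P) * p‖ < 1
  lt₂ : ‖P * (1 - p) * P‖ < 1

/-- The inverse square root of `1 - p (1 - P) p`, which equals `p P p` on the range of `p`. -/
def pairT (p P : Matrix ι ι ℂ) : Matrix ι ι ℂ := ∑' m, invSqrtCoeff m • (p * (1 - P) * p) ^ m

/-- The partial isometry in the polar decomposition of `P p`. -/
def pairK (p P : Matrix ι ι ℂ) : Matrix ι ι ℂ := P * p * pairT p P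

/-- The adjoint of `pairK`. -/
def pairL (p P : Matrix ι ι ℂ) : Matrix ι ι ℂ := pairT p P * p * P

namespace ProjPair

variable (h : ProjPair p P)

include h

lemma isSelfAdjoint : IsSelfAdjoint (1 - p * (1 - P) * p) := by
  rw [isSelfAdjoint_iff, star_eq_conjTranspose]
  simp only [conjTranspose_sub, conjTranspose_mul, conjTranspose_one, h.star₁, h.star₂, mul_assoc]

lemma pairT_eq : pairT p P = cfc (fun x : ℝ => (√x)⁻¹) (1 - p * (1 - P) * p) := by
  have := hasSum_cfc_invSqrt h.isSelfAdjoint one_pos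
    (by rw [inv_one, one_smul, sub_sub_cancel]; exact h.lt₁)
  rw [inv_one, one_smul, sub_sub_cancel, Real.sqrt_one, one_smul] at this
  exact this.tsum_eq

lemma pairT_mul_mul : pairT p P * (1 - p * (1 - P) * p) * pairT p P = 1 := by
  rw [h.pairT_eq]
  have hs := h.isSelfAdjoint
  refine invSqrt_mul_mul_invSqrt hs fun x hx => ?_
  have h2 := norm_apply_le_norm_cfc (fun x : ℝ => 1 - x) _ hx
  rw [cfc_sub (fun _ => (1 : ℝ)) (fun x => x) _, cfc_const_one ℝ _, cfc_id' ℝ _, sub_sub_cancel,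
    Real.norm_eq_abs] at h2
  linarith [(abs_lt.1 (h2.trans_lt h.lt₁)).2]

lemma pairT_comm : pairT p P * p = p * pairT p P := by
  have hc : Commute (1 - p * (1 - P) * p) p := by
    refine (Commute.one_left p).sub_left ?_
    show p * (1 - P) * p * p = p * (p * (1 - P) * p)
    rw [mul_assoc _ p p, ← mul_assoc p (p * (1 - P)), ← mul_assoc p p, h.idem₁]
  rw [h.pairT_eq]
  exact hc.cfc_real _

lemma pairK_conjTranspose : (pairK p P)ᴴ = pairL p P := by
  have : (pairT p P)ᴴ = pairT p P := by rw [h.pairT_eq, cfc_conjTranspose]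
  rw [pairK, pairL, conjTranspose_mul, conjTranspose_mul, this, h.star₁, h.star₂, mul_assoc]

lemma pairK_mul : pairK p P * p = pairK p P := by
  rw [pairK, mul_assoc, h.pairT_comm, ← mul_assoc, mul_assoc P, h.idem₁]

lemma mul_pairL : p * pairL p P = pairL p P := by
  rw [pairL, h.pairT_comm, ← mul_assoc, ← mul_assoc, h.idem₁]

lemma compression_mul : p * P * p = (1 - p * (1 - P) * p) * p := by
  rw [sub_mul, mul_assoc _ p p, mul_sub, sub_mul, h.idem₁, mul_one, h.idem₁]
  simp

lemma pairL_mul_pairK : pairL p P * pairK p P = p := by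
  calc pairT p P * p * P * (P * p * pairT p P) = pairT p P * (p * (P * P) * p) * pairT p P := by
        simp only [mul_assoc]
    _ = pairT p P * (1 - p * (1 - P) * p) * (p * pairT p P) := by
        rw [h.idem₂, h.compression_mul]; simp only [mul_assoc]
    _ = p := by rw [← h.pairT_comm, ← mul_assoc, h.pairT_mul_mul, one_mul]

lemma pairK_mul_pairL : pairK p P * pairL p P = P := by
  set Q := P - pairK p P * pairL p P with hQ
  have hPK : P * pairK p P = pairK p P := by rw [pairK, ← mul_assoc, ← mul_assoc, h.idem₂]
  have hPQ : P * Q = Q := by rw [hQ, mul_sub, ← mul_assoc, hPK, h.idem₂]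
  have hLP : pairL p P * P = pairL p P := by rw [pairL, mul_assoc, h.idem₂]
  have hLQ : pairL p P * Q = 0 := by
    rw [hQ, mul_sub, ← mul_assoc, h.pairL_mul_pairK, hLP, h.mul_pairL, sub_self]
  -- the factor `T` in `L Q = T p Q` is invertible
  have hpQ : p * Q = 0 := by
    have e : pairT p P * (p * Q) = 0 := by
      rw [pairL, mul_assoc, hPQ, mul_assoc] at hLQ
      exact hLQ
    calc p * Q = pairT p P * (1 - p * (1 - P) * p) * pairT p P * (p * Q) := by
          rw [h.pairT_mul_mul, one_mul]
      _ = 0 := by rw [mul_assoc _ (pairT p P), e, mul_zero]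
  have hQ2 : P * (1 - p) * P * Q = Q := by
    rw [mul_assoc _ P Q, hPQ, mul_assoc, sub_mul, hpQ, one_mul, sub_zero, hPQ]
  have hn : ‖Q‖ ≤ ‖P * (1 - p) * P‖ * ‖Q‖ := by
    conv_lhs => rw [← hQ2]
    exact norm_mul_le _ _
  have : Q = 0 := by
    by_contra hne
    have := (mul_lt_iff_lt_one_left (norm_pos_iff.2 hne)).2 h.lt₂
    linarith
  exact (sub_eq_zero.1 this).symm

end ProjPair

end ProjectorPair

section WeylFrame

variable {N n d : ℕ} [NeZero N] [NeZero n] {R : Rep N d} {δ : ℝ}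
  (ρ : su N →ₗ[ℝ] Mat d) (b : Fin 4 → Circle)

/-- A neighbourhood of the relevant link fields on which the free projector and the projectors
`projFamily` are in general position. -/
def frameDomain : Set (ℝ × Blocks n N) := {z ∈ familyDomain ρ b |
  ‖blockP b 1 * (1 - projFamily ρ b z) * blockP b 1‖ < 1 ∧
  ‖projFamily ρ b z * (1 - blockP b 1) * projFamily ρ b z‖ < 1}

lemma isOpen_frameDomain : IsOpen (frameDomain (n := n) ρ b) := by
  have hP : ContinuousOn (projFamily (n := n) ρ b) (familyDomain ρ b) := fun z hz =>
    (contDiffAt_projFamily ρ b hz).continuousAt.continuousWithinAt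
  have h : ContinuousOn (fun z => (‖blockP b 1 * (1 - projFamily (n := n) ρ b z) * blockP b 1‖,
      ‖projFamily ρ b z * (1 - blockP b 1) * projFamily ρ b z‖)) (familyDomain ρ b) := by
    fun_prop
  exact h.isOpen_inter_preimage (isOpen_familyDomain ρ b)
    ((isOpen_Iio (a := (1 : ℝ))).prod (isOpen_Iio (a := (1 : ℝ))))

/-- The partial isometries from the free Weyl fields to those in the presence of link fields. -/
def pairFrame (z : ℝ × Blocks n N) : Op n d := pairK (blockP b 1) (projFamily ρ b z)

/-- The adjoint of `pairFrame`. -/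
def pairDual (z : ℝ × Blocks n N) : Op n d := pairL (blockP b 1) (projFamily ρ b z)

variable {ρ}

lemma projPair {z : ℝ × Blocks n N} (hz : z ∈ frameDomain ρ b) :
    ProjPair (blockP b 1) (projFamily ρ b z) :=
  ⟨blockP_idem b (norm_gapB_one_lt b), blockP_conjTranspose b (norm_gapB_one_lt b),
    blockP_idem b hz.1.2, blockP_conjTranspose b hz.1.2, hz.2.1, hz.2.2⟩

lemma isFrame_pair : IsFrame (blockP b 1) (pairFrame ρ b) (pairDual ρ b) (projFamily ρ b)
    (frameDomain (n := n) ρ b) := by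
  have hP : ∀ z ∈ frameDomain (n := n) ρ b, SmoothAt (projFamily ρ b) z := fun z hz =>
    contDiffAt_projFamily ρ b hz.1
  have hT : ∀ z ∈ frameDomain (n := n) ρ b,
      SmoothAt (fun z => pairT (blockP b 1) (projFamily ρ b z)) z := fun z hz =>
    contDiffAt_powerSeries (B := fun z => blockP b 1 * (1 - projFamily ρ b z) * blockP b 1)
      norm_one_matrix_le abs_invSqrtCoeff_le_one ⟨isOpen_frameDomain ρ b, fun z hz =>
        (contDiffAt_const.mul (contDiffAt_const.sub (hP z hz))).mul contDiffAt_const,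
        fun z hz => hz.2.1⟩ hz
  exact ⟨isOpen_frameDomain ρ b, fun z hz => ((hP z hz).mul contDiffAt_const).mul (hT z hz),
    fun z hz => ((hT z hz).mul contDiffAt_const).mul (hP z hz),
    fun z hz => (projPair b hz).pairL_mul_pairK, fun z hz => (projPair b hz).pairK_mul,
    fun z hz => (projPair b hz).mul_pairL, fun z hz => (projPair b hz).pairK_mul_pairL.symm⟩

lemma SmallRep.mem_frameDomain (h : SmallRep R ρ δ) {U : Config n N}
    (hU : U ∈ smoothFields n R δ) {t : ℝ} (ht : t ∈ 𝕀) :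
    (t, coeConfig U) ∈ frameDomain (n := n) ρ b := by
  have hm := h.mem_familyDomain b hU ht
  have h1 := norm_gapB_one_lt (n := n) (d := d) b
  have hB := h.norm_repBlocks_sub_one_le (h.powConfig_mem hU ht)
  have h0 : ‖(1 : Blocks n d) - 1‖ ≤ 1 / 80 := by rw [sub_self, norm_zero]; norm_num
  rw [h.repBlocks_powConfig hU] at hB
  exact ⟨hm, norm_compression_lt_one (blockP_idem b h1) (blockP_conjTranspose b h1)
      (blockP_idem b hm.2) (blockP_conjTranspose b hm.2) fun ψ => eq_zero_of_blockP b h0 hB,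
    norm_compression_lt_one (blockP_idem b hm.2) (blockP_conjTranspose b hm.2)
      (blockP_idem b h1) (blockP_conjTranspose b h1) fun ψ => eq_zero_of_blockP b hB h0⟩

end WeylFrame

section WeylBasis

variable {N n d : ℕ} [NeZero N] [NeZero n] {R : Rep N d} {δ : ℝ}
  (ρ : su N →ₗ[ℝ] Mat d) (b : Fin 4 → Circle)

/-- The connection form of `pairFrame`. -/
def pairForm (z : ℝ × Blocks n N) : ℝ × Blocks n N →L[ℝ] ℂ :=
  frameForm 𝐓 (pairFrame ρ b) (pairDual ρ b) z

/-- The geometric phase of `pairFrame` along the family of link fields `U_t`. -/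
def pairPhase (M : Blocks n N) : ℂ := ∫ t in (0 : ℝ)..1, pairForm (n := n) ρ b (t, M) (1, 0)

/-- The frame at `t = 1` with its geometric phase removed, spread evenly over the basis vectors. -/
def weylFrame (M : Blocks n N) : Op n d :=
  Complex.exp (-(((2 * d * n ^ 4 : ℕ) : ℂ)⁻¹ * pairPhase ρ b M)) • pairFrame ρ b (1, M)

variable {ρ}

lemma SmallRep.contDiffAt_weylFrame (h : SmallRep R ρ δ) {U : Config n N}
    (hU : U ∈ smoothFields n R δ) : SmoothAt (weylFrame (n := n) ρ b) (coeConfig U) := by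
  have hm := fun (t : ℝ) (ht : t ∈ 𝕀) => h.mem_frameDomain b hU ht
  have hF := isFrame_pair (n := n) (ρ := ρ) b
  have h1 : SmoothAt (pairPhase (n := n) ρ b) (coeConfig U) :=
    contDiffAt_unitIntegral (G := fun z => pairForm (n := n) ρ b z (1, 0)) hF.isOpen
      (fun z hz => (hF.smooth_frameForm (tr := traceL (Idx n d)) hz).clm_apply contDiffAt_const) hm
  have h2 : SmoothAt (fun M => pairFrame (n := n) ρ b (1, M)) (coeConfig U) :=
    contDiffAt_slice (hF.smoothK _ (hm 1 (by simp)))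
  exact (contDiffAt_const.mul h1).neg.cexp.smul h2

lemma SmallRep.star_pairPhase (h : SmallRep R ρ δ) {U : Config n N} (hU : U ∈ smoothFields n R δ) :
    star (pairPhase ρ b (coeConfig U)) = -pairPhase ρ b (coeConfig U) := by
  have e : star (pairPhase ρ b (coeConfig U)) = ∫ t in (0 : ℝ)..1,
      (starRingEnd ℂ) (pairForm ρ b (t, coeConfig U) (1, 0)) :=
    intervalIntegral.intervalIntegral_conj.symm
  rw [e, pairPhase, ← integral_neg]
  exact unitIntegral_congr fun t ht => (isFrame_pair b).star_frameForm (h.mem_frameDomain b hU ht)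
    (fun z hz => (projPair b hz).pairK_conjTranspose) traceL_mul_comm
    (fun x => trace_conjTranspose x) _

lemma SmallRep.star_phaseFactor_mul (h : SmallRep R ρ δ) {U : Config n N}
    (hU : U ∈ smoothFields n R δ) (c : ℕ) :
    star (Complex.exp (-((c : ℂ)⁻¹ * pairPhase ρ b (coeConfig U)))) *
      Complex.exp (-((c : ℂ)⁻¹ * pairPhase ρ b (coeConfig U))) = 1 := by
  have e : star (Complex.exp (-((c : ℂ)⁻¹ * pairPhase ρ b (coeConfig U)))) =
      Complex.exp ((c : ℂ)⁻¹ * pairPhase ρ b (coeConfig U)) := by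
    have := h.star_pairPhase b hU
    rw [star_def] at this ⊢
    rw [← Complex.exp_conj, map_neg, map_mul, this, map_inv₀, conj_natCast, mul_neg, neg_neg]
  rw [e, ← Complex.exp_add, add_neg_cancel, Complex.exp_zero]

lemma SmallRep.pairForm_zero (h : SmallRep R ρ δ) {U : Config n N}
    (hU : U ∈ smoothFields n R δ) (w : Blocks n N) :
    pairForm ρ b (0, coeConfig U) (0, w) = 0 := by
  have h1 := fderiv_slice ((isFrame_pair b).smoothK _ (h.mem_frameDomain b hU (t := 0) (by simp)))
  have h2 : (fun M : Blocks n N => pairFrame ρ b (0, M)) =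
      fun _ => pairK (blockP b 1) (blockP b 1) := by
    funext M; rw [pairFrame, projFamily, blockFn_zero]
  rw [h2, fderiv_const_apply] at h1
  have h3 : 𝐝 (pairFrame ρ b) (0, coeConfig U) (0, w) = 0 := (DFunLike.congr_fun h1 w).symm
  rw [pairForm, frameForm, ContinuousLinearMap.comp_apply, h3, map_zero]

lemma trace_frame_algebra {ι : Type*} [Fintype ι] [DecidableEq ι] {m : ℕ}
    {W : Matrix ι (Fin m) ℂ} {p K K' L : Matrix ι ι ℂ} (h1 : Wᴴ * W = 1) (h2 : W * Wᴴ = p)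
    (hL : Kᴴ = L) (hp : L * K = p) (hr : p * L = L) {f f' c : ℂ} (hf : star f * f = 1)
    (hf' : f' = f * c) :
    ((f • K * W)ᴴ * ((f • K' + f' • K) * W)).trace = (K' * L).trace + c * m := by
  have e1 : (Wᴴ * L * (K' * W)).trace = (K' * L).trace := by
    rw [trace_mul_comm, Matrix.mul_assoc, ← Matrix.mul_assoc W, h2, hr]
  have e2 : (Wᴴ * L * (K * W)).trace = m := by
    rw [Matrix.mul_assoc, ← Matrix.mul_assoc L, hp, ← h2, Matrix.mul_assoc W, h1, Matrix.mul_one,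
      h1, trace_one, Fintype.card_fin]
  rw [smul_mul, conjTranspose_smul, conjTranspose_mul, hL, smul_mul,
    Matrix.add_mul, smul_mul, smul_mul, Matrix.mul_add, Matrix.mul_smul,
    Matrix.mul_smul, smul_add, smul_smul, smul_smul, trace_add, trace_smul,
    trace_smul, e1, e2, hf', ← mul_assoc, hf, one_smul, one_mul, smul_eq_mul]

/-- Bases of the spaces of Weyl fields, as isometries `V`, with the given measure term. -/
lemma SmallRep.exists_weylIsometry (h : SmallRep R ρ δ) {a : ℝ} (ha : a ≠ 0) :
    ∃ V : Config n N → Matrix (Idx n d) (Fin (2 * d * n ^ 4)) ℂ, SmoothOn (smoothFields n R δ) V ∧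
      ∀ U ∈ smoothFields n R δ, (V U)ᴴ * V U = 1 ∧ V U * (V U)ᴴ = hatPMinus R a b U ∧
        ∀ η : Pert n N, I * ((V U)ᴴ * variation a η V U).trace = measureTerm R a b η U := by
  have hp1 := norm_gapB_one_lt (n := n) (d := d) b
  obtain ⟨W, hW, hW'⟩ := exists_isometry_of_projector (blockP_idem b hp1)
    (blockP_conjTranspose b hp1) (trace_blockP_one b)
  let r : Op n d →L[ℝ] Matrix (Idx n d) (Fin (2 * d * n ^ 4)) ℂ := LinearMap.toContinuousLinearMap
    { toFun := fun A => A * W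
      map_add' := fun A B => Matrix.add_mul A B W
      map_smul' := fun c A => smul_mul c A W }
  have hr : ∀ U ∈ smoothFields n R δ,
      (fun U => weylFrame ρ b (coeConfig U) * W) U = (fun M => r (weylFrame ρ b M)) (coeConfig U) :=
    fun U _ => rfl
  refine ⟨fun U => weylFrame ρ b (coeConfig U) * W, h.smoothOn_of_eqOn hr fun U hU =>
    r.contDiff.contDiffAt.comp _ (h.contDiffAt_weylFrame b hU), fun U hU => ?_⟩
  have hm := fun (t : ℝ) (ht : t ∈ 𝕀) => h.mem_frameDomain b hU ht
  have hF := isFrame_pair (n := n) (ρ := ρ) b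
  have hq := projPair b (hm 1 (by simp))
  have hf := h.star_phaseFactor_mul b hU (2 * d * n ^ 4)
  have hs : (weylFrame ρ b (coeConfig U))ᴴ * weylFrame ρ b (coeConfig U) = blockP b 1 := by
    rw [weylFrame, conjTranspose_smul, smul_mul_smul_comm, hf, one_smul, pairFrame,
      hq.pairK_conjTranspose, hq.pairL_mul_pairK]
  have hs' : weylFrame ρ b (coeConfig U) * blockP b 1 * (weylFrame ρ b (coeConfig U))ᴴ =
      hatPMinus R a b U := by
    rw [weylFrame, conjTranspose_smul, smul_mul_assoc, smul_mul_smul_comm, mul_comm, hf,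
      one_smul, pairFrame, hq.pairK_conjTranspose, hq.pairK_mul, hq.pairK_mul_pairL,
      h.hatPMinus_eq_projFamily b ha U hU]
  refine ⟨?_, ?_, fun η => ?_⟩
  · simp only []
    rw [conjTranspose_mul, Matrix.mul_assoc, ← Matrix.mul_assoc _ _ W, hs, ← hW',
      Matrix.mul_assoc W, hW, Matrix.mul_one, hW]
  · simp only []
    rw [conjTranspose_mul, Matrix.mul_assoc, ← Matrix.mul_assoc W, hW', ← Matrix.mul_assoc, hs']
  by_cases hd : d = 0
  · subst hd
    simp [measureTerm, trace, Matrix.mul_apply]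
  have hc : ((2 * d * n ^ 4 : ℕ) : ℂ) ≠ 0 := Nat.cast_ne_zero.2
    (mul_ne_zero (mul_ne_zero two_ne_zero hd) (pow_ne_zero 4 (NeZero.ne n)))
  rw [h.variation_eq (f := fun M => r (weylFrame ρ b M)) hr hU
    (r.differentiable.differentiableAt.comp _
      ((h.contDiffAt_weylFrame b hU).differentiableAt (by simp))), h.measureTerm_eq b ha η U hU]
  set w := tangent a η (coeConfig U)
  congr 1
  obtain ⟨φ', hφ, hφ'⟩ := hF.hasFDerivAt_phase (tr := traceL (Idx n d)) traceL_mul_comm hm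
    fun q hq => contDiffAt_projFamily ρ b hq.1
  have hK : HasFDerivAt (fun M => pairFrame (n := n) ρ b (1, M))
      ((𝐝 (pairFrame ρ b) (1, coeConfig U)).comp (inr ℝ ℝ _))
      (coeConfig U) := by
    have := contDiffAt_slice (hF.smoothK _ (hm 1 (by simp)))
    rw [← fderiv_slice (hF.smoothK _ (hm 1 (by simp)))]
    exact this.hasFD
  have hN := (hφ.const_mul ((2 * d * n ^ 4 : ℕ) : ℂ)⁻¹).neg.cexp.smul hK
  have hrN : 𝐝 (fun M => r (weylFrame ρ b M)) (coeConfig U) w =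
      (Complex.exp (-(((2 * d * n ^ 4 : ℕ) : ℂ)⁻¹ * pairPhase ρ b (coeConfig U))) •
        𝐝 (pairFrame ρ b) (1, coeConfig U) (0, w) +
      (Complex.exp (-(((2 * d * n ^ 4 : ℕ) : ℂ)⁻¹ * pairPhase ρ b (coeConfig U))) *
        -(((2 * d * n ^ 4 : ℕ) : ℂ)⁻¹ * φ' w)) • pairFrame ρ b (1, coeConfig U)) * W := 
    DFunLike.congr_fun (r.hasFDerivAt.comp (coeConfig U) hN).fderiv w
  rw [hrN]
  refine (trace_frame_algebra hW hW' hq.pairK_conjTranspose hq.pairL_mul_pairK hq.mul_pairL hf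
    rfl).trans ?_
  have e := hφ' w
  rw [show frameForm _ _ _ ((0 : ℝ), coeConfig U) (0, w) = 0 from h.pairForm_zero b hU w,
    sub_zero] at e
  have e2 : frameForm 𝐓 (pairFrame ρ b) (pairDual ρ b) (1, coeConfig U) (0, w) =
    (𝐝 (pairFrame ρ b) (1, coeConfig U) (0, w) * pairDual ρ b (1, coeConfig U)).trace := rfl
  rw [neg_mul, mul_right_comm, inv_mul_cancel₀ hc, one_mul, e, e2]
  exact (sub_eq_add_neg _ _).symm.trans (sub_sub_cancel _ _)

end WeylBasis

/-! ### Grassmann integrals -/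

section Berezin

variable {m : ℕ}

lemma berezin_ιMulti {k : ℕ} (v : Fin k → Fin m ⊕ Fin m → ℂ) :
    berezin m (ExteriorAlgebra.ιMulti ℂ k v) = (Pi.single (m + m)
      ((Pi.basisFun ℂ (Fin m ⊕ Fin m)).det.domDomCongr finSumFinEquiv) :
      ∀ i, (Fin m ⊕ Fin m → ℂ) [⋀^Fin i]→ₗ[ℂ] ℂ) k v :=
  ExteriorAlgebra.liftAlternating_apply_ιMulti _ _

/-- The change of variables formula: Grassmann integrals scale with the determinant. -/
lemma berezin_map (f : (Fin m ⊕ Fin m → ℂ) →ₗ[ℂ] (Fin m ⊕ Fin m → ℂ)) (x : CoeffAlg m) :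
    berezin m (ExteriorAlgebra.map f x) = LinearMap.det f * berezin m x := by
  have e : berezin m ∘ₗ (ExteriorAlgebra.map f).toLinearMap = LinearMap.det f • berezin m := by
    refine ExteriorAlgebra.lhom_ext fun k => AlternatingMap.ext fun v => ?_
    show berezin m (ExteriorAlgebra.map f (ExteriorAlgebra.ιMulti ℂ k v)) =
      LinearMap.det f * berezin m (ExteriorAlgebra.ιMulti ℂ k v)
    rw [ExteriorAlgebra.map_apply_ιMulti, berezin_ιMulti, berezin_ιMulti]
    by_cases hk : k = m + m
    · subst hk
      rw [Pi.single_eq_same, AlternatingMap.domDomCongr_apply, AlternatingMap.domDomCongr_apply]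
      exact (Pi.basisFun ℂ (Fin m ⊕ Fin m)).det_comp f _
    · rw [Pi.single_eq_of_ne hk]
      simp
  exact LinearMap.congr_fun e x

lemma berezin_eq_zero {k : ℕ} (hk : k ≠ m + m) {x : CoeffAlg m}
    (hx : x ∈ ⋀[ℂ]^k (Fin m ⊕ Fin m → ℂ)) : berezin m x = 0 := by
  rw [← ExteriorAlgebra.ιMulti_span_fixedDegree] at hx
  refine Submodule.span_induction (p := fun x _ => berezin m x = 0) ?_ (map_zero _)
    (fun x y _ _ hx hy => by rw [map_add, hx, hy, add_zero])
    (fun c x _ hx => by rw [map_smul, hx, smul_zero]) hx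
  rintro _ ⟨v, rfl⟩
  rw [berezin_ιMulti, Pi.single_eq_of_ne hk]
  rfl

/-- The generators `c_j` and `c̄_k` of the Grassmann algebra. -/
def coeffVar (i : Fin m ⊕ Fin m) : CoeffAlg m :=
  ExteriorAlgebra.ι ℂ (Pi.single (M := fun _ => ℂ) i 1)

lemma berezin_list_prod_ne_zero {l : List (Fin m ⊕ Fin m)} (hl : l.Nodup)
    (hm : l.length = m + m) : berezin m (l.map coeffVar).prod ≠ 0 := by
  let g : Fin (m + m) → Fin m ⊕ Fin m := fun i => l.get (i.cast hm.symm)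
  have hg : Function.Injective g := fun i j h =>
    Fin.cast_injective _ (List.nodup_iff_injective_get.1 hl h)
  have e : (l.map coeffVar).prod =
      ExteriorAlgebra.ιMulti ℂ (m + m) fun i => Pi.single (M := fun _ => ℂ) (g i) 1 := by
    rw [ExteriorAlgebra.ιMulti_apply]
    congr 1
    refine List.ext_get (by simp [hm]) fun i h1 h2 => ?_
    simp [g, coeffVar]
  let τ : Equiv.Perm (Fin m ⊕ Fin m) := Equiv.ofBijective (g ∘ finSumFinEquiv)
    (Finite.injective_iff_bijective.1 (hg.comp finSumFinEquiv.injective))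
  rw [e, berezin_ιMulti, Pi.single_eq_same, AlternatingMap.domDomCongr_apply]
  have e2 : ((fun i => Pi.single (M := fun _ => ℂ) (g i) 1) ∘ finSumFinEquiv :
      Fin m ⊕ Fin m → Fin m ⊕ Fin m → ℂ) = Pi.basisFun ℂ (Fin m ⊕ Fin m) ∘ τ := by
    funext i
    simp [τ]
  rw [e2, AlternatingMap.map_perm, Module.Basis.det_self]
  rcases Int.units_eq_one_or (Equiv.Perm.sign τ) with h | h <;> simp [h]

lemma add_pow_succ_of_sq_eq_zero {A : Type*} [Ring A] {x s : A} (hc : x * s = s * x)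
    (hx : x * x = 0) (k : ℕ) :
    (x + s) ^ (k + 1) = s ^ (k + 1) + ((k + 1 : ℕ) : A) * (x * s ^ k) := by
  induction k with
  | zero => simp [add_comm]
  | succ k ih =>
    have h1 : s ^ (k + 1) * x = x * s ^ (k + 1) := ((show Commute x s from hc).pow_right _).eq.symm
    have h2 : x * s ^ k * x = 0 := by
      rw [mul_assoc, ← ((show Commute x s from hc).pow_right k).eq, ← mul_assoc, hx, zero_mul]
    rw [pow_succ, ih, add_mul, mul_add, h1, mul_assoc, mul_add, h2, zero_add, ← pow_succ,
      mul_assoc x, ← pow_succ]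
    push_cast
    noncomm_ring

/-- Powers of sums of commuting nilpotent elements. -/
lemma list_sum_pow {A : Type*} [Ring A] {l : List A} (hc : ∀ x ∈ l, ∀ y ∈ l, x * y = y * x)
    (hx : ∀ x ∈ l, x * x = 0) :
    l.sum ^ (l.length + 1) = 0 ∧ l.sum ^ l.length = (l.length.factorial : A) * l.prod := by
  induction l with
  | nil => simp
  | cons x l ih =>
    obtain ⟨h1, h2⟩ := ih (fun x hx y hy => hc x (by simp [hx]) y (by simp [hy]))
      fun x h => hx x (by simp [h])
    have hxs : x * l.sum = l.sum * x := Commute.list_sum_right x l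
      fun y hy => hc x (by simp) y (by simp [hy])
    have hxx := hx x (by simp)
    rw [List.sum_cons, List.length_cons, List.prod_cons, add_pow_succ_of_sq_eq_zero hxs hxx,
      add_pow_succ_of_sq_eq_zero hxs hxx, pow_succ _ (l.length + 1), h1, h2, Nat.factorial_succ]
    refine ⟨by simp, ?_⟩
    rw [zero_add, (Nat.cast_commute _ x).symm.left_comm, Nat.cast_mul, mul_assoc]

/-- `∑_j c̄_j c_j` -/
def coeffAction (m : ℕ) : CoeffAlg m := ∑ j : Fin m, coeffVar (Sum.inr j) * coeffVar (Sum.inl j)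

lemma berezin_coeffAction_pow_self : berezin m (coeffAction m ^ m) ≠ 0 := by
  have hsw : ∀ i j : Fin m ⊕ Fin m, coeffVar i * coeffVar j = -(coeffVar j * coeffVar i) :=
    fun i j => eq_neg_of_add_eq_zero_left (ExteriorAlgebra.ι_add_mul_swap _ _)
  have hsq : ∀ i : Fin m ⊕ Fin m, coeffVar i * coeffVar i = 0 := fun i =>
    ExteriorAlgebra.ι_sq_zero _
  have hc : ∀ i j k : Fin m ⊕ Fin m,
      coeffVar i * (coeffVar j * coeffVar k) =
        coeffVar j * coeffVar k * coeffVar i := fun i j k => by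
    rw [← mul_assoc, hsw i j, neg_mul, mul_assoc, hsw i k, mul_neg, neg_neg, mul_assoc]
  let x : Fin m → CoeffAlg m := fun j => coeffVar (Sum.inr j) * coeffVar (Sum.inl j)
  have h := (list_sum_pow (l := (List.finRange m).map x) (by
    simp only [List.mem_map, List.mem_finRange, true_and, forall_exists_index,
      forall_apply_eq_imp_iff]
    intro i j
    exact ((show Commute _ _ from hc _ _ _).mul_left (hc _ _ _))) (by
    simp only [List.mem_map, List.mem_finRange, true_and, forall_exists_index,
      forall_apply_eq_imp_iff]
    intro j
    show _ * _ * (_ * _) = 0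
    rw [mul_assoc, ← mul_assoc (coeffVar (Sum.inl j)), hsw (Sum.inl j), neg_mul, mul_assoc, hsq,
      mul_zero, neg_zero, mul_zero])).2
  rw [← Fin.sum_univ_def, List.length_map, List.length_finRange] at h
  have hp : ∀ l : List (Fin m), (l.map x).prod =
      ((l.flatMap fun j => [Sum.inr j, Sum.inl j]).map coeffVar).prod := by
    intro l
    induction l with
    | nil => rfl
    | cons j l ih => simp [ih, x, mul_assoc]
  rw [coeffAction, h, hp, ← nsmul_eq_mul, map_nsmul, nsmul_eq_mul]
  refine mul_ne_zero (Nat.cast_ne_zero.2 m.factorial_ne_zero)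
    (berezin_list_prod_ne_zero (List.nodup_flatMap.2 ⟨by simp, ?_⟩) ?_)
  · refine (List.nodup_finRange m).imp fun {i j} hij => ?_
    simp [Function.onFun, Ne.symm hij]
  · simp [List.length_flatMap, mul_two]

lemma berezin_coeffAction_pow {k : ℕ} (hk : k ≠ m) : berezin m (coeffAction m ^ k) = 0 := by
  refine berezin_eq_zero (k := 2 * k) (by omega) ?_
  have h : coeffAction m ∈ LinearMap.range (ExteriorAlgebra.ι ℂ (M := Fin m ⊕ Fin m → ℂ)) ^ 2 :=
    Submodule.sum_mem _ fun j _ => by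
      rw [sq]
      exact Submodule.mul_mem_mul (LinearMap.mem_range_self _ _) (LinearMap.mem_range_self _ _)
  have := Submodule.pow_mem_pow _ h k
  rwa [← pow_mul] at this

end Berezin

section Expectation

variable {n d m : ℕ} [NeZero n]

/-- The truncated exponential series of `-∑_j c̄_j c_j`. -/
def coeffBoltzmann (n d m : ℕ) [NeZero n] : CoeffAlg m :=
  ∑ k ∈ range (Fintype.card (Idx n d) + 1), ((k.factorial : ℂ)⁻¹) • (-coeffAction m) ^ k

lemma berezin_coeffBoltzmann_ne_zero (hm : m ≤ Fintype.card (Idx n d)) :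
    berezin m (coeffBoltzmann n d m) ≠ 0 := by
  have e : ∀ k, berezin m (((k.factorial : ℂ)⁻¹) • (-coeffAction m) ^ k) =
      (k.factorial : ℂ)⁻¹ * ((-1) ^ k * berezin m (coeffAction m ^ k)) := by
    intro k
    rw [map_smul, neg_pow, ← map_one (algebraMap ℂ (CoeffAlg m)), ← map_neg, ← map_pow,
      ← Algebra.smul_def, map_smul, smul_eq_mul, smul_eq_mul]
  rw [coeffBoltzmann, map_sum, sum_eq_single m]
  · rw [e]
    exact mul_ne_zero (inv_ne_zero (Nat.cast_ne_zero.2 m.factorial_ne_zero))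
      (mul_ne_zero (pow_ne_zero _ (by norm_num)) berezin_coeffAction_pow_self)
  · intro k _ hk
    rw [e, berezin_coeffAction_pow hk, mul_zero, mul_zero]
  · intro h
    exact absurd (Finset.mem_range.2 (by omega)) h

lemma expand_psi (v vb : Fin m → Idx n d → ℂ) (s : Idx n d) :
    expand v vb (psi s) = ∑ j, v j s • coeffVar (Sum.inl j) := by
  simp only [coeffVar, ← map_smul, ← map_sum]
  rw [expand, psi, ExteriorAlgebra.map_apply_ι]
  congr 1
  funext i
  cases i <;> simp [Pi.single_apply, Finset.sum_apply]

lemma expand_psiBar (v vb : Fin m → Idx n d → ℂ) (s : Idx n d) :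
    expand v vb (psiBar s) = ∑ k, vb k s • coeffVar (Sum.inr k) := by
  simp only [coeffVar, ← map_smul, ← map_sum]
  rw [expand, psiBar, ExteriorAlgebra.map_apply_ι]
  congr 1
  funext i
  cases i <;> simp [Pi.single_apply, Finset.sum_apply]

/-- The fermion integral of the Boltzmann factor is the determinant of the matrix representing the
Dirac operator in the chosen bases, up to a constant. -/
lemma expectation_one (a : ℝ) (D : Op n d) (v vb : Fin m → Idx n d → ℂ)
    {M : Mat m}
    (hM : ∀ k j, M k j = (a : ℂ) ^ 4 * ∑ s, ∑ s', D s s' * (vb k s * v j s')) :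
    expectation a D v vb 1 = M.det * berezin m (coeffBoltzmann n d m) := by
  let f := toLin' (fromBlocks Mᵀ 0 0 (1 : Mat m))
  have hf : LinearMap.det f = M.det := by
    rw [LinearMap.det_toLin', det_fromBlocks_zero₂₁, det_one, mul_one, det_transpose]
  have h1 : ∀ k, ExteriorAlgebra.map f (coeffVar (Sum.inr k)) = coeffVar (Sum.inr k) := by
    intro k
    rw [coeffVar, ExteriorAlgebra.map_apply_ι]
    congr 1
    funext i
    cases i <;> simp [f, toLin'_apply, Matrix.one_apply, Pi.single_apply]
  have h2 : ∀ k, ExteriorAlgebra.map f (coeffVar (Sum.inl k)) =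
      ∑ j, M k j • coeffVar (Sum.inl j) := by
    intro k
    simp only [coeffVar, ← map_smul, ← map_sum]
    rw [ExteriorAlgebra.map_apply_ι]
    congr 1
    funext i
    cases i <;> simp [f, toLin'_apply, Pi.single_apply]
  have h3 : expand v vb (fermionAction a D) = ExteriorAlgebra.map f (coeffAction m) := by
    simp only [fermionAction, coeffAction, map_smul, map_sum, map_mul, expand_psi, expand_psiBar,
      h1, h2, hM, mul_sum, sum_mul, smul_sum, smul_smul, smul_mul_assoc,
      mul_smul_comm, sum_smul]
    conv_rhs => rw [sum_comm]
    refine (sum_congr rfl fun s _ => sum_comm).trans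
      (Finset.sum_comm.trans (sum_congr rfl fun k _ => ?_))
    refine (sum_congr rfl fun s _ => sum_comm).trans
      (Finset.sum_comm.trans (sum_congr rfl fun j _ => ?_))
    refine sum_congr rfl fun s _ => sum_congr rfl fun s' _ => ?_
    congr 1
    ring
  have h4 : expand v vb (1 * boltzmann a D) = ExteriorAlgebra.map f (coeffBoltzmann n d m) := by
    simp only [one_mul, boltzmann, coeffBoltzmann, map_sum, map_smul, map_pow, map_neg, h3]
  rw [expectation, h4, berezin_map, hf]

/-- Smooth curves in an algebra without a topology: finite linear combinations with smooth
coefficients. -/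
inductive IsSmoothCombination {E A : Type*} [NormedAddCommGroup E] [NormedSpace ℝ E] [Ring A]
    [Algebra ℂ A] (z : E) : (E → A) → Prop
  | smul {c : E → ℂ} (hc : SmoothAt c z) (e : A) : IsSmoothCombination z fun y => c y • e
  | add {f g : E → A} (hf : IsSmoothCombination z f) (hg : IsSmoothCombination z g) :
    IsSmoothCombination z fun y => f y + g y

namespace IsSmoothCombination

variable {E A : Type*} [NormedAddCommGroup E] [NormedSpace ℝ E] [Ring A] [Algebra ℂ A] {z : E}
  {f g : E → A}

lemma const (e : A) : IsSmoothCombination z fun _ => e := by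
  simpa using smul (c := fun _ => 1) contDiffAt_const e

lemma mul (hf : IsSmoothCombination z f) (hg : IsSmoothCombination z g) :
    IsSmoothCombination z fun y => f y * g y := by
  induction hf with
  | smul hc e =>
    induction hg with
    | smul hc' e' => simpa only [smul_mul_smul_comm] using smul (hc.mul hc') (e * e')
    | add _ _ h1 h2 => simpa only [mul_add] using add h1 h2
  | add _ _ h1 h2 => simpa only [add_mul] using add h1 h2

lemma pow (hf : IsSmoothCombination z f) (k : ℕ) : IsSmoothCombination z fun y => f y ^ k := by
  induction k with
  | zero => simpa using const 1
  | succ k ih => simpa only [pow_succ] using ih.mul hf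

lemma smul_fn {c : E → ℂ} (hc : SmoothAt c z) (hf : IsSmoothCombination z f) :
    IsSmoothCombination z fun y => c y • f y := by
  simpa only [smul_mul_assoc, one_mul] using (smul hc (1 : A)).mul hf

lemma sum {ι : Type*} (s : Finset ι) {f : ι → E → A} (hf : ∀ i ∈ s, IsSmoothCombination z (f i)) :
    IsSmoothCombination z fun y => ∑ i ∈ s, f i y := by
  induction s using cons_induction with
  | empty => simpa using const 0
  | cons i s hi ih =>
    simp only [sum_cons]
    exact (hf i (by simp)).add (ih fun j hj => hf j (by simp [hj]))

lemma contDiffAt (hf : IsSmoothCombination z f) (ℓ : A →ₗ[ℂ] ℂ) :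
    SmoothAt (fun y => ℓ (f y)) z := by
  induction hf with
  | smul hc e => simpa using hc.mul contDiffAt_const
  | add _ _ h1 h2 => simpa using h1.add h2

end IsSmoothCombination

/-- Fermion expectation values depend smoothly on the Dirac operator and the basis vectors. -/
lemma contDiffAt_expectation {E : Type*} [NormedAddCommGroup E] [NormedSpace ℝ E] {z : E}
    {D : E → Op n d} {v : E → Fin m → Idx n d → ℂ} (hD : SmoothAt D z)
    (hv : SmoothAt v z) (a : ℝ) (vb : Fin m → Idx n d → ℂ) (O : FieldAlg n d) :
    SmoothAt (fun y => expectation a (D y) (v y) vb O) z := by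
  have hDe : ∀ s s', SmoothAt (fun y => D y s s') z := fun s s' =>
    (LinearMap.toContinuousLinearMap (entryLinearMap ℝ ℂ s s')).contDiff.contDiffAt.comp z hD
  have hve : ∀ j s, SmoothAt (fun y => v y j s) z := fun j s =>
    contDiffAt_pi.1 (contDiffAt_pi.1 hv j) s
  have hpsi : ∀ s, IsSmoothCombination z fun y => expand (v y) vb (psi s) := fun s => by
    simp only [expand_psi]
    exact .sum _ fun j _ => .smul (hve j s) _
  have hbar : ∀ s, IsSmoothCombination z fun y => expand (v y) vb (psiBar s) := fun s => by
    simp only [expand_psiBar]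
    exact .const _
  have hO : IsSmoothCombination z fun y => expand (v y) vb O := by
    induction O using ExteriorAlgebra.induction with
    | algebraMap r => simpa using .const _
    | ι x =>
      have e : ExteriorAlgebra.ι ℂ x = ∑ s, (x (Sum.inl s) • psi s + x (Sum.inr s) • psiBar s) := by
        simp only [psi, psiBar, ← map_smul, ← map_add, ← map_sum]
        congr 1
        funext i
        cases i <;> simp [Finset.sum_apply, Pi.single_apply]
      simp only [e, map_sum, map_add, map_smul]
      exact .sum _ fun s _ => (hpsi s |>.smul_fn contDiffAt_const).add
        (hbar s |>.smul_fn contDiffAt_const)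
    | mul a b ha hb => simpa only [map_mul] using ha.mul hb
    | add a b ha hb => simpa only [map_add] using ha.add hb
  have hS : IsSmoothCombination z fun y => expand (v y) vb (-fermionAction a (D y)) := by
    simp only [fermionAction, ← neg_smul, map_smul, map_sum, map_mul]
    exact .smul_fn contDiffAt_const (.sum _ fun s _ => .sum _ fun s' _ =>
      .smul_fn (hDe s s') ((hbar s).mul (hpsi s')))
  refine IsSmoothCombination.contDiffAt (f := fun y => expand (v y) vb (O * boltzmann a (D y)))
    ?_ (berezin m)
  simp only [map_mul, boltzmann, map_sum, map_smul, map_pow]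
  exact hO.mul (.sum _ fun k _ => .smul_fn contDiffAt_const (hS.pow k))

end Expectation

/-! ### The effective action -/

section Calculus

lemma eq_mul_exp_integral {y g : ℝ → ℂ} {a b : ℝ} (hab : a ≤ b)
    (hg : ContinuousOn g (Set.Icc a b)) (hy : ∀ t ∈ Set.Icc a b, HasDerivAt y (y t * g t) t) :
    y b = y a * Complex.exp (∫ t in a..b, g t) := by
  let G : ℝ → ℂ := Set.IccExtend hab ((Set.Icc a b).domRestrict g)
  have hG : Continuous G := (continuousOn_iff_continuous_domRestrict.1 hg).Icc_extend'
  have hGg : ∀ t ∈ Set.Icc a b, G t = g t := fun t ht => Set.IccExtend_of_mem _ _ ht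
  have hz : ∀ t ∈ Set.Icc a b, HasDerivAt (fun t => y t * Complex.exp (-∫ s in a..t, G s)) 0 t := by
    intro t ht
    refine ((hy t ht).mul (hG.integral_hasStrictDerivAt a t).hasDerivAt.neg.cexp).congr_deriv ?_
    rw [hGg t ht]
    ring
  have hc := constant_of_has_deriv_right_zero
    (fun t ht => (hz t ht).continuousAt.continuousWithinAt)
    (fun t ht => (hz t (Set.Ico_subset_Icc_self ht)).hasDerivWithinAt) b (Set.right_mem_Icc.2 hab)
  have e : ∫ t in a..b, g t = ∫ t in a..b, G t := by
    refine integral_congr fun t ht => ?_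
    rw [Set.uIcc_of_le hab] at ht
    exact (hGg t ht).symm
  simp only [integral_same, neg_zero, Complex.exp_zero, mul_one] at hc
  rw [← hc, e, mul_assoc, ← Complex.exp_add, neg_add_cancel, Complex.exp_zero, mul_one]

variable {ι κ : Type*} [Fintype ι] [DecidableEq ι] [Fintype κ] [DecidableEq κ] {s : ℝ}

lemma hasDerivAt_entry {X : ℝ → Matrix ι κ ℂ} {X' : Matrix ι κ ℂ} (h : HasDerivAt X X' s)
    (i : ι) (j : κ) : HasDerivAt (fun s => X s i j) (X' i j) s :=
  (LinearMap.toContinuousLinearMap (entryLinearMap ℝ ℂ i j)).hasFDerivAt.comp_hasDerivAt s h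

lemma hasDerivAt_det_of_eq_one {M : ℝ → Matrix ι ι ℂ} {M' : Matrix ι ι ℂ}
    (h : ∀ i j, HasDerivAt (fun s => M s i j) (M' i j) s) (h1 : M s = 1) :
    HasDerivAt (fun s => (M s).det) M'.trace s := by
  let f : ContinuousMultilinearMap ℂ (fun _ : ι => ι → ℂ) ℂ :=
    ⟨(detRowAlternating (n := ι) (R := ℂ)).toMultilinearMap,
      Continuous.matrix_det (A := fun M : Matrix ι ι ℂ => M) continuous_id⟩
  have hM : HasDerivAt (fun s i j => M s i j) (fun i j => M' i j) s :=
    hasDerivAt_pi.2 fun i => hasDerivAt_pi.2 fun j => h i j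
  have h2 := ((f.hasFDerivAt (x := M s)).restrictScalars ℝ).comp_hasDerivAt s hM
  refine h2.congr_deriv ?_
  refine (f.linearDeriv_apply (M s) M').trans ?_
  refine sum_congr rfl fun i _ => ?_
  show Matrix.det (Function.update (M s) i (M' i)) = M' i i
  rw [h1]
  show ((1 : Matrix ι ι ℂ).updateRow i (M' i)).det = _
  rw [← cramer_transpose_apply, transpose_one, cramer_one]
  rfl

variable {m : ℕ} {Q : Matrix (Fin m) ι ℂ} {D : ℝ → Matrix ι ι ℂ} {V : ℝ → Matrix ι (Fin m) ℂ}
  {D' p P : Matrix ι ι ℂ} {V' : Matrix ι (Fin m) ℂ}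

lemma mul_inv_weyl {D : Matrix ι ι ℂ} {V : Matrix ι (Fin m) ℂ} (hQ : Q * Qᴴ = 1)
    (hQ' : Qᴴ * Q = p) (hV' : V * Vᴴ = P) (hD : IsUnit D.det) (hpD : p * D = D * P) :
    (Vᴴ * D⁻¹ * Qᴴ) * (Q * D * V) = 1 ∧ (Q * D * V).det ≠ 0 := by
  have h : (Q * D * V) * (Vᴴ * D⁻¹ * Qᴴ) = 1 := by
    calc (Q * D * V) * (Vᴴ * D⁻¹ * Qᴴ) = Q * (D * (V * Vᴴ)) * D⁻¹ * Qᴴ := by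
          simp only [Matrix.mul_assoc]
      _ = Q * p * (D * D⁻¹) * Qᴴ := by rw [hV', ← hpD]; simp only [Matrix.mul_assoc]
      _ = (Q * Qᴴ) * (Q * Qᴴ) := by
          rw [mul_nonsing_inv _ hD, Matrix.mul_one, ← hQ']; simp only [Matrix.mul_assoc]
      _ = 1 := by rw [hQ, Matrix.one_mul]
  exact ⟨mul_eq_one_comm.1 h, (isUnit_det_of_right_inverse h).ne_zero⟩

/-- The logarithmic derivative of the fermion determinant in orthonormal bases consists of the
naive expression and the contribution of the basis vectors. -/
lemma hasDerivAt_det_weyl (hD' : HasDerivAt D D' s) (hV' : HasDerivAt V V' s)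
    (hQ : Q * Qᴴ = 1) (hQQ : Qᴴ * Q = p) (hV : (V s)ᴴ * V s = 1) (hVV : V s * (V s)ᴴ = P)
    (hD : IsUnit (D s).det) (hpD : p * D s = D s * P) :
    HasDerivAt (fun s => (Q * D s * V s).det) ((Q * D s * V s).det *
      ((D' * P * (D s)⁻¹ * p).trace + ((V s)ᴴ * V').trace)) s := by
  obtain ⟨h1, h2⟩ := mul_inv_weyl hQ hQQ hVV hD hpD
  set X := (V s)ᴴ * (D s)⁻¹ * Qᴴ with hX
  have hent : ∀ i j, HasDerivAt (fun r => (X * (Q * D r * V r)) i j)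
      ((X * (Q * D' * V s + Q * D s * V')) i j) s := by
    intro i j
    have e : ∀ r, (X * (Q * D r * V r)) i j = ∑ k, ∑ l, (X * Q) i l * D r l k * V r k j := by
      intro r
      rw [← Matrix.mul_assoc, ← Matrix.mul_assoc, Matrix.mul_apply]
      simp only [Matrix.mul_apply (M := X * Q), sum_mul]
    simp only [e]
    refine (HasDerivAt.fun_sum fun k _ => HasDerivAt.fun_sum fun l _ =>
      ((hasDerivAt_entry hD' l k).const_mul ((X * Q) i l)).mul
        (hasDerivAt_entry hV' k j)).congr_deriv ?_
    rw [Matrix.mul_add, ← Matrix.mul_assoc, ← Matrix.mul_assoc, ← Matrix.mul_assoc,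
      ← Matrix.mul_assoc, Matrix.add_apply, Matrix.mul_apply, Matrix.mul_apply]
    simp only [Matrix.mul_apply (M := X * Q), sum_mul, sum_add_distrib]
  have h3 := (hasDerivAt_det_of_eq_one hent h1).const_mul (Q * D s * V s).det
  have e : ∀ r, (Q * D s * V s).det * (X * (Q * D r * V r)).det = (Q * D r * V r).det := by
    intro r
    have h4 : (Q * D s * V s).det * X.det = 1 := by rw [mul_comm, ← det_mul, h1, det_one]
    rw [det_mul, ← mul_assoc, h4, one_mul]
  simp only [e] at h3
  refine h3.congr_deriv ?_
  congr 1
  have hP : (V s)ᴴ * P = (V s)ᴴ := by rw [← hVV, ← Matrix.mul_assoc, hV, Matrix.one_mul]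
  have t1 : (X * (Q * D' * V s)).trace = (D' * P * (D s)⁻¹ * p).trace := by
    have e : X * (Q * D' * V s) = (V s)ᴴ * (D s)⁻¹ * p * (D' * V s) := by
      rw [hX, ← hQQ]; simp only [Matrix.mul_assoc]
    rw [e, trace_mul_comm, ← hVV]
    simp only [Matrix.mul_assoc]
  have t2 : X * (Q * D s * V') = (V s)ᴴ * V' := by
    calc X * (Q * D s * V') = (V s)ᴴ * (D s)⁻¹ * ((Qᴴ * Q) * D s) * V' := by
          rw [hX]; simp only [Matrix.mul_assoc]
      _ = (V s)ᴴ * ((D s)⁻¹ * D s) * P * V' := by rw [hQQ, hpD]; simp only [Matrix.mul_assoc]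
      _ = _ := by rw [nonsing_inv_mul _ hD, Matrix.mul_one, hP]
  rw [Matrix.mul_add, trace_add, t1, t2]

end Calculus

section EffectiveAction

variable {N n d : ℕ} [NeZero N] [NeZero n] {R : Rep N d} {δ a : ℝ}
  {ρ : su N →ₗ[ℝ] Mat d} {U : Config n N}

section Curves

variable {F : Type*} [NormedAddCommGroup F] [NormedSpace ℝ F] {f : Config n N → F}

lemma SmoothOn.hasDerivAt (hf : SmoothOn (smoothFields n R δ) f) (hU : U ∈ smoothFields n R δ)
    (a : ℝ) (η : Pert n N) :
    HasDerivAt (fun s : ℝ => f (shift ((s * a) • η) U)) (variation a η f U) 0 := by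
  have h1 : DifferentiableAt ℝ (fun X : Pert n N => f (shift X U)) (((0 : ℝ) * a) • η) := by
    rw [zero_mul, zero_smul]
    exact (hf U hU).differentiableAt (by simp)
  have h2 : DifferentiableAt ℝ (fun s : ℝ => (s * a) • η) 0 := by fun_prop
  exact (DifferentiableAt.comp (0 : ℝ) h1 h2).hasDerivAt

lemma SmallRep.contDiffAt_comp_powConfig (h : SmallRep R ρ δ)
    (hf : SmoothOn (smoothFields n R δ) f) (hU : U ∈ smoothFields n R δ) {t : ℝ}
    (ht : t ∈ 𝕀) : SmoothAt (fun s => f (powConfig s U)) t := by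
  have e : (fun s => f (powConfig s U)) =
      fun s => f (shift ((s - t) • flowPert U) (powConfig t U)) := funext fun s => by
    rw [← h.powConfig_add hU, add_sub_cancel]
  rw [e]
  have h1 : SmoothAt (fun X : Pert n N => f (shift X (powConfig t U))) ((t - t) • flowPert U) := by
    rw [sub_self, zero_smul]
    exact hf _ (h.powConfig_mem hU ht)
  exact ContDiffAt.comp (f := fun s : ℝ => (s - t) • flowPert U) t h1 (by fun_prop)

/-- Along the family `U_t` the link field varies in the direction of its logarithm. -/
lemma SmallRep.hasDerivAt_comp_powConfig (h : SmallRep R ρ δ) (ha : a ≠ 0)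
    (hf : SmoothOn (smoothFields n R δ) f) (hU : U ∈ smoothFields n R δ) {t : ℝ}
    (ht : t ∈ 𝕀) : HasDerivAt (fun s => f (powConfig s U))
      (variation a (a⁻¹ • flowPert U) f (powConfig t U)) t := by
  have h1 := hf.hasDerivAt (h.powConfig_mem hU ht) a (a⁻¹ • flowPert U)
  have e : ∀ s : ℝ, shift ((s * a) • a⁻¹ • flowPert U) (powConfig t U) = powConfig (t + s) U :=
    fun s => by rw [smul_smul, mul_assoc, mul_inv_cancel₀ ha, mul_one, h.powConfig_add hU]
  simp only [e] at h1
  have h2 := HasDerivAt.comp_sub_const t t (by rw [sub_self]; exact h1)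
  simpa only [add_sub_cancel] using h2

end Curves

variable (b : Fin 4 → Circle)

lemma SmallRep.smoothOn_overlapD (h : SmallRep R ρ δ) (ha : a ≠ 0) :
    SmoothOn (smoothFields n R δ) (overlapD R a b) := by
  refine h.smoothOn_of_eqOn (f := fun M => (a : ℂ)⁻¹ • (1 - gamma5 n d *
    blockG b (blockFn ρ (1, M)))) (fun U hU => ?_) fun U hU => ?_
  · rw [overlapD_eq b R ha (h.norm_gapB_repBlocks b hU), ← h.repBlocks_powConfig hU,
      h.powConfig_one hU]
  · have hm := h.mem_familyDomain b hU (t := 1) (by simp)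
    have h1 : SmoothAt (fun z => blockG b (blockFn (n := n) ρ z)) (1, coeConfig U) :=
      (contDiffAt_blockG b hm.2).comp _ (contDiffAt_blockFn ρ hm.1)
    exact (contDiffAt_const.sub (contDiffAt_const.mul (contDiffAt_slice h1))).const_smul (a : ℂ)⁻¹

lemma SmallRep.smoothOn_hatPMinus (h : SmallRep R ρ δ) (ha : a ≠ 0) :
    SmoothOn (smoothFields n R δ) (hatPMinus R a b) :=
  h.smoothOn_of_eqOn (h.hatPMinus_eq_projFamily b ha) fun U hU =>
    h.contDiffAt_projFamily_slice b hU (t := 1) (by simp)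

variable {m : ℕ} {V : Config n N → Matrix (Idx n d) (Fin m) ℂ} {vb : Fin m → Idx n d → ℂ}

lemma expectation_one_columnBasis (ha : a ≠ 0) (D : Op n d) (V : Matrix (Idx n d) (Fin m) ℂ) :
    expectation a D (columnBasis a V) vb 1 =
      (rowMatrix a vb * D * V).det * berezin m (coeffBoltzmann n d m) := by
  refine expectation_one a D _ vb fun k j => ?_
  have ha' : (a : ℂ) ≠ 0 := Complex.ofReal_ne_zero.2 ha
  simp only [Matrix.mul_apply, rowMatrix, columnBasis, sum_mul, mul_sum]
  rw [sum_comm]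
  refine sum_congr rfl fun s _ => sum_congr rfl fun s' _ => ?_
  field_simp

/-- The variation of the fermion integral in terms of the Dirac operator and the measure term. -/
lemma SmallRep.variation_expectation (h : SmallRep R ρ δ) (ha : a ≠ 0)
    (hV : SmoothOn (smoothFields n R δ) V) (hU : U ∈ smoothFields n R δ)
    (h1 : (V U)ᴴ * V U = 1) (h2 : V U * (V U)ᴴ = hatPMinus R a b U)
    (hvb : IsDualWeylBasis a (pPlus n d) vb) (hD : IsUnit (overlapD R a b U).det) (η : Pert n N) :
    variation a η (fun U => expectation a (overlapD R a b U) (columnBasis a (V U)) vb 1) U =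
      expectation a (overlapD R a b U) (columnBasis a (V U)) vb 1 *
        ((variation a η (overlapD R a b) U * hatPMinus R a b U * (overlapD R a b U)⁻¹ *
          pPlus n d).trace + ((V U)ᴴ * variation a η V U).trace) := by
  have e0 : shift (((0 : ℝ) * a) • η) U = U := by rw [zero_mul, zero_smul, shift_zero]
  have h3 := (hasDerivAt_det_weyl (P := hatPMinus R a b U)
    ((h.smoothOn_overlapD b ha).hasDerivAt hU a η)
    (hV.hasDerivAt hU a η) hvb.rowMatrix_mul_conjTranspose
    (hvb.conjTranspose_mul_rowMatrix ha pPlus_conjTranspose pPlus_idem) (by rw [e0]; exact h1)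
    (by rw [e0]; exact h2) (by rw [e0]; exact hD)
    (by rw [e0]; exact pPlus_mul_overlapD b R ha (h.norm_gapB_repBlocks b hU))).mul_const
    (berezin m (coeffBoltzmann n d m))
  simp only [expectation_one_columnBasis ha]
  rw [variation, h3.deriv, e0]
  ring

/-- Integration of the effective action along the family `U_t`, where the measure term vanishes. -/
lemma SmallRep.expectation_powConfig (h : SmallRep R ρ δ) (ha : a ≠ 0)
    (hV : SmoothOn (smoothFields n R δ) V) (hVU : ∀ U ∈ smoothFields n R δ, (V U)ᴴ * V U = 1 ∧
      V U * (V U)ᴴ = hatPMinus R a b U ∧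
      ∀ η : Pert n N, I * ((V U)ᴴ * variation a η V U).trace = measureTerm R a b η U)
    (hE : SmoothOn (smoothFields n R δ)
      fun U => expectation a (overlapD R a b U) (columnBasis a (V U)) vb 1)
    (hU : U ∈ smoothFields n R δ) (hvb : IsDualWeylBasis a (pPlus n d) vb) {T₀ T₁ : ℝ}
    (h0 : 0 ≤ T₀) (h01 : T₀ ≤ T₁) (h1 : T₁ ≤ 1)
    (hD : ∀ t ∈ Set.Icc T₀ T₁, IsUnit (overlapD R a b (powConfig t U)).det) :
    ContinuousOn (fun t : ℝ =>
      (deriv (fun s => overlapD R a b (powConfig s U)) t * hatPMinus R a b (powConfig t U) *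
        (overlapD R a b (powConfig t U))⁻¹ * pPlus n d).trace) (Set.Icc T₀ T₁) ∧
    expectation a (overlapD R a b (powConfig T₁ U)) (columnBasis a (V (powConfig T₁ U))) vb 1 =
      expectation a (overlapD R a b (powConfig T₀ U)) (columnBasis a (V (powConfig T₀ U))) vb 1 *
        Complex.exp (∫ t in T₀..T₁, (deriv (fun s => overlapD R a b (powConfig s U)) t *
          hatPMinus R a b (powConfig t U) * (overlapD R a b (powConfig t U))⁻¹ *
            pPlus n d).trace) := by
  have hsub : ∀ t ∈ Set.Icc T₀ T₁, t ∈ 𝕀 := fun t ht =>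
    ⟨h0.trans ht.1, ht.2.trans h1⟩
  have hcont : ContinuousOn (fun t : ℝ =>
      (deriv (fun s => overlapD R a b (powConfig s U)) t * hatPMinus R a b (powConfig t U) *
        (overlapD R a b (powConfig t U))⁻¹ * pPlus n d).trace) (Set.Icc T₀ T₁) := by
    intro t ht
    have c1 := h.contDiffAt_comp_powConfig (h.smoothOn_overlapD b ha) hU (hsub t ht)
    have c2 := (h.contDiffAt_comp_powConfig (h.smoothOn_hatPMinus b ha) hU (hsub t ht)).continuousAt
    have c3 : ContinuousAt (deriv fun s => overlapD R a b (powConfig s U)) t :=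
      ((c1.fderiv_right (m := 0) (by simp)).clm_apply contDiffAt_const).continuousAt
    have c4 : ContinuousAt (fun s => (overlapD R a b (powConfig s U))⁻¹) t := by
      obtain ⟨u, hu⟩ := (isUnit_iff_isUnit_det _).2 (hD t ht)
      simp only [nonsing_inv_eq_ringInverse]
      refine ContinuousAt.comp (g := Ring.inverse) ?_ c1.continuousAt
      rw [← hu]
      exact NormedRing.inverse_continuousAt u
    exact (𝐓.continuous.continuousAt.comp
      (((c3.mul c2).mul c4).mul continuousAt_const)).continuousWithinAt
  refine ⟨hcont, eq_mul_exp_integral (y := fun t =>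
    expectation a (overlapD R a b (powConfig t U)) (columnBasis a (V (powConfig t U))) vb 1)
    h01 hcont fun t ht => ?_⟩
  have hUt := h.powConfig_mem hU (hsub t ht)
  obtain ⟨k1, k2, k3⟩ := hVU _ hUt
  refine (h.hasDerivAt_comp_powConfig ha hE hU (hsub t ht)).congr_deriv ?_
  have k4 := h.measureTerm_powConfig b hU ha (hsub t ht) (smul_inv_smul₀ ha (flowPert U))
  rw [← k3, mul_eq_zero, or_iff_right I_ne_zero] at k4
  rw [h.variation_expectation b ha hV hUt k1 k2 hvb (hD t ht), k4, add_zero,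
    (h.hasDerivAt_comp_powConfig ha (h.smoothOn_overlapD b ha) hU (hsub t ht)).deriv]

lemma SmallRep.expectation_one_ne_zero (h : SmallRep R ρ δ) (ha : a ≠ 0)
    {V : Matrix (Idx n d) (Fin (2 * d * n ^ 4)) ℂ} {vb : Fin (2 * d * n ^ 4) → Idx n d → ℂ}
    (hU : U ∈ smoothFields n R δ) (hV : V * Vᴴ = hatPMinus R a b U)
    (hvb : IsDualWeylBasis a (pPlus n d) vb) (hD : IsUnit (overlapD R a b U).det) :
    expectation a (overlapD R a b U) (columnBasis a V) vb 1 ≠ 0 := by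
  rw [expectation_one_columnBasis ha]
  refine mul_ne_zero (mul_inv_weyl hvb.rowMatrix_mul_conjTranspose
    (hvb.conjTranspose_mul_rowMatrix ha pPlus_conjTranspose pPlus_idem) hV hD
    (pPlus_mul_overlapD b R ha (h.norm_gapB_repBlocks b hU))).2 (berezin_coeffBoltzmann_ne_zero ?_)
  simp only [Fintype.card_prod, Fintype.card_fin, Fintype.card_pi, ZMod.card, prod_const, card_univ]
  nlinarith [Nat.zero_le (d * n ^ 4)]

/-- The coordinates of the basis vectors as linear functions of the isometry. -/
def columnBasisL (a : ℝ) (j : Fin m) : Matrix (Idx n d) (Fin m) ℂ →L[ℝ] (Idx n d → ℂ) :=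
  LinearMap.toContinuousLinearMap
    { toFun := fun V => columnBasis a V j
      map_add' := fun _ _ => funext fun _ => mul_add _ _ _
      map_smul' := fun c _ => funext fun _ => mul_smul_comm c _ _ }

lemma smoothOn_columnBasis (hV : SmoothOn (smoothFields n R δ) V) (j : Fin m) :
    SmoothOn (smoothFields n R δ) fun U => columnBasis a (V U) j := fun U hU => by
  have h1 := (columnBasisL (n := n) (d := d) a j).contDiff (n := ∞)
  exact h1.contDiffAt.comp 0 (hV U hU)

lemma sum_fieldInner_variation (ha : a ≠ 0) (hV : SmoothOn (smoothFields n R δ) V)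
    (hU : U ∈ smoothFields n R δ) (η : Pert n N) :
    ∑ j, fieldInner a (columnBasis a (V U) j) (variation a η (fun U => columnBasis a (V U) j) U) =
      ((V U)ᴴ * variation a η V U).trace := by
  have ha' : (a : ℂ) ≠ 0 := Complex.ofReal_ne_zero.2 ha
  have e : ∀ j, variation a η (fun U => columnBasis a (V U) j) U =
      columnBasis a (variation a η V U) j := fun j =>
    ((columnBasisL (n := n) (d := d) a j).hasFDerivAt.comp_hasDerivAt 0
      (hV.hasDerivAt hU a η)).deriv
  rw [trace]
  refine sum_congr rfl fun j _ => ?_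
  rw [e, fieldInner, mul_sum, diag_apply, Matrix.mul_apply]
  refine sum_congr rfl fun s _ => ?_
  simp only [columnBasis, star_mul', star_inv₀, star_pow, star_def, conj_ofReal,
    conjTranspose_apply]
  field_simp

end EffectiveAction

end LatticeWeyl

end

open LatticeWeyl in
theorem mainTheorem2 (N d : ℕ) (hN : 2 ≤ N) (R : Rep N d) (hR : Continuous R) (ε δ : ℝ)
    (hε : ε < 1 / (6 * (2 + Real.sqrt 2)))
    (hδ : 0 < δ)
    (hδ₁ : δ ≤ Real.sqrt 2 * Real.sqrt (1 - Real.cos (Real.pi / ((N : ℝ) - 1))))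
    (hδ₂ : 4 * δ + 6 * δ ^ 2 + 4 * δ ^ 3 + δ ^ 4 ≤ ε) :
    -- locality of the measure current, uniformly in the lattice size, spacing and link field
    (∃ θ : ℝ, 0 < θ ∧ ∃ C : ℕ → ℝ,
      ∀ (n : ℕ) [NeZero n] (a : ℝ), 0 < a → ∀ (b : Fin 4 → Circle) (x : Site n) (μ : Fin 4)
        (X : su N),
        IsLocalAt (smoothFields n R δ) x θ (fun k => C k * ‖X‖ / a ^ 3)
          (measureCurrent R a b x μ X)) ∧
    ∀ (n : ℕ) [NeZero n] (a : ℝ), 0 < a → ∀ b : Fin 4 → Circle,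
      -- smooth fields lie in the vacuum sector, and so does the family `U_t`, which is well defined
      (smoothFields n R δ ⊆ vacuumSector n R ε) ∧
      (∀ U ∈ smoothFields n R δ, powConfig 0 U = 1 ∧ powConfig 1 U = U ∧
        ∀ t ∈ Set.Icc (0 : ℝ) 1, powConfig t U ∈ smoothFields n R δ ∧
          ∀ x μ, (powConfig t U x μ : Matrix (Fin N) (Fin N) ℂ) = powMatrix t (U x μ)) ∧
      -- all derivatives and integrals in the measure term exist
      (∀ U ∈ smoothFields n R δ, ∀ t ∈ Set.Icc (0 : ℝ) 1,
        ContDiffAt ℝ ∞ (fun p : ℝ × Pert n N => projT R a b p.1 (shift p.2 U)) (t, 0)) ∧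
      (∀ η : Pert n N, SmoothOn (smoothFields n R δ) (measureTerm R a b η)) ∧
      (∀ U ∈ smoothFields n R δ, ∀ η : Pert n N,
        measureTerm R a b η U = (a : ℂ) ^ 4 * ∑ x, ∑ μ, measureCurrent R a b x μ (η x μ) U) ∧
      -- local integrability
      (∀ U ∈ smoothFields n R δ, ∀ η ζ : Pert n N,
        variation a η (measureTerm R a b ζ) U - variation a ζ (measureTerm R a b η) U
            + (a : ℂ) * measureTerm R a b (fun x μ => suBracket (η x μ) (ζ x μ)) U
          = Complex.I * (hatPMinus R a b U *
              ⁅variation a η (hatPMinus R a b) U, variation a ζ (hatPMinus R a b) U⁆).trace) ∧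
      -- the measure term vanishes along the family `U_t`
      (∀ U ∈ smoothFields n R δ, ∀ t ∈ Set.Icc (0 : ℝ) 1, ∀ η : Pert n N,
        (∀ x μ, HasDerivAt (fun s : ℝ => (powConfig s U x μ : Matrix (Fin N) (Fin N) ℂ))
          (a • ((η x μ : Matrix (Fin N) (Fin N) ℂ) * powConfig t U x μ)) t) →
        measureTerm R a b η (powConfig t U) = 0) ∧
      -- existence of the fermion integration measure
      (∃ vb : Fin (2 * d * n ^ 4) → Idx n d → ℂ, IsDualWeylBasis a (pPlus n d) vb) ∧
      ∃ v : Config n N → Fin (2 * d * n ^ 4) → Idx n d → ℂ,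
        (∀ U ∈ smoothFields n R δ, IsWeylBasis a (hatPMinus R a b U) (v U)) ∧
        (∀ j, SmoothOn (smoothFields n R δ) (fun U => v U j)) ∧
        (∀ U ∈ smoothFields n R δ, ∀ η : Pert n N,
          Complex.I * ∑ j, fieldInner a (v U j) (variation a η (fun U' => v U' j) U)
            = measureTerm R a b η U) ∧
        ∀ vb : Fin (2 * d * n ^ 4) → Idx n d → ℂ, IsDualWeylBasis a (pPlus n d) vb →
          -- all fermion expectation values are smooth functions of the link variables
          (∀ O : FieldAlg n d, SmoothOn (smoothFields n R δ)
            (fun U => expectation a (overlapD R a b U) (v U) vb O)) ∧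
          -- the variation of the effective action `ln ⟨1⟩_F`
          (∀ U ∈ smoothFields n R δ, IsUnit (overlapD R a b U).det →
            expectation a (overlapD R a b U) (v U) vb 1 ≠ 0 ∧
            ∀ η : Pert n N,
              variation a η (fun U' => expectation a (overlapD R a b U') (v U') vb 1) U
                  / expectation a (overlapD R a b U) (v U) vb 1
                = (variation a η (overlapD R a b) U * hatPMinus R a b U *
                    (overlapD R a b U)⁻¹ * pPlus n d).trace
                  - Complex.I * measureTerm R a b η U) ∧
          -- the effective action along the family `U_t`; recall that `U_0 = 1` and `U_1 = U`
          (∀ U ∈ smoothFields n R δ, ∀ T₀ T₁ : ℝ, 0 ≤ T₀ → T₀ ≤ T₁ → T₁ ≤ 1 →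
            (∀ t ∈ Set.Icc T₀ T₁, IsUnit (overlapD R a b (powConfig t U)).det) →
            ContinuousOn (fun t : ℝ =>
              (deriv (fun s => overlapD R a b (powConfig s U)) t * hatPMinus R a b (powConfig t U) *
                (overlapD R a b (powConfig t U))⁻¹ * pPlus n d).trace) (Set.Icc T₀ T₁) ∧
            expectation a (overlapD R a b (powConfig T₁ U)) (v (powConfig T₁ U)) vb 1
              = expectation a (overlapD R a b (powConfig T₀ U)) (v (powConfig T₀ U)) vb 1 *
                Complex.exp (∫ t in T₀..T₁,
                  (deriv (fun s => overlapD R a b (powConfig s U)) t *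
                    hatPMinus R a b (powConfig t U) *
                    (overlapD R a b (powConfig t U))⁻¹ * pPlus n d).trace)) := by
  obtain ⟨ρ, h⟩ := exists_smallRep hN R hR hε hδ hδ₁ hδ₂
  have : NeZero N := ⟨by omega⟩
  refine ⟨h.exists_isLocalAt_measureCurrent hδ, fun n _ a ha b => ?_⟩
  have ha' : a ≠ 0 := ha.ne'
  obtain ⟨V, hV, hVU⟩ := h.exists_weylIsometry (n := n) b ha'
  have hv : ∀ j, SmoothOn (smoothFields n R δ) fun U => columnBasis a (V U) j :=
    smoothOn_columnBasis hV
  have hE : ∀ (vb : Fin (2 * d * n ^ 4) → Idx n d → ℂ) (O : FieldAlg n d),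
      SmoothOn (smoothFields n R δ)
        fun U => expectation a (overlapD R a b U) (columnBasis a (V U)) vb O := fun vb O U hU =>
    contDiffAt_expectation (h.smoothOn_overlapD b ha' U hU) (contDiffAt_pi.2 fun j => hv j U hU) a
      vb O
  refine ⟨h.smoothFields_subset_vacuumSector (by nlinarith [pow_pos hδ 3, pow_pos hδ 4]),
    fun U hU => ⟨h.powConfig_zero hU, h.powConfig_one hU, fun t ht => ⟨h.powConfig_mem hU ht,
      h.coe_powConfig hU t⟩⟩,
    fun U hU t ht => h.contDiffAt_projT b hU ha' ht, h.smoothOn_measureTerm b ha',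
    fun U hU η => h.measureTerm_eq_sum_current b hU ha' η,
    fun U hU η ζ => h.local_integrability b hU ha' η ζ,
    fun U hU t ht η hη => h.measureTerm_powConfig b hU ha' ht (h.smul_eq_flowPert hU hη), ?_,
    fun U => columnBasis a (V U),
    fun U hU => isWeylBasis_columnBasis ha' (hVU U hU).1 (hVU U hU).2.1, hv, fun U hU η => ?_,
    fun vb hvb => ⟨hE vb, fun U hU hD => ⟨h.expectation_one_ne_zero b ha' hU (hVU U hU).2.1 hvb hD,
      fun η => ?_⟩, fun U hU T₀ T₁ h0 h01 h1 hD =>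
        h.expectation_powConfig b ha' hV hVU (hE vb 1) hU hvb h0 h01 h1 hD⟩⟩
  · obtain ⟨W, hW, hW'⟩ := exists_isometry_of_projector (P := pPlus n d) pPlus_idem
      pPlus_conjTranspose trace_pPlus
    exact ⟨_, isDualWeylBasis_of_isometry ha' hW hW'⟩
  · rw [sum_fieldInner_variation ha' hV hU, (hVU U hU).2.2]
  · rw [h.variation_expectation b ha' hV hU (hVU U hU).1 (hVU U hU).2.1 hvb hD,
      mul_div_cancel_left₀ _ (h.expectation_one_ne_zero b ha' hU (hVU U hU).2.1 hvb hD),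
      ← (hVU U hU).2.2 η, ← mul_assoc, Complex.I_mul_I]
    ring
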